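/- **Notation.** Let $n,l\in\mathbb N$ ($n,l\ge1$), $p,q,r\in(0,\infty]$ (integrals and sums are replaced by essential suprema and suprema when an exponent is $\infty$; $1/\infty=0$). For $k\in\mathbb N_0$, $m\in\mathbb Z^n$ let $Q_{k,m}=\prod_i(m_i2^{-k},(m_i+1)2^{-k})$, let $\widetilde Q_{k,m}$ be the corresponding half-open cube, let $\xi_{k,m}$ be its centre, and let $I^n=(-1,1)^n$. For an open cube $Q$ with side length $s$ and sides parallel to the axes put $$\delta^l_r(Q)\varphi=\Big(s^{-2n}\int_{sI^n}\int_Q|\Delta^l(h)\varphi(x)|^r\,dx\,dh\Big)^{1/r},\qquad \Delta^l(h)\varphi(x)=\sum_{j=0}^l\binom lj(-1)^{l+j}\varphi(x+jh).$$ A weight sequence $\{t_k\}_{k\ge0}$ (measurable $t_k:\mathbb R^n\to(0,\infty)$) is $p$-admissible if $t_k\in L_p^{loc}(\mathbb R^n)$ for all $k$; then $t_{k,m}:=\|t_k|L_p(Q_{k,m})\|$ and $\bar t_k:=2^{kn/p}\sum_m t_{k,m}\chi_{\widetilde Q_{k,m}}$. The space $\widetilde B^l_{p,q,r}(\mathbb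 R^n,\{t_k\})$ consists of all real $\varphi\in L_r^{loc}(\mathbb R^n)$ with $$\|\varphi|\widetilde B^l_{p,q,r}\|=\Big(\sum_{k\ge1}\big\|t_k\,\delta^l_r(\cdot+2^{-k}I^n)\varphi\,|\,L_p(\mathbb R^n)\big\|^q\Big)^{1/q}+\big\|\,t_0\,\|\varphi|L_r(\cdot+I^n)\|\,\big|L_p(\mathbb R^n)\big\|<\infty .$$ For $\alpha=(\alpha_1,\alpha_2)\in\mathbb R^2$, $\alpha_3\ge0$, $\sigma=(\sigma_1,\sigma_2)\in(0,\infty]^2$, the class $X^{\alpha_3}_{\alpha,\sigma,p}$ consists of the $p$-admissible $\{t_k\}$ for which there are $c_1,c_2>0$ such that for all $0\le k\le j$, $m\in\mathbb Z^n$ $$\Big(2^{kn}\!\int_{Q_{k,m}}\!\bar t_k^{\,p}\Big)^{\frac1p}\Big(2^{kn}\!\int_{Q_{k,m}}\!\bar t_j^{\,-\sigma_1}\Big)^{\frac1{\sigma_1}}\le c_12^{\alpha_1(k-j)},\qquad \Big(2^{kn}\!\int_{Q_{k,m}}\!\bar t_k^{\,p}\Big)^{-\frac1p}\Big(2^{kn}\!\int_{Q_{k,m}}\!\bar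 t_j^{\,\sigma_2}\Big)^{\frac1{\sigma_2}}\le c_22^{\alpha_2(j-k)},$$ and $0<t_{k,m}\le2^{\alpha_3}t_{k,\tilde m}$ for all $k$ whenever $|m_i-\tilde m_i|\le1$ for all $i$. Let $N^l(s)=\frac1{l!}\sum_{j=0}^{l+1}(-1)^j\binom{l+1}j(s-j)_+^l$ be the B-spline of degree $l$ with knots $0,1,\dots,l+1$, normalized so that its integer translates form a partition of unity, and $N^l_{k,m}(x)=\prod_{i=1}^nN^l(2^kx_i-m_i)$. For $f$ with continuous derivatives $D^\nu f$, $\nu_i\le l$, at $\xi_{k,m}$ set $$\alpha_{k,m}(f)=\sum_{0\le\nu_i\le l}\ \prod_{i=1}^n\frac{(-1)^{l-\nu_i}}{l!}\,\psi_i^{(l-\nu_i)}\big((\xi_{k,m})_i\big)\;D^\nu f(\xi_{k,m}),\qquad \psi_i(s)=\prod_{j=1}^{l}\Big(\frac{m_i+j}{2^k}-s\Big).$$ Fix $A\ge1$. Given $\varphi\in L_r^{loc}$, let $P_{k,m}$ be, for all $k,m$, polynomials of degree at most $l$ in each variable with $\|\varphi-P_{k,m}|L_r(Q_{k,m})\|\le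 A\inf_R\|\varphi-R|L_r(Q_{k,m})\|$, the infimum being over all polynomials $R$ of degree at most $l$ in each variable. Put $g_k=\sum_mP_{k,m}\chi_{Q_{k,m}}$, $T_k=\sum_m\alpha_{k,m}(g_k)N^l_{k,m}$ for $k\ge0$, and $T_{-1}=0$. For an array $\beta=\{\beta_{k,m}\}$ of reals write $$\|\beta\|_{*}=\Big(\sum_{k\ge0}\Big(\sum_{m\in\mathbb Z^n}t_{k,m}^p|\beta_{k,m}|^p\Big)^{q/p}\Big)^{1/q}.$$ Let $N_3(\varphi)$ be the infimum of $\|\beta\|_*$ over all arrays $\beta$ such that $\varphi=\sum_{k\ge0}\big(\sum_m\beta_{k,m}N^l_{k,m}\big)$ with convergence of the series in $k$ in $L_r^{loc}(\mathbb R^n)$ ($N_3(\varphi)=\infty$ if there are none), and let $N_4(\varphi)=\|\{\alpha_{k,m}(T_k-T_{k-1})\}\|_*$. **Corollary 4.4 (atomic decomposition).** Let $p,q,r\in(0,\infty]$, $\theta\in(0,\min\{r,p\}]$, $l\in\mathbb N$, and let $\{t_k\}\in X^{\alpha_3}_{\alpha,\sigma,p}$ with $\alpha_3\ge 0$, $\alpha_1>n(\frac1\theta-\frac1r)$,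 $\alpha_2<l$, $\sigma_1=\theta p_\theta'$, $\sigma_2=p$. Here $p_\theta=p/\theta$ ($p_\theta=1$ if $\theta=p=\infty$, $p_\theta=\infty$ if $\theta<p=\infty$) and $\frac1{p_\theta}+\frac1{p'_\theta}=1$. Then: 1) There is a constant $C>0$ such that every $\varphi\in\widetilde B^l_{p,q,r}(\mathbb R^n,\{t_k\})$ can be expanded as $\varphi=\sum_{k\ge0}\sum_{m}\beta_{k,m}(\varphi)N^l_{k,m}$ with convergence (in $k$) in $L_r^{loc}(\mathbb R^n)$, and, for every choice of the polynomials $P_{k,m}$, $$N_3(\varphi)\le N_4(\varphi)\le C\,\|\varphi|\widetilde B^l_{p,q,r}(\mathbb R^n,\{t_k\})\| .$$ 2) There are constants $C_1,C_2>0$ such that for every array $\beta$ with $\|\beta\|_*<\infty$ the series $\sum_{k\ge0}\sum_m\beta_{k,m}N^l_{k,m}$ converges (in $k$) in $L_r^{loc}(\mathbb R^n)$ to some $\varphi\in\widetilde B^l_{p,q,r}(\mathbb R^n,\{t_k\})$ and, for every choice of the polynomials $P_{k,m}$ for this $\varphi$, $$\|\varphi|\widetilde B^l_{p,q,r}(\mathbb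 R^n,\{t_k\})\|\le C_1N_3(\varphi)\le C_2N_4(\varphi).$$ -/

import Mathlib

open MeasureTheory Filter Topology
open scoped ENNReal NNReal

noncomputable section

namespace VarBesov

/-- The open cube with sides parallel to the axes, centre `c` and side length `s`. -/
def cube {n : ℕ} (c : Fin n → ℝ) (s : ℝ) : Set (Fin n → ℝ) :=
  {x | ∀ i, |x i - c i| < s / 2}

/-- The open dyadic cube `∏ (mᵢ 2⁻ᵏ, (mᵢ + 1) 2⁻ᵏ)`. -/
def dyadic {n : ℕ} (k : ℕ) (m : Fin n → ℤ) : Set (Fin n → ℝ) :=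
  {x | ∀ i, (m i : ℝ) / 2 ^ k < x i ∧ x i < ((m i : ℝ) + 1) / 2 ^ k}

/-- The half-open dyadic cube `∏ [mᵢ 2⁻ᵏ, (mᵢ + 1) 2⁻ᵏ)`. -/
def dyadicHalfOpen {n : ℕ} (k : ℕ) (m : Fin n → ℤ) : Set (Fin n → ℝ) :=
  {x | ∀ i, (m i : ℝ) / 2 ^ k ≤ x i ∧ x i < ((m i : ℝ) + 1) / 2 ^ k}

/-- The centre of a dyadic cube. -/
def dyadicCenter {n : ℕ} (k : ℕ) (m : Fin n → ℤ) : Fin n → ℝ :=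
  fun i => ((m i : ℝ) + 1 / 2) / 2 ^ k

/-- The `l_q` (quasi-)norm of a family in `[0, ∞]`, for `q ∈ (0, ∞]`. -/
def lNorm {ι : Type*} (q : ℝ≥0∞) (a : ι → ℝ≥0∞) : ℝ≥0∞ :=
  if q = ∞ then ⨆ i, a i else (∑' i, a i ^ q.toReal) ^ (1 / q.toReal)

/-- `f ∈ L_r^loc(ℝⁿ)`. -/
def MemLpLoc {n : ℕ} (r : ℝ≥0∞) (f : (Fin n → ℝ) → ℝ) : Prop :=
  ∀ K : Set (Fin n → ℝ), IsCompact K → MemLp f r (volume.restrict K)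

/-- Convergence `f_N → f` in `L_r^loc(ℝⁿ)`. -/
def TendstoLpLoc {n : ℕ} (r : ℝ≥0∞) (F : ℕ → (Fin n → ℝ) → ℝ) (f : (Fin n → ℝ) → ℝ) : Prop :=
  ∀ K : Set (Fin n → ℝ), IsCompact K →
    Tendsto (fun N => eLpNorm (fun x => F N x - f x) r (volume.restrict K)) atTop (𝓝 0)

/-! ### Differences and the Besov space of variable smoothness -/

/-- The difference `Δ^l(h) g (x)`. -/
def diff {n : ℕ} (l : ℕ) (h : Fin n → ℝ) (g : (Fin n → ℝ) → ℝ) (x : Fin n → ℝ) : ℝ :=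
  ∑ j ∈ Finset.range (l + 1), (l.choose j : ℝ) * (-1) ^ (l + j) * g (x + (j : ℝ) • h)

/-- `δ^l_r(Q) g` for the cube `Q` of centre `c` and side `s`: the `L_r` quasi-norm of
`(h, x) ↦ Δ^l(h) g (x)` over `(-s, s)ⁿ × Q` with respect to Lebesgue measure divided by `s ^ (2n)`
(the essential supremum if `r = ∞`). -/
def deltaOsc {n : ℕ} (l : ℕ) (r : ℝ≥0∞) (c : Fin n → ℝ) (s : ℝ) (g : (Fin n → ℝ) → ℝ) : ℝ≥0∞ :=
  eLpNorm (fun z : (Fin n → ℝ) × (Fin n → ℝ) => diff l z.1 g z.2) r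
    (ENNReal.ofReal (1 / s ^ (2 * n)) •
      ((volume.restrict (cube (0 : Fin n → ℝ) (2 * s))).prod (volume.restrict (cube c s))))

/-- The quasi-norm of `φ` in `B̃^l_{p,q,r}(ℝⁿ, {t_k})`. The cube `x + 2⁻ᵏ Iⁿ`, `Iⁿ = (-1, 1)ⁿ`,
has side `2 · 2⁻ᵏ`. -/
def besovNorm {n : ℕ} (l : ℕ) (p q r : ℝ≥0∞) (t : ℕ → (Fin n → ℝ) → ℝ)
    (φ : (Fin n → ℝ) → ℝ) : ℝ≥0∞ :=
  lNorm q (fun k : ℕ =>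
      eLpNorm (fun x => ENNReal.ofReal (t (k + 1) x) * deltaOsc l r x (2 * (1 / 2 ^ (k + 1))) φ)
        p volume)
    + eLpNorm (fun x => ENNReal.ofReal (t 0 x) * eLpNorm φ r (volume.restrict (cube x 2)))
        p volume

/-- `φ ∈ B̃^l_{p,q,r}(ℝⁿ, {t_k})`. -/
def MemBesov {n : ℕ} (l : ℕ) (p q r : ℝ≥0∞) (t : ℕ → (Fin n → ℝ) → ℝ)
    (φ : (Fin n → ℝ) → ℝ) : Prop :=
  MemLpLoc r φ ∧ besovNorm l p q r t φ < ∞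

/-! ### Weight sequences -/

/-- A weight: a (Lebesgue) measurable function with values in `(0, ∞)`. -/
def IsWeight {n : ℕ} (γ : (Fin n → ℝ) → ℝ) : Prop :=
  AEMeasurable γ volume ∧ ∀ x, 0 < γ x

/-- A `p`-admissible weight sequence. -/
def IsAdmissible {n : ℕ} (p : ℝ≥0∞) (t : ℕ → (Fin n → ℝ) → ℝ) : Prop :=
  ∀ k, IsWeight (t k) ∧ MemLpLoc p (t k)

/-- The `p`-associated multiple sequence `t_{k,m} = ‖t_k | L_p(Q_{k,m})‖`. -/
def assoc {n : ℕ} (p : ℝ≥0∞) (t : ℕ → (Fin n → ℝ) → ℝ) (k : ℕ) (m : Fin n → ℤ) : ℝ≥0∞ :=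
  eLpNorm (t k) p (volume.restrict (dyadic k m))

/-- The `p`-associated weight sequence `t̄_k = 2^{kn/p} ∑_m t_{k,m} χ_{Q̃_{k,m}}`. -/
def assocWeight {n : ℕ} (p : ℝ≥0∞) (t : ℕ → (Fin n → ℝ) → ℝ) (k : ℕ) (x : Fin n → ℝ) : ℝ≥0∞ :=
  (2 : ℝ≥0∞) ^ ((k : ℝ) * (n : ℝ) * (p⁻¹).toReal) *
    ∑' m : Fin n → ℤ, (dyadicHalfOpen k m).indicator (fun _ => assoc p t k m) x

/-- `(2^{kn} ∫_{Q_{k,m}} f^s)^{1/s}` (the essential supremum over `Q_{k,m}` if `s = ∞`). -/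
def avgNorm {n : ℕ} (s : ℝ≥0∞) (k : ℕ) (m : Fin n → ℤ) (f : (Fin n → ℝ) → ℝ≥0∞) : ℝ≥0∞ :=
  eLpNorm f s (((2 : ℝ≥0∞) ^ (k * n)) • volume.restrict (dyadic k m))

/-- The weight class `X^{α₃}_{(α₁,α₂),(σ₁,σ₂),p}(ℝⁿ)`. -/
structure WeightClass {n : ℕ} (p : ℝ≥0∞) (α₁ α₂ α₃ : ℝ) (σ₁ σ₂ : ℝ≥0∞)
    (t : ℕ → (Fin n → ℝ) → ℝ) : Prop where
  admissible : IsAdmissible p t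
  lower : ∃ C : ℝ, 0 < C ∧ ∀ k j : ℕ, k ≤ j → ∀ m : Fin n → ℤ,
    avgNorm p k m (assocWeight p t k) * avgNorm σ₁ k m (fun x => (assocWeight p t j x)⁻¹)
      ≤ ENNReal.ofReal (C * 2 ^ (α₁ * ((k : ℝ) - (j : ℝ))))
  upper : ∃ C : ℝ, 0 < C ∧ ∀ k j : ℕ, k ≤ j → ∀ m : Fin n → ℤ,
    (avgNorm p k m (assocWeight p t k))⁻¹ * avgNorm σ₂ k m (assocWeight p t j)
      ≤ ENNReal.ofReal (C * 2 ^ (α₂ * ((j : ℝ) - (k : ℝ))))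
  neighbours : ∀ (k : ℕ) (m m' : Fin n → ℤ), (∀ i, |m i - m' i| ≤ 1) →
    0 < assoc p t k m ∧ assoc p t k m ≤ ENNReal.ofReal (2 ^ α₃) * assoc p t k m'

/-- `p_θ = p / θ`, with `p_θ = 1` for `θ = p = ∞` (and `p_θ = ∞` for `θ < p = ∞`). -/
def pTheta (p θ : ℝ≥0∞) : ℝ≥0∞ :=
  if p = ∞ ∧ θ = ∞ then 1 else p / θ

/-! ### B-splines and the quasi-interpolant -/

/-- The B-spline `N^l` of degree `l` (`l ≥ 1`) with knots `0, 1, …, l + 1`, that is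
`(l + 1) [0, 1, …, l + 1] (· - s)_+^l`, with the divided difference written out; it is normalized
so that its integer translates form a partition of unity. -/
def bspline (l : ℕ) (s : ℝ) : ℝ :=
  (1 / (l.factorial : ℝ)) *
    ∑ j ∈ Finset.range (l + 2), (-1) ^ j * ((l + 1).choose j : ℝ) * (max (s - (j : ℝ)) 0) ^ l

/-- The tensor B-spline `N^l_{k,m}(x) = ∏ N^l(2ᵏ xᵢ - mᵢ)`. -/
def tensorSpline {n : ℕ} (l k : ℕ) (m : Fin n → ℤ) (x : Fin n → ℝ) : ℝ :=
  ∏ i, bspline l (2 ^ k * (x i - (m i : ℝ) / 2 ^ k))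

/-- The spline `∑_m b_m N^l_{k,m}` (at each point only finitely many terms are nonzero). -/
def splineSum {n : ℕ} (l k : ℕ) (b : (Fin n → ℤ) → ℝ) (x : Fin n → ℝ) : ℝ :=
  ∑' m : Fin n → ℤ, b m * tensorSpline l k m x

/-- The partial derivative `D^ν f`. -/
def mixedDeriv {n : ℕ} (ν : Fin n → ℕ) (f : (Fin n → ℝ) → ℝ) : (Fin n → ℝ) → ℝ :=
  (List.finRange n).foldr
    (fun i g => (fun (u : (Fin n → ℝ) → ℝ) (x : Fin n → ℝ) =>
      lineDeriv ℝ u x (Pi.single i (1 : ℝ)))^[ν i] g) f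

/-- `ψ(s) = ∏_{j=1}^{l} ((m + j) / 2ᵏ - s)`. -/
def knotPoly (l k : ℕ) (m : ℤ) (s : ℝ) : ℝ :=
  ∏ j ∈ Finset.Icc 1 l, (((m : ℝ) + (j : ℝ)) / 2 ^ k - s)

/-- The functional `α_{k,m}(f) = ∑_{0 ≤ ν_i ≤ l} a_{k,m,ν} D^ν f(ξ_{k,m})`, where
`a_{k,m,ν} = ∏ (-1)^{l - ν_i} / l! · D^{l - ν_i} ψ_{m_i}(ξ_{k,m_i})` and `ξ_{k,m}` is the centre of
`Q_{k,m}` (degree-`l` splines). -/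
def coeffFun {n : ℕ} (l k : ℕ) (m : Fin n → ℤ) (f : (Fin n → ℝ) → ℝ) : ℝ :=
  ∑ ν : Fin n → Fin (l + 1),
    (∏ i, (-1) ^ (l - (ν i : ℕ)) / (l.factorial : ℝ) *
      iteratedDeriv (l - (ν i : ℕ)) (knotPoly l k (m i)) (dyadicCenter k m i)) *
    mixedDeriv (fun i => (ν i : ℕ)) f (dyadicCenter k m)

/-- The quasi-interpolant `Q^l_k f = ∑_m α_{k,m}(f) N^l_{k,m}`. -/
def quasiInterp {n : ℕ} (l k : ℕ) (f : (Fin n → ℝ) → ℝ) : (Fin n → ℝ) → ℝ :=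
  splineSum l k (fun m => coeffFun l k m f)

/-- Polynomials of coordinate degree `< l + 1`. -/
def CoordDegLE {n : ℕ} (l : ℕ) (P : MvPolynomial (Fin n) ℝ) : Prop :=
  ∀ i, P.degreeOf i ≤ l

/-- The error of best `L_r(Q_{k,m})`-approximation of `φ` by polynomials of coordinate degree
`< l + 1`. -/
def bestApprox {n : ℕ} (l : ℕ) (r : ℝ≥0∞) (k : ℕ) (m : Fin n → ℤ)
    (φ : (Fin n → ℝ) → ℝ) : ℝ≥0∞ :=
  ⨅ R : {R : MvPolynomial (Fin n) ℝ // CoordDegLE l R},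
    eLpNorm (fun x => φ x - MvPolynomial.eval x R.1) r (volume.restrict (dyadic k m))

/-- `P k m` is, for all `k, m`, a polynomial of almost best `L_r(Q_{k,m})`-approximation to `φ`
with constant `A` among polynomials of coordinate degree `< l + 1`. -/
def IsNearBest {n : ℕ} (A : ℝ) (l : ℕ) (r : ℝ≥0∞) (φ : (Fin n → ℝ) → ℝ)
    (P : ℕ → (Fin n → ℤ) → MvPolynomial (Fin n) ℝ) : Prop :=
  ∀ k m, CoordDegLE l (P k m) ∧
    eLpNorm (fun x => φ x - MvPolynomial.eval x (P k m)) r (volume.restrict (dyadic k m))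
      ≤ ENNReal.ofReal A * bestApprox l r k m φ

/-- `g_k = ∑_m P_{Q_{k,m}} χ_{Q_{k,m}}` (the cubes are disjoint). -/
def piecewisePoly {n : ℕ} (P : ℕ → (Fin n → ℤ) → MvPolynomial (Fin n) ℝ) (k : ℕ)
    (x : Fin n → ℝ) : ℝ :=
  ∑' m : Fin n → ℤ, (dyadic k m).indicator (fun y => MvPolynomial.eval y (P k m)) x

/-- `T^l_k = Q^l_k(g_k)`, for a family `P` of almost best approximations. -/
def splineApprox {n : ℕ} (l : ℕ) (P : ℕ → (Fin n → ℤ) → MvPolynomial (Fin n) ℝ) (k : ℕ) :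
    (Fin n → ℝ) → ℝ :=
  quasiInterp l k (piecewisePoly P k)

/-- `T^l_k - T^l_{k-1}`, with `T^l_{-1} = 0`. -/
def splineIncrement {n : ℕ} (l : ℕ) (P : ℕ → (Fin n → ℤ) → MvPolynomial (Fin n) ℝ) :
    ℕ → (Fin n → ℝ) → ℝ
  | 0 => splineApprox l P 0
  | k + 1 => fun x => splineApprox l P (k + 1) x - splineApprox l P k x

/-! ### Spline series and coefficient quasi-norms -/

/-- `φ = ∑_k ∑_m β_{k,m} N^l_{k,m}` in `L_r^loc(ℝⁿ)`. -/
def Represents {n : ℕ} (l : ℕ) (r : ℝ≥0∞) (β : ℕ → (Fin n → ℤ) → ℝ)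
    (φ : (Fin n → ℝ) → ℝ) : Prop :=
  TendstoLpLoc r (fun N x => ∑ k ∈ Finset.range N, splineSum l k (β k) x) φ

/-- The coefficient quasi-norm `(∑_k (∑_m t_{k,m}^p |β_{k,m}|^p)^{q/p})^{1/q}`. -/
def coeffNorm {n : ℕ} (p q : ℝ≥0∞) (t : ℕ → (Fin n → ℝ) → ℝ)
    (β : ℕ → (Fin n → ℤ) → ℝ) : ℝ≥0∞ :=
  lNorm q (fun k : ℕ => lNorm p (fun m : Fin n → ℤ => assoc p t k m * ENNReal.ofReal |β k m|))

/-- `N₃(φ, l + 1)`: the infimum of the coefficient quasi-norms over all spline series converging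
to `φ` in `L_r^loc(ℝⁿ)`. -/
def N₃ {n : ℕ} (l : ℕ) (p q r : ℝ≥0∞) (t : ℕ → (Fin n → ℝ) → ℝ)
    (φ : (Fin n → ℝ) → ℝ) : ℝ≥0∞ :=
  ⨅ β : {β : ℕ → (Fin n → ℤ) → ℝ // Represents l r β φ}, coeffNorm p q t β.1

/-- `N₄(φ, l + 1)`: the coefficient quasi-norm of the array `α_{k,m}(T^l_k - T^l_{k-1})`, where
`T^l_k` is built from the family `P` of almost best approximations to `φ`. -/
def N₄ {n : ℕ} (l : ℕ) (p q : ℝ≥0∞) (t : ℕ → (Fin n → ℝ) → ℝ)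
    (P : ℕ → (Fin n → ℤ) → MvPolynomial (Fin n) ℝ) : ℝ≥0∞ :=
  coeffNorm p q t (fun k m => coeffFun l k m (splineIncrement l P k))

end VarBesov

end

noncomputable section

namespace VarBesov

/-! ### Quasi-norm inequalities valid for all exponents -/

section QuasiNorm

variable {α : Type*} [MeasurableSpace α] {μ : Measure α}

/-! Both directions compare averaged differences on dyadic cubes with spline coefficients, one
dyadic level at a time; the levels are then summed with geometrically decaying factors.

Besides the comparability of neighbouring `t_{k,m}`, the weights enter through two transfer
inequalities between levels k ≤ j. The lower condition, combined with Hölder's inequality for 1/θ =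
1/p + 1/σ₁, shows that L_r norms on level-k cubes of level-j step functions gain the factor 2^{-(α₁
- n(1/θ - 1/r))(j - k)} (`WeightClass.exists_lNorm_comp_floorIdx_le`). The upper condition shows
that carrying data which are constant on level-k cubes to level j costs at most 2^{α₂(j - k)}
(`WeightClass.exists_lNorm_ancestor_le`).

Analysis. Whitney's inequality (`exists_whitney`) bounds local polynomial approximation by averaged
differences. The functionals α_{k,m} are de Boor–Fix functionals: they are dual to the B-splines
(`coeffFun_splineSum`), and the quasi-interpolant built from them reproduces polynomials
(`splineSum_coeffFun_polyEval`). Hence T_k approximates φ as well as the local polynomials do. By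
the refinement equation T_k - T_{k-1} is a spline of level k, so its α_{k,m} are its coefficients,
and each is bounded by an L_r norm over a single cube; this bounds N₄. The partial sums telescope to
T_k, which converges to φ locally in L_r by the lower transfer to level 0.

Synthesis. In the level-k oscillation of a series ∑ s_j, a coarse term (j < k) is smooth: its l-th
difference with steps of size 2^{-k} is O(2^{-l(k - j)}), which beats 2^{α₂(k - j)} because α₂ < l.
For a fine term (j ≥ k) no cancellation is used; the lower transfer already gives decay. A discrete
Hardy inequality (`lNorm_iSup_geo_le`) sums the levels. Any array representing φ has the same sum
almost everywhere, so the bound passes to the infimum N₃.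

Exponents below 1 exclude the triangle inequality. A sum of geometrically decaying terms is instead
dominated by a weighted supremum, and a supremum by an l_p sum (`eLpNorm_tsum_geo_le`). Whitney's
inequality is likewise proved by selecting good points with Chebyshev's inequality and by
absorption. -/

theorem eLpNorm_le_iff_lintegral {ε : Type*} [ENorm ε] {p : ℝ≥0∞} (hp : p ≠ 0) (hp' : p ≠ ∞)
    {f : α → ε} {S : ℝ≥0∞} :
    eLpNorm f p μ ≤ S ↔ ∫⁻ x, ‖f x‖ₑ ^ p.toReal ∂μ ≤ S ^ p.toReal := by
  rw [eLpNorm_eq_lintegral_rpow_enorm_toReal hp hp', one_div,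
    ENNReal.rpow_inv_le_iff (ENNReal.toReal_pos hp hp')]

theorem eLpNorm_rpow_toReal {ε : Type*} [ENorm ε] {p : ℝ≥0∞} (hp : p ≠ 0) (hp' : p ≠ ∞)
    (f : α → ε) : eLpNorm f p μ ^ p.toReal = ∫⁻ x, ‖f x‖ₑ ^ p.toReal ∂μ := by
  rw [eLpNorm_eq_lintegral_rpow_enorm_toReal hp hp', one_div,
    ENNReal.rpow_inv_rpow (ENNReal.toReal_pos hp hp').ne']

theorem eLpNorm_mono_ennreal {ε : Type*} [ENorm ε] {p : ℝ≥0∞} {f : α → ε} {g : α → ℝ≥0∞}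
    (h : ∀ x, ‖f x‖ₑ ≤ g x) : eLpNorm f p μ ≤ eLpNorm g p μ :=
  eLpNorm_mono_enorm fun x => by simpa using h x

theorem eLpNorm_mono_ennreal_ae {ε : Type*} [ENorm ε] {p : ℝ≥0∞} {f : α → ε} {g : α → ℝ≥0∞}
    (h : ∀ᵐ x ∂μ, ‖f x‖ₑ ≤ g x) : eLpNorm f p μ ≤ eLpNorm g p μ :=
  eLpNorm_mono_enorm_ae (h.mono fun x hx => by simpa using hx)

theorem eLpNorm_const_mul_ennreal {p : ℝ≥0∞} (hp : p ≠ 0) (c : ℝ≥0∞) (hc : c ≠ ∞)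
    (f : α → ℝ≥0∞) : eLpNorm (fun x => c * f x) p μ = c * eLpNorm f p μ := by
  by_cases hp' : p = ∞
  · subst hp'
    simp only [eLpNorm_exponent_top, eLpNormEssSup, enorm_eq_self]
    exact ENNReal.essSup_const_mul
  · have h0 := ENNReal.toReal_pos hp hp'
    rw [eLpNorm_eq_lintegral_rpow_enorm_toReal hp hp', eLpNorm_eq_lintegral_rpow_enorm_toReal hp hp']
    simp only [enorm_eq_self, ENNReal.mul_rpow_of_nonneg _ _ h0.le]
    rw [lintegral_const_mul' _ _ (ENNReal.rpow_ne_top_of_nonneg h0.le hc),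
      ENNReal.mul_rpow_of_nonneg _ _ (by positivity), one_div, ENNReal.rpow_rpow_inv h0.ne']

variable {ι : Type*}

theorem lNorm_eq_eLpNorm [MeasurableSpace ι] [MeasurableSingletonClass ι]
    {q : ℝ≥0∞} (hq : q ≠ 0) (a : ι → ℝ≥0∞) : lNorm q a = eLpNorm a q Measure.count := by
  unfold lNorm
  split_ifs with h
  · subst h
    simp [eLpNorm_exponent_top]
  · rw [eLpNorm_eq_lintegral_rpow_enorm_toReal hq h, lintegral_count]
    simp

theorem le_lNorm {q : ℝ≥0∞} (hq : q ≠ 0) (a : ι → ℝ≥0∞) (i : ι) : a i ≤ lNorm q a := by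
  unfold lNorm
  split_ifs with h
  · exact le_iSup a i
  · rw [one_div, ENNReal.le_rpow_inv_iff (ENNReal.toReal_pos hq h)]
    exact ENNReal.le_tsum (f := fun i => a i ^ q.toReal) i

theorem lNorm_le_iff {q : ℝ≥0∞} (hq : q ≠ 0) (hq' : q ≠ ∞) {a : ι → ℝ≥0∞} {S : ℝ≥0∞} :
    lNorm q a ≤ S ↔ ∑' i, a i ^ q.toReal ≤ S ^ q.toReal := by
  rw [lNorm, if_neg hq', one_div, ENNReal.rpow_inv_le_iff (ENNReal.toReal_pos hq hq')]

theorem lNorm_rpow {q : ℝ≥0∞} (hq : q ≠ 0) (hq' : q ≠ ∞) (a : ι → ℝ≥0∞) :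
    lNorm q a ^ q.toReal = ∑' i, a i ^ q.toReal := by
  rw [lNorm, if_neg hq', one_div, ENNReal.rpow_inv_rpow (ENNReal.toReal_pos hq hq').ne']

theorem lNorm_mono {q : ℝ≥0∞} {a b : ι → ℝ≥0∞} (h : ∀ i, a i ≤ b i) :
    lNorm q a ≤ lNorm q b := by
  unfold lNorm
  split_ifs
  · exact iSup_mono h
  · gcongr with i
    exact h i

theorem lNorm_const_mul {q : ℝ≥0∞} (hq : q ≠ 0) (c : ℝ≥0∞) (a : ι → ℝ≥0∞) :
    lNorm q (fun i => c * a i) = c * lNorm q a := by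
  unfold lNorm
  split_ifs with h
  · rw [ENNReal.mul_iSup]
  · have h0 := ENNReal.toReal_pos hq h
    simp only [ENNReal.mul_rpow_of_nonneg _ _ h0.le]
    rw [ENNReal.tsum_mul_left, ENNReal.mul_rpow_of_nonneg _ _ (by positivity), one_div,
      ENNReal.rpow_rpow_inv h0.ne']

theorem lNorm_comp_equiv {ι' : Type*} {q : ℝ≥0∞} (e : ι' ≃ ι) (a : ι → ℝ≥0∞) :
    lNorm q (fun i => a (e i)) = lNorm q a := by
  unfold lNorm
  split_ifs
  · exact e.iSup_comp (g := a)
  · rw [e.tsum_eq (fun i => a i ^ q.toReal)]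

/-- The quasi-norm of a supremum is at most the `l_p` norm of the quasi-norms. -/
theorem eLpNorm_iSup_le [Countable ι] {p : ℝ≥0∞} (hp : p ≠ 0) {f : ι → α → ℝ≥0∞}
    (hf : ∀ i, AEMeasurable (f i) μ) :
    eLpNorm (fun x => ⨆ i, f i x) p μ ≤ lNorm p (fun i => eLpNorm (f i) p μ) := by
  by_cases hp' : p = ∞
  · subst hp'
    simp only [lNorm, if_true, eLpNorm_exponent_top, eLpNormEssSup, enorm_eq_self]
    refine essSup_le_of_ae_le _ ?_
    have : ∀ᵐ x ∂μ, ∀ i, f i x ≤ essSup (f i) μ := by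
      rw [ae_all_iff]
      exact fun i => ENNReal.ae_le_essSup _
    filter_upwards [this] with x hx
    exact iSup_mono hx
  · have h0 := ENNReal.toReal_pos hp hp'
    rw [eLpNorm_le_iff_lintegral hp hp', lNorm_rpow hp hp']
    simp only [eLpNorm_rpow_toReal hp hp', enorm_eq_self]
    rw [← lintegral_tsum fun i => (hf i).pow_const _]
    refine lintegral_mono fun x => ?_
    rw [← ENNReal.le_rpow_inv_iff h0]
    refine iSup_le fun i => ?_
    rw [ENNReal.le_rpow_inv_iff h0]
    exact ENNReal.le_tsum (f := fun i => f i x ^ p.toReal) i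

/-- The constant in the quasi-triangle inequality for `N` summands. -/
def quasiConst (p : ℝ≥0∞) (N : ℕ) : ℝ≥0∞ := N * (N : ℝ≥0∞) ^ (p.toReal⁻¹)

theorem quasiConst_ne_top (p : ℝ≥0∞) (N : ℕ) : quasiConst p N ≠ ∞ :=
  ENNReal.mul_ne_top (ENNReal.natCast_ne_top N)
    (ENNReal.rpow_ne_top_of_nonneg (by positivity) (ENNReal.natCast_ne_top N))

/-- For p < 1 there is no triangle inequality: N terms are bounded by N times their supremum, and
the supremum by the l_p sum of the norms. One constant serves all p; for p = ∞ the exponent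
`p.toReal⁻¹` is 0. -/
theorem eLpNorm_le_sum {ε : Type*} [ENorm ε] {p : ℝ≥0∞} (hp : p ≠ 0) (s : Finset ι) {g : α → ε}
    {f : ι → α → ℝ≥0∞} (hf : ∀ i ∈ s, AEMeasurable (f i) μ)
    (h : ∀ᵐ x ∂μ, ‖g x‖ₑ ≤ ∑ i ∈ s, f i x) :
    eLpNorm g p μ ≤ quasiConst p s.card * ∑ i ∈ s, eLpNorm (f i) p μ := by
  have h1 : eLpNorm g p μ ≤ eLpNorm (fun x => (s.card : ℝ≥0∞) * ⨆ i : s, f i x) p μ := by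
    refine eLpNorm_mono_ennreal_ae (h.mono fun x hx => hx.trans ?_)
    refine (Finset.sum_le_card_nsmul s _ (⨆ i : s, f i x) fun i hi => ?_).trans (by simp)
    exact le_iSup (fun i : s => f i x) ⟨i, hi⟩
  rw [eLpNorm_const_mul_ennreal hp _ (ENNReal.natCast_ne_top _)] at h1
  refine h1.trans ?_
  rw [quasiConst, mul_assoc]
  gcongr
  refine (eLpNorm_iSup_le hp fun i : s => hf i i.2).trans ?_
  have h2 : ∀ i : s, eLpNorm (f i) p μ ≤ ∑ i ∈ s, eLpNorm (f i) p μ := fun i =>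
    Finset.single_le_sum (f := fun i => eLpNorm (f i) p μ) (fun _ _ => zero_le) i.2
  by_cases hp' : p = ∞
  · simpa [lNorm, hp'] using h2
  · rw [lNorm_le_iff hp hp', ENNReal.mul_rpow_of_nonneg _ _ ENNReal.toReal_nonneg,
      ENNReal.rpow_inv_rpow (ENNReal.toReal_pos hp hp').ne', tsum_fintype]
    refine (Finset.sum_le_card_nsmul Finset.univ _ _ fun i _ =>
      ENNReal.rpow_le_rpow (h2 i) ENNReal.toReal_nonneg).trans (by simp)

theorem lNorm_sum_le [Countable ι] {κ : Type*} {p : ℝ≥0∞} (hp : p ≠ 0) (s : Finset κ)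
    (f : κ → ι → ℝ≥0∞) :
    lNorm p (fun i => ∑ k ∈ s, f k i) ≤ quasiConst p s.card * ∑ k ∈ s, lNorm p (f k) := by
  let _ : MeasurableSpace ι := ⊤
  simp only [lNorm_eq_eLpNorm hp]
  exact eLpNorm_le_sum hp s (fun i _ => (measurable_of_countable _).aemeasurable)
    (Eventually.of_forall fun x => by simp)

theorem eLpNorm_add_le_quasi {p : ℝ≥0∞} (hp : p ≠ 0) {f g h : α → ℝ}
    (hf : AEMeasurable f μ) (hg : AEMeasurable g μ) (hh : ∀ᵐ x ∂μ, |h x| ≤ |f x| + |g x|) :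
    eLpNorm h p μ ≤ quasiConst p 2 * (eLpNorm f p μ + eLpNorm g p μ) := by
  have := eLpNorm_le_sum (μ := μ) hp (Finset.univ : Finset (Fin 2)) (g := h)
    (f := ![fun x => ‖f x‖ₑ, fun x => ‖g x‖ₑ])
    (by intro i _; fin_cases i; exacts [hf.enorm, hg.enorm])
    (hh.mono fun x hx => by
      simp only [Fin.sum_univ_two, Matrix.cons_val_zero, Matrix.cons_val_one]
      rw [Real.enorm_eq_ofReal_abs, Real.enorm_eq_ofReal_abs, Real.enorm_eq_ofReal_abs,
        ← ENNReal.ofReal_add (abs_nonneg _) (abs_nonneg _)]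
      exact ENNReal.ofReal_le_ofReal hx)
  simpa [Fin.sum_univ_two, eLpNorm_enorm] using this

/-- Decomposition of a quasi-norm along a countable measurable partition. -/
theorem eLpNorm_eq_lNorm_fibres {ε : Type*} [TopologicalSpace ε] [ContinuousENorm ε] [Countable ι]
    {p : ℝ≥0∞} (hp : p ≠ 0)
    {π : α → ι} (hπ : ∀ i, MeasurableSet (π ⁻¹' {i})) (F : α → ε) :
    eLpNorm F p μ = lNorm p (fun i => eLpNorm F p (μ.restrict (π ⁻¹' {i}))) := by
  have hU : (⋃ i, π ⁻¹' {i}) = Set.univ := by ext; simp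
  by_cases hp' : p = ∞
  · subst hp'
    simp only [lNorm, if_true]
    refine le_antisymm ?_ (iSup_le fun i => eLpNorm_mono_measure _ Measure.restrict_le_self)
    simp only [eLpNorm_exponent_top]
    refine essSup_le_of_ae_le _ ?_
    have : ∀ᵐ x ∂μ, ∀ i, x ∈ π ⁻¹' {i} → ‖F x‖ₑ ≤ eLpNormEssSup F (μ.restrict (π ⁻¹' {i})) := by
      rw [ae_all_iff]
      intro i
      rw [← ae_restrict_iff' (hπ i)]
      exact ENNReal.ae_le_essSup _
    filter_upwards [this] with x hx
    exact (hx (π x) rfl).trans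
      (le_iSup (fun i => eLpNormEssSup F (μ.restrict (π ⁻¹' {i}))) (π x))
  · rw [lNorm, if_neg hp']
    simp only [eLpNorm_rpow_toReal hp hp']
    rw [eLpNorm_eq_lintegral_rpow_enorm_toReal hp hp', ← lintegral_iUnion hπ, hU,
      Measure.restrict_univ]
    exact fun i j hij => Disjoint.preimage _ (by simpa using hij)

/-- Fubini for r < ∞. For r = ∞ the exponent `r.toReal⁻¹` is 0, so the same formula gives the bound
without a measure factor. -/
theorem eLpNorm_prod_le {β : Type*} [MeasurableSpace β] {ν : Measure β} [SFinite ν] [SFinite μ]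
    {r : ℝ≥0∞} (hr : r ≠ 0) {F : α × β → ℝ} (hF : Measurable F) {S : ℝ≥0∞}
    (h : ∀ᵐ a ∂μ, eLpNorm (fun b => F (a, b)) r ν ≤ S) :
    eLpNorm F r (μ.prod ν) ≤ μ Set.univ ^ (r.toReal⁻¹) * S := by
  by_cases hr' : r = ∞
  · subst hr'
    simp only [ENNReal.toReal_top, inv_zero, ENNReal.rpow_zero, one_mul, eLpNorm_exponent_top]
    refine essSup_le_of_ae_le _ ?_
    refine (Measure.ae_prod_iff_ae_ae (measurableSet_le hF.enorm measurable_const)).2 ?_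
    filter_upwards [h] with a ha
    have : ∀ᵐ b ∂ν, ‖F (a, b)‖ₑ ≤ eLpNormEssSup (fun b => F (a, b)) ν := ENNReal.ae_le_essSup _
    exact this.mono fun b hb => hb.trans (by simpa [eLpNorm_exponent_top] using ha)
  · have h0 := ENNReal.toReal_pos hr hr'
    rw [eLpNorm_le_iff_lintegral hr hr', lintegral_prod _ (hF.enorm.pow_const _).aemeasurable,
      ENNReal.mul_rpow_of_nonneg _ _ h0.le, ENNReal.rpow_inv_rpow h0.ne', mul_comm,
      ← lintegral_const]
    refine lintegral_mono_ae (h.mono fun a ha => ?_)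
    rwa [eLpNorm_le_iff_lintegral hr hr'] at ha

/-- Off a set of small measure, the sections of a function on a product are controlled by its
quasi-norm. -/
theorem measure_section_gt_le {β : Type*} [MeasurableSpace β] {ν : Measure β} [SFinite ν]
    [SFinite μ] {r : ℝ≥0∞} (hr : r ≠ 0) {F : α × β → ℝ} (hF : Measurable F) {e : ℝ≥0∞}
    (he : e ≠ 0) (he' : e ≠ ∞) :
    μ {a | (e⁻¹) ^ (r.toReal⁻¹) * eLpNorm F r (μ.prod ν) < eLpNorm (fun b => F (a, b)) r ν} ≤ e := by
  by_cases hr' : r = ∞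
  · subst hr'
    simp only [ENNReal.toReal_top, inv_zero, ENNReal.rpow_zero, one_mul, eLpNorm_exponent_top]
    refine le_trans (le_of_eq ?_) zero_le
    have h1 : ∀ᵐ z ∂(μ.prod ν), ‖F z‖ₑ ≤ eLpNormEssSup F (μ.prod ν) := ENNReal.ae_le_essSup _
    have h2 := Measure.ae_ae_of_ae_prod h1
    rw [← compl_compl {a | _}, ← mem_ae_iff]
    filter_upwards [h2] with a ha
    simp only [Set.mem_compl_iff, Set.mem_ofPred_eq, not_lt]
    exact essSup_le_of_ae_le _ ha
  · have h0 := ENNReal.toReal_pos hr hr'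
    set D := eLpNorm F r (μ.prod ν) with hD
    have hDint : D ^ r.toReal = ∫⁻ a, ∫⁻ b, ‖F (a, b)‖ₑ ^ r.toReal ∂ν ∂μ := by
      rw [hD, eLpNorm_rpow_toReal hr hr', lintegral_prod _ (hF.enorm.pow_const _).aemeasurable]
    have hm : Measurable fun a => ∫⁻ b, ‖F (a, b)‖ₑ ^ r.toReal ∂ν :=
      (hF.enorm.pow_const _).lintegral_prod_right'
    -- Chebyshev's inequality below divides by a power of D. For D = ∞ the set is empty, and for D =
    -- 0 almost every section vanishes.
    by_cases hDt : D = ∞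
    · rw [hDt, ENNReal.mul_top (by simp [ENNReal.rpow_eq_zero_iff, he', h0.le])]
      simp
    by_cases hDz : D = 0
    · rw [hDz, mul_zero]
      rw [hDz, ENNReal.zero_rpow_of_pos h0, eq_comm, lintegral_eq_zero_iff hm] at hDint
      refine le_trans (le_of_eq ?_) zero_le
      rw [← compl_compl {a | _}, ← mem_ae_iff]
      filter_upwards [hDint] with a ha
      simp only [Set.mem_compl_iff, Set.mem_ofPred_eq, not_lt]
      rw [eLpNorm_le_iff_lintegral hr hr', ha]
      simp
    · have h1 : (e⁻¹ * D ^ r.toReal) * μ {a | e⁻¹ * D ^ r.toReal ≤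
          ∫⁻ b, ‖F (a, b)‖ₑ ^ r.toReal ∂ν} ≤ D ^ r.toReal := by
        rw [hDint]
        exact mul_meas_ge_le_lintegral hm _
      have h2 : μ {a | (e⁻¹) ^ (r.toReal⁻¹) * D < eLpNorm (fun b => F (a, b)) r ν} ≤
          μ {a | e⁻¹ * D ^ r.toReal ≤ ∫⁻ b, ‖F (a, b)‖ₑ ^ r.toReal ∂ν} := by
        refine measure_mono fun a ha => ?_
        simp only [Set.mem_ofPred_eq] at ha ⊢
        rw [← eLpNorm_rpow_toReal hr hr']
        refine le_trans (le_of_eq ?_) (ENNReal.rpow_le_rpow ha.le h0.le)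
        rw [ENNReal.mul_rpow_of_nonneg _ _ h0.le, ENNReal.rpow_inv_rpow h0.ne']
      refine h2.trans ?_
      have hDr : D ^ r.toReal ≠ 0 := by simp [ENNReal.rpow_eq_zero_iff, hDz, hDt]
      have hDr' : D ^ r.toReal ≠ ∞ := ENNReal.rpow_ne_top_of_nonneg h0.le hDt
      have h3 : D ^ r.toReal * (e⁻¹ * μ {a | e⁻¹ * D ^ r.toReal ≤
          ∫⁻ b, ‖F (a, b)‖ₑ ^ r.toReal ∂ν}) ≤ D ^ r.toReal * 1 := by
        rw [mul_one]
        refine le_trans (le_of_eq ?_) h1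
        ring
      rw [ENNReal.mul_le_mul_iff_right hDr hDr'] at h3
      rwa [mul_comm, ← div_eq_mul_inv, ENNReal.div_le_iff he he', one_mul] at h3

/-- Each term is at most the l_θ norm, so one writes `a i ^ r` as `a i ^ θ` times `a i ^ (r - θ)`
and bounds the second factor. -/
theorem lNorm_le_of_exponent_le {θ r : ℝ≥0∞} (hθ : θ ≠ 0) (h : θ ≤ r) (a : ι → ℝ≥0∞) :
    lNorm r a ≤ lNorm θ a := by
  have hr : r ≠ 0 := fun h0 => hθ (le_antisymm (h0 ▸ h) zero_le)
  by_cases hr' : r = ∞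
  · rw [lNorm, if_pos hr']
    exact iSup_le fun i => le_lNorm hθ a i
  have hθ' : θ ≠ ∞ := ne_top_of_le_ne_top hr' h
  have h0 := ENNReal.toReal_pos hθ hθ'
  have h1 : θ.toReal ≤ r.toReal := (ENNReal.toReal_le_toReal hθ' hr').2 h
  rw [lNorm_le_iff hr hr']
  have h2 : ∀ i, a i ^ r.toReal ≤ a i ^ θ.toReal * lNorm θ a ^ (r.toReal - θ.toReal) := fun i => by
    calc a i ^ r.toReal = a i ^ (θ.toReal + (r.toReal - θ.toReal)) := by ring_nf
      _ = a i ^ θ.toReal * a i ^ (r.toReal - θ.toReal) :=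
          ENNReal.rpow_add_of_nonneg _ _ h0.le (by linarith)
      _ ≤ _ := by
          exact mul_le_mul_right (ENNReal.rpow_le_rpow (le_lNorm hθ a i) (by linarith)) _
  refine (ENNReal.tsum_le_tsum h2).trans ?_
  rw [ENNReal.tsum_mul_right, ← lNorm_rpow hθ hθ', ← ENNReal.rpow_add_of_nonneg _ _ h0.le
    (by linarith)]
  exact le_of_eq (by ring_nf)

/-- Hölder's inequality for sequences, for all exponents. -/
theorem lNorm_mul_le [Countable ι] {θ p σ : ℝ≥0∞} (hθ : θ ≠ 0) (hp : p ≠ 0) (hσ : σ ≠ 0)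
    (h : θ⁻¹ = p⁻¹ + σ⁻¹) (a b : ι → ℝ≥0∞) :
    lNorm θ (fun i => a i * b i) ≤ lNorm p a * lNorm σ b := by
  -- If one of the two exponents is infinite, the other equals θ and the corresponding factor is
  -- replaced by its supremum.
  by_cases hσ' : σ = ∞
  · have : θ = p := by simpa [hσ'] using h
    subst this
    calc lNorm θ (fun i => a i * b i) ≤ lNorm θ (fun i => lNorm σ b * a i) :=
          lNorm_mono fun i => by rw [mul_comm]; gcongr; exact le_lNorm hσ b i
      _ = lNorm θ a * lNorm σ b := by rw [lNorm_const_mul hθ, mul_comm]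
  by_cases hp' : p = ∞
  · have : θ = σ := by simpa [hp'] using h
    subst this
    calc lNorm θ (fun i => a i * b i) ≤ lNorm θ (fun i => lNorm p a * b i) :=
          lNorm_mono fun i => by gcongr; exact le_lNorm hp a i
      _ = lNorm p a * lNorm θ b := by rw [lNorm_const_mul hθ]
  have hθ' : θ ≠ ∞ := by
    rintro rfl
    have : p⁻¹ = 0 := by simpa using (add_eq_zero.1 (h.symm.trans ENNReal.inv_top)).1
    exact hp' (ENNReal.inv_eq_zero.1 this)
  have h0 := ENNReal.toReal_pos hθ hθ'
  have h1 := ENNReal.toReal_pos hp hp'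
  have h2 := ENNReal.toReal_pos hσ hσ'
  have h3 : 1 / θ.toReal = 1 / p.toReal + 1 / σ.toReal := by
    have := congrArg ENNReal.toReal h
    rw [ENNReal.toReal_add (ENNReal.inv_ne_top.2 hp) (ENNReal.inv_ne_top.2 hσ)] at this
    simpa [ENNReal.toReal_inv, one_div] using this
  have h4 : θ.toReal < p.toReal := by
    have : 1 / p.toReal < 1 / θ.toReal := by rw [h3]; linarith [one_div_pos.2 h2]
    exact (one_div_lt_one_div h1 h0).1 this
  let _ : MeasurableSpace ι := ⊤
  have := ENNReal.lintegral_Lp_mul_le_Lq_mul_Lr h0 h4 h3 Measure.count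
    (measurable_of_countable a).aemeasurable (measurable_of_countable b).aemeasurable
  simpa [lNorm, hθ', hp', hσ', lintegral_count] using this

/-! ### Sums with geometric weights -/

/-- The distance of two indices. -/
def idxDist (j k : ℕ) : ℕ := (j - k) + (k - j)

theorem tsum_pow_idxDist_le (ρ : ℝ≥0∞) (k : ℕ) : ∑' j, ρ ^ idxDist j k ≤ 2 * (1 - ρ)⁻¹ := by
  have h1 : ∑' j, ρ ^ idxDist j k =
      ∑ j ∈ Finset.range k, ρ ^ idxDist j k + ∑' j, ρ ^ idxDist (j + k) k :=
    (Summable.sum_add_tsum_nat_add' (f := fun j => ρ ^ idxDist j k) ENNReal.summable).symm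
  have h2 : ∑' j, ρ ^ idxDist (j + k) k = (1 - ρ)⁻¹ := by
    rw [← ENNReal.tsum_geometric]
    refine tsum_congr fun j => ?_
    simp [idxDist]
  have h3 : ∑ j ∈ Finset.range k, ρ ^ idxDist j k ≤ (1 - ρ)⁻¹ := by
    rw [← ENNReal.tsum_geometric, ← Finset.sum_range_reflect]
    refine le_trans ?_ (Summable.sum_le_tsum ((Finset.range k).map (addRightEmbedding 1))
      (fun _ _ => zero_le) ENNReal.summable)
    rw [Finset.sum_map]
    refine Finset.sum_le_sum fun j hj => le_of_eq ?_
    have := Finset.mem_range.1 hj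
    congr 1
    simp only [idxDist, addRightEmbedding_apply]
    omega
  rw [h1, h2, two_mul]
  exact add_le_add_left h3 _

/-- The constant in the summation inequality for geometrically decaying terms. -/
def geoConst (p ρ : ℝ≥0∞) : ℝ≥0∞ :=
  (2 * (1 - ρ)⁻¹) * (2 * (1 - ρ ^ p.toReal)⁻¹) ^ (p.toReal⁻¹)

theorem geoConst_ne_top {p ρ : ℝ≥0∞} (hp : p ≠ 0) (hρ : ρ < 1) : geoConst p ρ ≠ ∞ := by
  have h1 : ∀ x : ℝ≥0∞, x < 1 → 2 * (1 - x)⁻¹ ≠ ∞ := fun x hx =>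
    ENNReal.mul_ne_top (by simp) (ENNReal.inv_ne_top.2 (tsub_pos_of_lt hx).ne')
  refine ENNReal.mul_ne_top (h1 _ hρ) ?_
  by_cases hp' : p = ∞
  · simp [hp']
  · refine ENNReal.rpow_ne_top_of_nonneg (by positivity) (h1 _ ?_)
    exact ENNReal.rpow_lt_one hρ (ENNReal.toReal_pos hp hp')

theorem lNorm_geo_le {p ρ : ℝ≥0∞} (hp : p ≠ 0) (hρ : ρ < 1) (k : ℕ) :
    lNorm p (fun j => ρ ^ idxDist j k) ≤ (2 * (1 - ρ ^ p.toReal)⁻¹) ^ (p.toReal⁻¹) := by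
  by_cases hp' : p = ∞
  · simp only [lNorm, hp', if_true, ENNReal.toReal_top, inv_zero, ENNReal.rpow_zero]
    exact iSup_le fun j => pow_le_one₀ zero_le hρ.le
  · rw [lNorm_le_iff hp hp', ENNReal.rpow_inv_rpow (ENNReal.toReal_pos hp hp').ne']
    refine le_trans (le_of_eq (tsum_congr fun j => ?_)) (tsum_pow_idxDist_le (ρ ^ p.toReal) k)
    rw [← ENNReal.rpow_natCast, ← ENNReal.rpow_natCast, ← ENNReal.rpow_mul, ← ENNReal.rpow_mul,
      mul_comm]

/-- The substitute for the triangle inequality in infinite sums. Of the two powers of `ρ ^ idxDist j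
k`, one is spent on dominating the sum by a weighted supremum, the other on the l_p summability of
the norms under that supremum. -/
theorem eLpNorm_tsum_geo_le {ε : Type*} [ENorm ε] {p ρ : ℝ≥0∞} (hp : p ≠ 0) (hρ0 : ρ ≠ 0)
    (hρ : ρ < 1) (k : ℕ) {g : α → ε} {f : ℕ → α → ℝ≥0∞} (hf : ∀ j, AEMeasurable (f j) μ)
    {S : ℝ≥0∞} (hS : ∀ j, eLpNorm (f j) p μ ≤ (ρ ^ idxDist j k) ^ 2 * S)
    (h : ∀ᵐ x ∂μ, ‖g x‖ₑ ≤ ∑' j, f j x) : eLpNorm g p μ ≤ geoConst p ρ * S := by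
  have hw0 : ∀ j, ρ ^ idxDist j k ≠ 0 := fun j => pow_ne_zero _ hρ0
  have hwt : ∀ j, ρ ^ idxDist j k ≠ ∞ := fun j => ENNReal.pow_ne_top (hρ.trans_le le_top).ne
  have h1 : eLpNorm g p μ ≤
      eLpNorm (fun x => (2 * (1 - ρ)⁻¹) * ⨆ j, (ρ ^ idxDist j k)⁻¹ * f j x) p μ := by
    refine eLpNorm_mono_ennreal_ae (h.mono fun x hx => hx.trans ?_)
    calc ∑' j, f j x = ∑' j, ρ ^ idxDist j k * ((ρ ^ idxDist j k)⁻¹ * f j x) := by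
          refine tsum_congr fun j => ?_
          rw [← mul_assoc, ENNReal.mul_inv_cancel (hw0 j) (hwt j), one_mul]
      _ ≤ ∑' j, ρ ^ idxDist j k * ⨆ j, (ρ ^ idxDist j k)⁻¹ * f j x := by
          refine ENNReal.tsum_le_tsum fun j => ?_
          gcongr
          exact le_iSup (fun j => (ρ ^ idxDist j k)⁻¹ * f j x) j
      _ ≤ _ := by
          rw [ENNReal.tsum_mul_right]
          gcongr
          exact tsum_pow_idxDist_le ρ k
  rw [eLpNorm_const_mul_ennreal hp _ (ENNReal.mul_ne_top (by simp)
    (ENNReal.inv_ne_top.2 (tsub_pos_of_lt hρ).ne'))] at h1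
  refine h1.trans ?_
  rw [geoConst, mul_assoc (2 * (1 - ρ)⁻¹)]
  refine mul_le_mul_right ?_ _
  refine (eLpNorm_iSup_le hp fun j => (hf j).const_mul _).trans ?_
  refine le_trans (lNorm_mono (b := fun j => S * ρ ^ idxDist j k) fun j => ?_) ?_
  · rw [eLpNorm_const_mul_ennreal hp _ (ENNReal.inv_ne_top.2 (hw0 j))]
    calc (ρ ^ idxDist j k)⁻¹ * eLpNorm (f j) p μ
        ≤ (ρ ^ idxDist j k)⁻¹ * ((ρ ^ idxDist j k) ^ 2 * S) := by gcongr; exact hS j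
      _ = ((ρ ^ idxDist j k)⁻¹ * ρ ^ idxDist j k) * (S * ρ ^ idxDist j k) := by ring
      _ = _ := by rw [ENNReal.inv_mul_cancel (hw0 j) (hwt j), one_mul]
  · rw [lNorm_const_mul hp, mul_comm]
    gcongr
    exact lNorm_geo_le hp hρ k

theorem lNorm_tsum_geo_le [Countable ι] {p ρ : ℝ≥0∞} (hp : p ≠ 0) (hρ0 : ρ ≠ 0) (hρ : ρ < 1)
    (k : ℕ) {g : ι → ℝ≥0∞} {f : ℕ → ι → ℝ≥0∞} {S : ℝ≥0∞}
    (hS : ∀ j, lNorm p (f j) ≤ (ρ ^ idxDist j k) ^ 2 * S) (h : ∀ i, g i ≤ ∑' j, f j i) :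
    lNorm p g ≤ geoConst p ρ * S := by
  let _ : MeasurableSpace ι := ⊤
  simp only [lNorm_eq_eLpNorm hp] at hS ⊢
  exact eLpNorm_tsum_geo_le hp hρ0 hρ k (fun j => (measurable_of_countable _).aemeasurable) hS
    (Eventually.of_forall fun x => by simpa using h x)

/-- A discrete Hardy inequality. -/
theorem lNorm_iSup_geo_le {q ρ : ℝ≥0∞} (hq : q ≠ 0) (hρ : ρ < 1) (W : ℕ → ℝ≥0∞) :
    lNorm q (fun k => ⨆ j, ρ ^ idxDist j k * W j) ≤
      (2 * (1 - ρ ^ q.toReal)⁻¹) ^ (q.toReal⁻¹) * lNorm q W := by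
  by_cases hq' : q = ∞
  · simp only [lNorm, hq', if_true, ENNReal.toReal_top, inv_zero, ENNReal.rpow_zero, one_mul]
    refine iSup_le fun k => iSup_mono fun j => ?_
    calc ρ ^ idxDist j k * W j ≤ 1 * W j := by gcongr; exact pow_le_one₀ zero_le hρ.le
      _ = W j := one_mul _
  · have h0 := ENNReal.toReal_pos hq hq'
    rw [lNorm_le_iff hq hq', ENNReal.mul_rpow_of_nonneg _ _ h0.le, ENNReal.rpow_inv_rpow h0.ne',
      lNorm_rpow hq hq']
    -- The q-th power of a supremum is at most the sum of the q-th powers, for every q > 0; after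
    -- that the two sums are interchanged.
    calc ∑' k, (⨆ j, ρ ^ idxDist j k * W j) ^ q.toReal
        ≤ ∑' k, ∑' j, (ρ ^ q.toReal) ^ idxDist k j * W j ^ q.toReal := by
          refine ENNReal.tsum_le_tsum fun k => ?_
          rw [← ENNReal.le_rpow_inv_iff h0]
          refine iSup_le fun j => ?_
          rw [ENNReal.le_rpow_inv_iff h0]
          refine le_trans (le_of_eq ?_) (ENNReal.le_tsum j)
          rw [ENNReal.mul_rpow_of_nonneg _ _ h0.le, ← ENNReal.rpow_natCast, ← ENNReal.rpow_natCast,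
            ← ENNReal.rpow_mul, ← ENNReal.rpow_mul, mul_comm (idxDist j k : ℝ)]
          simp only [idxDist, add_comm]
      _ = ∑' j, (∑' k, (ρ ^ q.toReal) ^ idxDist k j) * W j ^ q.toReal := by
          rw [ENNReal.tsum_comm]
          exact tsum_congr fun j => ENNReal.tsum_mul_right
      _ ≤ ∑' j, (2 * (1 - ρ ^ q.toReal)⁻¹) * W j ^ q.toReal := by
          refine ENNReal.tsum_le_tsum fun j => ?_
          gcongr
          exact tsum_pow_idxDist_le _ _
      _ = _ := ENNReal.tsum_mul_left

end QuasiNorm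

/-! ### Dyadic cubes -/

section Dyadic

variable {n : ℕ}

/-- The index of the half-open dyadic cube of level `k` containing `x`. -/
def floorIdx (k : ℕ) (x : Fin n → ℝ) : Fin n → ℤ := fun i => ⌊2 ^ k * x i⌋

/-- The index of the ancestor `d` levels up of the dyadic cube with index `m`. -/
def ancestor (d : ℕ) (m : Fin n → ℤ) : Fin n → ℤ := fun i => m i / 2 ^ d

/-- The indices of the dyadic cubes `d` levels below the cube with index `m`. -/
def descendants (d : ℕ) (m : Fin n → ℤ) : Set (Fin n → ℤ) := ancestor d ⁻¹' {m}

theorem mem_dyadicHalfOpen {k : ℕ} {m : Fin n → ℤ} {x : Fin n → ℝ} :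
    x ∈ dyadicHalfOpen k m ↔ floorIdx k x = m := by
  have h2 : (0 : ℝ) < 2 ^ k := by positivity
  rw [funext_iff]
  refine forall_congr' fun i => ?_
  rw [floorIdx, Int.floor_eq_iff, div_le_iff₀ h2, lt_div_iff₀ h2, mul_comm (x i)]

theorem dyadicHalfOpen_eq (k : ℕ) (m : Fin n → ℤ) : dyadicHalfOpen k m = floorIdx k ⁻¹' {m} := by
  ext x
  exact mem_dyadicHalfOpen

theorem floorIdx_eq_ancestor {k j : ℕ} (h : k ≤ j) (x : Fin n → ℝ) :
    floorIdx k x = ancestor (j - k) (floorIdx j x) := by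
  funext i
  have h1 : (2 : ℝ) ^ k * x i = (2 ^ j * x i) / ((2 ^ (j - k) : ℕ) : ℝ) := by
    obtain ⟨d, rfl⟩ := Nat.exists_eq_add_of_le h
    push_cast
    rw [Nat.add_sub_cancel_left, pow_add]
    field_simp
  rw [floorIdx, ancestor, h1, Int.floor_div_natCast]
  simp [floorIdx]

theorem dyadicHalfOpen_eq_preimage {k j : ℕ} (h : k ≤ j) (m : Fin n → ℤ) :
    dyadicHalfOpen k m = floorIdx j ⁻¹' descendants (j - k) m := by
  ext x
  rw [mem_dyadicHalfOpen, floorIdx_eq_ancestor h]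
  rfl

theorem measurable_floorIdx (k : ℕ) : Measurable (floorIdx k : (Fin n → ℝ) → Fin n → ℤ) :=
  measurable_pi_lambda _ fun i => Int.measurable_floor.comp (by fun_prop)

theorem measurableSet_dyadicHalfOpen (k : ℕ) (m : Fin n → ℤ) :
    MeasurableSet (dyadicHalfOpen k m) := by
  rw [dyadicHalfOpen_eq]
  exact measurable_floorIdx k (measurableSet_singleton m)

theorem restrict_dyadic (k : ℕ) (m : Fin n → ℤ) :
    (volume.restrict (dyadic k m) : Measure (Fin n → ℝ)) =
      volume.restrict (dyadicHalfOpen k m) := by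
  have h1 : dyadic k m =
      Set.pi Set.univ fun i => Set.Ioo ((m i : ℝ) / 2 ^ k) (((m i : ℝ) + 1) / 2 ^ k) := by
    ext x; simp [dyadic]
  have h2 : dyadicHalfOpen k m =
      Set.pi Set.univ fun i => Set.Ico ((m i : ℝ) / 2 ^ k) (((m i : ℝ) + 1) / 2 ^ k) := by
    ext x; simp [dyadicHalfOpen]
  rw [h1, h2]
  exact Measure.restrict_congr_set
    (Measure.univ_pi_Ioo_ae_eq_Icc.trans Measure.univ_pi_Ico_ae_eq_Icc.symm)

theorem volume_dyadicHalfOpen (k : ℕ) (m : Fin n → ℤ) :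
    volume (dyadicHalfOpen k m) = ((2 : ℝ≥0∞) ^ (k * n))⁻¹ := by
  have h2 : dyadicHalfOpen k m =
      Set.pi Set.univ fun i => Set.Ico ((m i : ℝ) / 2 ^ k) (((m i : ℝ) + 1) / 2 ^ k) := by
    ext x; simp [dyadicHalfOpen]
  rw [h2, Real.volume_pi_Ico]
  have : ∀ i, ENNReal.ofReal (((m i : ℝ) + 1) / 2 ^ k - (m i : ℝ) / 2 ^ k) =
      ((2 : ℝ≥0∞) ^ k)⁻¹ := fun i => by
    rw [show ((m i : ℝ) + 1) / 2 ^ k - (m i : ℝ) / 2 ^ k = ((2 : ℝ) ^ k)⁻¹ by ring,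
      ENNReal.ofReal_inv_of_pos (by positivity), ENNReal.ofReal_pow (by norm_num)]
    simp
  simp only [this, Finset.prod_const, Finset.card_univ, Fintype.card_fin]
  rw [← ENNReal.inv_pow, pow_mul]

/-- Normalized Lebesgue measure on a dyadic cube. -/
def cubeMeas (k : ℕ) (m : Fin n → ℤ) : Measure (Fin n → ℝ) :=
  ((2 : ℝ≥0∞) ^ (k * n)) • volume.restrict (dyadicHalfOpen k m)

/-- All cubes of one level have the same volume, so Lebesgue measure pushes forward to a multiple of
counting measure. This turns L_p norms of step functions into l_p norms. -/
theorem map_floorIdx_restrict (j : ℕ) (S : Set (Fin n → ℤ)) :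
    Measure.map (floorIdx j) (volume.restrict (floorIdx j ⁻¹' S) : Measure (Fin n → ℝ)) =
      ((2 : ℝ≥0∞) ^ (j * n))⁻¹ • Measure.count.restrict S := by
  have hS : MeasurableSet S := S.to_countable.measurableSet
  rw [← Measure.restrict_map (measurable_floorIdx j) hS, ← Measure.restrict_smul]
  congr 1
  refine Measure.ext_of_singleton fun m => ?_
  rw [Measure.map_apply (measurable_floorIdx j) (measurableSet_singleton m), ← dyadicHalfOpen_eq,
    volume_dyadicHalfOpen]
  simp

theorem map_val_count {ι : Type*} [Countable ι] [MeasurableSpace ι] [MeasurableSingletonClass ι]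
    (S : Set ι) :
    Measure.map (Subtype.val : S → ι) Measure.count = Measure.count.restrict S := by
  refine Measure.ext_of_singleton fun m => ?_
  rw [Measure.map_apply measurable_subtype_coe (measurableSet_singleton m),
    Measure.restrict_apply (measurableSet_singleton m)]
  by_cases hm : m ∈ S
  · have h1 : (Subtype.val : S → ι) ⁻¹' {m} = {⟨m, hm⟩} := by ext ⟨x, hx⟩; simp
    have h2 : ({m} : Set ι) ∩ S = {m} := by simpa using hm
    rw [h1, h2]
    simp
  · have h1 : (Subtype.val : S → ι) ⁻¹' {m} = ∅ := by
      ext ⟨x, hx⟩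
      simp only [Set.mem_preimage, Set.mem_singleton_iff, Set.mem_empty_iff_false, iff_false]
      rintro rfl
      exact hm hx
    have h2 : ({m} : Set ι) ∩ S = ∅ := by simpa using hm
    rw [h1, h2]
    simp

theorem eLpNorm_count_restrict {ι : Type*} [Countable ι] [MeasurableSpace ι]
    [MeasurableSingletonClass ι] {p : ℝ≥0∞} (hp : p ≠ 0) (S : Set ι) (a : ι → ℝ≥0∞) :
    eLpNorm a p (Measure.count.restrict S) = lNorm p (fun i : S => a i) := by
  rw [← map_val_count,
    (MeasurableEmbedding.subtype_coe S.to_countable.measurableSet).eLpNorm_map_measure,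
    lNorm_eq_eLpNorm hp]
  rfl

/-- The powers of two produced by comparing cubes of two levels. -/
theorem pow_mul_inv_pow_rpow (k j n : ℕ) (x : ℝ) :
    ((2 : ℝ≥0∞) ^ (k * n) * ((2 : ℝ≥0∞) ^ (j * n))⁻¹) ^ x =
      (2 : ℝ≥0∞) ^ (((k : ℝ) - j) * n * x) := by
  rw [← ENNReal.rpow_natCast, ← ENNReal.rpow_natCast, ← ENNReal.rpow_neg,
    ← ENNReal.rpow_add _ _ (by simp) (by simp), ← ENNReal.rpow_mul]
  congr 1
  push_cast
  ring

/-- The bridge from normalised averages over a cube to sums over its level-j descendants; the power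
of two is the ratio of the two cube volumes to the power 1/p, hence 1 for p = ∞. -/
theorem eLpNorm_comp_floorIdx {p : ℝ≥0∞} (hp : p ≠ 0) {k j : ℕ} (h : k ≤ j) (m : Fin n → ℤ)
    (a : (Fin n → ℤ) → ℝ≥0∞) :
    eLpNorm (fun x => a (floorIdx j x)) p (cubeMeas k m) =
      (2 : ℝ≥0∞) ^ (((k : ℝ) - j) * n * (p⁻¹).toReal) *
        lNorm p (fun m' : descendants (j - k) m => a m') := by
  have h0 : ((2 : ℝ≥0∞) ^ (j * n))⁻¹ ≠ 0 := by simp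
  rw [cubeMeas, eLpNorm_smul_measure_of_ne_zero (by simp), dyadicHalfOpen_eq_preimage h]
  have h1 : eLpNorm (fun x => a (floorIdx j x)) p
      (volume.restrict (floorIdx j ⁻¹' descendants (j - k) m) : Measure (Fin n → ℝ)) =
      eLpNorm a p (Measure.map (floorIdx j)
        (volume.restrict (floorIdx j ⁻¹' descendants (j - k) m))) := by
    rw [eLpNorm_map_measure (measurable_of_countable a).aestronglyMeasurable
      (measurable_floorIdx j).aemeasurable]
    rfl
  rw [h1, map_floorIdx_restrict, eLpNorm_smul_measure_of_ne_zero h0, eLpNorm_count_restrict hp,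
    smul_smul, ← ENNReal.mul_rpow_of_nonneg _ _ ENNReal.toReal_nonneg, pow_mul_inv_pow_rpow,
    one_div, smul_eq_mul]

theorem descendants_zero (m : Fin n → ℤ) : descendants 0 m = {m} := by
  ext m'
  simp [descendants, ancestor, funext_iff]

theorem lNorm_descendants {p : ℝ≥0∞} (hp : p ≠ 0) (d : ℕ) (a : (Fin n → ℤ) → ℝ≥0∞) :
    lNorm p (fun m : Fin n → ℤ => lNorm p (fun m' : descendants d m => a m')) = lNorm p a := by
  rw [lNorm_eq_eLpNorm hp a, eLpNorm_eq_lNorm_fibres hp (π := ancestor d)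
    fun m => (Set.to_countable _).measurableSet]
  congr 1
  funext m
  rw [eLpNorm_count_restrict hp]
  rfl

instance (k : ℕ) (m : Fin n → ℤ) : IsProbabilityMeasure (cubeMeas k m) := ⟨by
  rw [cubeMeas, Measure.smul_apply, Measure.restrict_apply_univ, volume_dyadicHalfOpen, smul_eq_mul,
    ENNReal.mul_inv_cancel (by simp) (by simp)]⟩

theorem lNorm_unique {ι : Type*} [Unique ι] {p : ℝ≥0∞} (hp : p ≠ 0) (a : ι → ℝ≥0∞) :
    lNorm p a = a default := by
  unfold lNorm
  split_ifs with h
  · simp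
  · rw [tsum_fintype, Fintype.sum_unique, one_div,
      ENNReal.rpow_rpow_inv (ENNReal.toReal_pos hp h).ne']

/-- The integer vectors with entries of absolute value at most `K`. -/
def intBox (n K : ℕ) : Finset (Fin n → ℤ) :=
  Fintype.piFinset fun _ => Finset.Icc (-(K : ℤ)) K

theorem mem_intBox {K : ℕ} {e : Fin n → ℤ} : e ∈ intBox n K ↔ ∀ i, |e i| ≤ K := by
  simp [intBox, abs_le]

end Dyadic

/-! ### Weight sequences -/

section Weights

variable {n : ℕ} {p : ℝ≥0∞} {t : ℕ → (Fin n → ℝ) → ℝ}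

theorem avgNorm_eq (s : ℝ≥0∞) (k : ℕ) (m : Fin n → ℤ) (f : (Fin n → ℝ) → ℝ≥0∞) :
    avgNorm s k m f = eLpNorm f s (cubeMeas k m) := by
  rw [avgNorm, restrict_dyadic, cubeMeas]

theorem assocWeight_eq (k : ℕ) (x : Fin n → ℝ) :
    assocWeight p t k x =
      (2 : ℝ≥0∞) ^ ((k : ℝ) * n * (p⁻¹).toReal) * assoc p t k (floorIdx k x) := by
  rw [assocWeight, tsum_eq_single (floorIdx k x)]
  · rw [Set.indicator_of_mem (mem_dyadicHalfOpen.2 rfl)]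
  · intro m hm
    exact Set.indicator_of_notMem (fun h => hm (mem_dyadicHalfOpen.1 h).symm) _

theorem dyadicHalfOpen_subset_closedBall (k : ℕ) (m : Fin n → ℤ) :
    dyadicHalfOpen k m ⊆ Metric.closedBall (fun i => (m i : ℝ) / 2 ^ k) (1 / 2 ^ k) := by
  intro x hx
  rw [Metric.mem_closedBall, dist_pi_le_iff (by positivity)]
  intro i
  have := hx i
  rw [Real.dist_eq, abs_le]
  rw [add_div] at this
  constructor
  · have : (0 : ℝ) < 1 / 2 ^ k := by positivity
    linarith [hx i]
  · linarith

theorem assoc_ne_top (ht : IsAdmissible p t) (k : ℕ) (m : Fin n → ℤ) : assoc p t k m ≠ ∞ := by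
  rw [assoc, restrict_dyadic]
  refine ((eLpNorm_mono_measure _ (Measure.restrict_mono (dyadicHalfOpen_subset_closedBall k m)
    le_rfl)).trans_lt ((ht k).2 _ (isCompact_closedBall _ _)).2).ne

variable {α₁ α₂ α₃ : ℝ} {σ₁ σ₂ : ℝ≥0∞}

theorem WeightClass.assoc_ne_top (ht : WeightClass p α₁ α₂ α₃ σ₁ σ₂ t) (k : ℕ) (m : Fin n → ℤ) :
    assoc p t k m ≠ ∞ := VarBesov.assoc_ne_top ht.admissible k m

theorem WeightClass.assoc_ne_zero (ht : WeightClass p α₁ α₂ α₃ σ₁ σ₂ t) (k : ℕ)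
    (m : Fin n → ℤ) : assoc p t k m ≠ 0 := (ht.neighbours k m m (by simp)).1.ne'

theorem avgNorm_assocWeight (hp : p ≠ 0) (k : ℕ) (m : Fin n → ℤ) :
    avgNorm p k m (assocWeight p t k) =
      (2 : ℝ≥0∞) ^ ((k : ℝ) * n * (p⁻¹).toReal) * assoc p t k m := by
  rw [avgNorm_eq, funext (assocWeight_eq (p := p) (t := t) k),
    eLpNorm_comp_floorIdx hp le_rfl m
      fun m' => (2 : ℝ≥0∞) ^ ((k : ℝ) * n * (p⁻¹).toReal) * assoc p t k m']
  simp only [sub_self, zero_mul, ENNReal.rpow_zero, one_mul]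
  have : lNorm p (fun m' : descendants 0 m =>
      (2 : ℝ≥0∞) ^ ((k : ℝ) * n * (p⁻¹).toReal) * assoc p t k m') =
      lNorm p (fun m' : ({m} : Set (Fin n → ℤ)) =>
        (2 : ℝ≥0∞) ^ ((k : ℝ) * n * (p⁻¹).toReal) * assoc p t k m') := by
    rw [descendants_zero]
  rw [Nat.sub_self, this, lNorm_unique hp]
  rfl

theorem two_rpow_ne_zero (x : ℝ) : (2 : ℝ≥0∞) ^ x ≠ 0 :=
  (ENNReal.rpow_pos (by norm_num) (by norm_num)).ne'

theorem two_rpow_ne_top (x : ℝ) : (2 : ℝ≥0∞) ^ x ≠ ∞ :=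
  ENNReal.rpow_ne_top_of_ne_zero (by norm_num) (by norm_num)

theorem two_rpow_add (x y : ℝ) : (2 : ℝ≥0∞) ^ (x + y) = 2 ^ x * 2 ^ y :=
  ENNReal.rpow_add _ _ (by norm_num) (by norm_num)

theorem ofReal_mul_two_rpow {C : ℝ} (hC : 0 ≤ C) (x : ℝ) :
    ENNReal.ofReal (C * 2 ^ x) = ENNReal.ofReal C * (2 : ℝ≥0∞) ^ x := by
  rw [ENNReal.ofReal_mul hC, ← ENNReal.ofReal_rpow_of_pos (by norm_num)]
  simp

/-- Apart from being nonzero, this is the only property of σ₁ = θ p_θ' that is used: it is the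
Hölder relation that splits off the weight. -/
theorem holder_exponent {θ : ℝ≥0∞} (hp : p ≠ 0) (hθ : θ ≠ 0) (h : θ ≤ p) :
    θ⁻¹ = p⁻¹ + (θ * ENNReal.conjExponent (pTheta p θ))⁻¹ := by
  by_cases hθ' : θ = ∞
  · have hp' : p = ∞ := by simpa [hθ'] using h
    subst hθ' hp'
    simp [pTheta, ENNReal.conjExponent]
  have h1 : 1 ≤ p / θ := by
    rwa [ENNReal.le_div_iff_mul_le (Or.inl hθ) (Or.inl hθ'), one_mul]
  have h2 := (ENNReal.HolderConjugate.conjExponent h1).inv_add_inv_eq_one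
  rw [pTheta, if_neg (by simp [hθ']), ENNReal.mul_inv (Or.inl hθ) (Or.inl hθ')]
  calc θ⁻¹ = θ⁻¹ * ((p / θ)⁻¹ + (ENNReal.conjExponent (p / θ))⁻¹) := by rw [h2, mul_one]
    _ = _ := by
      rw [mul_add, ENNReal.inv_div (Or.inl hθ') (Or.inl hθ), div_eq_mul_inv, ← mul_assoc,
        ENNReal.inv_mul_cancel hθ hθ', one_mul]

/-- The lower weight condition, in terms of the sequence `t_{k,m}`. -/
theorem WeightClass.exists_lower (ht : WeightClass p α₁ α₂ α₃ σ₁ σ₂ t) (hp : p ≠ 0) (hσ : σ₁ ≠ 0)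
    {θ : ℝ≥0∞} (hH : θ⁻¹ = p⁻¹ + σ₁⁻¹) :
    ∃ C : ℝ≥0, ∀ k j : ℕ, k ≤ j → ∀ m : Fin n → ℤ,
      assoc p t k m * lNorm σ₁ (fun m' : descendants (j - k) m => (assoc p t j m')⁻¹) ≤
        C * (2 : ℝ≥0∞) ^ (((k : ℝ) - j) * (α₁ - n * (θ⁻¹).toReal)) := by
  obtain ⟨C, hC, h⟩ := ht.lower
  refine ⟨C.toNNReal, fun k j hkj m => ?_⟩
  have h1 := h k j hkj m
  rw [avgNorm_assocWeight hp, ofReal_mul_two_rpow hC.le, avgNorm_eq,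
    show (fun x => (assocWeight p t j x)⁻¹) = fun x =>
      (fun m' => (2 : ℝ≥0∞) ^ (-((j : ℝ) * n * (p⁻¹).toReal)) * (assoc p t j m')⁻¹) (floorIdx j x)
      from funext fun x => by
        rw [assocWeight_eq, ENNReal.mul_inv (Or.inl (two_rpow_ne_zero _))
          (Or.inl (two_rpow_ne_top _)), ENNReal.rpow_neg],
    eLpNorm_comp_floorIdx hσ hkj m
      (fun m' => (2 : ℝ≥0∞) ^ (-((j : ℝ) * n * (p⁻¹).toReal)) * (assoc p t j m')⁻¹),
    lNorm_const_mul hσ] at h1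
  set X := lNorm σ₁ (fun m' : descendants (j - k) m => (assoc p t j m')⁻¹)
  set e := (k : ℝ) * n * (p⁻¹).toReal + (((k : ℝ) - j) * n * (σ₁⁻¹).toReal
    + -((j : ℝ) * n * (p⁻¹).toReal)) with he
  have h2 : (2 : ℝ≥0∞) ^ e * (assoc p t k m * X) ≤
      ENNReal.ofReal C * 2 ^ (α₁ * ((k : ℝ) - j)) := by
    refine le_trans (le_of_eq ?_) h1
    rw [he, two_rpow_add, two_rpow_add]
    ring
  have h3 : (θ⁻¹).toReal = (p⁻¹).toReal + (σ₁⁻¹).toReal := by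
    rw [hH, ENNReal.toReal_add (ENNReal.inv_ne_top.2 hp) (ENNReal.inv_ne_top.2 hσ)]
  calc assoc p t k m * X = 2 ^ (-e) * (2 ^ e * (assoc p t k m * X)) := by
        rw [← mul_assoc, ← two_rpow_add, neg_add_cancel, ENNReal.rpow_zero, one_mul]
    _ ≤ 2 ^ (-e) * (ENNReal.ofReal C * 2 ^ (α₁ * ((k : ℝ) - j))) := by gcongr
    _ = ENNReal.ofReal C * (2 ^ (-e) * 2 ^ (α₁ * ((k : ℝ) - j))) := by ring
    _ = _ := by
        rw [← two_rpow_add, h3]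
        congr 2
        rw [he]
        ring

/-- The upper weight condition, in terms of the sequence `t_{k,m}`. -/
theorem WeightClass.exists_upper (ht : WeightClass p α₁ α₂ α₃ σ₁ p t) (hp : p ≠ 0) :
    ∃ C : ℝ≥0, ∀ k j : ℕ, k ≤ j → ∀ m : Fin n → ℤ,
      lNorm p (fun m' : descendants (j - k) m => assoc p t j m') ≤
        C * (2 : ℝ≥0∞) ^ (((j : ℝ) - k) * α₂) * assoc p t k m := by
  obtain ⟨C, hC, h⟩ := ht.upper
  refine ⟨C.toNNReal, fun k j hkj m => ?_⟩
  have h1 := h k j hkj m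
  rw [avgNorm_assocWeight hp, ofReal_mul_two_rpow hC.le, avgNorm_eq,
    funext (assocWeight_eq (p := p) (t := t) j),
    eLpNorm_comp_floorIdx hp hkj m
      (fun m' => (2 : ℝ≥0∞) ^ (((j : ℝ) * n * (p⁻¹).toReal)) * assoc p t j m'),
    lNorm_const_mul hp] at h1
  set X := lNorm p (fun m' : descendants (j - k) m => assoc p t j m')
  have h2 : (2 : ℝ≥0∞) ^ ((k : ℝ) * n * (p⁻¹).toReal) * X ≤
      ENNReal.ofReal C * 2 ^ (α₂ * ((j : ℝ) - k)) *
        (2 ^ ((k : ℝ) * n * (p⁻¹).toReal) * assoc p t k m) := by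
    rw [mul_comm, ← div_eq_mul_inv, ENNReal.div_le_iff
      (mul_ne_zero (two_rpow_ne_zero _) (ht.assoc_ne_zero k m))
      (ENNReal.mul_ne_top (two_rpow_ne_top _) (ht.assoc_ne_top k m)), ← mul_assoc,
      ← two_rpow_add] at h1
    refine le_trans (le_of_eq ?_) h1
    congr 2
    ring
  rw [show ENNReal.ofReal C * 2 ^ (α₂ * ((j : ℝ) - k)) *
        (2 ^ ((k : ℝ) * n * (p⁻¹).toReal) * assoc p t k m) = 2 ^ ((k : ℝ) * n * (p⁻¹).toReal) *
        (ENNReal.ofReal C * 2 ^ (((j : ℝ) - k) * α₂) * assoc p t k m) by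
      rw [mul_comm α₂]; ring,
    ENNReal.mul_le_mul_iff_right (two_rpow_ne_zero _) (two_rpow_ne_top _)] at h2
  exact h2

/-- First r is lowered to θ, which enlarges sequence norms; then Hölder is applied to the product of
`assoc * a` and `assoc⁻¹`. -/
theorem WeightClass.lNorm_descendants_le (ht : WeightClass p α₁ α₂ α₃ σ₁ σ₂ t)
    (hp : p ≠ 0) (hσ : σ₁ ≠ 0) {θ r : ℝ≥0∞} (hθ : θ ≠ 0) (hθr : θ ≤ r)
    (hH : θ⁻¹ = p⁻¹ + σ₁⁻¹) (d j : ℕ) (m : Fin n → ℤ) (a : (Fin n → ℤ) → ℝ≥0∞) :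
    lNorm r (fun m' : descendants d m => a m') ≤
      lNorm p (fun m' : descendants d m => assoc p t j m' * a m') *
        lNorm σ₁ (fun m' : descendants d m => (assoc p t j m')⁻¹) := by
  refine (lNorm_le_of_exponent_le hθ hθr _).trans ?_
  refine le_trans (le_of_eq ?_) (lNorm_mul_le hθ hp hσ hH _ _)
  congr 1
  funext m'
  rw [mul_right_comm, ENNReal.mul_inv_cancel (ht.assoc_ne_zero _ _) (ht.assoc_ne_top _ _),
    one_mul]

/-- The scale-invariant form of the lower weight condition: summation over cubes of level `j` is
controlled on cubes of level `k ≤ j` with a geometric gain. -/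
theorem WeightClass.exists_lNorm_comp_floorIdx_le (ht : WeightClass p α₁ α₂ α₃ σ₁ σ₂ t)
    (hp : p ≠ 0) (hσ : σ₁ ≠ 0) {θ r : ℝ≥0∞} (hθ : θ ≠ 0) (hθr : θ ≤ r)
    (hH : θ⁻¹ = p⁻¹ + σ₁⁻¹) :
    ∃ C : ℝ≥0, ∀ k j : ℕ, k ≤ j → ∀ a : (Fin n → ℤ) → ℝ≥0∞,
      lNorm p (fun m => assoc p t k m * eLpNorm (fun x => a (floorIdx j x)) r (cubeMeas k m)) ≤
        C * ((2 : ℝ≥0∞) ^ (-(α₁ - n * ((θ⁻¹).toReal - (r⁻¹).toReal)))) ^ (j - k) *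
          lNorm p (fun m => assoc p t j m * a m) := by
  have hr : r ≠ 0 := fun h0 => hθ (le_antisymm (h0 ▸ hθr) zero_le)
  obtain ⟨C, hC⟩ := ht.exists_lower hp hσ hH
  refine ⟨C, fun k j hkj a => ?_⟩
  -- Per level the normalisation of the measure contributes n/r and the weight condition α₁ - n/θ;
  -- together they give the net rate.
  have hpow : (2 : ℝ≥0∞) ^ (((k : ℝ) - j) * n * (r⁻¹).toReal) *
      2 ^ (((k : ℝ) - j) * (α₁ - n * (θ⁻¹).toReal)) =
      ((2 : ℝ≥0∞) ^ (-(α₁ - n * ((θ⁻¹).toReal - (r⁻¹).toReal)))) ^ (j - k) := by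
    rw [← two_rpow_add, ← ENNReal.rpow_natCast, ← ENNReal.rpow_mul, Nat.cast_sub hkj]
    congr 1
    ring
  rw [← lNorm_descendants hp (j - k) (fun m' => assoc p t j m' * a m'), ← lNorm_const_mul hp]
  refine lNorm_mono fun m => ?_
  rw [eLpNorm_comp_floorIdx hr hkj, ← hpow]
  have h1 := ht.lNorm_descendants_le hp hσ hθ hθr hH (j - k) j m a
  have h2 := hC k j hkj m
  revert h1 h2
  generalize lNorm p (fun m' : descendants (j - k) m => assoc p t j m' * a m') = Y
  generalize lNorm σ₁ (fun m' : descendants (j - k) m => (assoc p t j m')⁻¹) = X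
  generalize lNorm r (fun m' : descendants (j - k) m => a m') = Z
  generalize (2 : ℝ≥0∞) ^ (((k : ℝ) - j) * n * (r⁻¹).toReal) = u
  generalize (2 : ℝ≥0∞) ^ (((k : ℝ) - j) * (α₁ - n * (θ⁻¹).toReal)) = v
  generalize assoc p t k m = w
  intro h1 h2
  calc w * (u * Z) ≤ w * (u * (Y * X)) := by gcongr
    _ = u * (w * X) * Y := by ring
    _ ≤ u * (C * v) * Y := by gcongr
    _ = _ := by ring

/-- On the descendants of a fixed cube the value of b is constant and factors out; what remains is
the sum of the weights, controlled by the upper condition. -/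
theorem WeightClass.exists_lNorm_ancestor_le (ht : WeightClass p α₁ α₂ α₃ σ₁ p t) (hp : p ≠ 0) :
    ∃ C : ℝ≥0, ∀ k j : ℕ, k ≤ j → ∀ b : (Fin n → ℤ) → ℝ≥0∞,
      lNorm p (fun m => assoc p t j m * b (ancestor (j - k) m)) ≤
        C * ((2 : ℝ≥0∞) ^ α₂) ^ (j - k) * lNorm p (fun m => assoc p t k m * b m) := by
  obtain ⟨C, hC⟩ := ht.exists_upper hp
  refine ⟨C, fun k j hkj b => ?_⟩
  rw [← lNorm_descendants hp (j - k), ← lNorm_const_mul hp]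
  refine lNorm_mono fun m => ?_
  calc lNorm p (fun m' : descendants (j - k) m => assoc p t j m' * b (ancestor (j - k) m'))
      = lNorm p (fun m' : descendants (j - k) m => b m * assoc p t j m') := by
        congr 1
        funext m'
        rw [show ancestor (j - k) (m' : Fin n → ℤ) = m from m'.2, mul_comm]
    _ = b m * lNorm p (fun m' : descendants (j - k) m => assoc p t j m') := lNorm_const_mul hp _ _
    _ ≤ b m * (C * (2 : ℝ≥0∞) ^ (((j : ℝ) - k) * α₂) * assoc p t k m) := by
        gcongr
        exact hC k j hkj m
    _ = _ := by
        rw [← ENNReal.rpow_natCast, ← ENNReal.rpow_mul, Nat.cast_sub hkj, mul_comm α₂]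
        ring

/-- The index m is moved to m + e in K steps between neighbours: a step by the signs of e shortens
every nonzero coordinate by one. -/
theorem WeightClass.assoc_le_of_box (ht : WeightClass p α₁ α₂ α₃ σ₁ σ₂ t) (K k : ℕ) :
    ∀ (m e : Fin n → ℤ), e ∈ intBox n K →
      assoc p t k m ≤ ENNReal.ofReal (2 ^ α₃) ^ K * assoc p t k (m + e) := by
  induction K with
  | zero =>
    intro m e he
    have : e = 0 := by
      funext i
      simpa using mem_intBox.1 he i
    simp [this]
  | succ K ih =>
    intro m e he
    have h1 := (ht.neighbours k m (m + fun i => (e i).sign) (fun i => by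
      simp only [Pi.add_apply, sub_add_cancel_left, abs_neg]
      rcases lt_trichotomy (e i) 0 with h | h | h <;> simp [h, Int.sign_eq_neg_one_of_neg,
        Int.sign_eq_one_of_pos])).2
    have h2 := ih (m + fun i => (e i).sign) (e - fun i => (e i).sign) (mem_intBox.2 fun i => by
      have := mem_intBox.1 he i
      push_cast at this
      rw [abs_le] at this ⊢
      simp only [Pi.sub_apply]
      rcases lt_trichotomy (e i) 0 with h | h | h
      · rw [Int.sign_eq_neg_one_of_neg h]; omega
      · rw [h]; simp
      · rw [Int.sign_eq_one_of_pos h]; omega)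
    rw [add_add_sub_cancel] at h2
    calc assoc p t k m ≤ ENNReal.ofReal (2 ^ α₃) * assoc p t k (m + fun i => (e i).sign) := h1
      _ ≤ ENNReal.ofReal (2 ^ α₃) * (ENNReal.ofReal (2 ^ α₃) ^ K * assoc p t k (m + e)) := by
          gcongr
      _ = _ := by ring

/-- Sums over a fixed number of neighbouring cubes cost only a constant: the weight is moved to the
shifted index, and a shift is a bijection of the index lattice. -/
theorem WeightClass.exists_lNorm_box_le (ht : WeightClass p α₁ α₂ α₃ σ₁ σ₂ t) (hp : p ≠ 0)
    (K : ℕ) :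
    ∃ C : ℝ≥0, ∀ (k : ℕ) (b : (Fin n → ℤ) → ℝ≥0∞),
      lNorm p (fun m => assoc p t k m * ∑ e ∈ intBox n K, b (m + e)) ≤
        C * lNorm p (fun m => assoc p t k m * b m) := by
  set D := ENNReal.ofReal (2 ^ α₃) ^ K
  have hD : D ≠ ∞ := ENNReal.pow_ne_top ENNReal.ofReal_ne_top
  set Q := quasiConst p (intBox n K).card
  refine ⟨(Q * ((intBox n K).card * D)).toNNReal, fun k b => ?_⟩
  rw [ENNReal.coe_toNNReal (ENNReal.mul_ne_top (quasiConst_ne_top _ _)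
    (ENNReal.mul_ne_top (ENNReal.natCast_ne_top _) hD))]
  calc lNorm p (fun m => assoc p t k m * ∑ e ∈ intBox n K, b (m + e))
      ≤ lNorm p (fun m => ∑ e ∈ intBox n K, D * (assoc p t k (m + e) * b (m + e))) := by
        refine lNorm_mono fun m => ?_
        rw [Finset.mul_sum]
        refine Finset.sum_le_sum fun e he => ?_
        rw [← mul_assoc]
        gcongr
        exact ht.assoc_le_of_box K k m e he
    _ ≤ Q * ∑ e ∈ intBox n K, lNorm p (fun m => D * (assoc p t k (m + e) * b (m + e))) :=
        lNorm_sum_le hp _ _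
    _ = Q * ∑ e ∈ intBox n K, D * lNorm p (fun m => assoc p t k m * b m) := by
        congr 1
        refine Finset.sum_congr rfl fun e _ => ?_
        rw [lNorm_const_mul hp]
        congr 1
        exact lNorm_comp_equiv (Equiv.addRight e) (fun m => assoc p t k m * b m)
    _ = _ := by
        rw [Finset.sum_const, nsmul_eq_mul]
        ring

end Weights

/-! ### The univariate B-spline -/

section Univariate

open Polynomial

/-- The polynomial with which `s ↦ N^l (s + i)` agrees on `[0, 1]`. -/
def piece (l : ℕ) (i : ℤ) : ℝ[X] :=
  C (1 / (l.factorial : ℝ)) * ∑ j ∈ Finset.range (l + 2),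
    if (j : ℤ) ≤ i then C ((-1) ^ j * ((l + 1).choose j : ℝ)) * (X + C ((i : ℝ) - j)) ^ l else 0

theorem bspline_add_eq_piece {l : ℕ} (hl : l ≠ 0) (i : ℤ) {s : ℝ} (h0 : 0 ≤ s) (h1 : s ≤ 1) :
    bspline l (s + i) = (piece l i).eval s := by
  rw [bspline, piece, eval_mul, eval_C, eval_finsetSum]
  congr 1
  refine Finset.sum_congr rfl fun j _ => ?_
  split_ifs with h
  · have : (j : ℝ) ≤ i := by exact_mod_cast h
    rw [max_eq_left (by linarith)]
    simp only [eval_mul, eval_C, eval_pow, eval_add, eval_X]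
    ring
  · have : (i : ℝ) + 1 ≤ j := by exact_mod_cast (not_le.1 h)
    rw [max_eq_right (by linarith), zero_pow hl]
    simp

theorem natDegree_piece_le (l : ℕ) (i : ℤ) : (piece l i).natDegree ≤ l := by
  refine (natDegree_C_mul_le _ _).trans (natDegree_sum_le_of_forall_le _ _ fun j _ => ?_)
  split_ifs
  · refine (natDegree_C_mul_le _ _).trans ?_
    exact (natDegree_pow_le).trans (by rw [natDegree_X_add_C, mul_one])
  · simp

/-- The polynomial `∏_{j=1}^{l} (j - X)`. -/
def knotPolynomial (l : ℕ) : ℝ[X] := ∏ j ∈ Finset.Icc 1 l, (C (j : ℝ) - X)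

theorem natDegree_knotPolynomial_le (l : ℕ) : (knotPolynomial l).natDegree ≤ l := by
  refine (natDegree_prod_le _ _).trans ?_
  refine (Finset.sum_le_card_nsmul _ _ 1 fun j _ => ?_).trans (by simp)
  exact (natDegree_sub_le _ _).trans (by simp)

/-- The dual functional of the B-spline `N^l` on polynomials, evaluated at `1/2`. -/
def dualFun (l : ℕ) : ℝ[X] →ₗ[ℝ] ℝ :=
  ∑ ν ∈ Finset.range (l + 1), ((-1) ^ (l - ν) / (l.factorial : ℝ) *
    (derivative^[l - ν] (knotPolynomial l)).eval (1 / 2)) •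
      (leval (1 / 2 : ℝ) ∘ₗ (derivative ^ ν))

theorem dualFun_apply (l : ℕ) (p : ℝ[X]) :
    dualFun l p = ∑ ν ∈ Finset.range (l + 1), ((-1) ^ (l - ν) / (l.factorial : ℝ) *
      (derivative^[l - ν] (knotPolynomial l)).eval (1 / 2)) *
        (derivative^[ν] p).eval (1 / 2) := by
  simp [dualFun, Module.End.pow_apply]

/-- The derivatives of `(X - c)^l` at 1/2 are multiples of powers of `1/2 - c`, and the alternating
signs turn the sum into the Taylor expansion at 1/2 of the knot polynomial, evaluated at c. The
choice of the point 1/2 is therefore immaterial. -/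
theorem dualFun_X_sub_C_pow (l : ℕ) (c : ℝ) :
    dualFun l ((X - C c) ^ l) = (knotPolynomial l).eval c := by
  have h1 : (knotPolynomial l).eval c = ∑ μ ∈ Finset.range (l + 1),
      (derivative^[μ] (knotPolynomial l)).eval (1 / 2) / (μ.factorial : ℝ) * (c - 1 / 2) ^ μ := by
    have h2 := taylor_eval (1 / 2 : ℝ) (knotPolynomial l) (c - 1 / 2)
    rw [sub_add_cancel] at h2
    rw [← h2, eval_eq_sum_range' (n := l + 1)
      (by rw [natDegree_taylor]; exact Nat.lt_succ_of_le (natDegree_knotPolynomial_le l))]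
    refine Finset.sum_congr rfl fun μ _ => ?_
    rw [taylor_coeff, ← factorial_smul_hasseDeriv]
    have : (μ.factorial : ℝ) ≠ 0 := by positivity
    rw [LinearMap.smul_apply, eval_smul, nsmul_eq_mul]
    field_simp
  rw [dualFun_apply, h1, ← Finset.sum_range_reflect]
  refine Finset.sum_congr rfl fun μ hμ => ?_
  have hμ' : μ ≤ l := Nat.lt_succ_iff.1 (Finset.mem_range.1 hμ)
  have e1 : l + 1 - 1 - μ = l - μ := by omega
  have e2 : l - (l - μ) = μ := by omega
  rw [e1, e2, iterate_derivative_X_sub_pow, e2]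
  have h3 : (μ.factorial : ℝ) * (l.descFactorial (l - μ) : ℝ) = l.factorial := by
    have := Nat.factorial_mul_descFactorial (Nat.sub_le l μ)
    rw [e2] at this
    exact_mod_cast this
  have h4 : (l.factorial : ℝ) ≠ 0 := by positivity
  have h5 : (μ.factorial : ℝ) ≠ 0 := by positivity
  rw [eval_smul, nsmul_eq_mul, eval_pow, eval_sub, eval_X, eval_C]
  rw [show c - 1 / 2 = -1 * (1 / 2 - c) by ring, mul_pow, ← h3]
  have h6 : (l.descFactorial (l - μ) : ℝ) ≠ 0 := by
    intro h; rw [h, mul_zero] at h3; exact h4 h3.symm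
  field_simp

theorem knotPolynomial_eval_neg (l d : ℕ) :
    (knotPolynomial l).eval (-(d : ℝ)) = l.factorial * ((l + d).choose l : ℝ) := by
  have h1 : (knotPolynomial l).eval (-(d : ℝ)) = ((d + 1).ascFactorial l : ℕ) := by
    rw [knotPolynomial, eval_prod]
    induction l with
    | zero => simp
    | succ l ih =>
      rw [Finset.prod_Icc_succ_top (by omega), ih, Nat.ascFactorial_succ]
      simp only [eval_sub, eval_C, eval_X]
      push_cast
      ring
  rw [h1, Nat.ascFactorial_eq_factorial_mul_choose, add_comm d l]
  push_cast
  ring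

theorem knotPolynomial_eval_natCast {l d : ℕ} (h1 : 1 ≤ d) (h2 : d ≤ l) :
    (knotPolynomial l).eval (d : ℝ) = 0 := by
  rw [knotPolynomial, eval_prod]
  exact Finset.prod_eq_zero (Finset.mem_Icc.2 ⟨h1, h2⟩) (by simp)

theorem coeff_one_sub_X_pow (N j : ℕ) :
    PowerSeries.coeff j ((1 - PowerSeries.X : PowerSeries ℝ) ^ N) = (-1) ^ j * (N.choose j : ℝ) := by
  have h1 : (1 - PowerSeries.X : PowerSeries ℝ) ^ N = (((1 - X) ^ N : ℝ[X]) : PowerSeries ℝ) := by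
    simp
  rw [h1, Polynomial.coeff_coe, show (1 - X : ℝ[X]) = (1 + X : ℝ[X]).comp (C (-1) * X) by simp; ring,
    ← pow_comp, comp_C_mul_X_coeff, coeff_one_add_X_pow, mul_comm]

/-- This is the coefficient of X^D in (1 - X)^{l+1} · (1 - X)^{-(l+1)} = 1. -/
theorem sum_alternating_choose (l : ℕ) (D : ℤ) :
    (∑ j ∈ Finset.range (l + 2), if (j : ℤ) ≤ D then
      (-1) ^ j * ((l + 1).choose j : ℝ) * ((l + (D - j).toNat).choose l : ℝ) else 0) =
      if D = 0 then 1 else 0 := by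
  rcases lt_or_ge D 0 with hD | hD
  · rw [if_neg hD.ne]
    refine Finset.sum_eq_zero fun j _ => if_neg ?_
    omega
  obtain ⟨D, rfl⟩ := Int.eq_ofNat_of_zero_le hD
  have h1 := congrArg (PowerSeries.coeff D)
    (PowerSeries.mk_add_choose_mul_one_sub_pow_eq_one (S := ℝ) (d := l))
  rw [mul_comm, PowerSeries.coeff_mul, Finset.Nat.sum_antidiagonal_eq_sum_range_succ_mk,
    PowerSeries.coeff_one] at h1
  simp only [coeff_one_sub_X_pow, PowerSeries.coeff_mk] at h1
  have h2 : ((D : ℤ) = 0) = (D = 0) := by simp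
  simp only [h2, ← h1]
  rw [← Finset.sum_filter]
  have h3 : ∑ j ∈ (Finset.range (l + 2)).filter (fun j : ℕ => (j : ℤ) ≤ (D : ℤ)),
      (-1) ^ j * ((l + 1).choose j : ℝ) * ((l + ((D : ℤ) - j).toNat).choose l : ℝ) =
      ∑ j ∈ (Finset.range (l + 2)).filter (fun j : ℕ => (j : ℤ) ≤ (D : ℤ)),
      (-1) ^ j * ((l + 1).choose j : ℝ) * ((l + (D - j)).choose l : ℝ) := by
    refine Finset.sum_congr rfl fun j hj => ?_
    have := (Finset.mem_filter.1 hj).2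
    rw [show ((D : ℤ) - j).toNat = D - j by omega]
  rw [h3]
  refine Finset.sum_subset (fun j hj => ?_) fun j hj hj' => ?_
  · have := (Finset.mem_filter.1 hj).2
    exact Finset.mem_range.2 (by omega)
  · have h4 := Finset.mem_range.1 hj
    have : l + 1 < j := by
      by_contra hcon
      exact hj' (Finset.mem_filter.2 ⟨Finset.mem_range.2 (by omega), by omega⟩)
    rw [Nat.choose_eq_zero_of_lt this]
    simp

/-- Each truncated power in the piece is sent to the value of the knot polynomial at i' + j - i.
Since j ≤ i and i' ≤ l this number is at most l; at 1, …, l the polynomial vanishes, and at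
nonpositive integers it is a binomial coefficient. The surviving terms form
`sum_alternating_choose`. -/
theorem dualFun_piece_comp {l : ℕ} (i : ℤ) {i' : ℕ} (hi' : i' ≤ l) :
    dualFun l ((piece l i).comp (X - C (i' : ℝ))) = if i = i' then 1 else 0 := by
  have h1 : (piece l i).comp (X - C (i' : ℝ)) = C (1 / (l.factorial : ℝ)) *
      ∑ j ∈ Finset.range (l + 2), if (j : ℤ) ≤ i then
        C ((-1) ^ j * ((l + 1).choose j : ℝ)) * (X - C ((i' : ℝ) + j - i)) ^ l else 0 := by
    rw [piece, mul_comp, C_comp, Polynomial.sum_comp]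
    congr 1
    refine Finset.sum_congr rfl fun j _ => ?_
    split_ifs
    · simp only [mul_comp, C_comp, pow_comp, add_comp, X_comp]
      congr 2
      simp only [C_add, C_sub]
      ring
    · simp
  have h0 : (l.factorial : ℝ) ≠ 0 := by positivity
  rw [h1, ← smul_eq_C_mul, map_smul, map_sum]
  have h2 := sum_alternating_choose l (i - i')
  simp only [sub_eq_zero] at h2
  rw [← h2, smul_eq_mul, Finset.mul_sum]
  refine Finset.sum_congr rfl fun j _ => ?_
  by_cases hj : (j : ℤ) ≤ i
  · rw [if_pos hj, ← smul_eq_C_mul, map_smul, dualFun_X_sub_C_pow, smul_eq_mul]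
    by_cases hj' : (j : ℤ) ≤ i - i'
    · rw [if_pos hj', show (i' : ℝ) + j - i = -(((i - i' - j).toNat : ℕ) : ℝ) by
        have : (((i - i' - j).toNat : ℕ) : ℤ) = i - i' - j := Int.toNat_of_nonneg (by omega)
        have : (((i - i' - j).toNat : ℕ) : ℝ) = i - i' - j := by exact_mod_cast this
        rw [this]; ring, knotPolynomial_eval_neg]
      field_simp
    · rw [if_neg hj', show (i' : ℝ) + j - i = (((i' + j - i).toNat : ℕ) : ℝ) by
        have : (((i' + j - i).toNat : ℕ) : ℤ) = i' + j - i := Int.toNat_of_nonneg (by omega)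
        have : (((i' + j - i).toNat : ℕ) : ℝ) = i' + j - i := by exact_mod_cast this
        rw [this], knotPolynomial_eval_natCast (by omega) (by omega)]
      ring
  · rw [if_neg hj, if_neg (by omega)]
    simp

theorem dualFun_piece (l : ℕ) (i : ℤ) : dualFun l (piece l i) = if i = 0 then 1 else 0 := by
  have := dualFun_piece_comp (l := l) i (i' := 0) (Nat.zero_le l)
  simpa using this

/-- Every polynomial of degree at most `l` is reproduced on `[0, 1]` by the dual functionals. -/
theorem sum_dualFun_comp_mul_piece {l : ℕ} {p : ℝ[X]} (hp : p.natDegree ≤ l) :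
    ∑ i : Fin (l + 1), C (dualFun l (p.comp (X - C (i : ℝ)))) * piece l (i : ℕ) = p := by
  -- Biorthogonality makes Φ surjective between spaces of equal dimension, hence injective; both
  -- sides of the claim have the same image under Φ.
  let Φ : degreeLT ℝ (l + 1) →ₗ[ℝ] (Fin (l + 1) → ℝ) :=
    { toFun := fun p i => dualFun l ((p : ℝ[X]).comp (X - C (i : ℝ)))
      map_add' := fun p q => by funext i; simp
      map_smul' := fun c p => by funext i; simp }
  have hmem : ∀ q : ℝ[X], q.natDegree ≤ l → q ∈ degreeLT ℝ (l + 1) := fun q hq => by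
    rw [mem_degreeLT]
    exact (degree_le_natDegree).trans_lt (by exact_mod_cast Nat.lt_succ_of_le hq)
  have hΦ : ∀ c : Fin (l + 1) → ℝ, ∀ (hc : (∑ i : Fin (l + 1), C (c i) * piece l (i : ℕ)) ∈
      degreeLT ℝ (l + 1)), Φ ⟨_, hc⟩ = c := fun c hc => by
    funext i
    change dualFun l ((∑ i : Fin (l + 1), C (c i) * piece l (i : ℕ)).comp (X - C (i : ℝ))) = c i
    rw [Polynomial.sum_comp, map_sum, Finset.sum_eq_single i]
    · rw [mul_comp, C_comp, ← smul_eq_C_mul, map_smul,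
        dualFun_piece_comp _ (Nat.lt_succ_iff.1 i.2)]
      simp
    · intro j _ hj
      rw [mul_comp, C_comp, ← smul_eq_C_mul, map_smul,
        dualFun_piece_comp _ (Nat.lt_succ_iff.1 i.2), if_neg]
      · simp
      · exact_mod_cast fun h => hj (Fin.ext h)
    · simp
  have hdeg : ∀ c : Fin (l + 1) → ℝ, (∑ i : Fin (l + 1), C (c i) * piece l (i : ℕ)) ∈
      degreeLT ℝ (l + 1) := fun c => hmem _ (natDegree_sum_le_of_forall_le _ _ fun i _ =>
        (natDegree_C_mul_le _ _).trans (natDegree_piece_le l _))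
  have hsurj : Function.Surjective Φ := fun c => ⟨⟨_, hdeg c⟩, hΦ c _⟩
  have : FiniteDimensional ℝ (degreeLT ℝ (l + 1)) :=
    Module.Finite.equiv (degreeLTEquiv ℝ (l + 1)).symm
  have hinj : Function.Injective Φ := by
    refine (LinearMap.injective_iff_surjective_of_finrank_eq_finrank ?_).2 hsurj
    exact (degreeLTEquiv ℝ (l + 1)).finrank_eq
  have := @hinj ⟨_, hdeg (Φ ⟨p, hmem p hp⟩)⟩ ⟨p, hmem p hp⟩ (hΦ _ _)
  exact congrArg Subtype.val this

/-! #### The refinement equation -/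

/-- Translation by `1/2` on functions. -/
def halfShift : Module.End ℝ (ℝ → ℝ) := LinearMap.funLeft ℝ ℝ fun s => s - 1 / 2

theorem halfShift_pow_apply (k : ℕ) (f : ℝ → ℝ) (s : ℝ) :
    (halfShift ^ k) f s = f (s - k / 2) := by
  induction k generalizing s with
  | zero => simp
  | succ k ih =>
    rw [pow_succ', Module.End.mul_apply, halfShift, LinearMap.funLeft_apply, ← halfShift, ih]
    congr 1
    push_cast
    ring

theorem one_add_smul_halfShift_pow_apply (c : ℝ) (a N : ℕ) (f : ℝ → ℝ) (s : ℝ) :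
    ((1 + c • halfShift ^ a) ^ N : Module.End ℝ (ℝ → ℝ)) f s =
      ∑ j ∈ Finset.range (N + 1), c ^ j * (N.choose j : ℝ) * f (s - (a * j : ℕ) / 2) := by
  rw [add_comm, (Commute.one_right (c • halfShift ^ a)).add_pow, LinearMap.sum_apply,
    Finset.sum_apply]
  refine Finset.sum_congr rfl fun j _ => ?_
  rw [one_pow, mul_one, _root_.smul_pow, ← pow_mul, ← nsmul_eq_mul', LinearMap.smul_apply,
    LinearMap.smul_apply, Pi.smul_apply, Pi.smul_apply, halfShift_pow_apply]
  simp only [nsmul_eq_mul, smul_eq_mul]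
  ring

/-- With S the translation by 1/2, N^l is (1 - S²)^{l+1} applied to a truncated power, and N^l(2·)
is (1 - S)^{l+1} applied to it, up to constants. The refinement coefficients come from 1 - S² = (1 +
S)(1 - S). -/
theorem bspline_refinement (l : ℕ) (s : ℝ) :
    bspline l s = ∑ j ∈ Finset.range (l + 2),
      (2 ^ l : ℝ)⁻¹ * ((l + 1).choose j : ℝ) * bspline l (2 * s - j) := by
  let f : ℝ → ℝ := fun s => (max s 0) ^ l
  have h1 : ∀ s, bspline l s = (1 / (l.factorial : ℝ)) *
      ((1 + (-1 : ℝ) • halfShift ^ 2) ^ (l + 1) : Module.End ℝ (ℝ → ℝ)) f s := fun s => by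
    rw [one_add_smul_halfShift_pow_apply, bspline]
    congr 1
    refine Finset.sum_congr rfl fun j _ => ?_
    simp only [f]
    push_cast
    congr 4
    ring
  have h2 : ∀ s, bspline l (2 * s) = (2 ^ l / (l.factorial : ℝ)) *
      ((1 + (-1 : ℝ) • halfShift ^ 1) ^ (l + 1) : Module.End ℝ (ℝ → ℝ)) f s := fun s => by
    rw [one_add_smul_halfShift_pow_apply, bspline, Finset.mul_sum, Finset.mul_sum]
    refine Finset.sum_congr rfl fun j _ => ?_
    have : (max (2 * s - (j : ℝ)) 0) ^ l = 2 ^ l * f (s - ((1 * j : ℕ) : ℝ) / 2) := by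
      simp only [f]
      rw [← mul_pow, mul_max_of_nonneg _ _ (by norm_num : (0 : ℝ) ≤ 2)]
      push_cast
      congr 2 <;> ring
    rw [this]
    ring
  have h3 : (1 + (-1 : ℝ) • halfShift ^ 2) ^ (l + 1) =
      (1 + (1 : ℝ) • halfShift ^ 1) ^ (l + 1) * (1 + (-1 : ℝ) • halfShift ^ 1) ^ (l + 1) := by
    have hneg : ∀ S : Module.End ℝ (ℝ → ℝ), (-1 : ℝ) • S = -S := fun S => by
      ext f x
      simp
    have hc : Commute (1 + (1 : ℝ) • halfShift ^ 1) (1 + (-1 : ℝ) • halfShift ^ 1) := by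
      rw [commute_iff_eq]
      simp only [one_smul, pow_one, hneg]
      noncomm_ring
    rw [← hc.mul_pow]
    congr 1
    refine LinearMap.ext fun f => funext fun x => ?_
    simp only [sq, pow_one, Module.End.mul_apply, LinearMap.add_apply, LinearMap.smul_apply,
      Module.End.one_apply, map_add, map_smul, Pi.add_apply, Pi.smul_apply, smul_eq_mul]
    ring
  rw [h1, h3, Module.End.mul_apply, one_add_smul_halfShift_pow_apply, Finset.mul_sum]
  refine Finset.sum_congr rfl fun j _ => ?_
  rw [show 2 * s - (j : ℝ) = 2 * (s - ((1 * j : ℕ) : ℝ) / 2) by push_cast; ring, h2]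
  field_simp
  simp

/-! #### Boundedness and smoothness -/

theorem bspline_eq_zero_of_nonpos {l : ℕ} (hl : l ≠ 0) {s : ℝ} (hs : s ≤ 0) : bspline l s = 0 := by
  rw [bspline, Finset.sum_eq_zero, mul_zero]
  intro j _
  rw [max_eq_right (by have : (0 : ℝ) ≤ j := by positivity
                       linarith), zero_pow hl, mul_zero]

/-- The alternating combination of truncated powers of degree `d` with `l + 2` knots. -/
def truncComb (l d : ℕ) (s : ℝ) : ℝ :=
  ∑ j ∈ Finset.range (l + 2), (-1) ^ j * ((l + 1).choose j : ℝ) * (max (s - (j : ℝ)) 0) ^ d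

/-- To the right of all knots the truncation is inactive, and the alternating sum is an (l+1)-th
finite difference of a polynomial of degree at most l. -/
theorem truncComb_eq_zero_of_ge {l d : ℕ} (hd : d ≤ l) {s : ℝ} (hs : (l : ℝ) + 1 ≤ s) :
    truncComb l d s = 0 := by
  have h1 : ((C s - X : ℝ[X]) ^ d).natDegree < l + 1 := by
    refine Nat.lt_succ_of_le ((natDegree_pow_le).trans ?_)
    have : (C s - X : ℝ[X]).natDegree ≤ 1 := (natDegree_sub_le _ _).trans (by simp)
    nlinarith
  have h2 := congrFun (Polynomial.fwdDiff_iter_eq_zero_of_degree_lt h1) 0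
  rw [fwdDiff_iter_eq_sum_shift] at h2
  have h3 : truncComb l d s = (-1) ^ (l + 1) * ∑ k ∈ Finset.range (l + 1 + 1),
      ((-1 : ℤ) ^ (l + 1 - k) * ((l + 1).choose k : ℤ)) • ((C s - X : ℝ[X]) ^ d).eval
        ((0 : ℝ) + k • (1 : ℝ)) := by
    rw [truncComb, Finset.mul_sum]
    refine Finset.sum_congr rfl fun j hj => ?_
    have hj' : j ≤ l + 1 := Nat.lt_succ_iff.1 (Finset.mem_range.1 hj)
    have hj2 : (j : ℝ) ≤ l + 1 := by exact_mod_cast hj'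
    rw [max_eq_left (by linarith)]
    have : (-1 : ℝ) ^ j = (-1) ^ (l + 1) * (-1) ^ (l + 1 - j) := by
      rw [← pow_add, show l + 1 + (l + 1 - j) = 2 * (l + 1 - j) + j by omega, pow_add, pow_mul]
      simp
    rw [this]
    simp only [zsmul_eq_mul, eval_pow, eval_sub, eval_C, eval_X, nsmul_eq_mul]
    push_cast
    ring_nf
  rw [h3, h2]
  simp

theorem bspline_eq_truncComb (l : ℕ) (s : ℝ) :
    bspline l s = (1 / (l.factorial : ℝ)) * truncComb l l s := rfl

theorem bspline_eq_zero_of_ge {l : ℕ} {s : ℝ} (hs : (l : ℝ) + 1 ≤ s) : bspline l s = 0 := by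
  rw [bspline_eq_truncComb, truncComb_eq_zero_of_ge le_rfl hs, mul_zero]

theorem continuous_truncComb (l d : ℕ) : Continuous (truncComb l d) := by
  unfold truncComb
  fun_prop

theorem continuous_bspline (l : ℕ) : Continuous (bspline l) :=
  continuous_const.mul (continuous_truncComb l l)

theorem exists_abs_truncComb_le {l d : ℕ} (hd0 : d ≠ 0) (hd : d ≤ l) :
    ∃ C : ℝ, 0 ≤ C ∧ ∀ s, |truncComb l d s| ≤ C := by
  obtain ⟨C, hC⟩ := (isCompact_Icc (a := (0 : ℝ)) (b := (l : ℝ) + 1)).exists_bound_of_continuousOn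
    (continuous_truncComb l d).continuousOn
  refine ⟨max C 0, le_max_right _ _, fun s => ?_⟩
  by_cases h1 : s ≤ 0
  · rw [truncComb, Finset.sum_eq_zero]
    · simp
    · intro j _
      rw [max_eq_right (by have : (0 : ℝ) ≤ j := by positivity
                           linarith), zero_pow hd0, mul_zero]
  by_cases h2 : (l : ℝ) + 1 ≤ s
  · rw [truncComb_eq_zero_of_ge hd h2]
    simp
  · exact (hC s ⟨(not_le.1 h1).le, (not_le.1 h2).le⟩).trans (le_max_left _ _)

/-- The exponent is at least 2 so that the truncated power is differentiable at its knot as well. -/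
theorem hasDerivAt_max_pow (d : ℕ) (s : ℝ) :
    HasDerivAt (fun s : ℝ => (max s 0) ^ (d + 2)) (((d + 2 : ℕ) : ℝ) * (max s 0) ^ (d + 1)) s := by
  rcases lt_trichotomy s 0 with hs | hs | hs
  · rw [max_eq_right hs.le, zero_pow (by omega), mul_zero]
    refine (hasDerivAt_const s (0 : ℝ)).congr_of_eventuallyEq ?_
    filter_upwards [Iio_mem_nhds hs] with x hx
    rw [max_eq_right (le_of_lt hx), zero_pow (by omega)]
  · subst hs
    rw [max_self, zero_pow (by omega), mul_zero, hasDerivAt_iff_tendsto_slope]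
    have h1 : Tendsto (fun x : ℝ => (max x 0) ^ (d + 1)) (𝓝[≠] 0) (𝓝 0) := by
      have : Continuous fun x : ℝ => (max x 0) ^ (d + 1) := by fun_prop
      simpa using (this.tendsto 0).mono_left nhdsWithin_le_nhds
    refine h1.congr' ?_
    filter_upwards [self_mem_nhdsWithin] with x hx
    rw [slope_def_field, max_self, zero_pow (by omega), sub_zero, sub_zero]
    rcases le_or_gt x 0 with h | h
    · rw [max_eq_right h]; simp
    · rw [max_eq_left h.le, pow_succ x (d + 1), mul_div_cancel_right₀ _ h.ne']
  · rw [max_eq_left hs.le]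
    refine (hasDerivAt_pow (d + 2) s).congr_of_eventuallyEq ?_
    filter_upwards [Ioi_mem_nhds hs] with x hx
    rw [max_eq_left (le_of_lt hx)]

theorem hasDerivAt_truncComb (l d : ℕ) (s : ℝ) :
    HasDerivAt (truncComb l (d + 2)) (((d + 2 : ℕ) : ℝ) * truncComb l (d + 1) s) s := by
  unfold truncComb
  rw [Finset.mul_sum]
  refine HasDerivAt.fun_sum fun j _ => ?_
  have := ((hasDerivAt_max_pow d (s - j)).comp_sub_const s (j : ℝ)).const_mul
    ((-1 : ℝ) ^ j * ((l + 1).choose j : ℝ))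
  refine this.congr_deriv ?_
  ring

theorem hasDerivAt_fwdDiff_iter {g g' : ℝ → ℝ} (h : ∀ x, HasDerivAt g (g' x) x) (t : ℝ) (ν : ℕ)
    (x : ℝ) : HasDerivAt ((fwdDiff t)^[ν] g) ((fwdDiff t)^[ν] g' x) x := by
  induction ν generalizing g g' with
  | zero => exact h x
  | succ ν ih =>
    rw [Function.iterate_succ_apply, Function.iterate_succ_apply]
    refine ih fun y => ?_
    exact ((h (y + t)).comp_add_const y t).sub (h y)

/-- Each difference is traded for a derivative by the mean value inequality, at the cost of |t| and
one degree. At degree 1 the function is only Lipschitz, which still yields the last difference; thus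
the order may reach the degree. -/
theorem exists_abs_fwdDiff_truncComb_le {l ν d : ℕ} (hd0 : d ≠ 0) (hd : d ≤ l) (hν : ν ≤ d) :
    ∃ C : ℝ, 0 ≤ C ∧ ∀ t s, |(fwdDiff t)^[ν] (truncComb l d) s| ≤ C * |t| ^ ν := by
  induction ν generalizing d with
  | zero =>
    obtain ⟨C, hC, h⟩ := exists_abs_truncComb_le hd0 hd
    exact ⟨C, hC, fun t s => by simpa using h s⟩
  | succ ν ih =>
    rcases Nat.lt_or_ge d 2 with h2 | h2
    · have hd1 : d = 1 := by omega
      have hν0 : ν = 0 := by omega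
      subst hd1 hν0
      refine ⟨∑ j ∈ Finset.range (l + 2), ((l + 1).choose j : ℝ), by positivity, fun t s => ?_⟩
      simp only [zero_add, Function.iterate_one, fwdDiff, truncComb, pow_one]
      rw [← Finset.sum_sub_distrib, Finset.sum_mul]
      refine (Finset.abs_sum_le_sum_abs _ _).trans (Finset.sum_le_sum fun j _ => ?_)
      rw [← mul_sub, abs_mul, abs_mul, abs_pow, abs_neg, abs_one, one_pow, one_mul, Nat.abs_cast]
      have := abs_max_sub_max_le_abs (s + t - (j : ℝ)) (s - j) 0
      rw [show s + t - (j : ℝ) - (s - j) = t by ring] at this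
      exact mul_le_mul_of_nonneg_left this (by positivity)
    · obtain ⟨d, rfl⟩ := Nat.exists_eq_add_of_le' h2
      obtain ⟨C, hC, h⟩ := ih (d := d + 1) (by omega) (by omega) (by omega)
      refine ⟨((d + 2 : ℕ) : ℝ) * C, by positivity, fun t s => ?_⟩
      rw [Function.iterate_succ_apply', fwdDiff]
      have hder := fun x => hasDerivAt_fwdDiff_iter (hasDerivAt_truncComb l d) t ν x
      have hb : ∀ x, ‖(fwdDiff t)^[ν] (fun s => ((d + 2 : ℕ) : ℝ) * truncComb l (d + 1) s) x‖ ≤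
          ((d + 2 : ℕ) : ℝ) * C * |t| ^ ν := fun x => by
        have e : (fun s => ((d + 2 : ℕ) : ℝ) * truncComb l (d + 1) s) =
          ((d + 2 : ℕ) : ℝ) • truncComb l (d + 1) := rfl
        rw [e, fwdDiff_iter_const_smul, Pi.smul_apply, smul_eq_mul, norm_mul, Real.norm_natCast,
          mul_assoc]
        exact mul_le_mul_of_nonneg_left (h t x) (by positivity)
      have := convex_univ.norm_image_sub_le_of_norm_hasDerivWithin_le
        (fun x _ => (hder x).hasDerivWithinAt) (fun x _ => hb x) (Set.mem_univ s)
        (Set.mem_univ (s + t))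
      rw [Real.norm_eq_abs, Real.norm_eq_abs, add_sub_cancel_left] at this
      rw [pow_succ, ← mul_assoc]
      exact this

theorem exists_abs_fwdDiff_bspline_le {l : ℕ} (hl : l ≠ 0) :
    ∃ C : ℝ, 0 ≤ C ∧ ∀ ν ≤ l, ∀ t s, |(fwdDiff t)^[ν] (bspline l) s| ≤ C * |t| ^ ν := by
  have h1 : ∀ ν : Fin (l + 1), ∃ C : ℝ, 0 ≤ C ∧ ∀ t s,
      |(fwdDiff t)^[(ν : ℕ)] (truncComb l l) s| ≤ C * |t| ^ (ν : ℕ) := fun ν =>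
    exists_abs_fwdDiff_truncComb_le hl le_rfl (Nat.lt_succ_iff.1 ν.2)
  choose C hC h using h1
  refine ⟨∑ ν, C ν, Finset.sum_nonneg fun ν _ => hC ν, fun ν hν t s => ?_⟩
  have e : bspline l = (1 / (l.factorial : ℝ)) • truncComb l l := rfl
  have h2 := h ⟨ν, Nat.lt_succ_of_le hν⟩ t s
  have h3 : (1 : ℝ) / l.factorial ≤ 1 := by
    rw [div_le_one (by positivity)]
    exact_mod_cast Nat.factorial_pos l
  rw [e, fwdDiff_iter_const_smul, Pi.smul_apply, smul_eq_mul, abs_mul, abs_of_nonneg (by positivity)]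
  calc 1 / (l.factorial : ℝ) * |(fwdDiff t)^[ν] (truncComb l l) s|
      ≤ 1 * (C ⟨ν, Nat.lt_succ_of_le hν⟩ * |t| ^ ν) := by gcongr
    _ ≤ (∑ ν, C ν) * |t| ^ ν := by
        rw [one_mul]
        gcongr
        exact Finset.single_le_sum (fun ν _ => hC ν) (Finset.mem_univ _)

end Univariate

/-! ### Tensor product splines -/

section Tensor

open Polynomial

variable {n : ℕ}

/-- The affine map taking the unit cube to the dyadic cube of level `k` and index `m`. -/
def cubeMap (k : ℕ) (m : Fin n → ℤ) (y : Fin n → ℝ) : Fin n → ℝ := fun i => (y i + m i) / 2 ^ k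

theorem tensorSpline_cubeMap (l k : ℕ) (m m' : Fin n → ℤ) (y : Fin n → ℝ) :
    tensorSpline l k m' (cubeMap k m y) = ∏ i, bspline l (y i + ((m i - m' i : ℤ) : ℝ)) := by
  refine Finset.prod_congr rfl fun i _ => ?_
  congr 1
  simp only [cubeMap]
  push_cast
  field_simp
  ring

theorem floorIdx_cubeMap (k : ℕ) (m : Fin n → ℤ) (y : Fin n → ℝ) :
    floorIdx k (cubeMap k m y) = floorIdx 0 y + m := by
  funext i
  simp only [floorIdx, cubeMap, Pi.add_apply, pow_zero, one_mul]
  rw [mul_div_cancel₀ _ (by positivity), Int.floor_add_intCast]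

theorem exists_cubeMap_eq (k : ℕ) (x : Fin n → ℝ) :
    ∃ y, cubeMap k (floorIdx k x) y = x ∧ ∀ i, 0 ≤ y i ∧ y i < 1 := by
  refine ⟨fun i => Int.fract (2 ^ k * x i), ?_, fun i => ⟨Int.fract_nonneg _, Int.fract_lt_one _⟩⟩
  funext i
  simp only [cubeMap, floorIdx, Int.fract_add_floor]
  field_simp

/-! #### The coefficient functionals -/

/-- One partial derivative. -/
def partialDeriv (i : Fin n) (u : (Fin n → ℝ) → ℝ) (x : Fin n → ℝ) : ℝ :=
  lineDeriv ℝ u x (Pi.single i (1 : ℝ))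

theorem mixedDeriv_eq (ν : Fin n → ℕ) (f : (Fin n → ℝ) → ℝ) :
    mixedDeriv ν f = (List.finRange n).foldr (fun i g => (partialDeriv i)^[ν i] g) f := rfl

/-- No differentiability is needed: both sides are derivatives along a rescaled line, and the
scaling rule for `deriv` holds unconditionally. -/
theorem partialDeriv_comp_cubeMap (i : Fin n) (k : ℕ) (m : Fin n → ℤ) (c : ℝ)
    (g : (Fin n → ℝ) → ℝ) :
    partialDeriv i (fun y => c * g (cubeMap k m y)) =
      fun y => c * ((2 : ℝ) ^ k)⁻¹ * partialDeriv i g (cubeMap k m y) := by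
  funext y
  simp only [partialDeriv, lineDeriv]
  have h1 : (fun t : ℝ => c * g (cubeMap k m (y + t • Pi.single i (1 : ℝ)))) =
      fun t => c * (fun s : ℝ => g (cubeMap k m y + s • Pi.single i (1 : ℝ)))
        (((2 : ℝ) ^ k)⁻¹ * t) := by
    funext t
    congr 2
    funext i'
    simp only [cubeMap, Pi.add_apply, Pi.smul_apply, smul_eq_mul]
    ring
  rw [h1, deriv_const_mul_field]
  have h2 := deriv_comp_mul_left (((2 : ℝ) ^ k)⁻¹)
    (fun s : ℝ => g (cubeMap k m y + s • Pi.single i (1 : ℝ))) 0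
  rw [h2]
  simp only [mul_zero, smul_eq_mul]
  ring

theorem partialDeriv_iter_comp_cubeMap (i : Fin n) (k : ℕ) (m : Fin n → ℤ) (a : ℕ) (c : ℝ)
    (g : (Fin n → ℝ) → ℝ) :
    (partialDeriv i)^[a] (fun y => c * g (cubeMap k m y)) =
      fun y => c * (((2 : ℝ) ^ k)⁻¹) ^ a * (partialDeriv i)^[a] g (cubeMap k m y) := by
  induction a generalizing c g with
  | zero => simp
  | succ a ih =>
    rw [Function.iterate_succ_apply, partialDeriv_comp_cubeMap, ih, Function.iterate_succ_apply]
    funext y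
    ring

theorem mixedDeriv_comp_cubeMap (ν : Fin n → ℕ) (k : ℕ) (m : Fin n → ℤ) (f : (Fin n → ℝ) → ℝ)
    (y : Fin n → ℝ) :
    mixedDeriv ν (fun y => f (cubeMap k m y)) y =
      (∏ i, (((2 : ℝ) ^ k)⁻¹) ^ ν i) * mixedDeriv ν f (cubeMap k m y) := by
  have key : ∀ L : List (Fin n),
      L.foldr (fun i g => (partialDeriv i)^[ν i] g) (fun y => f (cubeMap k m y)) =
      fun y => (L.map fun i => (((2 : ℝ) ^ k)⁻¹) ^ ν i).prod *
        L.foldr (fun i g => (partialDeriv i)^[ν i] g) f (cubeMap k m y) := by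
    intro L
    induction L with
    | nil => simp
    | cons i L ih =>
      rw [List.foldr_cons, ih, partialDeriv_iter_comp_cubeMap, List.foldr_cons, List.map_cons,
        List.prod_cons]
      funext y
      ring
  rw [mixedDeriv_eq, key, mixedDeriv_eq, Fin.prod_univ_def]

theorem EventuallyEq.mixedDeriv_eq {f g : (Fin n → ℝ) → ℝ} {x : Fin n → ℝ} (h : f =ᶠ[𝓝 x] g)
    (ν : Fin n → ℕ) : mixedDeriv ν f x = mixedDeriv ν g x := by
  have h1 : ∀ (i : Fin n) (f g : (Fin n → ℝ) → ℝ), f =ᶠ[𝓝 x] g →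
      partialDeriv i f =ᶠ[𝓝 x] partialDeriv i g := fun i f g h => by
    filter_upwards [h.eventuallyEq_nhds] with y hy
    exact hy.lineDeriv_eq
  have h2 : ∀ (i : Fin n) (a : ℕ) (f g : (Fin n → ℝ) → ℝ), f =ᶠ[𝓝 x] g →
      (partialDeriv i)^[a] f =ᶠ[𝓝 x] (partialDeriv i)^[a] g := fun i a => by
    induction a with
    | zero => exact fun f g h => h
    | succ a ih => exact fun f g h => ih _ _ (h1 i f g h)
  have key : ∀ L : List (Fin n),
      L.foldr (fun i g => (partialDeriv i)^[ν i] g) f =ᶠ[𝓝 x]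
      L.foldr (fun i g => (partialDeriv i)^[ν i] g) g := by
    intro L
    induction L with
    | nil => exact h
    | cons i L ih => exact h2 i _ _ _ ih
  exact (key _).eq_of_nhds

/-- The coefficients of the functional `refCoeff`. -/
def refWeight (l ν : ℕ) : ℝ :=
  (-1) ^ (l - ν) / (l.factorial : ℝ) * (derivative^[l - ν] (knotPolynomial l)).eval (1 / 2)

/-- The coefficient functional of the unit cube. -/
def refCoeff (l : ℕ) (f : (Fin n → ℝ) → ℝ) : ℝ :=
  ∑ ν : Fin n → Fin (l + 1), (∏ i, refWeight l (ν i)) *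
    mixedDeriv (fun i => (ν i : ℕ)) f (fun _ => 1 / 2)

theorem iteratedDeriv_polynomial_affine (P : ℝ[X]) (c u w : ℝ) (a : ℕ) :
    iteratedDeriv a (fun s => c * P.eval (u * s - w)) =
      fun s => c * u ^ a * (derivative^[a] P).eval (u * s - w) := by
  induction a with
  | zero => simp
  | succ a ih =>
    rw [iteratedDeriv_succ, ih]
    funext s
    have h1 : HasDerivAt (fun s : ℝ => u * s - w) u s := by
      simpa using ((hasDerivAt_id s).const_mul u).sub_const w
    have h2 := (((derivative^[a] P).hasDerivAt (u * s - w)).comp s h1).const_mul (c * u ^ a)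
    rw [Function.iterate_succ_apply']
    refine h2.deriv.trans ?_
    ring

theorem knotPoly_eq (l k : ℕ) (m : ℤ) :
    knotPoly l k m =
      fun s : ℝ => (((2 : ℝ) ^ k)⁻¹) ^ l * (knotPolynomial l).eval (2 ^ k * s - (m : ℝ)) := by
  funext s
  rw [knotPoly, knotPolynomial, eval_prod]
  have : (((2 : ℝ) ^ k)⁻¹) ^ l = ∏ _j ∈ Finset.Icc 1 l, ((2 : ℝ) ^ k)⁻¹ := by simp
  rw [this, ← Finset.prod_mul_distrib]
  refine Finset.prod_congr rfl fun j _ => ?_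
  simp only [eval_sub, eval_C, eval_X]
  field_simp
  ring

/-- The powers of 2^k cancel: the knot polynomial contributes 2^{-kl}, its derivatives 2^{k(l-ν)},
and the rescaled D^ν the remaining factor. All estimates for the functionals thus reduce to the unit
cube, uniformly in k and m. -/
theorem coeffFun_eq_refCoeff (l k : ℕ) (m : Fin n → ℤ) (f : (Fin n → ℝ) → ℝ) :
    coeffFun l k m f = refCoeff l (fun y => f (cubeMap k m y)) := by
  refine Finset.sum_congr rfl fun ν _ => ?_
  rw [mixedDeriv_comp_cubeMap, ← mul_assoc, ← Finset.prod_mul_distrib]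
  have hc : dyadicCenter k m = cubeMap k m (fun _ => 1 / 2) := by
    funext i
    simp only [dyadicCenter, cubeMap, add_comm]
  rw [hc]
  congr 1
  refine Finset.prod_congr rfl fun i _ => ?_
  have hν : (ν i : ℕ) ≤ l := Nat.lt_succ_iff.1 (ν i).2
  rw [knotPoly_eq, iteratedDeriv_polynomial_affine, refWeight]
  have h1 : (2 : ℝ) ^ k * cubeMap k m (fun _ => 1 / 2) i - m i = 1 / 2 := by
    simp only [cubeMap]
    field_simp
    ring
  have h2 : (((2 : ℝ) ^ k)⁻¹) ^ l * ((2 : ℝ) ^ k) ^ (l - (ν i : ℕ)) =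
      (((2 : ℝ) ^ k)⁻¹) ^ (ν i : ℕ) := by
    have hpos : (0 : ℝ) < 2 ^ k := by positivity
    nth_rewrite 1 [← Nat.sub_add_cancel hν]
    rw [pow_add, mul_right_comm, ← mul_pow, inv_mul_cancel₀ hpos.ne', one_pow, one_mul]
  simp only [h1, h2]
  ring

theorem EventuallyEq.refCoeff_eq {l : ℕ} {f g : (Fin n → ℝ) → ℝ}
    (h : f =ᶠ[𝓝 fun _ => 1 / 2] g) : refCoeff l f = refCoeff l g :=
  Finset.sum_congr rfl fun ν _ => by rw [EventuallyEq.mixedDeriv_eq h]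

theorem refCoeff_congr_unit {l : ℕ} {f g : (Fin n → ℝ) → ℝ}
    (h : ∀ y : Fin n → ℝ, (∀ i, 0 ≤ y i ∧ y i < 1) → f y = g y) : refCoeff l f = refCoeff l g := by
  refine EventuallyEq.refCoeff_eq ?_
  have : Set.pi Set.univ (fun _ : Fin n => Set.Ioo (0 : ℝ) 1) ∈ 𝓝 (fun _ : Fin n => (1 / 2 : ℝ)) :=
    set_pi_mem_nhds Set.finite_univ fun i _ => Ioo_mem_nhds (by norm_num) (by norm_num)
  filter_upwards [this] with y hy
  exact h y fun i => ⟨(hy i (Set.mem_univ i)).1.le, (hy i (Set.mem_univ i)).2⟩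

theorem partialDeriv_sum_prod {J : Type*} (s : Finset J) (c : J → ℝ) (P : J → Fin n → ℝ[X])
    (i : Fin n) :
    partialDeriv i (fun x => ∑ j ∈ s, c j * ∏ i', (P j i').eval (x i')) =
      fun x => ∑ j ∈ s, c j *
        ∏ i', (Function.update (P j) i (derivative (P j i)) i').eval (x i') := by
  funext x
  refine HasDerivAt.deriv ?_
  refine HasDerivAt.fun_sum fun j _ => HasDerivAt.const_mul _ ?_
  have h1 : (fun t : ℝ => ∏ i', (P j i').eval ((x + t • Pi.single i (1 : ℝ) : Fin n → ℝ) i')) =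
      fun t =>
      (P j i).eval (x i + t) * ∏ i' ∈ Finset.univ.erase i, (P j i').eval (x i') := by
    funext t
    rw [← Finset.mul_prod_erase _ _ (Finset.mem_univ i)]
    congr 1
    · simp
    · refine Finset.prod_congr rfl fun i' hi' => ?_
      simp [Pi.single_eq_of_ne (Finset.ne_of_mem_erase hi')]
  rw [h1, ← Finset.mul_prod_erase _ _ (Finset.mem_univ i), Function.update_self]
  have h2 : ∏ i' ∈ Finset.univ.erase i, (Function.update (P j) i (derivative (P j i)) i').eval
      (x i') = ∏ i' ∈ Finset.univ.erase i, (P j i').eval (x i') :=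
    Finset.prod_congr rfl fun i' hi' => by
      rw [Function.update_of_ne (Finset.ne_of_mem_erase hi')]
  rw [h2]
  refine HasDerivAt.mul_const ?_ _
  have h3 := ((P j i).hasDerivAt (x i + 0)).comp_const_add (x i) 0
  simpa using h3

theorem partialDeriv_iter_sum_prod {J : Type*} (s : Finset J) (c : J → ℝ) (P : J → Fin n → ℝ[X])
    (i : Fin n) (a : ℕ) :
    (partialDeriv i)^[a] (fun x => ∑ j ∈ s, c j * ∏ i', (P j i').eval (x i')) =
      fun x => ∑ j ∈ s, c j *
        ∏ i', (Function.update (P j) i (derivative^[a] (P j i)) i').eval (x i') := by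
  induction a generalizing P with
  | zero => simp
  | succ a ih =>
    rw [Function.iterate_succ_apply, partialDeriv_sum_prod, ih]
    simp

theorem mixedDeriv_sum_prod {J : Type*} (s : Finset J) (c : J → ℝ) (P : J → Fin n → ℝ[X])
    (ν : Fin n → ℕ) :
    mixedDeriv ν (fun x => ∑ j ∈ s, c j * ∏ i, (P j i).eval (x i)) =
      fun x => ∑ j ∈ s, c j * ∏ i, (derivative^[ν i] (P j i)).eval (x i) := by
  have key : ∀ L : List (Fin n), L.Nodup →
      L.foldr (fun i g => (partialDeriv i)^[ν i] g)
        (fun x => ∑ j ∈ s, c j * ∏ i, (P j i).eval (x i)) =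
      fun x => ∑ j ∈ s, c j *
        ∏ i, (if i ∈ L then derivative^[ν i] (P j i) else P j i).eval (x i) := by
    intro L
    induction L with
    | nil => simp
    | cons i L ih =>
      intro hL
      rw [List.foldr_cons, ih (List.nodup_cons.1 hL).2]
      refine (partialDeriv_iter_sum_prod s c
        (fun j i => if i ∈ L then derivative^[ν i] (P j i) else P j i) i (ν i)).trans ?_
      funext x
      refine Finset.sum_congr rfl fun j _ => ?_
      congr 1
      refine Finset.prod_congr rfl fun i' _ => ?_
      congr 1
      by_cases hi : i' = i
      · subst hi
        simp [(List.nodup_cons.1 hL).1]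
      · rw [Function.update_of_ne hi]
        simp [hi]
  rw [mixedDeriv_eq, key _ (List.nodup_finRange n)]
  simp

/-- The functional is a tensor product, so on products of univariate polynomials it factors into the
one-dimensional dual functionals. -/
theorem refCoeff_sum_prod {J : Type*} (l : ℕ) (s : Finset J) (c : J → ℝ)
    (P : J → Fin n → ℝ[X]) :
    refCoeff l (fun x => ∑ j ∈ s, c j * ∏ i, (P j i).eval (x i)) =
      ∑ j ∈ s, c j * ∏ i, dualFun l (P j i) := by
  simp only [refCoeff, mixedDeriv_sum_prod, Finset.mul_sum]
  rw [Finset.sum_comm]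
  refine Finset.sum_congr rfl fun j _ => ?_
  have h1 : ∀ i, dualFun l (P j i) = ∑ a : Fin (l + 1),
      refWeight l a * (derivative^[(a : ℕ)] (P j i)).eval (1 / 2) := fun i => by
    rw [dualFun_apply, Finset.sum_range]
    rfl
  simp only [h1]
  rw [Finset.prod_univ_sum, Fintype.piFinset_univ, Finset.mul_sum]
  refine Finset.sum_congr rfl fun ν _ => ?_
  rw [Finset.prod_mul_distrib]
  ring

/-! #### Splines on a cube -/

theorem tensorSpline_eq_zero {l : ℕ} (hl : l ≠ 0) {k : ℕ} {m : Fin n → ℤ} {x : Fin n → ℝ}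
    (h : ∃ i, floorIdx k x i - m i < 0 ∨ (l : ℤ) < floorIdx k x i - m i) :
    tensorSpline l k m x = 0 := by
  obtain ⟨y, hy, h01⟩ := exists_cubeMap_eq k x
  obtain ⟨i, hi⟩ := h
  rw [← hy, tensorSpline_cubeMap]
  refine Finset.prod_eq_zero (Finset.mem_univ i) ?_
  rcases hi with hi | hi
  · refine bspline_eq_zero_of_nonpos hl ?_
    have : ((floorIdx k x i - m i : ℤ) : ℝ) ≤ -1 := by exact_mod_cast (by omega)
    linarith [(h01 i).2]
  · refine bspline_eq_zero_of_ge ?_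
    have : (l : ℝ) + 1 ≤ ((floorIdx k x i - m i : ℤ) : ℝ) := by exact_mod_cast hi
    linarith [(h01 i).1]

theorem splineSum_eq_sum_intBox {l : ℕ} (hl : l ≠ 0) (k K : ℕ) (b : (Fin n → ℤ) → ℝ)
    (m : Fin n → ℤ) (x : Fin n → ℝ) (h : ∀ i, |floorIdx k x i - m i| + l ≤ K) :
    splineSum l k b x = ∑ e ∈ intBox n K, b (m + e) * tensorSpline l k (m + e) x := by
  rw [splineSum, tsum_eq_sum (s := (intBox n K).map (addLeftEmbedding m)), Finset.sum_map]
  · rfl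
  · intro m' hm'
    rw [tensorSpline_eq_zero hl, mul_zero]
    by_contra hcon
    push Not at hcon
    refine hm' (Finset.mem_map.2 ⟨m' - m, mem_intBox.2 fun i => ?_, by simp⟩)
    have h1 := hcon i
    have h2 := h i
    simp only [Pi.sub_apply]
    rcases abs_cases (floorIdx k x i - m i) with h3 | h3 <;> rw [abs_le] <;> omega

theorem splineSum_cubeMap {l : ℕ} (hl : l ≠ 0) (k : ℕ) (b : (Fin n → ℤ) → ℝ) (m : Fin n → ℤ)
    {y : Fin n → ℝ} (hy : ∀ i, 0 ≤ y i ∧ y i < 1) :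
    splineSum l k b (cubeMap k m y) = ∑ e : Fin n → Fin (l + 1),
      b (m - fun i => ((e i : ℕ) : ℤ)) * ∏ i, (piece l (e i : ℕ)).eval (y i) := by
  have hinj : Function.Injective
      fun e : Fin n → Fin (l + 1) => m - fun i => ((e i : ℕ) : ℤ) := fun e e' h => by
    funext i
    have h1 : m i - ((e i : ℕ) : ℤ) = m i - ((e' i : ℕ) : ℤ) := congrFun h i
    exact Fin.ext (by omega)
  have h0 : floorIdx 0 y = 0 := by
    funext i
    simp only [floorIdx, pow_zero, one_mul, Pi.zero_apply]
    exact Int.floor_eq_zero_iff.2 (hy i)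
  rw [splineSum, tsum_eq_sum (s := Finset.univ.image
    fun e : Fin n → Fin (l + 1) => m - fun i => ((e i : ℕ) : ℤ)), Finset.sum_image hinj.injOn]
  · refine Finset.sum_congr rfl fun e _ => ?_
    congr 1
    rw [tensorSpline_cubeMap]
    refine Finset.prod_congr rfl fun i _ => ?_
    rw [bspline_add_eq_piece hl _ (hy i).1 (hy i).2.le]
    simp
  · intro m' hm'
    rw [tensorSpline_eq_zero hl, mul_zero]
    by_contra hcon
    push Not at hcon
    rw [floorIdx_cubeMap, h0, zero_add] at hcon
    refine hm' (Finset.mem_image.2 ⟨fun i => ⟨(m i - m' i).toNat, ?_⟩, Finset.mem_univ _, ?_⟩)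
    · have := hcon i; omega
    · funext i
      have := hcon i
      simp only [Pi.sub_apply]
      omega

/-- Duality of the coefficient functionals and the B-splines. -/
theorem coeffFun_splineSum {l : ℕ} (hl : l ≠ 0) (k : ℕ) (b : (Fin n → ℤ) → ℝ) (m : Fin n → ℤ) :
    coeffFun l k m (splineSum l k b) = b m := by
  rw [coeffFun_eq_refCoeff, refCoeff_congr_unit fun y hy => splineSum_cubeMap hl k b m hy,
    refCoeff_sum_prod l Finset.univ (fun e : Fin n → Fin (l + 1) => b (m - fun i => ((e i : ℕ) : ℤ)))
      (fun e i => piece l (e i : ℕ)), Finset.sum_eq_single 0]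
  · have : (m - fun i : Fin n => (((0 : Fin n → Fin (l + 1)) i : ℕ) : ℤ)) = m := by
      funext i; simp
    rw [this]
    simp [dualFun_piece]
  · intro e _ he
    obtain ⟨i, hi⟩ := Function.ne_iff.1 he
    rw [Finset.prod_eq_zero (Finset.mem_univ i), mul_zero]
    rw [dualFun_piece, if_neg]
    intro h
    exact hi (Fin.ext (by simpa using h))
  · simp

/-! #### Polynomials of bounded coordinate degree -/

/-- The polynomial function `x ↦ ∑_ν c_ν x^ν`, `ν_i ≤ l`. -/
def polyEval {l : ℕ} (c : (Fin n → Fin (l + 1)) → ℝ) (x : Fin n → ℝ) : ℝ :=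
  ∑ ν, c ν * ∏ i, x i ^ (ν i : ℕ)

theorem exists_polyEval_eq_prod {l : ℕ} {P : Fin n → ℝ[X]} (hP : ∀ i, (P i).natDegree ≤ l) :
    ∃ c : (Fin n → Fin (l + 1)) → ℝ, ∀ x, ∏ i, (P i).eval (x i) = polyEval c x := by
  refine ⟨fun ν => ∏ i, (P i).coeff (ν i), fun x => ?_⟩
  have h1 : ∀ i, (P i).eval (x i) = ∑ a : Fin (l + 1), (P i).coeff a * x i ^ (a : ℕ) := fun i => by
    rw [eval_eq_sum_range' (Nat.lt_succ_of_le (hP i)), Finset.sum_range]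
  simp only [h1]
  rw [Finset.prod_univ_sum, Fintype.piFinset_univ]
  exact Finset.sum_congr rfl fun ν _ => Finset.prod_mul_distrib

theorem polyEval_sum {l : ℕ} {J : Type*} (s : Finset J) (a : J → ℝ)
    (c : J → (Fin n → Fin (l + 1)) → ℝ) (x : Fin n → ℝ) :
    ∑ j ∈ s, a j * polyEval (c j) x = polyEval (fun ν => ∑ j ∈ s, a j * c j ν) x := by
  simp only [polyEval, Finset.mul_sum, Finset.sum_mul]
  rw [Finset.sum_comm]
  exact Finset.sum_congr rfl fun ν _ => Finset.sum_congr rfl fun j _ => by ring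

theorem exists_polyEval_eq_sum_prod {l : ℕ} {J : Type*} (s : Finset J) (a : J → ℝ)
    {P : J → Fin n → ℝ[X]} (hP : ∀ j ∈ s, ∀ i, (P j i).natDegree ≤ l) :
    ∃ c : (Fin n → Fin (l + 1)) → ℝ, ∀ x,
      ∑ j ∈ s, a j * ∏ i, (P j i).eval (x i) = polyEval c x := by
  have h1 : ∀ j : s, ∃ c : (Fin n → Fin (l + 1)) → ℝ, ∀ x,
      ∏ i, (P j i).eval (x i) = polyEval c x := fun j => exists_polyEval_eq_prod (hP j j.2)
  choose c hc using h1
  refine ⟨fun ν => ∑ j : s, a j * c j ν, fun x => ?_⟩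
  rw [← polyEval_sum, ← Finset.sum_coe_sort]
  exact Finset.sum_congr rfl fun j _ => by rw [hc]

theorem polyEval_eq_sum_prod {l : ℕ} (c : (Fin n → Fin (l + 1)) → ℝ) (x : Fin n → ℝ) :
    polyEval c x = ∑ ν, c ν * ∏ i, ((X : ℝ[X]) ^ (ν i : ℕ)).eval (x i) := by
  simp [polyEval]

theorem polyEval_affine {l : ℕ} (c : (Fin n → Fin (l + 1)) → ℝ) (u : ℝ) (w : Fin n → ℝ)
    (x : Fin n → ℝ) : polyEval c (fun i => u * x i + w i) =
      ∑ ν, c ν * ∏ i, ((C u * X + C (w i) : ℝ[X]) ^ (ν i : ℕ)).eval (x i) := by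
  simp [polyEval]

theorem natDegree_affine_pow_le {l : ℕ} (u w : ℝ) (a : Fin (l + 1)) :
    ((C u * X + C w : ℝ[X]) ^ (a : ℕ)).natDegree ≤ l := by
  refine (natDegree_pow_le).trans ?_
  have h1 : (C u * X + C w : ℝ[X]).natDegree ≤ 1 := natDegree_linear_le
  have h2 : (a : ℕ) ≤ l := Nat.lt_succ_iff.1 a.2
  nlinarith

theorem exists_polyEval_affine {l : ℕ} (c : (Fin n → Fin (l + 1)) → ℝ) (u : ℝ)
    (w : Fin n → ℝ) :
    ∃ c' : (Fin n → Fin (l + 1)) → ℝ, ∀ x, polyEval c (fun i => u * x i + w i) = polyEval c' x := by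
  obtain ⟨c', hc'⟩ := exists_polyEval_eq_sum_prod (l := l) Finset.univ c
    (P := fun ν i => (C u * X + C (w i) : ℝ[X]) ^ (ν i : ℕ))
    fun ν _ i => natDegree_affine_pow_le u (w i) (ν i)
  exact ⟨c', fun x => by rw [polyEval_affine, hc']⟩

theorem cubeMap_eq (k : ℕ) (m : Fin n → ℤ) (y : Fin n → ℝ) :
    cubeMap k m y = fun i => ((2 : ℝ) ^ k)⁻¹ * y i + (m i : ℝ) / 2 ^ k := by
  funext i
  simp only [cubeMap]
  field_simp

theorem exists_polyEval_eq_eval {l : ℕ} {P : MvPolynomial (Fin n) ℝ} (hP : CoordDegLE l P) :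
    ∃ c : (Fin n → Fin (l + 1)) → ℝ, ∀ x, MvPolynomial.eval x P = polyEval c x := by
  obtain ⟨c, hc⟩ := exists_polyEval_eq_sum_prod (l := l) P.support (fun d => P.coeff d)
    (P := fun d i => (X : ℝ[X]) ^ d i) (fun d hd i => by
      rw [natDegree_X_pow]
      exact (MvPolynomial.degreeOf_le_iff.1 (hP i)) d hd)
  refine ⟨c, fun x => ?_⟩
  rw [← hc, MvPolynomial.eval_eq']
  simp

theorem exists_eval_eq_polyEval {l : ℕ} (c : (Fin n → Fin (l + 1)) → ℝ) :
    ∃ P : MvPolynomial (Fin n) ℝ, CoordDegLE l P ∧ ∀ x, MvPolynomial.eval x P = polyEval c x := by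
  refine ⟨∑ ν, MvPolynomial.monomial (Finsupp.equivFunOnFinite.symm fun i => (ν i : ℕ)) (c ν),
    fun i => ?_, fun x => ?_⟩
  · refine (MvPolynomial.degreeOf_sum_le _ _ _).trans (Finset.sup_le fun ν _ => ?_)
    rw [MvPolynomial.degreeOf_le_iff]
    intro d hd
    have := Finset.mem_singleton.1 (MvPolynomial.support_monomial_subset hd)
    subst this
    simpa using Nat.lt_succ_iff.1 (ν i).2
  · rw [map_sum]
    refine Finset.sum_congr rfl fun ν _ => ?_
    rw [MvPolynomial.eval_monomial, Finsupp.prod_fintype _ _ (by simp)]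
    simp

/-- The quasi-interpolant reproduces polynomials of coordinate degree at most `l`. -/
theorem splineSum_coeffFun_polyEval {l : ℕ} (hl : l ≠ 0) (k : ℕ)
    (c : (Fin n → Fin (l + 1)) → ℝ) (x : Fin n → ℝ) :
    splineSum l k (fun m => coeffFun l k m (polyEval c)) x = polyEval c x := by
  obtain ⟨y, hy, h01⟩ := exists_cubeMap_eq k x
  set m := floorIdx k x
  have hco : ∀ e : Fin n → Fin (l + 1),
      coeffFun l k (m - fun i => ((e i : ℕ) : ℤ)) (polyEval c) =
      ∑ ν, c ν * ∏ i, dualFun l (((C ((2 : ℝ) ^ k)⁻¹ * X + C ((m i : ℝ) / 2 ^ k) : ℝ[X]) ^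
        (ν i : ℕ)).comp (X - C ((e i : ℕ) : ℝ))) := fun e => by
    rw [coeffFun_eq_refCoeff, ← refCoeff_sum_prod]
    congr 1
    funext z
    have : cubeMap k (m - fun i => ((e i : ℕ) : ℤ)) z =
        fun i => ((2 : ℝ) ^ k)⁻¹ * (z i - (e i : ℕ)) + (m i : ℝ) / 2 ^ k := by
      funext i
      simp only [cubeMap, Pi.sub_apply]
      push_cast
      field_simp
      ring
    rw [this, polyEval]
    simp
  rw [← hy, splineSum_cubeMap hl k _ m h01, cubeMap_eq, polyEval_affine]
  simp only [hco, Finset.sum_mul]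
  rw [Finset.sum_comm]
  refine Finset.sum_congr rfl fun ν _ => ?_
  simp only [mul_assoc]
  rw [← Finset.mul_sum]
  congr 1
  simp only [← Finset.prod_mul_distrib]
  -- The sum over all shifts factors over the coordinates; each factor is the univariate
  -- reproduction identity `sum_dualFun_comp_mul_piece`.
  rw [← Fintype.piFinset_univ, ← Finset.prod_univ_sum (fun _ => (Finset.univ : Finset (Fin (l + 1))))
    (fun i a => dualFun l (((C ((2 : ℝ) ^ k)⁻¹ * X + C ((m i : ℝ) / 2 ^ k) : ℝ[X]) ^
        (ν i : ℕ)).comp (X - C ((a : ℕ) : ℝ))) * (piece l (a : ℕ)).eval (y i))]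
  refine Finset.prod_congr rfl fun i _ => ?_
  have h1 := sum_dualFun_comp_mul_piece
    (natDegree_affine_pow_le (((2 : ℝ) ^ k)⁻¹) ((m i : ℝ) / 2 ^ k) (ν i))
  have h2 := congrArg (eval (y i)) h1
  rw [eval_finsetSum] at h2
  rw [← h2]
  exact Finset.sum_congr rfl fun a _ => by rw [eval_mul, eval_C]

/-- On every dyadic cube of its level a spline is a polynomial. -/
theorem exists_polyEval_eq_splineSum {l : ℕ} (hl : l ≠ 0) (k : ℕ) (b : (Fin n → ℤ) → ℝ)
    (m : Fin n → ℤ) : ∃ c : (Fin n → Fin (l + 1)) → ℝ,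
      ∀ x, floorIdx k x = m → splineSum l k b x = polyEval c x := by
  obtain ⟨c₀, hc₀⟩ := exists_polyEval_eq_sum_prod (l := l) Finset.univ
    (fun e : Fin n → Fin (l + 1) => b (m - fun i => ((e i : ℕ) : ℤ)))
    (P := fun e i => piece l (e i : ℕ)) fun e _ i => natDegree_piece_le l _
  obtain ⟨c, hc⟩ := exists_polyEval_affine c₀ ((2 : ℝ) ^ k) (fun i => -(m i : ℝ))
  refine ⟨c, fun x hx => ?_⟩
  obtain ⟨y, hy, h01⟩ := exists_cubeMap_eq k x
  rw [hx] at hy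
  rw [← hc, ← hy, splineSum_cubeMap hl k b m h01, hc₀]
  congr 1
  funext i
  simp only [cubeMap]
  field_simp
  ring

/-! #### Refinement -/

theorem tensorSpline_refinement (l k : ℕ) (m : Fin n → ℤ) (x : Fin n → ℝ) :
    tensorSpline l k m x = ∑ e : Fin n → Fin (l + 2),
      (∏ i, (2 ^ l : ℝ)⁻¹ * ((l + 1).choose (e i) : ℝ)) *
        tensorSpline l (k + 1) (fun i => 2 * m i + ((e i : ℕ) : ℤ)) x := by
  simp only [tensorSpline]
  have h1 : ∀ i, bspline l (2 ^ k * (x i - (m i : ℝ) / 2 ^ k)) = ∑ a : Fin (l + 2),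
      (2 ^ l : ℝ)⁻¹ * ((l + 1).choose a : ℝ) *
        bspline l (2 ^ (k + 1) * (x i - ((2 * m i + ((a : ℕ) : ℤ) : ℤ) : ℝ) / 2 ^ (k + 1))) :=
      fun i => by
    rw [bspline_refinement, Finset.sum_range]
    refine Finset.sum_congr rfl fun a _ => ?_
    congr 2
    push_cast
    field_simp
    ring
  simp only [h1]
  rw [Finset.prod_univ_sum, Fintype.piFinset_univ]
  exact Finset.sum_congr rfl fun e _ => Finset.prod_mul_distrib

theorem summable_mul_tensorSpline {l : ℕ} (hl : l ≠ 0) (k : ℕ) (b : (Fin n → ℤ) → ℝ)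
    (x : Fin n → ℝ) : Summable fun m => b m * tensorSpline l k m x := by
  refine summable_of_hasFiniteSupport ((((intBox n l).map
    (addLeftEmbedding (floorIdx k x))).finite_toSet).subset fun m hm => ?_)
  by_contra hcon
  refine hm ?_
  have : tensorSpline l k m x = 0 := by
    refine tensorSpline_eq_zero hl ?_
    by_contra hcon2
    push Not at hcon2
    refine hcon (Finset.mem_coe.2 (Finset.mem_map.2
      ⟨m - floorIdx k x, mem_intBox.2 fun i => ?_, by simp⟩))
    have := hcon2 i
    simp only [Pi.sub_apply]
    rw [abs_le]
    omega
  simp [this]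

/-- Nestedness of the spline spaces, which makes T_{k+1} - T_k a spline of level k + 1. For each
refinement offset e, b is transported along the injection m ↦ 2m + e and extended by zero. -/
theorem exists_splineSum_succ_eq {l : ℕ} (hl : l ≠ 0) (k : ℕ) (b : (Fin n → ℤ) → ℝ) :
    ∃ b' : (Fin n → ℤ) → ℝ, splineSum l k b = splineSum l (k + 1) b' := by
  let g : (Fin n → Fin (l + 2)) → (Fin n → ℤ) → Fin n → ℤ :=
    fun e m i => 2 * m i + ((e i : ℕ) : ℤ)
  have hg : ∀ e, Function.Injective (g e) := fun e m m' h => by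
    funext i
    have : 2 * m i + ((e i : ℕ) : ℤ) = 2 * m' i + ((e i : ℕ) : ℤ) := congrFun h i
    omega
  let w : (Fin n → Fin (l + 2)) → ℝ := fun e => ∏ i, (2 ^ l : ℝ)⁻¹ * ((l + 1).choose (e i) : ℝ)
  let B : (Fin n → Fin (l + 2)) → (Fin n → ℤ) → ℝ := fun e m' => w e * Function.extend (g e) b 0 m'
  refine ⟨fun m' => ∑ e, B e m', funext fun x => ?_⟩
  have h1 : splineSum l (k + 1) (fun m' => ∑ e, B e m') x =
      ∑ e, ∑' m', B e m' * tensorSpline l (k + 1) m' x := by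
    rw [splineSum]
    simp only [Finset.sum_mul]
    exact Summable.tsum_finsetSum fun e _ => summable_mul_tensorSpline hl _ _ _
  have h2 : ∀ e, ∑' m', B e m' * tensorSpline l (k + 1) m' x =
      ∑' m, b m * (w e * tensorSpline l (k + 1) (g e m) x) := fun e => by
    rw [← (hg e).tsum_eq]
    · refine tsum_congr fun m => ?_
      simp only [B, (hg e).extend_apply]
      ring
    · intro m' hm'
      by_contra hcon
      refine hm' ?_
      simp only [B]
      rw [Function.extend_apply' _ _ _ (by simpa using hcon)]
      simp
  have h3 : ∀ e, Summable fun m => b m * (w e * tensorSpline l (k + 1) (g e m) x) := fun e => by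
    have := (summable_mul_tensorSpline hl (k + 1) (B e) x).comp_injective (hg e)
    refine this.congr fun m => ?_
    simp only [B, Function.comp, (hg e).extend_apply]
    ring
  rw [h1, Finset.sum_congr rfl fun e _ => h2 e, ← Summable.tsum_finsetSum fun e _ => h3 e,
    splineSum]
  refine tsum_congr fun m => ?_
  rw [tensorSpline_refinement, Finset.mul_sum]

theorem splineSum_sub {l : ℕ} (hl : l ≠ 0) (k : ℕ) (b b' : (Fin n → ℤ) → ℝ) (x : Fin n → ℝ) :
    splineSum l k b x - splineSum l k b' x = splineSum l k (fun m => b m - b' m) x := by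
  rw [splineSum, splineSum, splineSum, ← (summable_mul_tensorSpline hl k b x).tsum_sub
    (summable_mul_tensorSpline hl k b' x)]
  exact tsum_congr fun m => by ring

/-! #### Bounds -/

theorem diff_eq_fwdDiff (l : ℕ) (h : Fin n → ℝ) (g : (Fin n → ℝ) → ℝ) (x : Fin n → ℝ) :
    diff l h g x = (fwdDiff h)^[l] g x := by
  rw [fwdDiff_iter_eq_sum_shift, diff]
  refine Finset.sum_congr rfl fun j hj => ?_
  have hj' : j ≤ l := Nat.lt_succ_iff.1 (Finset.mem_range.1 hj)
  have h1 : (-1 : ℝ) ^ (l + j) = (-1) ^ (l - j) := by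
    rw [show l + j = 2 * j + (l - j) by omega, pow_add, pow_mul]
    simp
  rw [h1, zsmul_eq_mul]
  push_cast
  rw [Nat.cast_smul_eq_nsmul]
  ring

/-- Leibniz rule for differences, by induction from Δ(fg) = Δf · g(· + h) + f · Δg. Bounds of all
lower orders are assumed because the two factors share the differences. -/
theorem abs_fwdDiff_mul_le {E : Type*} [AddCommGroup E] (h : E) {τ : ℝ} (hτ : 0 ≤ τ) (ν : ℕ) :
    ∀ (A B : ℝ), 0 ≤ A → 0 ≤ B → ∀ f g : E → ℝ,
      (∀ a ≤ ν, ∀ x, |(fwdDiff h)^[a] f x| ≤ A * τ ^ a) →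
      (∀ a ≤ ν, ∀ x, |(fwdDiff h)^[a] g x| ≤ B * τ ^ a) →
      ∀ x, |(fwdDiff h)^[ν] (fun x => f x * g x) x| ≤ 2 ^ ν * (A * B) * τ ^ ν := by
  induction ν with
  | zero =>
    intro A B hA hB f g hf hg x
    have h1 := hf 0 le_rfl x
    have h2 := hg 0 le_rfl x
    simp only [Function.iterate_zero, id, pow_zero, mul_one, one_mul] at h1 h2 ⊢
    rw [abs_mul]
    gcongr
  | succ ν ih =>
    intro A B hA hB f g hf hg x
    have h1 : fwdDiff h (fun x => f x * g x) =
        (fun x => fwdDiff h f x * g (x + h)) + fun x => f x * fwdDiff h g x := by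
      funext x
      simp only [fwdDiff, Pi.add_apply]
      ring
    have hg' : ∀ a ≤ ν, ∀ x, |(fwdDiff h)^[a] (fun x => g (x + h)) x| ≤ B * τ ^ a :=
      fun a ha x => by
        rw [fwdDiff_iter_comp_add]
        exact hg a (by omega) _
    have e1 := ih (A * τ) B (by positivity) hB (fwdDiff h f) (fun x => g (x + h))
      (fun a ha x => by
        have := hf (a + 1) (by omega) x
        rw [Function.iterate_succ_apply] at this
        rwa [mul_assoc, ← pow_succ']) hg' x
    have e2 := ih A (B * τ) hA (by positivity) f (fwdDiff h g) (fun a ha x => hf a (by omega) x)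
      (fun a ha x => by
        have := hg (a + 1) (by omega) x
        rw [Function.iterate_succ_apply] at this
        rwa [mul_assoc, ← pow_succ']) x
    rw [Function.iterate_succ_apply, h1, fwdDiff_iter_add, Pi.add_apply]
    refine (abs_add_le _ _).trans ((add_le_add e1 e2).trans (le_of_eq ?_))
    ring

theorem exists_abs_fwdDiff_tensorSpline_le (n : ℕ) {l : ℕ} (hl : l ≠ 0) :
    ∃ C : ℝ, 0 ≤ C ∧ ∀ (k : ℕ) (m : Fin n → ℤ) (h x : Fin n → ℝ), ∀ ν ≤ l,
      |(fwdDiff h)^[ν] (tensorSpline l k m) x| ≤ C * (2 ^ k * ‖h‖) ^ ν := by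
  obtain ⟨D, hD, hDb⟩ := exists_abs_fwdDiff_bspline_le hl
  have hone : ∀ (k : ℕ) (m : Fin n → ℤ) (h : Fin n → ℝ) (i : Fin n), ∀ ν ≤ l, ∀ x,
      |(fwdDiff h)^[ν] (fun x : Fin n → ℝ => bspline l (2 ^ k * (x i - (m i : ℝ) / 2 ^ k))) x| ≤
        D * (2 ^ k * ‖h‖) ^ ν := by
    intro k m h i ν hν x
    have h1 : (fwdDiff h)^[ν] (fun x : Fin n → ℝ => bspline l (2 ^ k * (x i - (m i : ℝ) / 2 ^ k))) x
        = (fwdDiff (2 ^ k * h i))^[ν] (bspline l) (2 ^ k * (x i - (m i : ℝ) / 2 ^ k)) := by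
      rw [fwdDiff_iter_eq_sum_shift, fwdDiff_iter_eq_sum_shift]
      refine Finset.sum_congr rfl fun j _ => ?_
      congr 2
      rw [Pi.add_apply, Pi.smul_apply, nsmul_eq_mul, nsmul_eq_mul]
      ring
    rw [h1]
    refine (hDb ν hν _ _).trans ?_
    have h2 : |2 ^ k * h i| ≤ 2 ^ k * ‖h‖ := by
      rw [abs_mul, abs_of_nonneg (by positivity : (0 : ℝ) ≤ 2 ^ k)]
      gcongr
      exact norm_le_pi_norm h i
    gcongr
  have key : ∀ s : Finset (Fin n), ∃ C : ℝ, 0 ≤ C ∧ ∀ (k : ℕ) (m : Fin n → ℤ) (h : Fin n → ℝ),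
      ∀ ν ≤ l, ∀ x, |(fwdDiff h)^[ν] (fun x : Fin n → ℝ =>
        ∏ i ∈ s, bspline l (2 ^ k * (x i - (m i : ℝ) / 2 ^ k))) x| ≤ C * (2 ^ k * ‖h‖) ^ ν := by
    intro s
    induction s using Finset.induction_on with
    | empty =>
      refine ⟨1, zero_le_one, fun k m h ν _ x => ?_⟩
      simp only [Finset.prod_empty]
      cases ν with
      | zero => simp
      | succ ν =>
        rw [Function.iterate_succ_apply, fwdDiff_const, ← Pi.zero_def, fwdDiff_iter_eq_sum_shift]
        simp only [Pi.zero_apply, smul_zero, Finset.sum_const_zero, abs_zero]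
        positivity
    | insert i s hi ih =>
      obtain ⟨C, hC, hCb⟩ := ih
      refine ⟨2 ^ l * (D * C), by positivity, fun k m h ν hν x => ?_⟩
      simp only [Finset.prod_insert hi]
      refine (abs_fwdDiff_mul_le h (by positivity) ν D C hD hC _ _
        (fun a ha x => hone k m h i a (ha.trans hν) x)
        (fun a ha x => hCb k m h a (ha.trans hν) x) x).trans ?_
      gcongr
      norm_num
  obtain ⟨C, hC, hCb⟩ := key Finset.univ
  exact ⟨C, hC, fun k m h x ν hν => hCb k m h ν hν x⟩

theorem exists_abs_splineSum_le (n : ℕ) {l : ℕ} (hl : l ≠ 0) :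
    ∃ C : ℝ, 0 ≤ C ∧ ∀ (k : ℕ) (b : (Fin n → ℤ) → ℝ) (x : Fin n → ℝ),
      |splineSum l k b x| ≤ C * ∑ e ∈ intBox n l, |b (floorIdx k x + e)| := by
  obtain ⟨C, hC, hCb⟩ := exists_abs_fwdDiff_tensorSpline_le n hl
  refine ⟨C, hC, fun k b x => ?_⟩
  rw [splineSum_eq_sum_intBox hl k l b (floorIdx k x) x (by simp), Finset.mul_sum]
  refine (Finset.abs_sum_le_sum_abs _ _).trans (Finset.sum_le_sum fun e _ => ?_)
  rw [abs_mul, mul_comm]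
  gcongr
  simpa using hCb k (floorIdx k x + e) 0 x 0 (Nat.zero_le l)

theorem abs_floorIdx_sub_le {k : ℕ} {x y : Fin n → ℝ} {R : ℕ} (h : 2 ^ k * ‖x - y‖ ≤ R)
    (i : Fin n) : |floorIdx k x i - floorIdx k y i| ≤ R + 1 := by
  have h1 : |2 ^ k * x i - 2 ^ k * y i| ≤ R := by
    rw [← mul_sub, abs_mul, abs_of_nonneg (by positivity : (0 : ℝ) ≤ 2 ^ k)]
    refine le_trans ?_ h
    gcongr
    exact norm_le_pi_norm (x - y) i
  have h2 := Int.floor_le (2 ^ k * x i)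
  have h3 := Int.lt_floor_add_one (2 ^ k * x i)
  have h4 := Int.floor_le (2 ^ k * y i)
  have h5 := Int.lt_floor_add_one (2 ^ k * y i)
  rw [abs_le] at h1
  simp only [floorIdx]
  have h6 : ((⌊2 ^ k * x i⌋ - ⌊2 ^ k * y i⌋ : ℤ) : ℝ) < (R : ℝ) + 1 := by push_cast; linarith
  have h7 : -((R : ℝ) + 1) < ((⌊2 ^ k * x i⌋ - ⌊2 ^ k * y i⌋ : ℤ) : ℝ) := by push_cast; linarith
  have h8 : ⌊2 ^ k * x i⌋ - ⌊2 ^ k * y i⌋ < (R : ℤ) + 1 := by exact_mod_cast h6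
  have h9 : -((R : ℤ) + 1) < ⌊2 ^ k * x i⌋ - ⌊2 ^ k * y i⌋ := by exact_mod_cast h7
  rw [abs_le]
  omega

theorem exists_abs_diff_splineSum_le (n : ℕ) {l : ℕ} (hl : l ≠ 0) :
    ∃ C : ℝ, 0 ≤ C ∧ ∀ (k : ℕ) (b : (Fin n → ℤ) → ℝ) (h x : Fin n → ℝ), 2 ^ k * ‖h‖ ≤ 2 →
      |diff l h (splineSum l k b) x| ≤
        C * (2 ^ k * ‖h‖) ^ l * ∑ e ∈ intBox n (3 * l + 1), |b (floorIdx k x + e)| := by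
  obtain ⟨C, hC, hCb⟩ := exists_abs_fwdDiff_tensorSpline_le n hl
  refine ⟨C, hC, fun k b h x hh => ?_⟩
  have h1 : ∀ j ∈ Finset.range (l + 1), splineSum l k b (x + (j : ℝ) • h) =
      ∑ e ∈ intBox n (3 * l + 1), b (floorIdx k x + e) *
        tensorSpline l k (floorIdx k x + e) (x + (j : ℝ) • h) := fun j hj => by
    -- A displacement of at most 2l cells changes the index by at most 2l + 1, and the supports of
    -- the B-splines add l; this is the box size 3l + 1, common to all points of the difference.
    refine splineSum_eq_sum_intBox hl k _ b _ _ fun i => ?_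
    have hj' : j ≤ l := Nat.lt_succ_iff.1 (Finset.mem_range.1 hj)
    have h2 : 2 ^ k * ‖x + (j : ℝ) • h - x‖ ≤ ((2 * l : ℕ) : ℝ) := by
      rw [add_sub_cancel_left, norm_smul, Real.norm_natCast, mul_left_comm]
      have : (j : ℝ) ≤ l := by exact_mod_cast hj'
      push_cast
      nlinarith [norm_nonneg h]
    have := abs_floorIdx_sub_le h2 i
    push_cast at this ⊢
    omega
  have h3 : diff l h (splineSum l k b) x = ∑ e ∈ intBox n (3 * l + 1), b (floorIdx k x + e) *
      diff l h (tensorSpline l k (floorIdx k x + e)) x := by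
    simp only [diff, Finset.mul_sum]
    rw [Finset.sum_comm]
    refine Finset.sum_congr rfl fun j hj => ?_
    rw [h1 j hj, Finset.mul_sum]
    exact Finset.sum_congr rfl fun e _ => by ring
  rw [h3, Finset.mul_sum]
  refine (Finset.abs_sum_le_sum_abs _ _).trans (Finset.sum_le_sum fun e _ => ?_)
  rw [abs_mul, mul_comm, diff_eq_fwdDiff]
  gcongr
  exact hCb k _ h x l le_rfl

theorem continuous_tensorSpline (l k : ℕ) (m : Fin n → ℤ) : Continuous (tensorSpline l k m) := by
  unfold tensorSpline
  exact continuous_finsetProd _ fun i _ => (continuous_bspline l).comp (by fun_prop)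

theorem measurable_eval_floorIdx (k : ℕ) {F : (Fin n → ℤ) → (Fin n → ℝ) → ℝ}
    (hF : ∀ m, Measurable (F m)) : Measurable fun x => F (floorIdx k x) x := by
  intro s hs
  have : (fun x => F (floorIdx k x) x) ⁻¹' s =
      ⋃ m, (dyadicHalfOpen k m ∩ F m ⁻¹' s) := by
    ext x
    simp [mem_dyadicHalfOpen]
  rw [this]
  exact MeasurableSet.iUnion fun m => (measurableSet_dyadicHalfOpen k m).inter (hF m hs)

theorem measurable_splineSum {l : ℕ} (hl : l ≠ 0) (k : ℕ) (b : (Fin n → ℤ) → ℝ) :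
    Measurable (splineSum l k b) := by
  have h1 : splineSum l k b = fun x => ∑ e ∈ intBox n l, b (floorIdx k x + e) *
      tensorSpline l k (floorIdx k x + e) x := by
    funext x
    exact splineSum_eq_sum_intBox hl k l b (floorIdx k x) x (by simp)
  rw [h1]
  exact measurable_eval_floorIdx k (F := fun m x => ∑ e ∈ intBox n l, b (m + e) *
    tensorSpline l k (m + e) x) fun m => Finset.measurable_sum _ fun e _ =>
      (continuous_tensorSpline l k (m + e)).measurable.const_mul _

end Tensor

/-! ### Norms of polynomials on cubes -/

section PolyNorm

variable {n : ℕ}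

/-- `cubeMap` as a homeomorphism. -/
def cubeHomeomorph (k : ℕ) (m : Fin n → ℤ) : (Fin n → ℝ) ≃ₜ (Fin n → ℝ) :=
  (Homeomorph.smulOfNeZero (((2 : ℝ) ^ k)⁻¹) (by positivity)).trans
    (Homeomorph.addRight fun i => (m i : ℝ) / 2 ^ k)

theorem coe_cubeHomeomorph (k : ℕ) (m : Fin n → ℤ) :
    (cubeHomeomorph k m : (Fin n → ℝ) → Fin n → ℝ) = cubeMap k m := by
  funext y
  rw [cubeMap_eq]
  rfl

theorem measurableEmbedding_cubeMap (k : ℕ) (m : Fin n → ℤ) :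
    MeasurableEmbedding (cubeMap k m : (Fin n → ℝ) → Fin n → ℝ) := by
  rw [← coe_cubeHomeomorph]
  exact (cubeHomeomorph k m).measurableEmbedding

theorem continuous_cubeMap (k : ℕ) (m : Fin n → ℤ) :
    Continuous (cubeMap k m : (Fin n → ℝ) → Fin n → ℝ) := by
  rw [← coe_cubeHomeomorph]
  exact (cubeHomeomorph k m).continuous

theorem map_smul_volume (k : ℕ) :
    Measure.map (fun y : Fin n → ℝ => ((2 : ℝ) ^ k)⁻¹ • y) volume =
      (2 : ℝ≥0∞) ^ (k * n) • (volume : Measure (Fin n → ℝ)) := by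
  have h0 : ((2 : ℝ) ^ k)⁻¹ ≠ 0 := by positivity
  rw [Measure.map_addHaar_smul _ h0]
  congr 1
  rw [Module.finrank_fin_fun, inv_pow, inv_inv, ← pow_mul, abs_of_nonneg (by positivity),
    ENNReal.ofReal_pow (by norm_num)]
  simp

theorem map_cubeMap_volume (k : ℕ) (m : Fin n → ℤ) :
    Measure.map (cubeMap k m) volume = (2 : ℝ≥0∞) ^ (k * n) • (volume : Measure (Fin n → ℝ)) := by
  have h1 : (cubeMap k m : (Fin n → ℝ) → Fin n → ℝ) =
      (fun y => y + fun i => (m i : ℝ) / 2 ^ k) ∘ fun y => ((2 : ℝ) ^ k)⁻¹ • y := by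
    funext y
    rw [cubeMap_eq]
    rfl
  rw [h1, ← Measure.map_map (measurable_add_const _) (measurable_const_smul _), map_smul_volume,
    Measure.map_smul, map_add_right_eq_self]

theorem cubeMap_preimage_dyadicHalfOpen (k : ℕ) (m e : Fin n → ℤ) :
    cubeMap k m ⁻¹' dyadicHalfOpen k (m + e) = dyadicHalfOpen 0 e := by
  ext y
  rw [Set.mem_preimage, mem_dyadicHalfOpen, mem_dyadicHalfOpen, floorIdx_cubeMap, add_comm]
  exact add_right_inj m

theorem map_cubeMap_cubeMeas (k : ℕ) (m e : Fin n → ℤ) :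
    Measure.map (cubeMap k m) (cubeMeas 0 e) = cubeMeas k (m + e) := by
  rw [cubeMeas, cubeMeas, zero_mul, pow_zero, one_smul, ← Measure.restrict_smul,
    ← map_cubeMap_volume k m, Measure.restrict_map (measurableEmbedding_cubeMap k m).measurable
      (measurableSet_dyadicHalfOpen _ _), cubeMap_preimage_dyadicHalfOpen]

theorem eLpNorm_cubeMeas (r : ℝ≥0∞) (k : ℕ) (m e : Fin n → ℤ) {ε : Type*} [TopologicalSpace ε]
    [ContinuousENorm ε] (F : (Fin n → ℝ) → ε) :
    eLpNorm F r (cubeMeas k (m + e)) = eLpNorm (fun y => F (cubeMap k m y)) r (cubeMeas 0 e) := by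
  rw [← map_cubeMap_cubeMeas, (measurableEmbedding_cubeMap k m).eLpNorm_map_measure]
  rfl

theorem cubeMeas_eq_dyadic (k : ℕ) (m : Fin n → ℤ) :
    cubeMeas k m = (2 : ℝ≥0∞) ^ (k * n) • volume.restrict (dyadic k m) := by
  rw [cubeMeas, restrict_dyadic]

theorem isOpen_dyadic (k : ℕ) (m : Fin n → ℤ) : IsOpen (dyadic k m) := by
  have : dyadic k m =
      Set.pi Set.univ fun i => Set.Ioo ((m i : ℝ) / 2 ^ k) (((m i : ℝ) + 1) / 2 ^ k) := by
    ext x; simp [dyadic]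
  rw [this]
  exact isOpen_set_pi Set.finite_univ fun _ _ => isOpen_Ioo

theorem ae_mem_dyadic (k : ℕ) (m : Fin n → ℤ) : ∀ᵐ x ∂cubeMeas k m, x ∈ dyadic k m := by
  rw [cubeMeas_eq_dyadic]
  exact Measure.ae_smul_measure (ae_restrict_mem (isOpen_dyadic k m).measurableSet) _

theorem ae_mem_dyadicHalfOpen (k : ℕ) (m : Fin n → ℤ) : ∀ᵐ x ∂cubeMeas k m, floorIdx k x = m :=
  (Measure.ae_smul_measure (ae_restrict_mem (measurableSet_dyadicHalfOpen k m)) _).mono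
    fun _ => mem_dyadicHalfOpen.1

theorem continuous_polyEval {l : ℕ} (c : (Fin n → Fin (l + 1)) → ℝ) : Continuous (polyEval c) := by
  unfold polyEval
  fun_prop

/-- Continuity upgrades almost everywhere vanishing to vanishing on the open cube, and a polynomial
that vanishes on a product of infinite sets is zero. -/
theorem eq_zero_of_polyEval_ae_eq_zero {l : ℕ} {c : (Fin n → Fin (l + 1)) → ℝ}
    (h : polyEval c =ᵐ[cubeMeas 0 0] 0) : c = 0 := by
  have h0 : (volume.restrict (dyadic 0 0) : Measure (Fin n → ℝ)) = cubeMeas 0 0 := by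
    rw [cubeMeas_eq_dyadic]; simp
  have h1 : Set.EqOn (polyEval c) 0 (dyadic 0 0) := by
    refine Measure.eqOn_open_of_ae_eq (μ := volume) (by rwa [h0]) (isOpen_dyadic _ _)
      (continuous_polyEval c).continuousOn continuousOn_const
  set P : MvPolynomial (Fin n) ℝ :=
    ∑ ν, MvPolynomial.monomial (Finsupp.equivFunOnFinite.symm fun i => (ν i : ℕ)) (c ν) with hP
  have h2 : ∀ x, MvPolynomial.eval x P = polyEval c x := fun x => by
    rw [hP, map_sum]
    refine Finset.sum_congr rfl fun ν _ => ?_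
    rw [MvPolynomial.eval_monomial, Finsupp.prod_fintype _ _ (by simp)]
    simp
  have h3 : P = 0 := by
    refine MvPolynomial.funext_set (fun _ => Set.Ioo (0 : ℝ) 1)
      (fun _ => Set.Ioo_infinite one_pos) ?_
    intro x hx
    rw [h2, map_zero]
    refine h1 fun i => ?_
    simpa using hx i (Set.mem_univ i)
  funext ν
  have h4 := congrArg (MvPolynomial.coeff (Finsupp.equivFunOnFinite.symm fun i => (ν i : ℕ))) h3
  rw [hP, MvPolynomial.coeff_sum, MvPolynomial.coeff_zero, Finset.sum_eq_single ν] at h4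
  · simpa using h4
  · intro ν' _ hν'
    rw [MvPolynomial.coeff_monomial, if_neg]
    intro h
    refine hν' (funext fun i => Fin.ext ?_)
    exact congrFun (Finsupp.equivFunOnFinite.symm.injective h) i
  · simp

theorem polyEval_smul {l : ℕ} (a : ℝ) (c : (Fin n → Fin (l + 1)) → ℝ) (x : Fin n → ℝ) :
    polyEval (a • c) x = a * polyEval c x := by
  simp only [polyEval, Finset.mul_sum, Pi.smul_apply, smul_eq_mul, mul_assoc]

/-- Comparison of norms in finite dimension for every r > 0, by compactness: normalised
counterexamples converge on the unit sphere, and by Fatou the limit polynomial would vanish almost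
everywhere. No triangle inequality is involved. -/
theorem exists_enorm_le_eLpNorm_polyEval (n l : ℕ) {r : ℝ≥0∞} (hr : r ≠ 0) :
    ∃ C : ℝ≥0, ∀ c : (Fin n → Fin (l + 1)) → ℝ,
      ‖c‖ₑ ≤ C * eLpNorm (polyEval c) r (cubeMeas 0 0) := by
  by_contra hcon
  push Not at hcon
  choose c hc using fun j : ℕ => hcon (j : ℝ≥0)
  have hc0 : ∀ j, ‖c j‖ ≠ 0 := fun j h => by
    have := hc j
    rw [← ofReal_norm, h] at this
    simp at this
  set u : ℕ → (Fin n → Fin (l + 1)) → ℝ := fun j => ‖c j‖⁻¹ • c j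
  have hu1 : ∀ j, u j ∈ Metric.sphere (0 : (Fin n → Fin (l + 1)) → ℝ) 1 := fun j => by
    simp only [u, mem_sphere_zero_iff_norm, norm_smul, norm_inv, norm_norm]
    exact inv_mul_cancel₀ (hc0 j)
  have hu2 : ∀ j : ℕ, (j : ℝ≥0∞) * eLpNorm (polyEval (u j)) r (cubeMeas 0 0) ≤ 1 := fun j => by
    have h1 : polyEval (u j) = ‖c j‖⁻¹ • polyEval (c j) := by
      funext x
      exact polyEval_smul _ _ _
    have h2 : ‖(‖c j‖⁻¹ : ℝ)‖ₑ * ‖c j‖ₑ = 1 := by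
      rw [← enorm_norm (c j), ← enorm_mul, inv_mul_cancel₀ (hc0 j), enorm_one]
    rw [h1, eLpNorm_const_smul, mul_left_comm, ← h2]
    exact mul_le_mul_right (hc j).le _
  obtain ⟨w, hw, ψ, hψ, hlim⟩ := (isCompact_sphere (0 : (Fin n → Fin (l + 1)) → ℝ) 1).tendsto_subseq hu1
  have h1 : eLpNorm (polyEval w) r (cubeMeas 0 0) ≤
      liminf (fun j => eLpNorm (polyEval (u (ψ j))) r (cubeMeas 0 0)) atTop := by
    refine Lp.eLpNorm_lim_le_liminf_eLpNorm
      (fun j => (continuous_polyEval _).aestronglyMeasurable) _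
      (Eventually.of_forall fun x => ?_)
    have hcont : Continuous fun c : (Fin n → Fin (l + 1)) → ℝ => polyEval c x := by
      unfold polyEval
      fun_prop
    exact (hcont.tendsto w).comp hlim
  have h2 : Tendsto (fun j => eLpNorm (polyEval (u (ψ j))) r (cubeMeas 0 0)) atTop (𝓝 0) := by
    have h3 : Tendsto (fun j : ℕ => ((ψ j : ℕ) : ℝ≥0∞)⁻¹) atTop (𝓝 0) :=
      ENNReal.tendsto_inv_nat_nhds_zero.comp hψ.tendsto_atTop
    refine tendsto_of_tendsto_of_tendsto_of_le_of_le tendsto_const_nhds h3 (fun _ => zero_le)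
      fun j => ?_
    rw [ENNReal.le_inv_iff_mul_le, mul_comm]
    exact hu2 _
  rw [h2.liminf_eq, nonpos_iff_eq_zero,
    eLpNorm_eq_zero_iff (continuous_polyEval w).aestronglyMeasurable hr] at h1
  have h3 := eq_zero_of_polyEval_ae_eq_zero h1
  rw [h3] at hw
  simp at hw

/-- On a fixed finite-dimensional space of polynomials a linear functional is bounded by the
coefficients, hence by the L_r norm. Rescaling to the unit cube makes the constant independent of
the cube. -/
theorem exists_abs_coeffFun_le (n l : ℕ) {r : ℝ≥0∞} (hr : r ≠ 0) :
    ∃ C : ℝ≥0, ∀ (k : ℕ) (m : Fin n → ℤ) (f : (Fin n → ℝ) → ℝ) (c : (Fin n → Fin (l + 1)) → ℝ),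
      (∀ x ∈ dyadic k m, f x = polyEval c x) →
        ENNReal.ofReal |coeffFun l k m f| ≤ C * eLpNorm f r (cubeMeas k m) := by
  obtain ⟨C, hC⟩ := exists_enorm_le_eLpNorm_polyEval n l hr
  have hlin : ∀ c : (Fin n → Fin (l + 1)) → ℝ, refCoeff l (polyEval c) =
      ∑ ν, c ν * ∏ i, dualFun l ((Polynomial.X : Polynomial ℝ) ^ (ν i : ℕ)) := fun c => by
    rw [← refCoeff_sum_prod]
    congr 1
    funext x
    exact polyEval_eq_sum_prod c x
  set D : ℝ := ∑ ν : Fin n → Fin (l + 1),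
    |∏ i, dualFun l ((Polynomial.X : Polynomial ℝ) ^ (ν i : ℕ))|
  have hD : 0 ≤ D := Finset.sum_nonneg fun _ _ => abs_nonneg _
  have hlin' : ∀ c : (Fin n → Fin (l + 1)) → ℝ, |refCoeff l (polyEval c)| ≤ D * ‖c‖ := fun c => by
    rw [hlin, Finset.sum_mul]
    refine (Finset.abs_sum_le_sum_abs _ _).trans (Finset.sum_le_sum fun ν _ => ?_)
    rw [abs_mul, mul_comm]
    gcongr
    exact norm_le_pi_norm c ν
  refine ⟨D.toNNReal * C, fun k m f c hf => ?_⟩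
  obtain ⟨c', hc'⟩ := exists_polyEval_affine c (((2 : ℝ) ^ k)⁻¹) (fun i => (m i : ℝ) / 2 ^ k)
  have hy : ∀ y ∈ dyadic (n := n) 0 0, f (cubeMap k m y) = polyEval c' y := fun y hy => by
    rw [← hc', ← cubeMap_eq, hf]
    intro i
    have h1 := hy i
    simp only [Pi.zero_apply, Int.cast_zero, pow_zero, div_one, zero_add] at h1
    simp only [cubeMap]
    constructor <;> refine div_lt_div_of_pos_right ?_ (by positivity) <;> linarith
  have h1 : coeffFun l k m f = refCoeff l (polyEval c') := by
    rw [coeffFun_eq_refCoeff]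
    refine EventuallyEq.refCoeff_eq ?_
    filter_upwards [(isOpen_dyadic (n := n) 0 0).mem_nhds fun i => by norm_num] with y hy'
    exact hy y hy'
  have h2 : eLpNorm f r (cubeMeas k m) = eLpNorm (polyEval c') r (cubeMeas 0 0) := by
    conv_lhs => rw [← add_zero m]
    rw [eLpNorm_cubeMeas]
    exact eLpNorm_congr_ae ((ae_mem_dyadic 0 0).mono fun y h => hy y h)
  rw [h1, h2]
  calc ENNReal.ofReal |refCoeff l (polyEval c')| ≤ ENNReal.ofReal (D * ‖c'‖) :=
        ENNReal.ofReal_le_ofReal (hlin' c')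
    _ = ENNReal.ofReal D * ‖c'‖ₑ := by rw [ENNReal.ofReal_mul hD, ofReal_norm]
    _ ≤ ENNReal.ofReal D * (C * eLpNorm (polyEval c') r (cubeMeas 0 0)) :=
        mul_le_mul_right (hC c') _
    _ = _ := by rw [← mul_assoc, ENNReal.ofReal, ENNReal.coe_mul]

end PolyNorm

/-! ### Whitney's inequality on a line -/

section WhitneyLine

open Polynomial

/-- The Lagrange basis polynomials for the nodes `0, …, l - 1`. -/
def nodeBasis (l a : ℕ) : ℝ[X] := Lagrange.basis (Finset.range l) (fun a : ℕ => (a : ℝ)) a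

theorem natDegree_nodeBasis_lt {l a : ℕ} (ha : a ∈ Finset.range l) :
    (nodeBasis l a).natDegree < l := by
  rw [nodeBasis, Lagrange.natDegree_basis (Nat.cast_injective.injOn) ha, Finset.card_range]
  have := Finset.mem_range.1 ha
  omega

theorem eval_eq_sum_nodeBasis {l : ℕ} {P : ℝ[X]} (hP : P.degree < l) (s : ℝ) :
    P.eval s = ∑ a ∈ Finset.range l, (nodeBasis l a).eval s * P.eval (a : ℝ) := by
  have h := Lagrange.eq_interpolate (s := Finset.range l) (v := fun a : ℕ => (a : ℝ)) (f := P)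
    Nat.cast_injective.injOn (by simpa using hP)
  conv_lhs => rw [h]
  rw [Lagrange.interpolate_apply, eval_finsetSum]
  exact Finset.sum_congr rfl fun a _ => by rw [eval_mul, eval_C, mul_comm, nodeBasis]

/-- The Taylor coefficient of order d at 1 of `X^j` is the binomial coefficient of j over d. For d <
l the function s ↦ C(Ms, d) is a polynomial of degree below l, so Lagrange interpolation at 0, …, l
- 1 is exact for it and all these coefficients cancel. -/
theorem X_sub_one_pow_dvd_interpolation (l i : ℕ) {M : ℕ} (hM : M ≠ 0) :
    (X - C 1 : ℝ[X]) ^ l ∣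
      X ^ i - ∑ a ∈ Finset.range l, C ((nodeBasis l a).eval ((i : ℝ) / M)) * X ^ (a * M) := by
  rw [X_sub_C_pow_dvd_iff, X_pow_dvd_iff]
  intro d hd
  have hM' : (M : ℝ) ≠ 0 := by exact_mod_cast hM
  set P : ℝ[X] := C ((d.factorial : ℝ)⁻¹) * (descPochhammer ℝ d).comp (C (M : ℝ) * X) with hP
  have hev : ∀ (s : ℝ) (j : ℕ), M * s = j → P.eval s = (j.choose d : ℝ) := fun s j hj => by
    rw [hP, eval_mul, eval_C, eval_comp, eval_mul, eval_C, eval_X, hj,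
      descPochhammer_eval_eq_descFactorial, Nat.descFactorial_eq_factorial_mul_choose]
    push_cast
    rw [inv_mul_cancel_left₀ (by positivity)]
  have hdeg : P.degree < l := by
    refine lt_of_le_of_lt (degree_le_natDegree) ?_
    refine Nat.cast_lt.2 (lt_of_le_of_lt ?_ hd)
    refine (natDegree_C_mul_le _ _).trans (natDegree_comp_le.trans ?_)
    have h1 : (C (M : ℝ) * X : ℝ[X]).natDegree ≤ 1 := (natDegree_C_mul_le _ _).trans natDegree_X.le
    have h2 : (descPochhammer ℝ d).natDegree ≤ d := (descPochhammer_natDegree ℝ d).le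
    nlinarith
  have key := eval_eq_sum_nodeBasis hdeg ((i : ℝ) / M)
  rw [hev _ i (mul_div_cancel₀ _ hM')] at key
  have hev' : ∀ a : ℕ, P.eval (a : ℝ) = ((a * M).choose d : ℝ) := fun a =>
    hev a (a * M) (by push_cast; ring)
  simp only [hev'] at key
  simp only [sub_comp, pow_comp, X_comp, Polynomial.sum_comp, mul_comp, C_comp, map_one, coeff_sub,
    finsetSum_coeff, coeff_C_mul, coeff_X_add_one_pow]
  rw [key, sub_self]

/-- The shift by `t` on functions of a real variable. -/
def shift (t : ℝ) : Module.End ℝ (ℝ → ℝ) := LinearMap.funLeft ℝ ℝ (fun u => u + t)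

theorem shift_pow_apply (t : ℝ) (j : ℕ) (φ : ℝ → ℝ) (u : ℝ) :
    (shift t ^ j) φ u = φ (u + j * t) := by
  induction j generalizing u with
  | zero => simp
  | succ j ih =>
    rw [pow_succ', Module.End.mul_apply]
    change (shift t ^ j) φ (u + t) = _
    rw [ih]
    congr 1
    push_cast
    ring

theorem shift_sub_one_pow (t : ℝ) (l : ℕ) (φ : ℝ → ℝ) :
    ((shift t - 1) ^ l) φ = (fwdDiff t)^[l] φ := by
  induction l with
  | zero => simp
  | succ l ih =>
    rw [pow_succ', Module.End.mul_apply, ih, Function.iterate_succ_apply']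
    rfl

theorem aeval_shift_apply (t : ℝ) (Q : ℝ[X]) (φ : ℝ → ℝ) (u : ℝ) :
    (aeval (shift t) Q) φ u = ∑ i ∈ Finset.range (Q.natDegree + 1), Q.coeff i * φ (u + i * t) := by
  rw [aeval_eq_sum_range, LinearMap.sum_apply, Finset.sum_apply]
  refine Finset.sum_congr rfl fun i _ => ?_
  rw [LinearMap.smul_apply, Pi.smul_apply, shift_pow_apply, smul_eq_mul]

/-- Substituting the shift operator for X in the divisibility turns the factor (X - 1)^l into l-th
differences: the interpolation error is a fixed combination of them, independent of the step, the
function and the base point. -/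
theorem exists_interpolation_error_eq (l i : ℕ) {M : ℕ} (hM : M ≠ 0) :
    ∃ Q : ℝ[X], ∀ (t : ℝ) (φ : ℝ → ℝ) (u : ℝ),
      φ (u + i * t) - ∑ a ∈ Finset.range l, (nodeBasis l a).eval ((i : ℝ) / M) *
          φ (u + ((a * M : ℕ) : ℝ) * t) =
        ∑ d ∈ Finset.range (Q.natDegree + 1), Q.coeff d * (fwdDiff t)^[l] φ (u + d * t) := by
  obtain ⟨Q, hQ⟩ := X_sub_one_pow_dvd_interpolation l i hM
  refine ⟨Q, fun t φ u => ?_⟩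
  have h1 := congrArg (fun W : ℝ[X] => (aeval (shift t) W) φ u) (hQ.trans (mul_comm _ _))
  simp only [map_sub, map_sum, map_mul, map_pow, aeval_X, aeval_C, map_one] at h1
  rw [Module.End.mul_apply (aeval (shift t) Q), shift_sub_one_pow, aeval_shift_apply] at h1
  rw [← h1]
  simp only [LinearMap.sub_apply, LinearMap.sum_apply, Pi.sub_apply, Finset.sum_apply,
    Module.End.mul_apply, Module.algebraMap_end_apply, Pi.smul_apply, smul_eq_mul, shift_pow_apply]

theorem fwdDiff_iter_polynomial_eq_zero {P : ℝ[X]} {l : ℕ} (hP : P.natDegree < l) (t u : ℝ) :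
    (fwdDiff t)^[l] (fun s => P.eval s) u = 0 := by
  have h1 : (P.comp (C t * X + C u)).natDegree < l := by
    refine lt_of_le_of_lt natDegree_comp_le ?_
    have : (C t * X + C u : ℝ[X]).natDegree ≤ 1 := natDegree_linear_le
    nlinarith
  have h2 := congrFun (fwdDiff_iter_eq_zero_of_degree_lt h1) 0
  rw [fwdDiff_iter_eq_sum_shift] at h2 ⊢
  rw [Pi.zero_apply] at h2
  rw [← h2]
  refine Finset.sum_congr rfl fun k _ => ?_
  simp only [eval_comp, eval_add, eval_mul, eval_C, eval_X, nsmul_eq_mul]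
  ring_nf

theorem eLpNorm_linComb_le {α ι : Type*} [MeasurableSpace α] {μ : Measure α} {p : ℝ≥0∞}
    (hp : p ≠ 0) (s : Finset ι) (w : ι → ℝ) {f : ι → α → ℝ} (hf : ∀ i ∈ s, AEMeasurable (f i) μ)
    {S : ℝ≥0∞} (hS : ∀ i ∈ s, eLpNorm (f i) p μ ≤ S) :
    eLpNorm (fun x => ∑ i ∈ s, w i * f i x) p μ ≤
      quasiConst p s.card * (∑ i ∈ s, ‖w i‖ₑ) * S := by
  have h1 : eLpNorm (fun x => ∑ i ∈ s, w i * f i x) p μ ≤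
      quasiConst p s.card * ∑ i ∈ s, eLpNorm (fun x => ‖w i‖ₑ * ‖f i x‖ₑ) p μ :=
    eLpNorm_le_sum hp s (fun i hi => (hf i hi).enorm.const_mul _)
      (Eventually.of_forall fun x => (enorm_sum_le _ _).trans_eq (by simp only [enorm_mul]))
  refine h1.trans ?_
  rw [mul_assoc, Finset.sum_mul]
  refine mul_le_mul_right (Finset.sum_le_sum fun i hi => ?_) _
  rw [eLpNorm_const_mul_ennreal hp _ enorm_ne_top, eLpNorm_enorm]
  exact mul_le_mul_right (hS i hi) _

theorem sum_enorm_ne_top {ι : Type*} (s : Finset ι) (w : ι → ℝ) : ∑ i ∈ s, ‖w i‖ₑ ≠ ∞ :=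
  ENNReal.sum_ne_top.2 fun _ _ => enorm_ne_top

/-- As the evaluation point 1/M tends to the node 0, the basis polynomials of the other nodes tend
to zero there. This supplies the small factor for the absorption argument. -/
theorem exists_small_nodeBasis (l : ℕ) {ε : ℝ≥0∞} (hε : ε ≠ 0) :
    ∃ M : ℕ, M ≠ 0 ∧
      ∑ a ∈ (Finset.range l).erase 0, ‖(nodeBasis l a).eval ((1 : ℕ) / (M : ℝ))‖ₑ < ε := by
  have h1 : Tendsto (fun s : ℝ => ∑ a ∈ (Finset.range l).erase 0, ‖(nodeBasis l a).eval s‖ₑ)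
      (𝓝 0) (𝓝 0) := by
    have h2 : ∑ a ∈ (Finset.range l).erase 0, ‖(nodeBasis l a).eval (0 : ℝ)‖ₑ = 0 := by
      refine Finset.sum_eq_zero fun a ha => ?_
      obtain ⟨h0, ha'⟩ := Finset.mem_erase.1 ha
      have h3 := Lagrange.eval_basis_of_ne (s := Finset.range l) (v := fun a : ℕ => (a : ℝ))
        (i := a) (j := 0) h0 (Finset.mem_range.2 (by have := Finset.mem_range.1 ha'; omega))
      rw [nodeBasis, show (0 : ℝ) = ((0 : ℕ) : ℝ) by simp, h3, enorm_zero]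
    have h4 : Continuous fun s : ℝ => ∑ a ∈ (Finset.range l).erase 0, ‖(nodeBasis l a).eval s‖ₑ :=
      continuous_finsetSum _ fun a _ => (nodeBasis l a).continuous.enorm
    simpa only [h2] using h4.tendsto 0
  have h5 : Tendsto (fun M : ℕ => (((1 : ℕ) : ℝ) / (M : ℝ))) atTop (𝓝 0) :=
    tendsto_const_div_atTop_nhds_zero_nat _
  obtain ⟨M, hM1, hM2⟩ := (((h1.comp h5).eventually (gt_mem_nhds (pos_iff_ne_zero.2 hε))).and
    (eventually_ge_atTop 1)).exists
  exact ⟨M, by omega, hM1⟩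

theorem le_two_mul_of_le_add_half {S X : ℝ≥0∞} (hS : S ≠ ∞) (h : S ≤ X + 2⁻¹ * S) : S ≤ 2 * X := by
  have h1 : S = 2⁻¹ * S + 2⁻¹ * S := by rw [← add_mul, ENNReal.inv_two_add_inv_two, one_mul]
  have h2 : 2⁻¹ * S ≠ ∞ := ENNReal.mul_ne_top (by simp) hS
  have h3 : 2⁻¹ * S ≤ X := by
    have h' : 2⁻¹ * S + 2⁻¹ * S ≤ X + 2⁻¹ * S := h1.symm.le.trans h
    exact (ENNReal.add_le_add_iff_right h2).1 h'
  calc S = 2 * (2⁻¹ * S) := by rw [← mul_assoc, ENNReal.mul_inv_cancel (by simp) (by simp), one_mul]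
    _ ≤ 2 * X := mul_le_mul_right h3 _

end WhitneyLine

/-! ### Whitney's inequality for functions of one variable with values in L_r. -/

section WhitneyLine

open Polynomial

theorem measurable_fwdDiff_iter {α : Type*} [MeasurableSpace α] {F : ℝ → α → ℝ}
    (hF : ∀ v, Measurable (F v)) (l : ℕ) (t u : ℝ) :
    Measurable fun x => (fwdDiff t)^[l] (fun s => F s x) u := by
  simp only [fwdDiff_iter_eq_sum_shift]
  exact Finset.measurable_sum _ fun i _ => by
    simpa only [Pi.smul_def] using (hF (u + i • t)).const_smul ((-1 : ℤ) ^ (l - i) * (l.choose i : ℤ))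

theorem fwdDiff_iter_sub_nodeBasis (l : ℕ) (φ : ℝ → ℝ) (w : ℕ → ℝ) (t u : ℝ) :
    (fwdDiff t)^[l] (fun s => φ s - ∑ a ∈ Finset.range l, (nodeBasis l a).eval s * w a) u =
      (fwdDiff t)^[l] φ u := by
  have h1 : (fun s => φ s - ∑ a ∈ Finset.range l, (nodeBasis l a).eval s * w a) =
      φ - ∑ a ∈ Finset.range l, w a • fun s => (nodeBasis l a).eval s := by
    funext s
    simp [mul_comm]
  rw [h1, ← shift_sub_one_pow, map_sub, map_sum, Pi.sub_apply, Finset.sum_apply,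
    shift_sub_one_pow, Finset.sum_eq_zero, sub_zero]
  intro a ha
  rw [map_smul, shift_sub_one_pow, Pi.smul_apply,
    fwdDiff_iter_polynomial_eq_zero (natDegree_nodeBasis_lt ha), smul_zero]

/-- The constant in `eLpNorm_sum_coeff_fwdDiff_le`. -/
def coeffConst (r : ℝ≥0∞) (Q : ℝ[X]) : ℝ≥0∞ :=
  quasiConst r ((Finset.range (Q.natDegree + 1)).card) *
    ∑ d ∈ Finset.range (Q.natDegree + 1), ‖Q.coeff d‖ₑ

theorem coeffConst_ne_top (r : ℝ≥0∞) (Q : ℝ[X]) : coeffConst r Q ≠ ∞ :=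
  ENNReal.mul_ne_top (quasiConst_ne_top _ _) (sum_enorm_ne_top _ _)

theorem eLpNorm_sum_coeff_fwdDiff_le {r : ℝ≥0∞} (hr : r ≠ 0) {α : Type*} [MeasurableSpace α]
    {μ : Measure α} {F : ℝ → α → ℝ} (hF : ∀ v, Measurable (F v)) (l : ℕ) (Q : ℝ[X]) {U : ℝ}
    {η : ℝ≥0∞} (hη : ∀ u t : ℝ, |u| ≤ U → |t| ≤ 1 →
      eLpNorm (fun x => (fwdDiff t)^[l] (fun s => F s x) u) r μ ≤ η)
    {u τ : ℝ} (hu : |u| + Q.natDegree ≤ U) (hτ : |τ| ≤ 1) :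
    eLpNorm (fun x => ∑ d ∈ Finset.range (Q.natDegree + 1),
      Q.coeff d * (fwdDiff τ)^[l] (fun s => F s x) (u + d * τ)) r μ ≤ coeffConst r Q * η := by
  refine eLpNorm_linComb_le hr (Finset.range (Q.natDegree + 1)) (fun d => Q.coeff d)
    (f := fun d x => (fwdDiff τ)^[l] (fun s => F s x) (u + d * τ))
    (fun d _ => (measurable_fwdDiff_iter hF l τ _).aemeasurable) (S := η) fun d hd => ?_
  refine hη (u + d * τ) τ ?_ hτ
  have h3 : d ≤ Q.natDegree := Nat.lt_succ_iff.1 (Finset.mem_range.1 hd)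
  have h4 : (d : ℝ) ≤ Q.natDegree := by exact_mod_cast h3
  calc |u + d * τ| ≤ |u| + |d * τ| := abs_add_le _ _
    _ ≤ |u| + Q.natDegree := by
      rw [abs_mul, Nat.abs_cast]
      have : (d : ℝ) * |τ| ≤ Q.natDegree * 1 := by gcongr
      linarith
    _ ≤ U := hu

/-- Rounding v down in the left half and up in the right half makes the multiples of τ point into
the interval; the assumption on V leaves room for all of them. -/
theorem exists_base_point {l M V : ℕ} (hV : 2 * (l * M) ≤ V) {v : ℝ} (h0 : 0 ≤ v) (h1 : v ≤ V) :
    ∃ (i : ℕ) (τ : ℝ), i ≤ V ∧ |τ| ≤ 1 ∧ v = i + τ ∧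
      ∀ a < l, 0 ≤ (i : ℝ) + ((a * M : ℕ) : ℝ) * τ ∧ (i : ℝ) + ((a * M : ℕ) : ℝ) * τ ≤ V := by
  have hV' : 2 * ((l * M : ℕ) : ℝ) ≤ V := by exact_mod_cast hV
  have ha' : ∀ a < l, ((a * M : ℕ) : ℝ) ≤ ((l * M : ℕ) : ℝ) := fun a ha => by
    exact_mod_cast Nat.mul_le_mul_right M ha.le
  rcases le_or_gt v (V / 2) with h | h
  · refine ⟨⌊v⌋₊, v - ⌊v⌋₊, Nat.floor_le_of_le h1, ?_, by ring, fun a ha => ?_⟩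
    · rw [abs_le]
      constructor <;> linarith [Nat.floor_le h0, Nat.lt_floor_add_one v]
    · have e1 := Nat.floor_le h0
      have e2 := Nat.lt_floor_add_one v
      have e3 := ha' a ha
      have e4 : (0 : ℝ) ≤ ((a * M : ℕ) : ℝ) := Nat.cast_nonneg _
      have e5 : (0 : ℝ) ≤ (⌊v⌋₊ : ℝ) := Nat.cast_nonneg _
      constructor
      · nlinarith
      · nlinarith
  · refine ⟨⌈v⌉₊, v - ⌈v⌉₊, Nat.ceil_le.2 h1, ?_, by ring, fun a ha => ?_⟩
    · rw [abs_le]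
      constructor <;> linarith [Nat.le_ceil v, Nat.ceil_lt_add_one h0]
    · have e1 := Nat.le_ceil v
      have e2 := Nat.ceil_lt_add_one h0
      have e3 := ha' a ha
      have e4 : (0 : ℝ) ≤ ((a * M : ℕ) : ℝ) := Nat.cast_nonneg _
      have e5 : (⌈v⌉₊ : ℝ) ≤ V := by exact_mod_cast Nat.ceil_le.2 h1
      constructor
      · nlinarith
      · nlinarith

/-- A function with values in an `L_r` space whose `l`-th differences are small is close to the
polynomial interpolating it at `0, …, l - 1`. -/
theorem exists_whitney_line {l : ℕ} (hl : l ≠ 0) {r : ℝ≥0∞} (hr : r ≠ 0) :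
    ∃ V₀ : ℕ, ∀ V : ℕ, V₀ ≤ V → ∃ (C : ℝ≥0) (U : ℕ), ∀ {α : Type} [MeasurableSpace α]
      (μ : Measure α) (F : ℝ → α → ℝ) (η B : ℝ≥0∞), (∀ v, Measurable (F v)) → B ≠ ∞ →
      (∀ v : ℝ, |v| ≤ U → eLpNorm (F v) r μ ≤ B) →
      (∀ u t : ℝ, |u| ≤ U → |t| ≤ 1 → eLpNorm (fun x => (fwdDiff t)^[l] (fun s => F s x) u) r μ ≤ η) →
      ∀ v : ℝ, 0 ≤ v → v ≤ V →
        eLpNorm (fun x => F v x - ∑ a ∈ Finset.range l, (nodeBasis l a).eval v * F a x) r μ ≤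
          C * η := by
  set q := quasiConst r 2 with hq
  set s₀ := (Finset.range l).erase 0 with hs₀
  set q₀ := quasiConst r s₀.card with hq₀
  have hqt : q ≠ ∞ := quasiConst_ne_top _ _
  have hq₀t : q₀ ≠ ∞ := quasiConst_ne_top _ _
  -- M is so large that the nodes other than the first carry total weight at most 1/2 even after
  -- multiplication by q, q and q₀, the constants of the three quasi-triangle inequalities used
  -- below.
  obtain ⟨M, hM, hMε⟩ := exists_small_nodeBasis l (ε := (2 * (q * q * q₀))⁻¹)
    (ENNReal.inv_ne_zero.2 (ENNReal.mul_ne_top (by simp)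
      (ENNReal.mul_ne_top (ENNReal.mul_ne_top hqt hqt) hq₀t)))
  obtain ⟨Q₁, hQ₁⟩ := exists_interpolation_error_eq l 1 hM
  obtain ⟨w, hw⟩ : ∃ w : ℕ → ℝ, ∀ a, (nodeBasis l a).eval ((1 : ℕ) / (M : ℝ)) = w a :=
    ⟨_, fun _ => rfl⟩
  simp only [hw] at hMε hQ₁
  have hsmall : q * q * q₀ * ∑ a ∈ s₀, ‖w a‖ₑ ≤ 2⁻¹ := by
    refine (mul_le_mul_right hMε.le _).trans ?_
    rw [ENNReal.mul_inv (by simp) (by simp), mul_left_comm]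
    exact (mul_le_mul_right (ENNReal.mul_inv_le_one _) _).trans_eq (mul_one _)
  choose Q₀ hQ₀ using fun i : ℕ => exists_interpolation_error_eq l i one_ne_zero
  refine ⟨2 * (l * M), fun V hV => ?_⟩
  have hlV : l ≤ V := by nlinarith [Nat.pos_of_ne_zero hM]
  set c₀ : ℝ≥0∞ := ∑ i ∈ Finset.range (V + 1), coeffConst r (Q₀ i) with hc₀
  have hc₀t : c₀ ≠ ∞ := ENNReal.sum_ne_top.2 fun i _ => coeffConst_ne_top _ _
  set c₁ : ℝ≥0∞ := coeffConst r Q₁ with hc₁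
  have hc₁t : c₁ ≠ ∞ := coeffConst_ne_top _ _
  set L₀ : ℝ≥0∞ := ‖w 0‖ₑ with hL₀
  set X : ℝ≥0∞ := q * (L₀ * c₀) + q * q * c₁ with hX
  have hXt : X ≠ ∞ := ENNReal.add_ne_top.2
    ⟨ENNReal.mul_ne_top hqt (ENNReal.mul_ne_top enorm_ne_top hc₀t),
      ENNReal.mul_ne_top (ENNReal.mul_ne_top hqt hqt) hc₁t⟩
  refine ⟨(2 * X).toNNReal, V + Q₁.natDegree + ∑ i ∈ Finset.range (V + 1), (Q₀ i).natDegree,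
    fun {α} _ μ F η B hF hB hFB hη => ?_⟩
  rw [ENNReal.coe_toNNReal (ENNReal.mul_ne_top (by simp) hXt)]
  set U := V + Q₁.natDegree + ∑ i ∈ Finset.range (V + 1), (Q₀ i).natDegree with hU
  have hVU : (V : ℝ) ≤ U := by
    rw [hU]; exact_mod_cast (by omega)
  set G : ℝ → α → ℝ := fun v x =>
    F v x - ∑ a ∈ Finset.range l, (nodeBasis l a).eval v * F a x with hG
  have hGm : ∀ v, Measurable (G v) := fun v =>
    (hF v).sub (Finset.measurable_sum _ fun a _ => (hF _).const_mul _)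
  have hdm := measurable_fwdDiff_iter hF l
  -- At integers the interpolation identity with M = 1 and step 1 expresses G purely by differences
  -- of F, without absorption.
  have hint : ∀ i ≤ V, eLpNorm (G i) r μ ≤ c₀ * η := by
    intro i hi
    have h1 : G i = fun x => ∑ d ∈ Finset.range ((Q₀ i).natDegree + 1),
        (Q₀ i).coeff d * (fwdDiff 1)^[l] (fun s => F s x) (0 + d * 1) := by
      funext x
      rw [← hQ₀ i 1 (fun s => F s x) 0]
      simp only [hG, zero_add, mul_one, Nat.cast_one, div_one]
    have h2 : (Q₀ i).natDegree ≤ ∑ i ∈ Finset.range (V + 1), (Q₀ i).natDegree :=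
      Finset.single_le_sum (f := fun i => (Q₀ i).natDegree) (fun _ _ => Nat.zero_le _)
        (Finset.mem_range.2 (by omega))
    have h3 : (Q₀ i).natDegree ≤ U := by omega
    have h4 : coeffConst r (Q₀ i) ≤ c₀ := Finset.single_le_sum
      (f := fun i => coeffConst r (Q₀ i)) (fun _ _ => zero_le) (Finset.mem_range.2 (by omega))
    rw [h1]
    refine (eLpNorm_sum_coeff_fwdDiff_le hr hF l (Q₀ i) hη ?_ (by simp)).trans
      (mul_le_mul_left h4 _)
    rw [abs_zero, zero_add]
    exact_mod_cast h3
  set S : ℝ≥0∞ := ⨆ v : Set.Icc (0 : ℝ) V, eLpNorm (G v) r μ with hS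
  have hSle : ∀ v : ℝ, 0 ≤ v → v ≤ V → eLpNorm (G v) r μ ≤ S := fun v h0 h1 =>
    le_iSup (fun v : Set.Icc (0 : ℝ) V => eLpNorm (G v) r μ) ⟨v, h0, h1⟩
  -- The only use of B: the supremum has to be finite to be absorbed, but its size does not enter
  -- the final constant.
  have hSt : S ≠ ∞ := by
    obtain ⟨D, hD⟩ := (isCompact_Icc (a := (0 : ℝ)) (b := V)).exists_bound_of_continuousOn
      (f := fun s => ∑ a ∈ Finset.range l, |(nodeBasis l a).eval s|)
      (Continuous.continuousOn (continuous_finsetSum _ fun a _ => (nodeBasis l a).continuous.abs))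
    have : S ≤ q * (B + quasiConst r (Finset.range l).card * ENNReal.ofReal D * B) := by
      refine iSup_le fun ⟨v, h0, h1⟩ => ?_
      refine (eLpNorm_add_le_quasi hr (hF v).aemeasurable
        (g := fun x => ∑ a ∈ Finset.range l, (nodeBasis l a).eval v * F a x)
        (Finset.measurable_sum _ fun a _ => (hF _).const_mul _).aemeasurable
        (Eventually.of_forall fun x => abs_sub _ _)).trans ?_
      refine mul_le_mul_right (add_le_add (hFB v ?_) ?_) _
      · rw [abs_of_nonneg h0]; exact h1.trans hVU
      · refine (eLpNorm_linComb_le hr (Finset.range l) (fun a => (nodeBasis l a).eval v)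
          (f := fun a x => F a x) (fun a _ => (hF a).aemeasurable) (S := B) fun a ha => ?_).trans ?_
        · refine hFB _ ?_
          rw [Nat.abs_cast]
          have := Finset.mem_range.1 ha
          refine le_trans ?_ hVU
          exact_mod_cast (by omega)
        · refine mul_le_mul_left (mul_le_mul_right ?_ _) _
          have h2 := hD v ⟨h0, h1⟩
          rw [Real.norm_of_nonneg (Finset.sum_nonneg fun _ _ => abs_nonneg _)] at h2
          refine le_trans (le_of_eq ?_) (ENNReal.ofReal_le_ofReal h2)
          rw [ENNReal.ofReal_sum_of_nonneg fun _ _ => abs_nonneg _]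
          exact Finset.sum_congr rfl fun a _ => (Real.enorm_eq_ofReal_abs _)
    refine ne_top_of_le_ne_top ?_ this
    exact ENNReal.mul_ne_top hqt (ENNReal.add_ne_top.2 ⟨hB, ENNReal.mul_ne_top
      (ENNReal.mul_ne_top (quasiConst_ne_top _ _) ENNReal.ofReal_ne_top) hB⟩)
  have key : ∀ v : ℝ, 0 ≤ v → v ≤ V → eLpNorm (G v) r μ ≤ X * η + 2⁻¹ * S := by
    intro v h0 h1
    obtain ⟨i, τ, hiV, hτ, hv, hnode⟩ := exists_base_point hV h0 h1
    -- The interpolation identity for G with base i, step τ and fraction 1/M, at v = i + τ: a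
    -- multiple of G at an integer, small multiples of G at points of [0, V], and differences. The
    -- latter are those of F, since the subtracted interpolant has degree below l.
    have hid : ∀ x, G v x = w 0 * G i x +
        (∑ a ∈ s₀, w a * G (i + ((a * M : ℕ) : ℝ) * τ) x +
        ∑ d ∈ Finset.range (Q₁.natDegree + 1),
          Q₁.coeff d * (fwdDiff τ)^[l] (fun s => F s x) (i + d * τ)) := by
      intro x
      have h2 := hQ₁ τ (fun s => G s x) i
      have h3 : ∀ u, (fwdDiff τ)^[l] (fun s => G s x) u = (fwdDiff τ)^[l] (fun s => F s x) u :=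
        fun u => fwdDiff_iter_sub_nodeBasis l (fun s => F s x) (fun a => F a x) τ u
      simp only [h3] at h2
      rw [← Finset.add_sum_erase _ _ (Finset.mem_range.2 (Nat.pos_of_ne_zero hl)), ← hs₀] at h2
      rw [← h2, hv]
      simp only [Nat.cast_one, one_mul, zero_mul, Nat.cast_zero, add_zero]
      ring
    have hA : eLpNorm (fun x => w 0 * G i x) r μ ≤
        L₀ * (c₀ * η) := by
      refine (eLpNorm_const_smul (w 0) (G i) r μ).trans_le ?_
      exact mul_le_mul_right (hint i hiV) _
    have hBm : Measurable fun x => ∑ a ∈ s₀, w a *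
        G (i + ((a * M : ℕ) : ℝ) * τ) x :=
      Finset.measurable_sum _ fun a _ => (hGm _).const_mul _
    have hDm : Measurable fun x => ∑ d ∈ Finset.range (Q₁.natDegree + 1),
          Q₁.coeff d * (fwdDiff τ)^[l] (fun s => F s x) (i + d * τ) :=
      Finset.measurable_sum _ fun d _ => (hdm _ _).const_mul _
    have hBn : eLpNorm (fun x => ∑ a ∈ s₀, w a *
        G (i + ((a * M : ℕ) : ℝ) * τ) x) r μ ≤
        q₀ * (∑ a ∈ s₀, ‖w a‖ₑ) * S := by
      refine eLpNorm_linComb_le hr s₀ w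
        (f := fun a => G (i + ((a * M : ℕ) : ℝ) * τ)) (fun a _ => (hGm _).aemeasurable) fun a ha => ?_
      have := hnode a (Finset.mem_range.1 (Finset.mem_of_mem_erase ha))
      exact hSle _ this.1 this.2
    have hDn : eLpNorm (fun x => ∑ d ∈ Finset.range (Q₁.natDegree + 1),
          Q₁.coeff d * (fwdDiff τ)^[l] (fun s => F s x) (i + d * τ)) r μ ≤ c₁ * η := by
      refine eLpNorm_sum_coeff_fwdDiff_le hr hF l Q₁ hη ?_ hτ
      rw [Nat.abs_cast, hU]
      exact_mod_cast (by omega)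
    have e1 : eLpNorm (G v) r μ ≤ q * (L₀ * (c₀ * η) + q *
        (q₀ * (∑ a ∈ s₀, ‖w a‖ₑ) * S + c₁ * η)) := by
      refine (eLpNorm_add_le_quasi hr ((hGm i).const_mul _).aemeasurable
        (hBm.add hDm).aemeasurable (Eventually.of_forall fun x => ?_)).trans
        (mul_le_mul_right (add_le_add hA ?_) _)
      · rw [hid x]; exact abs_add_le _ _
      · exact (eLpNorm_add_le_quasi hr hBm.aemeasurable hDm.aemeasurable
          (Eventually.of_forall fun x => abs_add_le _ _)).trans
          (mul_le_mul_right (add_le_add hBn hDn) _)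
    refine e1.trans ?_
    have e2 : q * (L₀ * (c₀ * η) + q *
        (q₀ * (∑ a ∈ s₀, ‖w a‖ₑ) * S + c₁ * η)) =
        X * η + (q * q * q₀ * ∑ a ∈ s₀, ‖w a‖ₑ) * S := by
      rw [hX]; ring
    rw [e2]
    exact add_le_add le_rfl (mul_le_mul_left hsmall _)
  intro v h0 h1
  refine (hSle v h0 h1).trans ?_
  rw [mul_assoc]
  exact le_two_mul_of_le_add_half hSt (iSup_le fun ⟨v, h0, h1⟩ => key v h0 h1)

end WhitneyLine

/-! ### Whitney's inequality -/

section Whitney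

variable {n : ℕ}

theorem eLpNorm_translate_le {r : ℝ≥0∞} (f : (Fin n → ℝ) → ℝ) (w : Fin n → ℝ)
    {S T : Set (Fin n → ℝ)} (hT : MeasurableSet T) (h : ∀ x ∈ S, x + w ∈ T) :
    eLpNorm (fun x => f (x + w)) r (volume.restrict S) ≤ eLpNorm f r (volume.restrict T) := by
  have h1 : (volume.restrict T : Measure (Fin n → ℝ)) =
      Measure.map (fun x => x + w) (volume.restrict ((fun x => x + w) ⁻¹' T)) := by
    rw [← Measure.restrict_map (measurable_add_const w) hT, map_add_right_eq_self]
  rw [h1, (measurableEmbedding_addRight w).eLpNorm_map_measure]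
  exact eLpNorm_mono_measure _ (Measure.restrict_mono h le_rfl)

theorem measurable_diff (l : ℕ) {g : (Fin n → ℝ) → ℝ} (hg : Measurable g) :
    Measurable fun z : (Fin n → ℝ) × (Fin n → ℝ) => diff l z.1 g z.2 := by
  unfold diff
  exact Finset.measurable_sum _ fun j _ =>
    (hg.comp (measurable_snd.add (measurable_fst.const_smul (j : ℝ)))).const_mul _

theorem diff_zero_left {l : ℕ} (hl : l ≠ 0) (g : (Fin n → ℝ) → ℝ) (x : Fin n → ℝ) :
    diff l 0 g x = 0 := by
  obtain ⟨l, rfl⟩ := Nat.exists_eq_succ_of_ne_zero hl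
  rw [diff_eq_fwdDiff, Function.iterate_succ_apply]
  have : fwdDiff 0 g = 0 := by
    funext y
    simp [fwdDiff]
  rw [this, fwdDiff_iter_eq_sum_shift]
  simp

/-- Both sides are the same double sum of the values g(x + jh + ijv), summed in the two orders. -/
theorem sum_diff_add_smul (l : ℕ) (h v : Fin n → ℝ) (g : (Fin n → ℝ) → ℝ) (x : Fin n → ℝ) :
    ∑ i ∈ Finset.range (l + 1), ((-1) ^ i * (l.choose i : ℝ)) * diff l (h + (i : ℝ) • v) g x =
      ∑ j ∈ Finset.range (l + 1), ((-1) ^ j * (l.choose j : ℝ)) *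
        diff l ((j : ℝ) • v) g (x + (j : ℝ) • h) := by
  simp only [diff, Finset.mul_sum]
  rw [Finset.sum_comm]
  refine Finset.sum_congr rfl fun j _ => Finset.sum_congr rfl fun i _ => ?_
  have h1 : x + (j : ℝ) • (h + (i : ℝ) • v) = x + (j : ℝ) • h + (i : ℝ) • (j : ℝ) • v := by
    rw [smul_add, smul_comm (i : ℝ), add_assoc]
  rw [h1, pow_add, pow_add]
  ring

/-- Separating the zero indices in `sum_diff_add_smul` leaves the difference with step h on one side
and a difference with step 0 on the other, which vanishes as l ≠ 0. A difference with a prescribed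
step is thus expressed by differences whose steps all involve the free vector v. -/
theorem diff_eq_sum_sub_sum {l : ℕ} (hl : l ≠ 0) (h v : Fin n → ℝ) (g : (Fin n → ℝ) → ℝ)
    (x : Fin n → ℝ) :
    diff l h g x = ∑ j ∈ Finset.Icc 1 l, ((-1) ^ j * (l.choose j : ℝ)) *
        diff l ((j : ℝ) • v) g (x + (j : ℝ) • h) -
      ∑ i ∈ Finset.Icc 1 l, ((-1) ^ i * (l.choose i : ℝ)) * diff l (h + (i : ℝ) • v) g x := by
  have h1 := sum_diff_add_smul l h v g x
  have h2 : ∀ f : ℕ → ℝ, ∑ i ∈ Finset.range (l + 1), f i = f 0 + ∑ i ∈ Finset.Icc 1 l, f i :=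
    fun f => by
      rw [Finset.range_eq_Ico, Finset.sum_eq_sum_Ico_succ_bot (Nat.succ_pos l), zero_add]
      rfl
  rw [h2, h2] at h1
  simp only [pow_zero, Nat.choose_zero_right, Nat.cast_one, mul_one, Nat.cast_zero, zero_smul,
    add_zero, one_mul, diff_zero_left hl, zero_add] at h1
  linarith

theorem volume_preimage_add_smul_le (w : Fin n → ℝ) {c : ℝ} (hc : 1 ≤ c) (T : Set (Fin n → ℝ)) :
    volume {v | w + c • v ∈ T} ≤ volume T := by
  have h1 : {v | w + c • v ∈ T} = (fun v => c • v) ⁻¹' ((fun y => w + y) ⁻¹' T) := rfl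
  rw [h1, Measure.addHaar_preimage_smul _ (by positivity), measure_preimage_add]
  refine mul_le_of_le_one_left zero_le ?_
  rw [abs_of_nonneg (by positivity), ENNReal.ofReal_le_one]
  exact inv_le_one_of_one_le₀ (one_le_pow₀ hc)

/-- Passage from averaged to individual steps. By Chebyshev, most steps u have a controlled
difference; a vector v is chosen such that all steps jv and h + iv in `diff_eq_sum_sub_sum` are of
this kind. -/
theorem exists_eLpNorm_diff_le (n : ℕ) {l : ℕ} (hl : l ≠ 0) {r : ℝ≥0∞} (hr : r ≠ 0) (K : ℕ) :
    ∃ C : ℝ≥0, ∀ g : (Fin n → ℝ) → ℝ, Measurable g → ∀ h : Fin n → ℝ, ‖h‖ ≤ 1 →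
      eLpNorm (diff l h g) r (volume.restrict (Metric.closedBall 0 K)) ≤
        C * eLpNorm (fun z : (Fin n → ℝ) × (Fin n → ℝ) => diff l z.1 g z.2) r
          ((volume.restrict (Metric.ball 0 2)).prod
            (volume.restrict (Metric.closedBall 0 ((K + l : ℕ) : ℝ)))) := by
  have hl0 : (0 : ℝ) < l := by exact_mod_cast Nat.pos_of_ne_zero hl
  set b : ℝ≥0∞ := volume (Metric.ball (0 : Fin n → ℝ) (1 / l)) with hb
  have hb0 : b ≠ 0 := (Metric.measure_ball_pos _ _ (by positivity)).ne'
  have hbt : b ≠ ∞ := measure_ball_lt_top.ne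
  -- There are 2l conditions on v, each excluding a set of measure at most e, and 2l · e < b, so
  -- part of the ball survives. Its radius 1/l keeps the steps jv of norm below 1 and h + iv of norm
  -- below 2.
  set e : ℝ≥0∞ := b / (2 * l + 1 : ℕ) with he
  have he0 : e ≠ 0 := ENNReal.div_ne_zero.2 ⟨hb0, ENNReal.natCast_ne_top _⟩
  have het : e ≠ ∞ := ENNReal.div_ne_top hbt (by simp)
  have hne : (2 * l : ℕ) * e < b := by
    have h1 : ((2 * l + 1 : ℕ) : ℝ≥0∞) * e = b := by
      rw [he, ENNReal.mul_div_cancel (by simp) (ENNReal.natCast_ne_top _)]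
    rw [← h1]
    exact (ENNReal.mul_lt_mul_iff_left he0 het).2 (by exact_mod_cast Nat.lt_succ_self _)
  set κ : ℝ≥0∞ := (e⁻¹) ^ (r.toReal⁻¹) with hκ
  have hκt : κ ≠ ∞ := ENNReal.rpow_ne_top_of_nonneg (by positivity) (ENNReal.inv_ne_top.2 he0)
  set c : ℝ≥0∞ := quasiConst r (Finset.Icc 1 l).card *
    ∑ i ∈ Finset.Icc 1 l, ‖((-1 : ℝ) ^ i * (l.choose i : ℝ))‖ₑ with hc
  have hct : c ≠ ∞ := ENNReal.mul_ne_top (quasiConst_ne_top _ _) (sum_enorm_ne_top _ _)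
  refine ⟨(quasiConst r 2 * (c * κ + c * κ)).toNNReal, fun g hg h hh => ?_⟩
  rw [ENNReal.coe_toNNReal (ENNReal.mul_ne_top (quasiConst_ne_top _ _) (ENNReal.add_ne_top.2
    ⟨ENNReal.mul_ne_top hct hκt, ENNReal.mul_ne_top hct hκt⟩))]
  set ν : Measure (Fin n → ℝ) := volume.restrict (Metric.closedBall 0 ((K + l : ℕ) : ℝ)) with hν
  set D : ℝ≥0∞ := eLpNorm (fun z : (Fin n → ℝ) × (Fin n → ℝ) => diff l z.1 g z.2) r
    ((volume.restrict (Metric.ball 0 2)).prod ν) with hD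
  have hdm := measurable_diff l hg
  have hdm' : ∀ u, Measurable (diff l u g) := fun u => hdm.comp (measurable_const.prodMk measurable_id)
  set bad : Set (Fin n → ℝ) := {u | κ * D < eLpNorm (diff l u g) r ν} ∩ Metric.ball 0 2 with hbad
  have hbade : volume bad ≤ e :=
    (Measure.le_restrict_apply _ _).trans (measure_section_gt_le hr hdm he0 het)
  obtain ⟨v, hv, hv1, hv2⟩ : ∃ v ∈ Metric.ball (0 : Fin n → ℝ) (1 / l),
      (∀ i ∈ Finset.Icc 1 l, h + (i : ℝ) • v ∉ bad) ∧ ∀ i ∈ Finset.Icc 1 l, (i : ℝ) • v ∉ bad := by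
    by_contra hcon
    push Not at hcon
    have hsub : Metric.ball (0 : Fin n → ℝ) (1 / l) ⊆
        (⋃ i ∈ Finset.Icc 1 l, {v | h + (i : ℝ) • v ∈ bad}) ∪
          ⋃ i ∈ Finset.Icc 1 l, {v | 0 + (i : ℝ) • v ∈ bad} := by
      intro v hv
      by_cases h1 : ∀ i ∈ Finset.Icc 1 l, h + (i : ℝ) • v ∉ bad
      · obtain ⟨i, hi, hi'⟩ := hcon v hv h1
        exact Or.inr (Set.mem_biUnion hi (by simpa using hi'))
      · push Not at h1
        obtain ⟨i, hi, hi'⟩ := h1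
        exact Or.inl (Set.mem_biUnion hi hi')
    have hU : ∀ w : Fin n → ℝ, volume (⋃ i ∈ Finset.Icc 1 l, {v | w + (i : ℝ) • v ∈ bad}) ≤ l * e :=
      fun w => by
        refine (measure_biUnion_finset_le _ _).trans ?_
        refine (Finset.sum_le_card_nsmul _ _ e fun i hi => ?_).trans_eq ?_
        · refine (volume_preimage_add_smul_le w ?_ bad).trans hbade
          exact_mod_cast (Finset.mem_Icc.1 hi).1
        · simp
    have h3 : b ≤ (2 * l : ℕ) * e := by
      refine (measure_mono hsub).trans ((measure_union_le _ _).trans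
        ((add_le_add (hU h) (hU 0)).trans_eq ?_))
      push_cast
      ring
    exact absurd h3 (not_le.2 hne)
  have hvn : ∀ i ∈ Finset.Icc 1 l, ‖(i : ℝ) • v‖ < 1 := fun i hi => by
    rw [mem_ball_zero_iff] at hv
    have h1 : (i : ℝ) ≤ l := by exact_mod_cast (Finset.mem_Icc.1 hi).2
    rw [norm_smul, Real.norm_natCast]
    calc (i : ℝ) * ‖v‖ ≤ l * ‖v‖ := by gcongr
      _ < l * (1 / l) := by gcongr
      _ = 1 := by field_simp
  have good : ∀ u : Fin n → ℝ, u ∉ bad → ‖u‖ < 2 → eLpNorm (diff l u g) r ν ≤ κ * D := by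
    intro u hu hu2
    by_contra hcon
    exact hu ⟨not_le.1 hcon, mem_ball_zero_iff.2 hu2⟩
  have hA : eLpNorm (fun x => ∑ j ∈ Finset.Icc 1 l, ((-1) ^ j * (l.choose j : ℝ)) *
      diff l ((j : ℝ) • v) g (x + (j : ℝ) • h)) r (volume.restrict (Metric.closedBall 0 K)) ≤
      c * (κ * D) := by
    refine eLpNorm_linComb_le hr (Finset.Icc 1 l) (fun j => (-1 : ℝ) ^ j * (l.choose j : ℝ))
      (f := fun j x => diff l ((j : ℝ) • v) g (x + (j : ℝ) • h))
      (fun j _ => ((hdm' _).comp (measurable_add_const _)).aemeasurable) fun j hj => ?_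
    refine (eLpNorm_translate_le (diff l ((j : ℝ) • v) g) ((j : ℝ) • h)
      Metric.isClosed_closedBall.measurableSet fun x hx => ?_).trans
      (good _ (hv2 j hj) ((hvn j hj).trans (by norm_num)))
    rw [mem_closedBall_zero_iff] at hx ⊢
    have h1 : (j : ℝ) ≤ l := by exact_mod_cast (Finset.mem_Icc.1 hj).2
    refine (norm_add_le _ _).trans ?_
    rw [norm_smul, Real.norm_natCast]
    have : (j : ℝ) * ‖h‖ ≤ l * 1 := by gcongr
    push_cast
    linarith
  have hB : eLpNorm (fun x => ∑ i ∈ Finset.Icc 1 l, ((-1) ^ i * (l.choose i : ℝ)) *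
      diff l (h + (i : ℝ) • v) g x) r (volume.restrict (Metric.closedBall 0 K)) ≤
      c * (κ * D) := by
    refine eLpNorm_linComb_le hr (Finset.Icc 1 l) (fun j => (-1 : ℝ) ^ j * (l.choose j : ℝ))
      (f := fun i x => diff l (h + (i : ℝ) • v) g x)
      (fun j _ => (hdm' _).aemeasurable) fun i hi => ?_
    refine (eLpNorm_mono_measure _ (Measure.restrict_mono (Metric.closedBall_subset_closedBall ?_)
      le_rfl)).trans (good _ (hv1 i hi) ((norm_add_le _ _).trans_lt ?_))
    · exact_mod_cast Nat.le_add_right K l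
    · linarith [hvn i hi]
  have hAm : Measurable fun x => ∑ j ∈ Finset.Icc 1 l, ((-1) ^ j * (l.choose j : ℝ)) *
      diff l ((j : ℝ) • v) g (x + (j : ℝ) • h) :=
    Finset.measurable_sum _ fun j _ => ((hdm' _).comp (measurable_add_const _)).const_mul _
  have hBm : Measurable fun x => ∑ i ∈ Finset.Icc 1 l, ((-1) ^ i * (l.choose i : ℝ)) *
      diff l (h + (i : ℝ) • v) g x :=
    Finset.measurable_sum _ fun j _ => (hdm' _).const_mul _
  refine (eLpNorm_add_le_quasi hr hAm.aemeasurable hBm.aemeasurable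
    (Eventually.of_forall fun x => ?_)).trans ((mul_le_mul_right (add_le_add hA hB) _).trans_eq ?_)
  · rw [diff_eq_sum_sub_sum hl h v g x]
    exact abs_sub _ _
  · ring

end Whitney

/-! ### Whitney's inequality in several variables, by interpolation in one variable after another.
-/

section WhitneyCube

variable {n : ℕ}

/-- Interpolation in the `i`-th variable at the nodes `0, …, l - 1`. -/
def interp (l : ℕ) (i : Fin n) (Φ : (Fin n → ℝ) → ℝ) (v : Fin n → ℝ) : ℝ :=
  ∑ b ∈ Finset.range l, (nodeBasis l b).eval (v i) * Φ (Function.update v i (b : ℝ))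

/-- The products of polynomials of degree at most `l` in the variables from `L` and functions of
the other variables. -/
def partialProducts (l : ℕ) (L : List (Fin n)) : Set ((Fin n → ℝ) → ℝ) :=
  {Φ | ∃ (P : Fin n → Polynomial ℝ) (κ : (Fin n → ℝ) → ℝ), (∀ i, (P i).natDegree ≤ l) ∧
    (∀ v v', (∀ i ∉ L, v i = v' i) → κ v = κ v') ∧
    Φ = fun v => (∏ i, if i ∈ L then (P i).eval (v i) else 1) * κ v}

theorem interp_mem_span {l : ℕ} {i : Fin n} {L : List (Fin n)} (hi : i ∉ L)
    {Φ : (Fin n → ℝ) → ℝ} (hΦ : Φ ∈ Submodule.span ℝ (partialProducts l L)) :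
    interp l i Φ ∈ Submodule.span ℝ (partialProducts l (i :: L)) := by
  induction hΦ using Submodule.span_induction with
  | zero =>
    have : interp l i (0 : (Fin n → ℝ) → ℝ) = 0 := by
      funext v; simp [interp]
    rw [this]; exact zero_mem _
  | add Φ Ψ _ _ h1 h2 =>
    have : interp l i (Φ + Ψ) = interp l i Φ + interp l i Ψ := by
      funext v
      simp [interp, mul_add, Finset.sum_add_distrib]
    rw [this]; exact add_mem h1 h2
  | smul a Φ _ h1 =>
    have : interp l i (a • Φ) = a • interp l i Φ := by
      funext v
      simp only [interp, Pi.smul_apply, smul_eq_mul, Finset.mul_sum]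
      exact Finset.sum_congr rfl fun b _ => by ring
    rw [this]; exact Submodule.smul_mem _ _ h1
  | mem Φ hΦ =>
    obtain ⟨P, κ, hP, hκ, rfl⟩ := hΦ
    have : interp l i (fun v => (∏ i, if i ∈ L then (P i).eval (v i) else 1) * κ v) =
        ∑ b ∈ Finset.range l, fun v => (nodeBasis l b).eval (v i) *
          ((∏ i', if i' ∈ L then (P i').eval (Function.update v i (b : ℝ) i') else 1) *
            κ (Function.update v i (b : ℝ))) := by
      funext v
      simp [interp]
    rw [this]
    refine sum_mem fun b hb => Submodule.subset_span ?_
    refine ⟨Function.update P i (nodeBasis l b), fun v => κ (Function.update v i (b : ℝ)),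
      fun i' => ?_, fun v v' hv => hκ _ _ fun i' hi' => ?_, funext fun v => ?_⟩
    · by_cases h : i' = i
      · subst h; simpa using (natDegree_nodeBasis_lt hb).le
      · simpa [h] using hP i'
    · by_cases h : i' = i
      · subst h; simp
      · rw [Function.update_of_ne h, Function.update_of_ne h]
        exact hv i' (by simp [h, hi'])
    · rw [← mul_assoc]
      congr 1
      rw [← Finset.mul_prod_erase _ _ (Finset.mem_univ i),
        ← Finset.mul_prod_erase Finset.univ (fun i' => if i' ∈ i :: L then _ else _)
          (Finset.mem_univ i)]
      simp only [hi, if_false, one_mul, List.mem_cons_self, if_true, Function.update_self]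
      congr 1
      refine Finset.prod_congr rfl fun i' hi' => ?_
      have h := Finset.ne_of_mem_erase hi'
      simp [h]

theorem polyEval_add {l : ℕ} (c c' : (Fin n → Fin (l + 1)) → ℝ) (x : Fin n → ℝ) :
    polyEval (c + c') x = polyEval c x + polyEval c' x := by
  simp only [polyEval, Pi.add_apply, add_mul, Finset.sum_add_distrib]

/-- Each interpolation turns one further variable into a polynomial one; when no variable is left,
the remaining factor is a constant. -/
theorem exists_polyEval_eq_interp (l : ℕ) (Φ : (Fin n → ℝ) → ℝ) :
    ∃ c : (Fin n → Fin (l + 1)) → ℝ, ∀ v,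
      (List.finRange n).foldr (interp l) Φ v = polyEval c v := by
  have h1 : ∀ L : List (Fin n), L.Nodup →
      L.foldr (interp l) Φ ∈ Submodule.span ℝ (partialProducts l L) := by
    intro L
    induction L with
    | nil =>
      intro _
      refine Submodule.subset_span ⟨0, Φ, by simp, fun v v' h => ?_, by simp⟩
      rw [funext fun i => h i (by simp)]
    | cons i L ih =>
      intro hL
      exact interp_mem_span (List.nodup_cons.1 hL).1 (ih (List.nodup_cons.1 hL).2)
  have h2 := h1 _ (List.nodup_finRange n)
  generalize (List.finRange n).foldr (interp l) Φ = Ψ at h2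
  induction h2 using Submodule.span_induction with
  | zero => exact ⟨0, fun v => by simp [polyEval]⟩
  | add Φ Ψ _ _ h1 h2 =>
    obtain ⟨c, hc⟩ := h1
    obtain ⟨c', hc'⟩ := h2
    exact ⟨c + c', fun v => by rw [polyEval_add, Pi.add_apply, hc, hc']⟩
  | smul a Φ _ h1 =>
    obtain ⟨c, hc⟩ := h1
    exact ⟨a • c, fun v => by rw [polyEval_smul, Pi.smul_apply, hc, smul_eq_mul]⟩
  | mem Φ hΦ =>
    obtain ⟨P, κ, hP, hκ, rfl⟩ := hΦ
    obtain ⟨c, hc⟩ := exists_polyEval_eq_prod hP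
    refine ⟨κ 0 • c, fun v => ?_⟩
    have h0 := hκ v 0 (by simp)
    simp [polyEval_smul, ← hc, h0, mul_comm]

theorem measurable_interp_foldr (l : ℕ) {g : (Fin n → ℝ) → ℝ} (hg : Measurable g)
    (L : List (Fin n)) : Measurable fun z : (Fin n → ℝ) × (Fin n → ℝ) =>
      L.foldr (interp l) (fun w => g (z.2 + w)) z.1 := by
  induction L with
  | nil => exact hg.comp (measurable_snd.add measurable_fst)
  | cons i L ih =>
    simp only [List.foldr_cons, interp]
    refine Finset.measurable_sum _ fun b _ => Measurable.mul ?_ ?_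
    · exact (nodeBasis l b).continuous.measurable.comp ((measurable_pi_apply i).comp measurable_fst)
    · have hu : Measurable fun z : (Fin n → ℝ) × (Fin n → ℝ) =>
          (Function.update z.1 i (b : ℝ), z.2) := by
        refine Measurable.prodMk ?_ measurable_snd
        refine measurable_pi_lambda _ fun i' => ?_
        by_cases h : i' = i
        · subst h; simp
        · simp only [Function.update_of_ne h]
          exact (measurable_pi_apply i').comp measurable_fst
      exact ih.comp hu

theorem fwdDiff_iter_update (l : ℕ) (g : (Fin n → ℝ) → ℝ) (x v : Fin n → ℝ) (i : Fin n)
    (t u : ℝ) : (fwdDiff t)^[l] (fun s => g (x + Function.update v i s)) u =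
      diff l (Pi.single i t) g (x + Function.update v i u) := by
  rw [diff_eq_fwdDiff, fwdDiff_iter_eq_sum_shift, fwdDiff_iter_eq_sum_shift]
  refine Finset.sum_congr rfl fun j _ => ?_
  congr 2
  rw [add_assoc]
  congr 1
  funext i'
  by_cases h : i' = i
  · subst h; simp
  · simp [Function.update_of_ne h, Pi.single_eq_of_ne h]

theorem norm_update_le {v : Fin n → ℝ} {R : ℝ} (hv : ‖v‖ ≤ R) {u : ℝ} (hu : |u| ≤ R) (i : Fin n) :
    ‖Function.update v i u‖ ≤ R := by
  refine (pi_norm_le_iff_of_nonneg ((norm_nonneg v).trans hv)).2 fun i' => ?_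
  by_cases h : i' = i
  · subst h; simpa using hu
  · rw [Function.update_of_ne h]; exact (norm_le_pi_norm v i').trans hv

theorem exists_sum_nodeBasis_le (l : ℕ) (V : ℝ) :
    ∃ D : ℝ≥0, ∀ s, 0 ≤ s → s ≤ V → ∑ a ∈ Finset.range l, ‖(nodeBasis l a).eval s‖ₑ ≤ D := by
  obtain ⟨D, hD⟩ := (isCompact_Icc (a := (0 : ℝ)) (b := V)).exists_bound_of_continuousOn
    (f := fun s => ∑ a ∈ Finset.range l, |(nodeBasis l a).eval s|)
    (Continuous.continuousOn (continuous_finsetSum _ fun a _ => (nodeBasis l a).continuous.abs))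
  refine ⟨D.toNNReal, fun s h0 h1 => ?_⟩
  have h2 := hD s ⟨h0, h1⟩
  rw [Real.norm_of_nonneg (Finset.sum_nonneg fun _ _ => abs_nonneg _)] at h2
  refine le_trans (le_of_eq ?_) (ENNReal.ofReal_le_ofReal h2)
  rw [ENNReal.ofReal_sum_of_nonneg fun _ _ => abs_nonneg _]
  exact Finset.sum_congr rfl fun a _ => (Real.enorm_eq_ofReal_abs _)

/-- Induction over the variables through g - I_i I_L g = (g - I_i g) + I_i (g - I_L g). The first
part is the one-dimensional result applied to u ↦ g(· + v with i-th entry u) as an L_r-valued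
function; in the second, V ≥ l keeps the nodes in the admitted range. -/
theorem exists_eLpNorm_sub_interp_le (n : ℕ) {l : ℕ} (hl : l ≠ 0) {r : ℝ≥0∞} (hr : r ≠ 0) :
    ∃ V₀ : ℕ, ∀ V : ℕ, V₀ ≤ V → ∀ (K : ℕ) (L : List (Fin n)), ∃ (C : ℝ≥0) (U : ℕ),
      ∀ (g : (Fin n → ℝ) → ℝ) (η : ℝ≥0∞), Measurable g →
      (∀ R : ℕ, eLpNorm g r (volume.restrict (Metric.closedBall 0 R)) ≠ ∞) →
      (∀ h : Fin n → ℝ, ‖h‖ ≤ 1 →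
        eLpNorm (diff l h g) r (volume.restrict (Metric.closedBall 0 U)) ≤ η) →
      ∀ v : Fin n → ℝ, (∀ i, 0 ≤ v i ∧ v i ≤ V) →
        eLpNorm (fun x => g (x + v) - L.foldr (interp l) (fun w => g (x + w)) v) r
          (volume.restrict (Metric.closedBall 0 K)) ≤ C * η := by
  obtain ⟨V₀, hV₀⟩ := exists_whitney_line hl hr
  refine ⟨max V₀ l, fun V hV K L => ?_⟩
  obtain ⟨C₁, U₁, hline⟩ := hV₀ V ((le_max_left _ _).trans hV)
  obtain ⟨D, hD⟩ := exists_sum_nodeBasis_le l V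
  have hlV : l ≤ V := (le_max_right _ _).trans hV
  induction L with
  | nil =>
    refine ⟨0, 0, fun g η _ _ _ v _ => ?_⟩
    simp
  | cons i L ih =>
    obtain ⟨C₂, U₂, ih⟩ := ih
    set q := (quasiConst r 2).toNNReal with hq
    set q' := (quasiConst r (Finset.range l).card).toNNReal with hq'
    refine ⟨q * (C₁ + q' * D * C₂), max U₂ (K + (V + U₁)), fun g η hg hfin hη v hv => ?_⟩
    have hvn : ‖v‖ ≤ ((V + U₁ : ℕ) : ℝ) := by
      refine (pi_norm_le_iff_of_nonneg (Nat.cast_nonneg _)).2 fun i => ?_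
      rw [Real.norm_of_nonneg (hv i).1]
      push_cast
      linarith [(hv i).2, Nat.cast_nonneg (α := ℝ) U₁]
    have hun : ∀ u : ℝ, |u| ≤ U₁ → ‖Function.update v i u‖ ≤ ((V + U₁ : ℕ) : ℝ) := fun u hu =>
      norm_update_le hvn (hu.trans (by exact_mod_cast Nat.le_add_left _ _)) i
    have hmem : ∀ u : ℝ, |u| ≤ U₁ → ∀ x ∈ Metric.closedBall (0 : Fin n → ℝ) K,
        x + Function.update v i u ∈ Metric.closedBall (0 : Fin n → ℝ) ((K + (V + U₁) : ℕ) : ℝ) :=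
      fun u hu x hx => by
        rw [mem_closedBall_zero_iff] at hx ⊢
        refine (norm_add_le _ _).trans ?_
        rw [Nat.cast_add]
        exact add_le_add hx (hun u hu)
    have hFm : ∀ u : ℝ, Measurable fun x => g (x + Function.update v i u) := fun u =>
      hg.comp (measurable_add_const _)
    have h1 := hline (volume.restrict (Metric.closedBall (0 : Fin n → ℝ) K))
      (fun u x => g (x + Function.update v i u)) η
      (eLpNorm g r (volume.restrict (Metric.closedBall 0 ((K + (V + U₁) : ℕ) : ℝ)))) hFm
      (hfin _)
      (fun u hu => eLpNorm_translate_le g _ Metric.isClosed_closedBall.measurableSet (hmem u hu))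
      (fun u t hu ht => by
        simp only [fwdDiff_iter_update]
        refine (eLpNorm_translate_le (diff l (Pi.single i t) g) _
          Metric.isClosed_closedBall.measurableSet (hmem u hu)).trans
          ((eLpNorm_mono_measure _ (Measure.restrict_mono
            (Metric.closedBall_subset_closedBall ?_) le_rfl)).trans (hη (Pi.single i t) ?_))
        · exact_mod_cast le_max_right _ _
        · rw [Pi.norm_single]; exact ht) (v i) (hv i).1 (hv i).2
    rw [Function.update_eq_self] at h1
    have hfm : ∀ w, Measurable fun x => g (x + w) - L.foldr (interp l) (fun w => g (x + w)) w :=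
      fun w => (hg.comp (measurable_add_const _)).sub
        ((measurable_interp_foldr l hg L).comp (measurable_const.prodMk measurable_id))
    have h2 : eLpNorm (fun x => ∑ b ∈ Finset.range l, (nodeBasis l b).eval (v i) *
        (g (x + Function.update v i (b : ℝ)) - L.foldr (interp l) (fun w => g (x + w))
          (Function.update v i (b : ℝ)))) r (volume.restrict (Metric.closedBall 0 K)) ≤
        q' * D * (C₂ * η) := by
      refine (eLpNorm_linComb_le hr (Finset.range l) (fun b => (nodeBasis l b).eval (v i))
        (f := fun b x => g (x + Function.update v i (b : ℝ)) - L.foldr (interp l)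
          (fun w => g (x + w)) (Function.update v i (b : ℝ))) (fun b _ => (hfm _).aemeasurable)
        (S := C₂ * η) fun b hb => ?_).trans ?_
      · refine ih g η hg hfin (fun h hh => (eLpNorm_mono_measure _ (Measure.restrict_mono
          (Metric.closedBall_subset_closedBall ?_) le_rfl)).trans (hη h hh)) _ fun i' => ?_
        · exact_mod_cast le_max_left _ _
        · by_cases h : i' = i
          · subst h
            rw [Function.update_self]
            have := Finset.mem_range.1 hb
            exact ⟨Nat.cast_nonneg _, by exact_mod_cast (by omega)⟩
          · rw [Function.update_of_ne h]; exact hv i'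
      · rw [hq', ENNReal.coe_toNNReal (quasiConst_ne_top _ _)]
        exact mul_le_mul_left (mul_le_mul_right (hD (v i) (hv i).1 (hv i).2) _) _
    have hm1 : Measurable fun x => g (x + v) - ∑ a ∈ Finset.range l, (nodeBasis l a).eval (v i) *
        g (x + Function.update v i (a : ℝ)) :=
      (hg.comp (measurable_add_const _)).sub (Finset.measurable_sum _ fun a _ =>
        (hFm a).const_mul _)
    have hm2 := Finset.measurable_sum (Finset.range l) (f := fun b x => (nodeBasis l b).eval (v i) *
        (g (x + Function.update v i (b : ℝ)) - L.foldr (interp l) (fun w => g (x + w))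
          (Function.update v i (b : ℝ)))) fun b _ => (hfm _).const_mul _
    refine (eLpNorm_add_le_quasi hr hm1.aemeasurable hm2.aemeasurable
      (Eventually.of_forall fun x => ?_)).trans
      ((mul_le_mul_right (add_le_add h1 h2) _).trans_eq ?_)
    · refine le_trans (le_of_eq ?_) (abs_add_le _ _)
      congr 1
      simp only [List.foldr_cons, interp, mul_sub, Finset.sum_sub_distrib]
      ring
    · have hqe : (q : ℝ≥0∞) = quasiConst r 2 := ENNReal.coe_toNNReal (quasiConst_ne_top _ _)
      rw [← hqe]
      push_cast
      ring

/-- Whitney's inequality. -/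
theorem exists_whitney (n : ℕ) {l : ℕ} (hl : l ≠ 0) {r : ℝ≥0∞} (hr : r ≠ 0) (K : ℕ) :
    ∃ (C : ℝ≥0) (U : ℕ), ∀ g : (Fin n → ℝ) → ℝ, Measurable g →
      (∀ R : ℕ, eLpNorm g r (volume.restrict (Metric.closedBall 0 R)) ≠ ∞) →
      ∃ c : (Fin n → Fin (l + 1)) → ℝ,
        eLpNorm (fun x => g x - polyEval c x) r (volume.restrict (Metric.closedBall 0 K)) ≤
          C * eLpNorm (fun z : (Fin n → ℝ) × (Fin n → ℝ) => diff l z.1 g z.2) r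
            ((volume.restrict (Metric.ball 0 2)).prod
              (volume.restrict (Metric.closedBall 0 (U : ℝ)))) := by
  obtain ⟨V₀, hV₀⟩ := exists_eLpNorm_sub_interp_le n hl hr
  set V := max V₀ (2 * K + 1) with hV
  have hVK : 2 * (K : ℝ) + 1 ≤ V := by exact_mod_cast le_max_right V₀ (2 * K + 1)
  obtain ⟨C₁, U₁, h1⟩ := hV₀ V (le_max_left _ _) (K + 1) (List.finRange n)
  obtain ⟨C₂, h2⟩ := exists_eLpNorm_diff_le n hl hr U₁
  set box : Set (Fin n → ℝ) := Set.Icc 0 (fun _ => (V : ℝ)) with hbox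
  -- A unit cube of base points, placed so that y + [0, V]ⁿ contains the ball of radius K for every
  -- y in Y; this is why V is at least 2K + 1.
  set Y : Set (Fin n → ℝ) := Metric.closedBall (fun _ => -((K : ℝ) + 1 / 2)) (1 / 2) with hY
  have hY1 : volume Y = 1 := by
    rw [hY, Real.volume_pi_closedBall _ (by norm_num)]
    simp
  have hbox' : volume box ≠ ∞ := isCompact_Icc.measure_lt_top.ne
  set κ : ℝ≥0∞ := (2⁻¹ : ℝ≥0∞)⁻¹ ^ (r.toReal⁻¹) * (volume box ^ (r.toReal⁻¹) * (C₁ * C₂)) with hκ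
  have hκt : κ ≠ ∞ := ENNReal.mul_ne_top (ENNReal.rpow_ne_top_of_nonneg (by positivity) (by simp))
    (ENNReal.mul_ne_top (ENNReal.rpow_ne_top_of_nonneg (by positivity) hbox')
      (ENNReal.mul_ne_top ENNReal.coe_ne_top ENNReal.coe_ne_top))
  refine ⟨κ.toNNReal, U₁ + l, fun g hg hfin => ?_⟩
  rw [ENNReal.coe_toNNReal hκt]
  set D : ℝ≥0∞ := eLpNorm (fun z : (Fin n → ℝ) × (Fin n → ℝ) => diff l z.1 g z.2) r
    ((volume.restrict (Metric.ball 0 2)).prod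
      (volume.restrict (Metric.closedBall 0 ((U₁ + l : ℕ) : ℝ)))) with hD
  have h3 := h1 g (C₂ * D) hg hfin (h2 g hg)
  set F : (Fin n → ℝ) × (Fin n → ℝ) → ℝ := fun z =>
    g (z.2 + z.1) - (List.finRange n).foldr (interp l) (fun w => g (z.2 + w)) z.1 with hF
  have hFm : Measurable F :=
    (hg.comp (measurable_snd.add measurable_fst)).sub (measurable_interp_foldr l hg _)
  have hmemY : ∀ y ∈ Y, ∀ i, -((K : ℝ) + 1) ≤ y i ∧ y i ≤ -K := fun y hy i => by
    rw [hY, mem_closedBall_iff_norm] at hy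
    have := (norm_le_pi_norm _ i).trans hy
    rw [Pi.sub_apply, Real.norm_eq_abs, abs_le] at this
    constructor <;> linarith
  have hYsub : Y ⊆ Metric.closedBall 0 ((K + 1 : ℕ) : ℝ) := fun y hy => by
    rw [mem_closedBall_zero_iff, pi_norm_le_iff_of_nonneg (Nat.cast_nonneg _)]
    intro i
    have := hmemY y hy i
    rw [Real.norm_eq_abs, abs_le]
    push_cast
    constructor <;> linarith [Nat.cast_nonneg (α := ℝ) K]
  have h4 : eLpNorm F r ((volume.restrict box).prod (volume.restrict Y)) ≤
      volume box ^ (r.toReal⁻¹) * (C₁ * (C₂ * D)) := by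
    have := eLpNorm_prod_le (μ := volume.restrict box) (ν := volume.restrict Y) hr hFm
      (S := C₁ * (C₂ * D)) ((ae_restrict_mem measurableSet_Icc).mono fun v hv =>
        (eLpNorm_mono_measure _ (Measure.restrict_mono hYsub le_rfl)).trans
          (h3 v fun i => ⟨hv.1 i, hv.2 i⟩))
    rwa [Measure.restrict_apply_univ] at this
  have h5 : eLpNorm (F ∘ Prod.swap) r ((volume.restrict Y).prod (volume.restrict box)) =
      eLpNorm F r ((volume.restrict box).prod (volume.restrict Y)) :=
    eLpNorm_comp_measurePreserving hFm.aestronglyMeasurable Measure.measurePreserving_swap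
  -- The interpolation estimate holds for each v as a norm in the base point. Exchanging the
  -- variables, Chebyshev discards at most half of Y, and any remaining y gives a single polynomial
  -- that is good for all v together.
  have h6 := measure_section_gt_le (μ := volume.restrict Y) (ν := volume.restrict box) hr
    (hFm.comp measurable_swap) (e := 2⁻¹) (by simp) (by simp)
  obtain ⟨y, hyY, hy⟩ : ∃ y ∈ Y, eLpNorm (fun v => F (v, y)) r (volume.restrict box) ≤ κ * D := by
    by_contra hcon
    push Not at hcon
    have h7 : volume Y ≤ 2⁻¹ := by
      refine le_trans ?_ ((Measure.le_restrict_apply _ _).trans h6)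
      refine measure_mono fun y hy => ⟨?_, hy⟩
      refine lt_of_le_of_lt ?_ (hcon y hy)
      rw [h5]
      refine (mul_le_mul_right h4 _).trans_eq ?_
      rw [hκ]
      ring
    rw [hY1] at h7
    exact absurd h7 (not_le.2 (by simp))
  obtain ⟨c₀, hc₀⟩ := exists_polyEval_eq_interp l fun w => g (y + w)
  obtain ⟨c, hc⟩ := exists_polyEval_affine c₀ 1 (-y)
  refine ⟨c, le_trans (le_of_eq ?_) ((eLpNorm_translate_le (fun v => F (v, y)) (-y)
    (S := Metric.closedBall 0 K) (T := box) measurableSet_Icc fun x hx => ?_).trans hy)⟩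
  · congr 1
    funext x
    rw [hF, ← hc]
    simp only [hc₀]
    congr 2
    · simp
    · funext i; simp
  · rw [mem_closedBall_zero_iff] at hx
    have h8 : ∀ i, -(K : ℝ) ≤ x i ∧ x i ≤ K := fun i =>
      abs_le.1 ((Real.norm_eq_abs _).symm.le.trans ((norm_le_pi_norm x i).trans hx))
    constructor <;> intro i <;> have e1 := hmemY y hyY i <;> have e2 := h8 i <;>
      simp only [Pi.add_apply, Pi.neg_apply, Pi.zero_apply] <;> linarith

end WhitneyCube

/-! ### Local oscillations on dyadic cubes -/

section Oscillation

variable {n : ℕ}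

theorem eLpNorm_restrict_le_sum {α ι : Type*} [MeasurableSpace α] {μ : Measure α} {r : ℝ≥0∞}
    (hr : r ≠ 0) (s : Finset ι) {S : Set α} (hS : MeasurableSet S) {T : ι → Set α}
    (hT : ∀ i ∈ s, MeasurableSet (T i)) (hST : S ⊆ ⋃ i ∈ s, T i) {F : α → ℝ}
    (hF : AEMeasurable F μ) :
    eLpNorm F r (μ.restrict S) ≤ quasiConst r s.card * ∑ i ∈ s, eLpNorm F r (μ.restrict (T i)) := by
  have h1 : eLpNorm F r (μ.restrict S) ≤ quasiConst r s.card *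
      ∑ i ∈ s, eLpNorm (fun x => (T i).indicator (fun x => ‖F x‖ₑ) x) r (μ.restrict S) := by
    refine eLpNorm_le_sum hr s (fun i hi => (hF.restrict.enorm.indicator (hT i hi)))
      ((ae_restrict_mem hS).mono fun x hx => ?_)
    obtain ⟨i, hi, hxi⟩ := Set.mem_iUnion₂.1 (hST hx)
    refine le_trans (le_of_eq ?_) (Finset.single_le_sum
      (f := fun i => (T i).indicator (fun x => ‖F x‖ₑ) x) (fun _ _ => zero_le) hi)
    rw [Set.indicator_of_mem hxi]
  refine h1.trans (mul_le_mul_right (Finset.sum_le_sum fun i hi => ?_) _)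
  refine (eLpNorm_mono_measure _ Measure.restrict_le_self).trans ?_
  rw [← eLpNorm_indicator_eq_eLpNorm_restrict (hT i hi)]
  refine eLpNorm_mono_enorm fun x => ?_
  by_cases hx : x ∈ T i <;> simp [hx]

/-- The `L_r` norm of the differences of `φ` on a dyadic cube, in the coordinates of that cube. -/
def oscCube (l : ℕ) (r : ℝ≥0∞) (φ : (Fin n → ℝ) → ℝ) (k : ℕ) (m : Fin n → ℤ) : ℝ≥0∞ :=
  eLpNorm (fun z : (Fin n → ℝ) × (Fin n → ℝ) => diff l z.1 (fun y => φ (cubeMap k m y)) z.2) r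
    ((volume.restrict (Metric.ball 0 2)).prod (cubeMeas 0 0))

theorem cubeMeas_zero (m : Fin n → ℤ) : cubeMeas 0 m = volume.restrict (dyadicHalfOpen 0 m) := by
  rw [cubeMeas, zero_mul, pow_zero, one_smul]

theorem oscCube_add (l : ℕ) (r : ℝ≥0∞) (φ : (Fin n → ℝ) → ℝ) (k : ℕ) (m e : Fin n → ℤ) :
    eLpNorm (fun z : (Fin n → ℝ) × (Fin n → ℝ) => diff l z.1 (fun y => φ (cubeMap k m y)) z.2) r
      ((volume.restrict (Metric.ball 0 2)).prod (cubeMeas 0 e)) = oscCube l r φ k (m + e) := by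
  have h1 := map_cubeMap_cubeMeas 0 e (0 : Fin n → ℤ)
  rw [add_zero] at h1
  have hp : MeasurableEmbedding (Prod.map (id : (Fin n → ℝ) → Fin n → ℝ) (cubeMap 0 e)) :=
    MeasurableEmbedding.id.prodMap (measurableEmbedding_cubeMap 0 e)
  have h2 : (volume.restrict (Metric.ball 0 2)).prod (cubeMeas 0 e) = Measure.map
      (Prod.map id (cubeMap 0 e))
      ((volume.restrict (Metric.ball (0 : Fin n → ℝ) 2)).prod (cubeMeas 0 0)) := by
    rw [← Measure.map_prod_map _ _ measurable_id (measurableEmbedding_cubeMap 0 e).measurable,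
      Measure.map_id, h1]
  rw [h2, hp.eLpNorm_map_measure, oscCube]
  congr 1
  funext z
  simp only [Function.comp, Prod.map, id, diff]
  refine Finset.sum_congr rfl fun j _ => ?_
  congr 2
  funext i
  simp only [cubeMap, Pi.add_apply, Pi.smul_apply, smul_eq_mul, pow_zero, div_one]
  push_cast
  ring

theorem floorIdx_zero_mem_intBox {R : ℕ} {x : Fin n → ℝ} (hx : ‖x‖ ≤ R) :
    floorIdx 0 x ∈ intBox n (R + 1) := by
  refine mem_intBox.2 fun i => ?_
  have h := abs_floorIdx_sub_le (k := 0) (x := x) (y := 0) (R := R) (by simpa using hx) i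
  simpa [floorIdx] using h

theorem dyadicHalfOpen_zero_subset {K : ℕ} {e : Fin n → ℤ} (he : e ∈ intBox n K) :
    dyadicHalfOpen 0 e ⊆ Metric.closedBall 0 ((K + 1 : ℕ) : ℝ) := by
  intro x hx
  rw [mem_closedBall_zero_iff, pi_norm_le_iff_of_nonneg (Nat.cast_nonneg _)]
  intro i
  have h1 := hx i
  have h2 := abs_le.1 (mem_intBox.1 he i)
  have h3 : (-(K : ℝ)) ≤ e i := by exact_mod_cast h2.1
  have h4 : (e i : ℝ) ≤ K := by exact_mod_cast h2.2
  simp only [pow_zero, div_one] at h1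
  rw [Real.norm_eq_abs, abs_le]
  push_cast
  constructor <;> linarith

theorem eLpNorm_comp_cubeMap_ne_top {r : ℝ≥0∞} {φ : (Fin n → ℝ) → ℝ} (hφ : MemLpLoc r φ)
    (k : ℕ) (m : Fin n → ℤ) (R : ℝ) :
    eLpNorm (fun y => φ (cubeMap k m y)) r (volume.restrict (Metric.closedBall 0 R)) ≠ ∞ := by
  set K : Set (Fin n → ℝ) := cubeMap k m '' Metric.closedBall 0 R with hK
  have hKc : IsCompact K := (isCompact_closedBall 0 R).image (continuous_cubeMap k m)
  have hpre : cubeMap k m ⁻¹' K = Metric.closedBall 0 R :=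
    Set.preimage_image_eq _ (measurableEmbedding_cubeMap k m).injective
  have h1 : Measure.map (cubeMap k m) (volume.restrict (Metric.closedBall 0 R)) =
      (2 : ℝ≥0∞) ^ (k * n) • volume.restrict K := by
    rw [← Measure.restrict_smul, ← map_cubeMap_volume k m, Measure.restrict_map
      (measurableEmbedding_cubeMap k m).measurable hKc.measurableSet, hpre]
  have h2 := (measurableEmbedding_cubeMap k m).eLpNorm_map_measure (p := r) (g := φ)
    (μ := volume.restrict (Metric.closedBall 0 R))
  rw [h1, eLpNorm_smul_measure_of_ne_zero (by positivity)] at h2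
  change eLpNorm (φ ∘ cubeMap k m) r _ ≠ ∞
  rw [← h2, smul_eq_mul]
  exact ENNReal.mul_ne_top (ENNReal.rpow_ne_top_of_nonneg ENNReal.toReal_nonneg (by simp))
    (hφ K hKc).2.ne

theorem eLpNorm_diff_closedBall_le {l : ℕ} {r : ℝ≥0∞} (hr : r ≠ 0) {φ : (Fin n → ℝ) → ℝ}
    (hφ : Measurable φ) (k : ℕ) (m : Fin n → ℤ) (U : ℕ) :
    eLpNorm (fun z : (Fin n → ℝ) × (Fin n → ℝ) => diff l z.1 (fun y => φ (cubeMap k m y)) z.2) r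
      ((volume.restrict (Metric.ball 0 2)).prod (volume.restrict (Metric.closedBall 0 (U : ℝ)))) ≤
      quasiConst r (intBox n (U + 1)).card *
        ∑ e' ∈ intBox n (U + 1), oscCube l r φ k (m + e') := by
  have hgm : Measurable fun y => φ (cubeMap k m y) :=
    hφ.comp (measurableEmbedding_cubeMap k m).measurable
  have h1 := eLpNorm_restrict_le_sum (μ := (volume : Measure (Fin n → ℝ)).prod volume) hr
    (intBox n (U + 1)) (S := Metric.ball 0 2 ×ˢ Metric.closedBall 0 (U : ℝ))
    (measurableSet_ball.prod measurableSet_closedBall)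
    (T := fun e' => Metric.ball 0 2 ×ˢ dyadicHalfOpen 0 e')
    (fun e' _ => measurableSet_ball.prod (measurableSet_dyadicHalfOpen _ _))
    (by
      rintro ⟨h, x⟩ ⟨hh, hx⟩
      exact Set.mem_iUnion₂.2 ⟨floorIdx 0 x,
        floorIdx_zero_mem_intBox (mem_closedBall_zero_iff.1 hx), hh, mem_dyadicHalfOpen.2 rfl⟩)
    (measurable_diff l hgm).aemeasurable
  rw [← Measure.prod_restrict] at h1
  refine h1.trans_eq ?_
  congr 1
  refine Finset.sum_congr rfl fun e' _ => ?_
  rw [← oscCube_add, ← Measure.prod_restrict, cubeMeas_zero]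

/-- Whitney's inequality at a dyadic cube. -/
theorem exists_whitney_dyadic (n : ℕ) {l : ℕ} (hl : l ≠ 0) {r : ℝ≥0∞} (hr : r ≠ 0) (K : ℕ) :
    ∃ (C : ℝ≥0) (U : ℕ), ∀ φ : (Fin n → ℝ) → ℝ, Measurable φ → MemLpLoc r φ →
      ∀ (k : ℕ) (m : Fin n → ℤ), ∃ c : (Fin n → Fin (l + 1)) → ℝ, ∀ e ∈ intBox n K,
        eLpNorm (fun x => φ x - polyEval c x) r (cubeMeas k (m + e)) ≤
          C * ∑ e' ∈ intBox n U, oscCube l r φ k (m + e') := by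
  obtain ⟨C, U, h⟩ := exists_whitney n hl hr (K + 1)
  set q := quasiConst r (intBox n (U + 1)).card with hq
  have hqt : q ≠ ∞ := quasiConst_ne_top _ _
  refine ⟨C * q.toNNReal, U + 1, fun φ hφ hφ' k m => ?_⟩
  set g : (Fin n → ℝ) → ℝ := fun y => φ (cubeMap k m y) with hg
  have hgm : Measurable g := hφ.comp (measurableEmbedding_cubeMap k m).measurable
  obtain ⟨c₀, hc₀⟩ := h g hgm fun R => eLpNorm_comp_cubeMap_ne_top hφ' k m R
  obtain ⟨c, hc⟩ := exists_polyEval_affine c₀ ((2 : ℝ) ^ k) (fun i => -(m i : ℝ))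
  refine ⟨c, fun e he => ?_⟩
  rw [eLpNorm_cubeMeas, cubeMeas_zero]
  have hc' : ∀ y, polyEval c (cubeMap k m y) = polyEval c₀ y := fun y => by
    rw [← hc]
    congr 1
    funext i
    simp only [cubeMap]
    field_simp
    ring
  simp only [hc']
  refine (eLpNorm_mono_measure _ (Measure.restrict_mono (dyadicHalfOpen_zero_subset he)
    le_rfl)).trans (hc₀.trans ?_)
  rw [ENNReal.coe_mul, mul_assoc, ENNReal.coe_toNNReal hqt]
  exact mul_le_mul_right (eLpNorm_diff_closedBall_le hr hφ k m U) _

theorem ball_eq_cube {s : ℝ} (hs : 0 < s) : Metric.ball (0 : Fin n → ℝ) s = cube 0 (2 * s) := by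
  ext x
  rw [mem_ball_zero_iff, pi_norm_lt_iff hs]
  simp [cube]

theorem isOpen_cube (c : Fin n → ℝ) (s : ℝ) : IsOpen (cube c s) := by
  have : cube c s = ⋂ i, {x : Fin n → ℝ | |x i - c i| < s / 2} := by
    ext x; simp [cube]
  rw [this]
  exact isOpen_iInter_of_finite fun i => isOpen_lt (by fun_prop) continuous_const

theorem dyadicHalfOpen_subset_cube {k : ℕ} {m : Fin n → ℤ} {x : Fin n → ℝ}
    (hx : floorIdx k x = m) : dyadicHalfOpen k m ⊆ cube x (2 * (1 / 2 ^ k)) := by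
  intro y hy i
  have h1 := mem_dyadicHalfOpen.2 hx i
  have h2 := hy i
  have h3 : ((m i : ℝ) + 1) / 2 ^ k = (m i : ℝ) / 2 ^ k + 1 / 2 ^ k := by ring
  rw [abs_lt]
  constructor <;> linarith [h1.1, h1.2, h2.1, h2.2]

theorem diff_comp_cubeMap (l k : ℕ) (m : Fin n → ℤ) (φ : (Fin n → ℝ) → ℝ) (h y : Fin n → ℝ) :
    diff l h (fun y => φ (cubeMap k m y)) y = diff l (((2 : ℝ) ^ k)⁻¹ • h) φ (cubeMap k m y) := by
  refine Finset.sum_congr rfl fun j _ => ?_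
  congr 1
  refine congrArg φ (funext fun i => ?_)
  simp only [cubeMap, Pi.add_apply, Pi.smul_apply, smul_eq_mul]
  ring

theorem oscCube_eq (l : ℕ) (r : ℝ≥0∞) (φ : (Fin n → ℝ) → ℝ) (k : ℕ) (m : Fin n → ℤ) :
    oscCube l r φ k m = eLpNorm (fun z : (Fin n → ℝ) × (Fin n → ℝ) => diff l z.1 φ z.2) r
      (((2 : ℝ≥0∞) ^ (k * n) * 2 ^ (k * n)) • ((volume.restrict
        (cube (0 : Fin n → ℝ) (2 * (2 * (1 / 2 ^ k))))).prod
          (volume.restrict (dyadicHalfOpen k m)))) := by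
  have h0 : ((2 : ℝ) ^ k)⁻¹ ≠ 0 := by positivity
  have hsm : MeasurableEmbedding fun y : Fin n → ℝ => ((2 : ℝ) ^ k)⁻¹ • y :=
    measurableEmbedding_const_smul₀ h0
  have hp := hsm.prodMap (measurableEmbedding_cubeMap k m)
  have hpre : (fun y : Fin n → ℝ => ((2 : ℝ) ^ k)⁻¹ • y) ⁻¹'
      cube (0 : Fin n → ℝ) (2 * (2 * (1 / 2 ^ k))) = Metric.ball 0 2 := by
    rw [← ball_eq_cube (by positivity)]
    ext y
    simp only [Set.mem_preimage, mem_ball_zero_iff, norm_smul, norm_inv, norm_pow, Real.norm_ofNat]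
    rw [inv_mul_lt_iff₀ (by positivity)]
    have : (2 : ℝ) ^ k * (2 * (1 / 2 ^ k)) = 2 := by field_simp
    rw [this]
  have h1 : Measure.map (fun y : Fin n → ℝ => ((2 : ℝ) ^ k)⁻¹ • y)
      (volume.restrict (Metric.ball 0 2)) = (2 : ℝ≥0∞) ^ (k * n) •
        volume.restrict (cube (0 : Fin n → ℝ) (2 * (2 * (1 / 2 ^ k)))) := by
    rw [← Measure.restrict_smul, ← map_smul_volume, Measure.restrict_map hsm.measurable
      (isOpen_cube _ _).measurableSet, hpre]
  have h2 := map_cubeMap_cubeMeas k m (0 : Fin n → ℤ)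
  rw [add_zero] at h2
  have h3 : Measure.map (Prod.map (fun y : Fin n → ℝ => ((2 : ℝ) ^ k)⁻¹ • y) (cubeMap k m))
      ((volume.restrict (Metric.ball (0 : Fin n → ℝ) 2)).prod (cubeMeas 0 0)) =
      ((2 : ℝ≥0∞) ^ (k * n) * 2 ^ (k * n)) • ((volume.restrict
        (cube (0 : Fin n → ℝ) (2 * (2 * (1 / 2 ^ k))))).prod
          (volume.restrict (dyadicHalfOpen k m))) := by
    rw [← Measure.map_prod_map _ _ hsm.measurable (measurableEmbedding_cubeMap k m).measurable,
      h1, h2, cubeMeas, Measure.prod_smul_left, Measure.prod_smul_right, smul_smul]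
  rw [← h3, hp.eLpNorm_map_measure, oscCube]
  congr 1
  funext z
  exact diff_comp_cubeMap l k m φ z.1 z.2

/-- The measure in the definition of `deltaOsc` in terms of dyadic scales. -/
theorem ofReal_side_pow (k n : ℕ) :
    (4 : ℝ≥0∞) ^ n * ENNReal.ofReal (1 / (2 * (1 / (2 : ℝ) ^ k)) ^ (2 * n)) =
      (2 : ℝ≥0∞) ^ (k * n) * 2 ^ (k * n) := by
  have h1 : 1 / (2 * (1 / (2 : ℝ) ^ k)) ^ (2 * n) = 2 ^ (k * n) * 2 ^ (k * n) / 4 ^ n := by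
    have h2 : ((2 : ℝ) ^ k) ^ (2 * n) = 2 ^ (k * n) * 2 ^ (k * n) := by
      rw [← pow_mul, ← pow_add]
      congr 1
      ring
    rw [mul_pow, one_div_pow, h2, pow_mul 2 2 n]
    norm_num
    field_simp
  rw [h1, ENNReal.ofReal_div_of_pos (by positivity), ENNReal.ofReal_mul (by positivity),
    ENNReal.ofReal_pow (by norm_num), ENNReal.ofReal_pow (by norm_num)]
  simp only [ENNReal.ofReal_ofNat]
  rw [ENNReal.mul_div_cancel (by simp) (by finiteness)]

/-- The steps range over the same cube on both sides, and the dyadic cube of x lies in x + 2^{-k}Iⁿ;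
only the normalisations differ, by 4ⁿ. -/
theorem exists_oscCube_le_deltaOsc (n l : ℕ) (r : ℝ≥0∞) :
    ∃ C : ℝ≥0, ∀ (φ : (Fin n → ℝ) → ℝ) (k : ℕ) (x : Fin n → ℝ),
      oscCube l r φ k (floorIdx k x) ≤ C * deltaOsc l r x (2 * (1 / 2 ^ k)) φ := by
  have hct : ((4 : ℝ≥0∞) ^ n) ^ (1 / r).toReal ≠ ∞ :=
    ENNReal.rpow_ne_top_of_nonneg ENNReal.toReal_nonneg (by finiteness)
  refine ⟨(((4 : ℝ≥0∞) ^ n) ^ (1 / r).toReal).toNNReal, fun φ k x => ?_⟩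
  rw [ENNReal.coe_toNNReal hct, oscCube_eq, deltaOsc]
  refine le_trans ?_ (eLpNorm_smul_measure_of_ne_zero (c := (4 : ℝ≥0∞) ^ n) (by positivity)
    _ _ _).le
  rw [smul_smul, ofReal_side_pow]
  refine eLpNorm_mono_measure _ ?_
  refine fun s => mul_le_mul_right ?_ _
  rw [Measure.prod_restrict, Measure.prod_restrict]
  exact Measure.restrict_mono (Set.prod_mono le_rfl (dyadicHalfOpen_subset_cube rfl)) le_rfl s

end Oscillation

/-! ### Spline approximation -/

section Approximation

variable {n : ℕ}

/-- The weights `assoc` are norms of `t k` over the cubes of a partition, so weighted sequence norms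
are weighted integrals of step functions. This links coefficients with the quasi-norm of the
function space. -/
theorem lNorm_assoc_mul {p : ℝ≥0∞} (hp : p ≠ 0) {t : ℕ → (Fin n → ℝ) → ℝ} {k : ℕ}
    (ht : ∀ x, 0 < t k x) (h0 : ∀ m, assoc p t k m ≠ 0) (b : (Fin n → ℤ) → ℝ≥0∞) :
    lNorm p (fun m => assoc p t k m * b m) =
      eLpNorm (fun x => ENNReal.ofReal (t k x) * b (floorIdx k x)) p volume := by
  rw [eLpNorm_eq_lNorm_fibres hp (π := floorIdx k)
    fun m => by rw [← dyadicHalfOpen_eq]; exact measurableSet_dyadicHalfOpen k m]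
  congr 1
  funext m
  rw [← dyadicHalfOpen_eq]
  have h1 : assoc p t k m = eLpNorm (fun x => ENNReal.ofReal (t k x)) p
      (volume.restrict (dyadicHalfOpen k m)) := by
    rw [assoc, restrict_dyadic]
    refine eLpNorm_congr_enorm_ae (Eventually.of_forall fun x => ?_)
    rw [Real.enorm_eq_ofReal_abs, abs_of_pos (ht x), enorm_eq_self]
  have h2 : eLpNorm (fun x => ENNReal.ofReal (t k x) * b (floorIdx k x)) p
      (volume.restrict (dyadicHalfOpen k m)) =
      eLpNorm (fun x => b m * ENNReal.ofReal (t k x)) p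
        (volume.restrict (dyadicHalfOpen k m)) := by
    refine eLpNorm_congr_ae ((ae_restrict_mem (measurableSet_dyadicHalfOpen k m)).mono
      fun x hx => ?_)
    simp only [mem_dyadicHalfOpen.1 hx, mul_comm]
  rw [h2]
  -- An infinite value cannot be pulled out of the norm as a constant; here both sides are infinite,
  -- by comparison with all natural multiples.
  by_cases hb : b m = ∞
  · rw [hb, ENNReal.mul_top (h0 m)]
    symm
    have hsup : (⨆ N : ℕ, assoc p t k m * (N : ℝ≥0∞)) = ∞ := by
      rw [← ENNReal.mul_iSup, ENNReal.iSup_natCast, ENNReal.mul_top (h0 m)]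
    refine eq_top_iff.2 (hsup.symm.le.trans (iSup_le fun N => ?_))
    rw [h1, mul_comm, ← eLpNorm_const_mul_ennreal hp _ (ENNReal.natCast_ne_top N)]
    refine eLpNorm_mono_ennreal fun x => ?_
    rw [enorm_eq_self]
    exact mul_le_mul_left le_top _
  · rw [eLpNorm_const_mul_ennreal hp _ hb, ← h1, mul_comm]

theorem coeffFun_polyEval_sub {l : ℕ} (k : ℕ) (m : Fin n → ℤ) (c c' : (Fin n → Fin (l + 1)) → ℝ) :
    coeffFun l k m (polyEval (c - c')) =
      coeffFun l k m (polyEval c) - coeffFun l k m (polyEval c') := by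
  have h : ∀ c : (Fin n → Fin (l + 1)) → ℝ, coeffFun l k m (polyEval c) = ∑ ν, c ν * ∏ i,
      dualFun l ((Polynomial.C (((2 : ℝ) ^ k)⁻¹) * Polynomial.X +
        Polynomial.C ((m i : ℝ) / 2 ^ k)) ^ (ν i : ℕ)) := fun c => by
    rw [coeffFun_eq_refCoeff, ← refCoeff_sum_prod]
    congr 1
    funext y
    rw [cubeMap_eq, polyEval_affine]
  rw [h, h, h, ← Finset.sum_sub_distrib]
  exact Finset.sum_congr rfl fun ν _ => by rw [Pi.sub_apply]; ring

theorem floorIdx_of_mem_dyadic {k : ℕ} {m : Fin n → ℤ} {x : Fin n → ℝ} (hx : x ∈ dyadic k m) :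
    floorIdx k x = m :=
  mem_dyadicHalfOpen.1 fun i => ⟨(hx i).1.le, (hx i).2⟩

theorem piecewisePoly_eq (P : ℕ → (Fin n → ℤ) → MvPolynomial (Fin n) ℝ) {k : ℕ} {m : Fin n → ℤ}
    {x : Fin n → ℝ} (hx : x ∈ dyadic k m) :
    piecewisePoly P k x = MvPolynomial.eval x (P k m) := by
  rw [piecewisePoly, tsum_eq_single m, Set.indicator_of_mem hx]
  intro m' hm'
  refine Set.indicator_of_notMem (fun h => hm' ?_) _
  rw [← floorIdx_of_mem_dyadic h, floorIdx_of_mem_dyadic hx]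

theorem measurable_splineApprox {l : ℕ} (hl : l ≠ 0)
    (P : ℕ → (Fin n → ℤ) → MvPolynomial (Fin n) ℝ) (k : ℕ) : Measurable (splineApprox l P k) :=
  measurable_splineSum hl _ _

/-- A polynomial c close to φ on all cubes of the box around m is reproduced by the
quasi-interpolant. Hence T_k - c is on Q_{k,m} a spline whose coefficients come from P_{k,m'} - c on
the neighbouring cubes, and these are bounded by the local errors. -/
theorem exists_eLpNorm_sub_splineApprox_le (n : ℕ) {l : ℕ} (hl : l ≠ 0) {r : ℝ≥0∞} (hr : r ≠ 0)
    (A : ℝ≥0) :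
    ∃ C : ℝ≥0, ∀ (φ : (Fin n → ℝ) → ℝ) (P : ℕ → (Fin n → ℤ) → MvPolynomial (Fin n) ℝ) (k : ℕ)
      (ω : (Fin n → ℤ) → ℝ≥0∞), Measurable φ → (∀ m, CoordDegLE l (P k m)) →
      (∀ m, ∃ c : (Fin n → Fin (l + 1)) → ℝ, ∀ e ∈ intBox n l,
        eLpNorm (fun x => φ x - polyEval c x) r (cubeMeas k (m + e)) ≤ ω m) →
      (∀ m, eLpNorm (fun x => φ x - MvPolynomial.eval x (P k m)) r (cubeMeas k m) ≤ A * ω m) →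
      ∀ m, eLpNorm (fun x => φ x - splineApprox l P k x) r (cubeMeas k m) ≤
        C * ∑ e ∈ intBox n l, ω (m + e) := by
  obtain ⟨C₁, hC₁, h₁⟩ := exists_abs_splineSum_le n hl
  obtain ⟨C₂, h₂⟩ := exists_abs_coeffFun_le n l hr
  set q := (quasiConst r 2).toNNReal with hq
  have hqe : (q : ℝ≥0∞) = quasiConst r 2 := ENNReal.coe_toNNReal (quasiConst_ne_top _ _)
  set M : ℝ≥0 := ((intBox n l).card : ℝ≥0) with hM
  refine ⟨q * (1 + C₁.toNNReal * C₂ * q * (A + M)), fun φ P k ω hφ hP hω hPω m => ?_⟩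
  obtain ⟨c, hc⟩ := hω m
  choose cP hcP using fun m => exists_polyEval_eq_eval (hP m)
  have h0 : (0 : Fin n → ℤ) ∈ intBox n l := mem_intBox.2 fun i => by simp
  set W : ℝ≥0∞ := ∑ e ∈ intBox n l, ω (m + e) with hW
  have hle : ∀ e ∈ intBox n l, ω (m + e) ≤ W := fun e he =>
    Finset.single_le_sum (f := fun e => ω (m + e)) (fun _ _ => zero_le) he
  have hle0 : ω m ≤ W := by simpa using hle 0 h0
  set b : (Fin n → ℤ) → ℝ := fun m' => coeffFun l k m' (polyEval (cP m' - c)) with hb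
  have hbe : ∀ m', coeffFun l k m' (piecewisePoly P k) - coeffFun l k m' (polyEval c) = b m' := by
    intro m'
    rw [hb]
    simp only [coeffFun_polyEval_sub]
    congr 1
    rw [coeffFun_eq_refCoeff, coeffFun_eq_refCoeff]
    refine EventuallyEq.refCoeff_eq ?_
    filter_upwards [(isOpen_dyadic (n := n) 0 0).mem_nhds fun i => by norm_num] with y hy
    have hy' : cubeMap k m' y ∈ dyadic k m' := fun i => by
      have h1 := hy i
      simp only [Pi.zero_apply, Int.cast_zero, pow_zero, div_one, zero_add] at h1
      simp only [cubeMap]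
      constructor <;> refine div_lt_div_of_pos_right ?_ (by positivity) <;> linarith
    rw [piecewisePoly_eq P hy', hcP]
  have hbb : ∀ e ∈ intBox n l, ENNReal.ofReal |b (m + e)| ≤
      C₂ * (q * (A * ω (m + e) + ω m)) := by
    intro e he
    refine (h₂ k (m + e) (polyEval (cP (m + e) - c)) (cP (m + e) - c) fun x _ => rfl).trans
      (mul_le_mul_right ?_ _)
    rw [hqe]
    refine (eLpNorm_add_le_quasi hr
      (f := fun x => φ x - MvPolynomial.eval x (P k (m + e)))
      (g := fun x => φ x - polyEval c x) ?_ ?_ (Eventually.of_forall fun x => ?_)).trans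
      (mul_le_mul_right (add_le_add (hPω _) (hc e he)) _)
    · refine (hφ.sub ?_).aemeasurable
      simp only [hcP]
      exact (continuous_polyEval _).measurable
    · exact (hφ.sub (continuous_polyEval c).measurable).aemeasurable
    · have h3 : polyEval (cP (m + e) - c) x =
          (φ x - polyEval c x) - (φ x - MvPolynomial.eval x (P k (m + e))) := by
        rw [hcP, sub_eq_add_neg (cP (m + e)) c, polyEval_add, ← neg_one_smul ℝ c, polyEval_smul]
        ring
      rw [h3]
      exact (abs_sub _ _).trans_eq (add_comm _ _)
  have hT : ∀ x, splineApprox l P k x - polyEval c x = splineSum l k b x := fun x => by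
    rw [← splineSum_coeffFun_polyEval hl k c x, splineApprox, quasiInterp, splineSum_sub hl]
    simp only [hbe]
  have hB : eLpNorm (fun x => splineApprox l P k x - polyEval c x) r (cubeMeas k m) ≤
      C₁.toNNReal * (C₂ * (q * ((A + M) * W))) := by
    have h4 : ∀ᵐ x ∂cubeMeas k m, ‖splineApprox l P k x - polyEval c x‖ₑ ≤
        C₁.toNNReal * (C₂ * (q * ((A + M) * W))) := by
      refine (ae_mem_dyadicHalfOpen k m).mono fun x hx => ?_
      rw [hT, Real.enorm_eq_ofReal_abs]
      refine (ENNReal.ofReal_le_ofReal (h₁ k b x)).trans ?_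
      rw [hx, ENNReal.ofReal_mul hC₁, ENNReal.ofReal_sum_of_nonneg fun _ _ => abs_nonneg _]
      refine mul_le_mul_right ?_ _
      refine (Finset.sum_le_sum hbb).trans ?_
      · rw [← Finset.mul_sum, ← Finset.mul_sum, Finset.sum_add_distrib, ← Finset.mul_sum,
          Finset.sum_const, nsmul_eq_mul, add_mul]
        refine mul_le_mul_right (mul_le_mul_right (add_le_add le_rfl ?_) _) _
        rw [hM]
        push_cast
        exact mul_le_mul_right hle0 _
    refine (eLpNorm_mono_ennreal_ae (g := fun _ => _) h4).trans ?_
    rw [eLpNorm_const _ hr (IsProbabilityMeasure.ne_zero _)]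
    simp
  have hA : eLpNorm (fun x => φ x - polyEval c x) r (cubeMeas k m) ≤ W := by
    have := hc 0 h0
    rw [add_zero] at this
    exact this.trans hle0
  refine (eLpNorm_add_le_quasi hr (hφ.sub (continuous_polyEval c).measurable).aemeasurable
    ((measurable_splineApprox hl P k).sub (continuous_polyEval c).measurable).aemeasurable
    (Eventually.of_forall fun x => ?_)).trans ((mul_le_mul_right (add_le_add hA hB) _).trans_eq ?_)
  · rw [show φ x - splineApprox l P k x = (φ x - polyEval c x) -
      (splineApprox l P k x - polyEval c x) by ring]
    exact abs_sub _ _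
  · rw [← hqe]
    push_cast
    ring

/-- The terms of the quasi-norm in the space of variable smoothness. -/
def besovTerm (l : ℕ) (p r : ℝ≥0∞) (t : ℕ → (Fin n → ℝ) → ℝ) (φ : (Fin n → ℝ) → ℝ) : ℕ → ℝ≥0∞
  | 0 => eLpNorm (fun x => ENNReal.ofReal (t 0 x) * eLpNorm φ r (volume.restrict (cube x 2)))
      p volume
  | k + 1 => eLpNorm (fun x => ENNReal.ofReal (t (k + 1) x) *
      deltaOsc l r x (2 * (1 / 2 ^ (k + 1))) φ) p volume

theorem besovNorm_eq (l : ℕ) (p q r : ℝ≥0∞) (t : ℕ → (Fin n → ℝ) → ℝ) (φ : (Fin n → ℝ) → ℝ) :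
    besovNorm l p q r t φ =
      lNorm q (fun k => besovTerm l p r t φ (k + 1)) + besovTerm l p r t φ 0 := rfl

theorem lNorm_le_succ {q : ℝ≥0∞} (hq : q ≠ 0) (a : ℕ → ℝ≥0∞) :
    lNorm q a ≤ quasiConst q 2 * (lNorm q (fun k => a (k + 1)) + a 0) := by
  set f : Fin 2 → ℕ → ℝ≥0∞ :=
    ![fun k => if k = 0 then 0 else a k, fun k => if k = 0 then a 0 else 0] with hf
  have h1 : lNorm q a ≤ lNorm q (fun k => ∑ i ∈ (Finset.univ : Finset (Fin 2)), f i k) := by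
    refine lNorm_mono fun k => ?_
    rw [Fin.sum_univ_two]
    simp only [hf, Matrix.cons_val_zero, Matrix.cons_val_one]
    by_cases hk : k = 0 <;> simp [hk]
  have h2 : lNorm q (f 0) ≤ lNorm q (fun k => a (k + 1)) := by
    simp only [hf, Matrix.cons_val_zero]
    unfold lNorm
    split_ifs with h
    · refine iSup_le fun k => ?_
      cases k with
      | zero => simp
      | succ k => simpa using le_iSup (fun k => a (k + 1)) k
    · have h0 := ENNReal.toReal_pos hq h
      rw [tsum_eq_zero_add' ENNReal.summable]
      simp [ENNReal.zero_rpow_of_pos h0]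
  have h3 : lNorm q (f 1) ≤ a 0 := by
    have hf1 : f 1 = fun k => if k = 0 then a 0 else 0 := rfl
    rw [hf1]
    unfold lNorm
    split_ifs with h
    · refine iSup_le fun k => ?_
      by_cases hk : k = 0 <;> simp [hk]
    · have h0 := ENNReal.toReal_pos hq h
      rw [tsum_eq_zero_add' ENNReal.summable]
      simp only [Nat.add_eq_zero_iff, one_ne_zero, and_false, if_false, if_true,
        ENNReal.zero_rpow_of_pos h0, tsum_zero, add_zero, one_div]
      rw [ENNReal.rpow_rpow_inv h0.ne']
  refine h1.trans ((lNorm_sum_le hq _ _).trans ?_)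
  rw [Fin.sum_univ_two, Finset.card_univ, Fintype.card_fin]
  exact mul_le_mul_right (add_le_add h2 h3) _

theorem lNorm_besovTerm_le {q : ℝ≥0∞} (hq : q ≠ 0) (l : ℕ) (p r : ℝ≥0∞)
    (t : ℕ → (Fin n → ℝ) → ℝ) (φ : (Fin n → ℝ) → ℝ) :
    lNorm q (besovTerm l p r t φ) ≤ quasiConst q 2 * besovNorm l p q r t φ :=
  lNorm_le_succ hq _

theorem besovTerm_le {q : ℝ≥0∞} (hq : q ≠ 0) (l : ℕ) (p r : ℝ≥0∞) (t : ℕ → (Fin n → ℝ) → ℝ)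
    (φ : (Fin n → ℝ) → ℝ) (k : ℕ) : besovTerm l p r t φ k ≤ besovNorm l p q r t φ := by
  rw [besovNorm_eq]
  cases k with
  | zero => exact le_add_self
  | succ k =>
    exact (le_lNorm hq (fun k => besovTerm l p r t φ (k + 1)) k).trans le_self_add

variable {p : ℝ≥0∞} {t : ℕ → (Fin n → ℝ) → ℝ} {α₁ α₂ α₃ : ℝ} {σ₁ σ₂ : ℝ≥0∞}

/-- The errors of local polynomial approximation are controlled by the terms of the quasi-norm. -/
theorem WeightClass.exists_local_error (ht : WeightClass p α₁ α₂ α₃ σ₁ σ₂ t) (hp : p ≠ 0) {l : ℕ}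
    (hl : l ≠ 0) {r : ℝ≥0∞} (hr : r ≠ 0) :
    ∃ C : ℝ≥0, ∀ φ : (Fin n → ℝ) → ℝ, Measurable φ → MemLpLoc r φ →
      ∃ ω : ℕ → (Fin n → ℤ) → ℝ≥0∞,
        (∀ k m, ∃ c : (Fin n → Fin (l + 1)) → ℝ, ∀ e ∈ intBox n l,
          eLpNorm (fun x => φ x - polyEval c x) r (cubeMeas k (m + e)) ≤ ω k m) ∧
        (∀ m, eLpNorm φ r (cubeMeas 0 m) ≤ ω 0 m) ∧
        ∀ k, lNorm p (fun m => assoc p t k m * ω k m) ≤ C * besovTerm l p r t φ k := by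
  obtain ⟨C₁, U, h₁⟩ := exists_whitney_dyadic n hl hr l
  obtain ⟨C₂, h₂⟩ := exists_oscCube_le_deltaOsc n l r
  obtain ⟨C₃, h₃⟩ := ht.exists_lNorm_box_le hp U
  obtain ⟨C₄, h₄⟩ := ht.exists_lNorm_box_le hp l
  refine ⟨C₄ + C₁ * C₃ * C₂, fun φ hφ hφ' => ?_⟩
  have hpos : ∀ k x, 0 < t k x := fun k => (ht.admissible k).1.2
  -- At level 0 the quasi-norm measures φ itself and not its differences, so the approximating
  -- polynomial is zero; at higher levels ω is the Whitney bound.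
  refine ⟨fun k m => if k = 0 then ∑ e ∈ intBox n l, eLpNorm φ r (cubeMeas 0 (m + e)) else
    C₁ * ∑ e ∈ intBox n U, oscCube l r φ k (m + e), fun k m => ?_, fun m => ?_, fun k => ?_⟩
  · by_cases hk : k = 0
    · subst hk
      refine ⟨0, fun e he => ?_⟩
      have : ∀ x : Fin n → ℝ, polyEval (0 : (Fin n → Fin (l + 1)) → ℝ) x = 0 := fun x => by
        simp [polyEval]
      simp only [this, sub_zero, if_true]
      exact Finset.single_le_sum (f := fun e => eLpNorm φ r (cubeMeas 0 (m + e)))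
        (fun _ _ => zero_le) he
    · simpa only [hk, if_false] using h₁ φ hφ hφ' k m
  · simp only [if_true]
    have := Finset.single_le_sum (f := fun e => eLpNorm φ r (cubeMeas 0 (m + e)))
      (fun _ _ => zero_le) (mem_intBox.2 fun i => by simp : (0 : Fin n → ℤ) ∈ intBox n l)
    simpa using this
  · cases k with
    | zero =>
      simp only [if_true]
      refine (h₄ 0 fun m => eLpNorm φ r (cubeMeas 0 m)).trans ?_
      rw [lNorm_assoc_mul hp (hpos 0) (ht.assoc_ne_zero 0) fun m => eLpNorm φ r (cubeMeas 0 m)]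
      refine mul_le_mul' (by push_cast; exact le_self_add) (eLpNorm_mono_ennreal fun x => ?_)
      rw [enorm_eq_self]
      refine mul_le_mul_right ?_ _
      rw [cubeMeas_zero]
      refine eLpNorm_mono_measure _ (Measure.restrict_mono ?_ le_rfl)
      simpa using dyadicHalfOpen_subset_cube (k := 0) (x := x) rfl
    | succ k =>
      have h6 : (fun m => assoc p t (k + 1) m * (if k + 1 = 0 then
          ∑ e ∈ intBox n l, eLpNorm φ r (cubeMeas 0 (m + e)) else
          C₁ * ∑ e ∈ intBox n U, oscCube l r φ (k + 1) (m + e))) = fun m => C₁ *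
          (assoc p t (k + 1) m * ∑ e ∈ intBox n U, oscCube l r φ (k + 1) (m + e)) := by
        funext m
        rw [if_neg (Nat.succ_ne_zero k), mul_left_comm]
      rw [h6, lNorm_const_mul hp]
      refine (mul_le_mul_right (h₃ (k + 1) (oscCube l r φ (k + 1))) _).trans ?_
      rw [lNorm_assoc_mul hp (hpos (k + 1)) (ht.assoc_ne_zero (k + 1)) (oscCube l r φ (k + 1))]
      have h5 : eLpNorm (fun x => ENNReal.ofReal (t (k + 1) x) *
          oscCube l r φ (k + 1) (floorIdx (k + 1) x)) p volume ≤
          C₂ * besovTerm l p r t φ (k + 1) := by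
        rw [besovTerm, ← eLpNorm_const_mul_ennreal hp _ ENNReal.coe_ne_top]
        refine eLpNorm_mono_ennreal fun x => ?_
        rw [enorm_eq_self, mul_left_comm]
        exact mul_le_mul_right (h₂ φ (k + 1) x) _
      refine (mul_le_mul_right (mul_le_mul_right h5 _) _).trans ?_
      rw [← mul_assoc, ← mul_assoc]
      refine mul_le_mul_left ?_ _
      push_cast
      exact le_add_self

end Approximation

/-! ### The quasi-interpolants of a function of variable smoothness -/

section Decomposition

variable {n : ℕ}

theorem exists_splineIncrement_eq {l : ℕ} (hl : l ≠ 0)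
    (P : ℕ → (Fin n → ℤ) → MvPolynomial (Fin n) ℝ) (k : ℕ) :
    ∃ b : (Fin n → ℤ) → ℝ, splineIncrement l P k = splineSum l k b := by
  cases k with
  | zero => exact ⟨_, rfl⟩
  | succ k =>
    obtain ⟨b', hb'⟩ := exists_splineSum_succ_eq hl k fun m => coeffFun l k m (piecewisePoly P k)
    refine ⟨fun m => coeffFun l (k + 1) m (piecewisePoly P (k + 1)) - b' m, funext fun x => ?_⟩
    change splineApprox l P (k + 1) x - splineApprox l P k x = _
    rw [splineApprox, splineApprox, quasiInterp, quasiInterp, hb', splineSum_sub hl]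

/-- The increment is a spline of level k, so by duality its functionals are its coefficients and
nothing is lost in the expansion. -/
theorem splineSum_coeffFun_splineIncrement {l : ℕ} (hl : l ≠ 0)
    (P : ℕ → (Fin n → ℤ) → MvPolynomial (Fin n) ℝ) (k : ℕ) :
    splineSum l k (fun m => coeffFun l k m (splineIncrement l P k)) = splineIncrement l P k := by
  obtain ⟨b, hb⟩ := exists_splineIncrement_eq hl P k
  simp only [hb, coeffFun_splineSum hl]

theorem sum_splineIncrement (l : ℕ) (P : ℕ → (Fin n → ℤ) → MvPolynomial (Fin n) ℝ) (N : ℕ)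
    (x : Fin n → ℝ) :
    ∑ k ∈ Finset.range (N + 1), splineIncrement l P k x = splineApprox l P N x := by
  induction N with
  | zero => simp [splineIncrement]
  | succ N ih =>
    rw [Finset.sum_range_succ, ih, splineIncrement]
    ring

theorem measurable_splineIncrement {l : ℕ} (hl : l ≠ 0)
    (P : ℕ → (Fin n → ℤ) → MvPolynomial (Fin n) ℝ) (k : ℕ) :
    Measurable (splineIncrement l P k) := by
  obtain ⟨b, hb⟩ := exists_splineIncrement_eq hl P k
  rw [hb]
  exact measurable_splineSum hl k b

/-- Comparison of norms on a cube with norms on smaller cubes. -/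
theorem eLpNorm_le_comp_floorIdx {r : ℝ≥0∞} (hr : r ≠ 0) {k j : ℕ} (hkj : k ≤ j) (m : Fin n → ℤ)
    {F : (Fin n → ℝ) → ℝ} {a : (Fin n → ℤ) → ℝ≥0∞}
    (h : ∀ m', eLpNorm F r (cubeMeas j m') ≤ a m') :
    eLpNorm F r (cubeMeas k m) ≤ eLpNorm (fun x => a (floorIdx j x)) r (cubeMeas k m) := by
  have hπ : ∀ m' : Fin n → ℤ, MeasurableSet (floorIdx j ⁻¹' {m'} : Set (Fin n → ℝ)) := fun m' => by
    rw [← dyadicHalfOpen_eq]; exact measurableSet_dyadicHalfOpen j m'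
  rw [eLpNorm_eq_lNorm_fibres hr hπ F,
    eLpNorm_eq_lNorm_fibres hr hπ (fun x => a (floorIdx j x))]
  refine lNorm_mono fun m' => ?_
  have h1 : (cubeMeas k m).restrict (floorIdx j ⁻¹' {m'}) =
      (2 : ℝ≥0∞) ^ (k * n) • volume.restrict (dyadicHalfOpen j m' ∩ dyadicHalfOpen k m) := by
    rw [cubeMeas, Measure.restrict_smul, Measure.restrict_restrict (hπ m'), dyadicHalfOpen_eq j m']
  by_cases hm : ancestor (j - k) m' = m
  · have h2 : dyadicHalfOpen j m' ∩ dyadicHalfOpen k m = dyadicHalfOpen j m' := by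
      refine Set.inter_eq_left.2 fun x hx => ?_
      rw [mem_dyadicHalfOpen] at hx ⊢
      rw [floorIdx_eq_ancestor hkj, hx, hm]
    have h3 : (cubeMeas k m).restrict (floorIdx j ⁻¹' {m'}) =
        ((2 : ℝ≥0∞) ^ (k * n) * ((2 : ℝ≥0∞) ^ (j * n))⁻¹) • cubeMeas j m' := by
      rw [h1, h2, cubeMeas, smul_smul, mul_assoc, ENNReal.inv_mul_cancel (by simp) (by finiteness),
        mul_one]
    have h4 : eLpNorm (fun x => a (floorIdx j x)) r (cubeMeas j m') = a m' := by
      rw [eLpNorm_congr_ae (g := fun _ => a m') ((ae_mem_dyadicHalfOpen j m').mono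
        fun x hx => by simp only [hx]), eLpNorm_const _ hr (IsProbabilityMeasure.ne_zero _)]
      simp
    have hc : (2 : ℝ≥0∞) ^ (k * n) * ((2 : ℝ≥0∞) ^ (j * n))⁻¹ ≠ 0 :=
      mul_ne_zero (by simp) (ENNReal.inv_ne_zero.2 (by finiteness))
    rw [h3, eLpNorm_smul_measure_of_ne_zero hc, eLpNorm_smul_measure_of_ne_zero hc, h4,
      smul_eq_mul, smul_eq_mul]
    exact mul_le_mul_right (h m') _
  · have h2 : dyadicHalfOpen j m' ∩ dyadicHalfOpen k m = ∅ := by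
      refine Set.eq_empty_iff_forall_notMem.2 fun x hx => hm ?_
      rw [← mem_dyadicHalfOpen.1 hx.1, ← floorIdx_eq_ancestor hkj, mem_dyadicHalfOpen.1 hx.2]
    rw [h1, h2]
    simp

theorem eLpNorm_cubeMeas_succ_le (r : ℝ≥0∞) (k : ℕ) (m : Fin n → ℤ) (F : (Fin n → ℝ) → ℝ) :
    eLpNorm F r (cubeMeas (k + 1) m) ≤
      ((2 : ℝ≥0∞) ^ n) ^ (1 / r).toReal * eLpNorm F r (cubeMeas k (ancestor 1 m)) := by
  rw [← smul_eq_mul, ← eLpNorm_smul_measure_of_ne_zero (by positivity)]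
  refine eLpNorm_mono_measure _ ?_
  rw [cubeMeas, cubeMeas, smul_smul, ← pow_add, show n + k * n = (k + 1) * n by ring]
  refine fun s => mul_le_mul_right ?_ _
  refine Measure.restrict_mono (fun x hx => ?_) le_rfl s
  rw [mem_dyadicHalfOpen] at hx ⊢
  rw [floorIdx_eq_ancestor (Nat.le_succ k), hx, Nat.succ_sub le_rfl, Nat.sub_self]

theorem exists_eLpNorm_restrict_le_sum {r : ℝ≥0∞} (hr : r ≠ 0) {K : Set (Fin n → ℝ)}
    (hK : IsCompact K) : ∃ s : Finset (Fin n → ℤ), ∀ F : (Fin n → ℝ) → ℝ, AEMeasurable F volume →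
      eLpNorm F r (volume.restrict K) ≤ quasiConst r s.card *
        ∑ m ∈ s, eLpNorm F r (cubeMeas 0 m) := by
  obtain ⟨R, hR⟩ := hK.isBounded.subset_closedBall 0
  obtain ⟨N, hN⟩ := exists_nat_ge R
  refine ⟨intBox n (N + 1), fun F hF => ?_⟩
  simp only [cubeMeas_zero]
  refine eLpNorm_restrict_le_sum hr _ hK.measurableSet
    (fun m _ => measurableSet_dyadicHalfOpen 0 m) (fun x hx => ?_) hF
  refine Set.mem_iUnion₂.2 ⟨floorIdx 0 x, floorIdx_zero_mem_intBox ?_, mem_dyadicHalfOpen.2 rfl⟩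
  exact (mem_closedBall_zero_iff.1 (hR hx)).trans hN

theorem tendstoLpLoc_of_cubeMeas {r : ℝ≥0∞} (hr : r ≠ 0) {F : ℕ → (Fin n → ℝ) → ℝ}
    {f : (Fin n → ℝ) → ℝ} (hF : ∀ N, AEMeasurable (F N) volume) (hf : AEMeasurable f volume)
    (h : ∀ m, Tendsto (fun N => eLpNorm (fun x => F N x - f x) r (cubeMeas 0 m)) atTop (𝓝 0)) :
    TendstoLpLoc r F f := by
  intro K hK
  obtain ⟨s, hs⟩ := exists_eLpNorm_restrict_le_sum hr hK
  have h1 : Tendsto (fun N => quasiConst r s.card *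
      ∑ m ∈ s, eLpNorm (fun x => F N x - f x) r (cubeMeas 0 m)) atTop (𝓝 0) := by
    have h2 := ENNReal.Tendsto.const_mul (a := quasiConst r s.card)
      (tendsto_finsetSum s fun m _ => h m) (Or.inr (quasiConst_ne_top _ _))
    simpa using h2
  exact tendsto_of_tendsto_of_tendsto_of_le_of_le tendsto_const_nhds h1 (fun _ => zero_le)
    fun N => hs _ ((hF N).sub hf)

variable {p : ℝ≥0∞} {t : ℕ → (Fin n → ℝ) → ℝ} {α₁ α₂ α₃ : ℝ} {σ₁ : ℝ≥0∞}

/-- The decay rate of the norms on large cubes. -/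
theorem two_rpow_neg_lt_one {x : ℝ} (hx : 0 < x) : (2 : ℝ≥0∞) ^ (-x) < 1 := by
  rw [ENNReal.rpow_neg, ENNReal.inv_lt_one]
  exact ENNReal.one_lt_rpow (by norm_num) hx

/-- The lower transfer from level k to level 0 gains ρ^k with ρ < 1; on a fixed unit cube the weight
is a positive finite number and can be divided out. -/
theorem WeightClass.tendsto_eLpNorm_cubeMeas (ht : WeightClass p α₁ α₂ α₃ σ₁ p t)
    (hp : p ≠ 0) (hσ : σ₁ ≠ 0) {θ r : ℝ≥0∞} (hθ : θ ≠ 0) (hθr : θ ≤ r)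
    (hH : θ⁻¹ = p⁻¹ + σ₁⁻¹) (hα₁ : (n : ℝ) * ((θ⁻¹).toReal - (r⁻¹).toReal) < α₁)
    {F : ℕ → (Fin n → ℝ) → ℝ} {a : ℕ → (Fin n → ℤ) → ℝ≥0∞}
    (h : ∀ k m, eLpNorm (F k) r (cubeMeas k m) ≤ a k m) {S : ℝ≥0∞} (hS : S ≠ ∞)
    (haS : ∀ k, lNorm p (fun m => assoc p t k m * a k m) ≤ S) (m : Fin n → ℤ) :
    Tendsto (fun k => eLpNorm (F k) r (cubeMeas 0 m)) atTop (𝓝 0) := by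
  have hr : r ≠ 0 := (lt_of_lt_of_le (pos_iff_ne_zero.2 hθ) hθr).ne'
  obtain ⟨C, hC⟩ := ht.exists_lNorm_comp_floorIdx_le hp hσ hθ hθr hH
  set ρ : ℝ≥0∞ := (2 : ℝ≥0∞) ^ (-(α₁ - n * ((θ⁻¹).toReal - (r⁻¹).toReal))) with hρ
  have hρ1 : ρ < 1 := two_rpow_neg_lt_one (by linarith)
  have h0 := ht.assoc_ne_zero 0 m
  have h0' := ht.assoc_ne_top 0 m
  have hle : ∀ k, eLpNorm (F k) r (cubeMeas 0 m) ≤ (assoc p t 0 m)⁻¹ * (C * S) * ρ ^ k := by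
    intro k
    have h1 := (le_lNorm hp (fun m => assoc p t 0 m *
      eLpNorm (fun x => a k (floorIdx k x)) r (cubeMeas 0 m)) m).trans (hC 0 k (Nat.zero_le k) (a k))
    rw [Nat.sub_zero] at h1
    have h2 : eLpNorm (F k) r (cubeMeas 0 m) ≤
        eLpNorm (fun x => a k (floorIdx k x)) r (cubeMeas 0 m) :=
      eLpNorm_le_comp_floorIdx hr (Nat.zero_le k) m (h k)
    calc eLpNorm (F k) r (cubeMeas 0 m)
        ≤ (assoc p t 0 m)⁻¹ * (assoc p t 0 m *
          eLpNorm (fun x => a k (floorIdx k x)) r (cubeMeas 0 m)) := by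
          rw [← mul_assoc, ENNReal.inv_mul_cancel h0 h0', one_mul]; exact h2
      _ ≤ (assoc p t 0 m)⁻¹ * (C * ρ ^ k * S) :=
          mul_le_mul_right (h1.trans (mul_le_mul_right (haS k) _)) _
      _ = _ := by ring
  have hlim : Tendsto (fun k => (assoc p t 0 m)⁻¹ * (C * S) * ρ ^ k) atTop (𝓝 0) := by
    have := ENNReal.Tendsto.const_mul (a := (assoc p t 0 m)⁻¹ * (C * S))
      (ENNReal.tendsto_pow_atTop_nhds_zero_of_lt_one hρ1) (Or.inr (ENNReal.mul_ne_top
        (ENNReal.inv_ne_top.2 h0) (ENNReal.mul_ne_top ENNReal.coe_ne_top hS)))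
    simpa using this
  exact tendsto_of_tendsto_of_tendsto_of_le_of_le tendsto_const_nhds hlim (fun _ => zero_le) hle

theorem WeightClass.exists_lNorm_sub_splineApprox_le (ht : WeightClass p α₁ α₂ α₃ σ₁ p t)
    (hp : p ≠ 0) {l : ℕ} (hl : l ≠ 0) {r : ℝ≥0∞} (hr : r ≠ 0) (A C₀ : ℝ≥0) :
    ∃ C : ℝ≥0, ∀ (φ : (Fin n → ℝ) → ℝ) (P : ℕ → (Fin n → ℤ) → MvPolynomial (Fin n) ℝ)
      (ω : ℕ → (Fin n → ℤ) → ℝ≥0∞), Measurable φ → (∀ k m, CoordDegLE l (P k m)) →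
      (∀ k m, ∃ c : (Fin n → Fin (l + 1)) → ℝ, ∀ e ∈ intBox n l,
        eLpNorm (fun x => φ x - polyEval c x) r (cubeMeas k (m + e)) ≤ ω k m) →
      (∀ k, lNorm p (fun m => assoc p t k m * ω k m) ≤ C₀ * besovTerm l p r t φ k) →
      (∀ k m, eLpNorm (fun x => φ x - MvPolynomial.eval x (P k m)) r (cubeMeas k m) ≤
        A * ω k m) →
      ∀ k, lNorm p (fun m => assoc p t k m *
        eLpNorm (fun x => φ x - splineApprox l P k x) r (cubeMeas k m)) ≤
          C * besovTerm l p r t φ k := by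
  obtain ⟨C₁, h₁⟩ := exists_eLpNorm_sub_splineApprox_le n hl hr A
  obtain ⟨C₂, h₂⟩ := ht.exists_lNorm_box_le hp l
  refine ⟨C₁ * (C₂ * C₀), fun φ P ω hφ hP hω hωC hPω k => ?_⟩
  calc lNorm p (fun m => assoc p t k m *
        eLpNorm (fun x => φ x - splineApprox l P k x) r (cubeMeas k m))
      ≤ lNorm p (fun m => C₁ * (assoc p t k m * ∑ e ∈ intBox n l, ω k (m + e))) := by
        refine lNorm_mono fun m => ?_
        rw [mul_left_comm]
        exact mul_le_mul_right (h₁ φ P k (ω k) hφ (hP k) (hω k) (hPω k) m) _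
    _ = C₁ * lNorm p (fun m => assoc p t k m * ∑ e ∈ intBox n l, ω k (m + e)) :=
        lNorm_const_mul hp _ _
    _ ≤ C₁ * (C₂ * (C₀ * besovTerm l p r t φ k)) :=
        mul_le_mul_right ((h₂ k (ω k)).trans (mul_le_mul_right (hωC k) _)) _
    _ = _ := by push_cast; ring

end Decomposition

/-! ### Decomposition into splines -/

section DecompositionNorm

variable {n : ℕ}

/-- The index shift is treated as a case of the discrete Hardy inequality with ratio 1/2: the term
at the same index costs 1, the preceding one costs 2, hence the factor 3. -/
theorem lNorm_le_of_le_add_pred {q C : ℝ≥0∞} (hq : q ≠ 0) {E τ : ℕ → ℝ≥0∞} (h0 : E 0 ≤ C * τ 0)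
    (h : ∀ k, E (k + 1) ≤ C * (τ (k + 1) + τ k)) :
    lNorm q E ≤ C * 3 * ((2 * (1 - (2⁻¹ : ℝ≥0∞) ^ q.toReal)⁻¹) ^ (q.toReal⁻¹) * lNorm q τ) := by
  have hle : ∀ k, τ k ≤ ⨆ j, (2⁻¹ : ℝ≥0∞) ^ idxDist j k * τ j := fun k => by
    refine le_trans (le_of_eq ?_) (le_iSup (fun j => (2⁻¹ : ℝ≥0∞) ^ idxDist j k * τ j) k)
    simp [idxDist]
  have hle' : ∀ k, τ k ≤ 2 * ⨆ j, (2⁻¹ : ℝ≥0∞) ^ idxDist j (k + 1) * τ j := fun k => by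
    refine le_trans (le_of_eq ?_) (mul_le_mul_right
      (le_iSup (fun j => (2⁻¹ : ℝ≥0∞) ^ idxDist j (k + 1) * τ j) k) 2)
    have : idxDist k (k + 1) = 1 := by simp [idxDist]
    rw [this, pow_one, ← mul_assoc, ENNReal.mul_inv_cancel (by norm_num) (by norm_num), one_mul]
  refine le_trans (lNorm_mono (b := fun k => C * 3 * ⨆ j, (2⁻¹ : ℝ≥0∞) ^ idxDist j k * τ j)
    fun k => ?_) ?_
  · cases k with
    | zero =>
      refine h0.trans (mul_le_mul' ?_ (hle 0))
      exact le_mul_of_one_le_right zero_le (by norm_num)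
    | succ k =>
      refine (h k).trans ?_
      rw [mul_assoc]
      refine mul_le_mul_right ((add_le_add (hle (k + 1)) (hle' k)).trans_eq ?_) _
      ring
  · rw [lNorm_const_mul hq]
    exact mul_le_mul_right (lNorm_iSup_geo_le hq (by norm_num) τ) _

/-- On Q_{k,m} the increment is a polynomial, so its functional is bounded by its L_r norm there.
Inserting φ leaves the errors of two consecutive levels, the coarser one measured on the parent
cube. -/
theorem exists_ofReal_abs_coeffFun_splineIncrement_le (n : ℕ) {l : ℕ} (hl : l ≠ 0) {r : ℝ≥0∞}
    (hr : r ≠ 0) :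
    ∃ C : ℝ≥0, ∀ (φ : (Fin n → ℝ) → ℝ) (P : ℕ → (Fin n → ℤ) → MvPolynomial (Fin n) ℝ),
      Measurable φ →
      (∀ m, ENNReal.ofReal |coeffFun l 0 m (splineIncrement l P 0)| ≤
        C * (eLpNorm φ r (cubeMeas 0 m) +
          eLpNorm (fun x => φ x - splineApprox l P 0 x) r (cubeMeas 0 m))) ∧
      ∀ k m, ENNReal.ofReal |coeffFun l (k + 1) m (splineIncrement l P (k + 1))| ≤
        C * (eLpNorm (fun x => φ x - splineApprox l P (k + 1) x) r (cubeMeas (k + 1) m) +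
          eLpNorm (fun x => φ x - splineApprox l P k x) r (cubeMeas k (ancestor 1 m))) := by
  obtain ⟨C₁, h₁⟩ := exists_abs_coeffFun_le n l hr
  set D : ℝ≥0∞ := ((2 : ℝ≥0∞) ^ n) ^ (1 / r).toReal with hD
  have hDt : D ≠ ∞ := ENNReal.rpow_ne_top_of_nonneg (by positivity) (by finiteness)
  have hqt := quasiConst_ne_top r 2
  set Q := quasiConst r 2 with hQ
  have hCt : C₁ * Q * (1 + D) ≠ ∞ := ENNReal.mul_ne_top (ENNReal.mul_ne_top ENNReal.coe_ne_top hqt)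
    (ENNReal.add_ne_top.2 ⟨ENNReal.one_ne_top, hDt⟩)
  have hC : ∀ k m (P : ℕ → (Fin n → ℤ) → MvPolynomial (Fin n) ℝ),
      ENNReal.ofReal |coeffFun l k m (splineIncrement l P k)| ≤
        C₁ * eLpNorm (splineIncrement l P k) r (cubeMeas k m) := by
    intro k m P
    obtain ⟨b, hb⟩ := exists_splineIncrement_eq hl P k
    obtain ⟨c, hc⟩ := exists_polyEval_eq_splineSum hl k b m
    rw [hb]
    exact h₁ k m (splineSum l k b) c fun x hx => hc x (floorIdx_of_mem_dyadic hx)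
  refine ⟨(C₁ * Q * (1 + D)).toNNReal, fun φ P hφ => ⟨fun m => ?_, fun k m => ?_⟩⟩
  · rw [ENNReal.coe_toNNReal hCt]
    refine (hC 0 m P).trans ?_
    have h2 : eLpNorm (splineIncrement l P 0) r (cubeMeas 0 m) ≤ Q * (eLpNorm φ r (cubeMeas 0 m) +
        eLpNorm (fun x => φ x - splineApprox l P 0 x) r (cubeMeas 0 m)) := by
      refine eLpNorm_add_le_quasi hr hφ.aemeasurable
        (hφ.sub (measurable_splineApprox hl P 0)).aemeasurable (Eventually.of_forall fun x => ?_)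
      have : splineIncrement l P 0 x = φ x - (φ x - splineApprox l P 0 x) := by
        simp [splineIncrement]
      rw [this]
      exact abs_sub _ _
    refine (mul_le_mul_right h2 _).trans ?_
    rw [← mul_assoc]
    refine mul_le_mul_left ?_ _
    exact le_mul_of_one_le_right zero_le le_self_add
  · rw [ENNReal.coe_toNNReal hCt]
    refine (hC (k + 1) m P).trans ?_
    have h2 : eLpNorm (splineIncrement l P (k + 1)) r (cubeMeas (k + 1) m) ≤
        Q * (eLpNorm (fun x => φ x - splineApprox l P (k + 1) x) r (cubeMeas (k + 1) m) +
          eLpNorm (fun x => φ x - splineApprox l P k x) r (cubeMeas (k + 1) m)) := by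
      refine eLpNorm_add_le_quasi hr (hφ.sub (measurable_splineApprox hl P (k + 1))).aemeasurable
        (hφ.sub (measurable_splineApprox hl P k)).aemeasurable (Eventually.of_forall fun x => ?_)
      have : splineIncrement l P (k + 1) x =
          (φ x - splineApprox l P k x) - (φ x - splineApprox l P (k + 1) x) := by
        simp [splineIncrement]
      rw [this]
      exact (abs_sub _ _).trans_eq (add_comm _ _)
    refine (mul_le_mul_right h2 _).trans ?_
    rw [← mul_assoc, mul_assoc (C₁ * Q)]
    refine mul_le_mul_right ?_ _
    rw [mul_add]
    refine add_le_add (le_mul_of_one_le_left zero_le le_self_add) ?_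
    exact (eLpNorm_cubeMeas_succ_le r k m _).trans (mul_le_mul_left le_add_self _)

theorem lNorm_add_le {p : ℝ≥0∞} (hp : p ≠ 0) (a b : (Fin n → ℤ) → ℝ≥0∞) :
    lNorm p (fun m => a m + b m) ≤ quasiConst p 2 * (lNorm p a + lNorm p b) := by
  have := lNorm_sum_le hp (Finset.univ : Finset (Fin 2)) ![a, b]
  simpa [Fin.sum_univ_two] using this

variable {p : ℝ≥0∞} {t : ℕ → (Fin n → ℝ) → ℝ} {α₁ α₂ α₃ : ℝ} {σ₁ : ℝ≥0∞}

theorem WeightClass.exists_spline_decomposition (ht : WeightClass p α₁ α₂ α₃ σ₁ p t)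
    (hp : p ≠ 0) (hσ : σ₁ ≠ 0) {θ r : ℝ≥0∞} (hθ : θ ≠ 0) (hθr : θ ≤ r)
    (hH : θ⁻¹ = p⁻¹ + σ₁⁻¹) (hα₁ : (n : ℝ) * ((θ⁻¹).toReal - (r⁻¹).toReal) < α₁)
    {l : ℕ} (hl : l ≠ 0) {q : ℝ≥0∞} (hq : q ≠ 0) (A C₀ : ℝ≥0) :
    ∃ C : ℝ≥0, ∀ (φ : (Fin n → ℝ) → ℝ) (P : ℕ → (Fin n → ℤ) → MvPolynomial (Fin n) ℝ)
      (ω : ℕ → (Fin n → ℤ) → ℝ≥0∞), Measurable φ → besovNorm l p q r t φ ≠ ∞ →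
      (∀ k m, CoordDegLE l (P k m)) →
      (∀ k m, ∃ c : (Fin n → Fin (l + 1)) → ℝ, ∀ e ∈ intBox n l,
        eLpNorm (fun x => φ x - polyEval c x) r (cubeMeas k (m + e)) ≤ ω k m) →
      (∀ m, eLpNorm φ r (cubeMeas 0 m) ≤ ω 0 m) →
      (∀ k, lNorm p (fun m => assoc p t k m * ω k m) ≤ C₀ * besovTerm l p r t φ k) →
      (∀ k m, eLpNorm (fun x => φ x - MvPolynomial.eval x (P k m)) r (cubeMeas k m) ≤
        A * ω k m) →
      Represents l r (fun k m => coeffFun l k m (splineIncrement l P k)) φ ∧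
        N₄ l p q t P ≤ C * besovNorm l p q r t φ := by
  have hr : r ≠ 0 := (lt_of_lt_of_le (pos_iff_ne_zero.2 hθ) hθr).ne'
  obtain ⟨C₁, h₁⟩ := ht.exists_lNorm_sub_splineApprox_le hp hl hr A C₀
  obtain ⟨C₂, h₂⟩ := exists_ofReal_abs_coeffFun_splineIncrement_le n hl hr
  obtain ⟨C₃, h₃⟩ := ht.exists_lNorm_ancestor_le hp
  set B : ℝ≥0∞ := C₃ * (2 : ℝ≥0∞) ^ α₂ with hB
  set Q : ℝ≥0∞ := quasiConst p 2 with hQ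
  set G : ℝ≥0∞ := (2 * (1 - (2⁻¹ : ℝ≥0∞) ^ q.toReal)⁻¹) ^ (q.toReal⁻¹) with hG
  set D : ℝ≥0∞ := C₂ * (Q * (C₀ + C₁ + B * C₁)) with hD
  have hGt : G ≠ ∞ := fun h => by
    have h1 := geoConst_ne_top (p := q) (ρ := 2⁻¹) hq (by norm_num)
    rw [geoConst, ← hG, h, ENNReal.mul_top] at h1
    · exact h1 rfl
    · norm_num
  have hBt : B ≠ ∞ := ENNReal.mul_ne_top ENNReal.coe_ne_top (two_rpow_ne_top α₂)
  have hDt : D ≠ ∞ := by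
    refine ENNReal.mul_ne_top ENNReal.coe_ne_top (ENNReal.mul_ne_top (quasiConst_ne_top _ _) ?_)
    refine ENNReal.add_ne_top.2 ⟨?_, ENNReal.mul_ne_top hBt ENNReal.coe_ne_top⟩
    exact ENNReal.add_ne_top.2 ⟨ENNReal.coe_ne_top, ENNReal.coe_ne_top⟩
  have hCt : D * 3 * (G * quasiConst q 2) ≠ ∞ :=
    ENNReal.mul_ne_top (ENNReal.mul_ne_top hDt (by norm_num))
      (ENNReal.mul_ne_top hGt (quasiConst_ne_top _ _))
  refine ⟨(D * 3 * (G * quasiConst q 2)).toNNReal, fun φ P ω hφ hfin hP hω hω0 hωC hPω => ?_⟩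
  have hT := h₁ φ P ω hφ hP hω hωC hPω
  constructor
  · have htend := ht.tendsto_eLpNorm_cubeMeas hp hσ hθ hθr hH hα₁
      (F := fun k x => φ x - splineApprox l P k x)
      (a := fun k m => eLpNorm (fun x => φ x - splineApprox l P k x) r (cubeMeas k m))
      (fun k m => le_rfl) (S := C₁ * besovNorm l p q r t φ)
      (ENNReal.mul_ne_top ENNReal.coe_ne_top hfin)
      (fun k => (hT k).trans (mul_le_mul_right (besovTerm_le hq l p r t φ k) _))
    unfold Represents
    simp only [splineSum_coeffFun_splineIncrement hl]
    refine tendstoLpLoc_of_cubeMeas hr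
      (fun N => (Finset.measurable_fun_sum _ fun k _ =>
        measurable_splineIncrement hl P k).aemeasurable) hφ.aemeasurable fun m => ?_
    -- The partial sum with N + 1 terms is T_N.
    rw [← tendsto_add_atTop_iff_nat 1]
    refine (htend m).congr fun N => ?_
    simp only [sum_splineIncrement]
    rw [← eLpNorm_neg]
    congr 1
    funext x
    simp
  · obtain ⟨h20, h2s⟩ := h₂ φ P hφ
    rw [ENNReal.coe_toNNReal hCt, N₄, coeffNorm]
    refine (lNorm_le_of_le_add_pred (C := D) (τ := besovTerm l p r t φ) hq ?_ fun k => ?_).trans ?_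
    · calc lNorm p (fun m => assoc p t 0 m *
            ENNReal.ofReal |coeffFun l 0 m (splineIncrement l P 0)|)
          ≤ lNorm p (fun m => C₂ * (assoc p t 0 m * ω 0 m + assoc p t 0 m *
            eLpNorm (fun x => φ x - splineApprox l P 0 x) r (cubeMeas 0 m))) := by
            refine lNorm_mono fun m => ?_
            rw [← mul_add, mul_left_comm]
            exact mul_le_mul_right ((h20 m).trans
              (mul_le_mul_right (add_le_add (hω0 m) le_rfl) _)) _
        _ ≤ C₂ * (Q * (C₀ * besovTerm l p r t φ 0 + C₁ * besovTerm l p r t φ 0)) := by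
            rw [lNorm_const_mul hp]
            exact mul_le_mul_right ((lNorm_add_le hp (fun m => assoc p t 0 m * ω 0 m) _).trans
              (mul_le_mul_right (add_le_add (hωC 0) (hT 0)) _)) _
        _ = C₂ * (Q * (C₀ + C₁)) * besovTerm l p r t φ 0 := by ring
        _ ≤ _ := mul_le_mul_left (mul_le_mul_right (mul_le_mul_right le_self_add _) _) _
    · have h31 := h₃ k (k + 1) (Nat.le_succ k)
        fun m => eLpNorm (fun x => φ x - splineApprox l P k x) r (cubeMeas k m)
      rw [Nat.add_sub_cancel_left, pow_one] at h31
      have h32 := h31.trans (mul_le_mul_right (hT k) _)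
      calc lNorm p (fun m => assoc p t (k + 1) m *
            ENNReal.ofReal |coeffFun l (k + 1) m (splineIncrement l P (k + 1))|)
          ≤ lNorm p (fun m => C₂ * (assoc p t (k + 1) m *
            eLpNorm (fun x => φ x - splineApprox l P (k + 1) x) r (cubeMeas (k + 1) m) +
            assoc p t (k + 1) m *
            eLpNorm (fun x => φ x - splineApprox l P k x) r (cubeMeas k (ancestor 1 m)))) := by
            refine lNorm_mono fun m => ?_
            rw [← mul_add, mul_left_comm]
            exact mul_le_mul_right (h2s k m) _
        _ ≤ C₂ * (Q * (C₁ * besovTerm l p r t φ (k + 1) + B * (C₁ * besovTerm l p r t φ k))) := by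
            rw [lNorm_const_mul hp]
            exact mul_le_mul_right ((lNorm_add_le hp (fun m => assoc p t (k + 1) m *
              eLpNorm (fun x => φ x - splineApprox l P (k + 1) x) r (cubeMeas (k + 1) m)) _).trans
              (mul_le_mul_right (add_le_add (hT (k + 1)) h32) _)) _
        _ ≤ C₂ * (Q * ((C₀ + C₁ + B * C₁) * besovTerm l p r t φ (k + 1) +
            (C₀ + C₁ + B * C₁) * besovTerm l p r t φ k)) := by
            refine mul_le_mul_right (mul_le_mul_right (add_le_add (mul_le_mul_left ?_ _) ?_) _) _
            · exact le_add_self.trans le_self_add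
            · rw [← mul_assoc]
              exact mul_le_mul_left le_add_self _
        _ = _ := by rw [hD]; ring
    · rw [mul_assoc (D * 3), mul_assoc G]
      exact mul_le_mul_right (mul_le_mul_right (lNorm_besovTerm_le hq l p r t φ) _) _

theorem IsNearBest.eLpNorm_le {A : ℝ} {l : ℕ} {r : ℝ≥0∞} {φ : (Fin n → ℝ) → ℝ}
    {P : ℕ → (Fin n → ℤ) → MvPolynomial (Fin n) ℝ} (h : IsNearBest A l r φ P) (k : ℕ)
    (m : Fin n → ℤ) (c : (Fin n → Fin (l + 1)) → ℝ) :
    eLpNorm (fun x => φ x - MvPolynomial.eval x (P k m)) r (cubeMeas k m) ≤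
      ENNReal.ofReal A * eLpNorm (fun x => φ x - polyEval c x) r (cubeMeas k m) := by
  obtain ⟨R, hR, hRc⟩ := exists_eval_eq_polyEval c
  have h1 := (h k m).2.trans (mul_le_mul_right (iInf_le _ (⟨R, hR⟩ :
    {R : MvPolynomial (Fin n) ℝ // CoordDegLE l R})) _)
  simp only [hRc] at h1
  have h0 : (2 : ℝ≥0∞) ^ (k * n) ≠ 0 := by simp
  rw [cubeMeas_eq_dyadic, eLpNorm_smul_measure_of_ne_zero h0, eLpNorm_smul_measure_of_ne_zero h0,
    smul_eq_mul, smul_eq_mul, mul_left_comm]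
  exact mul_le_mul_right h1 _

theorem WeightClass.exists_decomposition_of_measurable (ht : WeightClass p α₁ α₂ α₃ σ₁ p t)
    (hp : p ≠ 0) (hσ : σ₁ ≠ 0) {θ r : ℝ≥0∞} (hθ : θ ≠ 0) (hθr : θ ≤ r)
    (hH : θ⁻¹ = p⁻¹ + σ₁⁻¹) (hα₁ : (n : ℝ) * ((θ⁻¹).toReal - (r⁻¹).toReal) < α₁)
    {l : ℕ} (hl : l ≠ 0) {q : ℝ≥0∞} (hq : q ≠ 0) (A : ℝ) :
    ∃ C : ℝ≥0, ∀ φ : (Fin n → ℝ) → ℝ, Measurable φ → MemBesov l p q r t φ →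
      (∃ β, Represents l r β φ ∧ coeffNorm p q t β ≤ C * besovNorm l p q r t φ) ∧
      ∀ P : ℕ → (Fin n → ℤ) → MvPolynomial (Fin n) ℝ, IsNearBest A l r φ P →
        Represents l r (fun k m => coeffFun l k m (splineIncrement l P k)) φ ∧
        N₄ l p q t P ≤ C * besovNorm l p q r t φ := by
  have hr : r ≠ 0 := (lt_of_lt_of_le (pos_iff_ne_zero.2 hθ) hθr).ne'
  obtain ⟨C₀, h₀⟩ := ht.exists_local_error hp hl hr
  obtain ⟨C, hC⟩ := ht.exists_spline_decomposition hp hσ hθ hθr hH hα₁ hl hq (A.toNNReal + 1) C₀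
  refine ⟨C, fun φ hφ hB => ?_⟩
  obtain ⟨ω, hω, hω0, hωC⟩ := h₀ φ hφ hB.1
  have he0 : (0 : Fin n → ℤ) ∈ intBox n l := mem_intBox.2 fun i => by simp
  have hω' : ∀ k m, ∃ c : (Fin n → Fin (l + 1)) → ℝ,
      eLpNorm (fun x => φ x - polyEval c x) r (cubeMeas k m) ≤ ω k m := fun k m => by
    obtain ⟨c, hc⟩ := hω k m
    exact ⟨c, by simpa using hc 0 he0⟩
  choose c hc using hω'
  refine ⟨?_, fun P hP => ?_⟩
  -- The Whitney polynomials themselves give a representation, so its existence does not depend on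
  -- there being near-best polynomials for the given A.
  · choose P hP hPc using fun k m => exists_eval_eq_polyEval (c k m)
    refine ⟨_, hC φ P ω hφ hB.2.ne hP hω hω0 hωC fun k m => ?_⟩
    simp only [hPc]
    refine (hc k m).trans (le_mul_of_one_le_left zero_le ?_)
    push_cast
    exact le_add_self
  · refine hC φ P ω hφ hB.2.ne (fun k m => (hP k m).1) hω hω0 hωC fun k m => ?_
    refine (hP.eLpNorm_le k m (c k m)).trans (mul_le_mul' ?_ (hc k m))
    push_cast
    exact le_self_add

end DecompositionNorm

/-! ### Invariance under changes on null sets -/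

section AECongr

variable {n : ℕ}

/-- For fixed z.1 the map is a translation in z.2, so each section of the preimage is null;
replacing N by a measurable null set allows Fubini. -/
theorem ae_prod_comp_add_smul {N : Set (Fin n → ℝ)} (hN : volume N = 0) (a : ℝ) :
    ∀ᵐ z : (Fin n → ℝ) × (Fin n → ℝ) ∂(volume.prod volume), z.2 + a • z.1 ∉ N := by
  set M := toMeasurable volume N with hM
  have hM0 : volume M = 0 := (measure_toMeasurable N).trans hN
  have hf : Measurable fun z : (Fin n → ℝ) × (Fin n → ℝ) => z.2 + a • z.1 := by fun_prop
  have hS := hf (measurableSet_toMeasurable volume N)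
  have h : (volume.prod volume) ((fun z : (Fin n → ℝ) × (Fin n → ℝ) => z.2 + a • z.1) ⁻¹' M) = 0 := by
    rw [Measure.measure_prod_null hS]
    refine Eventually.of_forall fun h => ?_
    change volume ((fun y => y + a • h) ⁻¹' M) = 0
    rw [measure_preimage_add_right, hM0]
  exact measure_mono_null (fun z hz => subset_toMeasurable volume N (not_not.1 hz)) h

theorem deltaOsc_congr_ae (l : ℕ) (r : ℝ≥0∞) (c : Fin n → ℝ) (s : ℝ) {φ ψ : (Fin n → ℝ) → ℝ}
    (h : φ =ᵐ[volume] ψ) : deltaOsc l r c s φ = deltaOsc l r c s ψ := by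
  refine eLpNorm_congr_ae ?_
  have h1 : ∀ᵐ z : (Fin n → ℝ) × (Fin n → ℝ) ∂(volume.prod volume),
      ∀ j : ℕ, φ (z.2 + (j : ℝ) • z.1) = ψ (z.2 + (j : ℝ) • z.1) :=
    ae_all_iff.2 fun j => (ae_prod_comp_add_smul h (j : ℝ)).mono fun z hz => not_not.1 hz
  refine Measure.ae_smul_measure ?_ _
  rw [Measure.prod_restrict]
  refine ae_restrict_of_ae (h1.mono fun z hz => ?_)
  exact Finset.sum_congr rfl fun j _ => by rw [hz j]

theorem besovNorm_congr_ae (l : ℕ) (p q r : ℝ≥0∞) (t : ℕ → (Fin n → ℝ) → ℝ)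
    {φ ψ : (Fin n → ℝ) → ℝ} (h : φ =ᵐ[volume] ψ) :
    besovNorm l p q r t φ = besovNorm l p q r t ψ := by
  have h2 : ∀ x : Fin n → ℝ, eLpNorm φ r (volume.restrict (cube x 2)) =
      eLpNorm ψ r (volume.restrict (cube x 2)) := fun x =>
    eLpNorm_congr_ae (ae_restrict_of_ae h)
  simp only [besovNorm, deltaOsc_congr_ae l r _ _ h, h2]

theorem MemLpLoc.congr_ae {r : ℝ≥0∞} {φ ψ : (Fin n → ℝ) → ℝ} (hφ : MemLpLoc r φ)
    (h : φ =ᵐ[volume] ψ) : MemLpLoc r ψ :=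
  fun K hK => (memLp_congr_ae (ae_restrict_of_ae h)).1 (hφ K hK)

theorem represents_congr_ae {l : ℕ} {r : ℝ≥0∞} {β : ℕ → (Fin n → ℤ) → ℝ}
    {φ ψ : (Fin n → ℝ) → ℝ} (h : φ =ᵐ[volume] ψ) :
    Represents l r β φ ↔ Represents l r β ψ := by
  refine forall₂_congr fun K _ => ?_
  have h1 : ∀ N : ℕ, eLpNorm (fun x => ∑ k ∈ Finset.range N, splineSum l k (β k) x - φ x) r
      (volume.restrict K) = eLpNorm (fun x => ∑ k ∈ Finset.range N, splineSum l k (β k) x - ψ x) r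
      (volume.restrict K) := fun N =>
    eLpNorm_congr_ae ((ae_restrict_of_ae h).mono fun x hx => by simp only [hx])
  simp only [h1]

theorem isNearBest_congr_ae {A : ℝ} {l : ℕ} {r : ℝ≥0∞}
    {P : ℕ → (Fin n → ℤ) → MvPolynomial (Fin n) ℝ} {φ ψ : (Fin n → ℝ) → ℝ}
    (h : φ =ᵐ[volume] ψ) : IsNearBest A l r φ P ↔ IsNearBest A l r ψ P := by
  have h1 : ∀ (k : ℕ) (m : Fin n → ℤ) (R : MvPolynomial (Fin n) ℝ),
      eLpNorm (fun x => φ x - MvPolynomial.eval x R) r (volume.restrict (dyadic k m)) =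
      eLpNorm (fun x => ψ x - MvPolynomial.eval x R) r (volume.restrict (dyadic k m)) :=
    fun k m R => eLpNorm_congr_ae ((ae_restrict_of_ae h).mono fun x hx => by simp only [hx])
  simp only [IsNearBest, bestApprox, h1]

theorem iUnion_closedBall_natCast :
    (⋃ N : ℕ, Metric.closedBall (0 : Fin n → ℝ) N) = Set.univ :=
  Metric.iUnion_closedBall_nat 0

theorem MemLpLoc.aemeasurable {r : ℝ≥0∞} {φ : (Fin n → ℝ) → ℝ} (hφ : MemLpLoc r φ) :
    AEMeasurable φ volume := by
  rw [← Measure.restrict_univ (μ := volume), ← iUnion_closedBall_natCast, aemeasurable_iUnion_iff]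
  exact fun N => (hφ _ (isCompact_closedBall _ _)).1.aemeasurable

theorem measurable_splineSum_partial {l : ℕ} (hl : l ≠ 0) (β : ℕ → (Fin n → ℤ) → ℝ) (N : ℕ) :
    Measurable fun x => ∑ k ∈ Finset.range N, splineSum l k (β k) x :=
  Finset.measurable_fun_sum _ fun k _ => measurable_splineSum hl k (β k)

/-- Uniqueness of limits in L_r^loc, through the quasi-triangle inequality. It identifies the sum of
any representing array with the given function. -/
theorem Represents.ae_eq {l : ℕ} (hl : l ≠ 0) {r : ℝ≥0∞} (hr : r ≠ 0)
    {β : ℕ → (Fin n → ℤ) → ℝ} {φ ψ : (Fin n → ℝ) → ℝ} (hφm : AEMeasurable φ volume)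
    (hψm : AEMeasurable ψ volume) (hφ : Represents l r β φ) (hψ : Represents l r β ψ) :
    φ =ᵐ[volume] ψ := by
  have hK : ∀ N : ℕ, φ =ᵐ[volume.restrict (Metric.closedBall 0 N)] ψ := by
    intro N
    set μ : Measure (Fin n → ℝ) := volume.restrict (Metric.closedBall 0 N) with hμ
    have h1 := hφ _ (isCompact_closedBall 0 N)
    have h2 := hψ _ (isCompact_closedBall 0 N)
    have h3 := ENNReal.Tendsto.const_mul (a := quasiConst r 2) (h1.add h2)
      (Or.inr (quasiConst_ne_top _ _))
    rw [add_zero, mul_zero] at h3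
    have h4 : eLpNorm (fun x => φ x - ψ x) r μ = 0 := by
      refine le_antisymm (ge_of_tendsto' h3 fun M => ?_) zero_le
      have hm := measurable_splineSum_partial hl β M
      refine eLpNorm_add_le_quasi hr (hm.aemeasurable.sub hφm).restrict
        (hm.aemeasurable.sub hψm).restrict (Eventually.of_forall fun x => ?_)
      rw [show φ x - ψ x = (∑ k ∈ Finset.range M, splineSum l k (β k) x - ψ x) -
        (∑ k ∈ Finset.range M, splineSum l k (β k) x - φ x) by ring]
      exact (abs_sub _ _).trans_eq (add_comm _ _)
    have h5 := (eLpNorm_eq_zero_iff (hφm.sub hψm).restrict.aestronglyMeasurable hr).1 h4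
    exact h5.mono fun x hx => sub_eq_zero.1 hx
  rw [← Measure.restrict_univ (μ := volume), ← iUnion_closedBall_natCast]
  exact (ae_restrict_iUnion_iff _ _).2 hK

end AECongr

/-! ### Sums over all levels -/

section Levels

variable {n : ℕ}

/-- The budget of five powers of ρ: two are spent on summing the levels inside the L_r norm, two on
the outer l_p norm, and the last one stays under the supremum for the Hardy inequality in q. -/
theorem lNorm_mul_eLpNorm_tsum_geo_le {ι α : Type*} [Countable ι] [MeasurableSpace α]
    {p r ρ : ℝ≥0∞} (hp : p ≠ 0) (hr : r ≠ 0) (hρ0 : ρ ≠ 0) (hρ : ρ < 1) (k : ℕ) {a : ι → ℝ≥0∞}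
    {w : ℕ → ι → ℝ≥0∞} {C : ℝ≥0∞} {τ : ℕ → ℝ≥0∞}
    (hw : ∀ j, lNorm p (fun i => a i * w j i) ≤ C * (ρ ^ 5) ^ idxDist j k * τ j)
    {μ : ι → Measure α} {F : ι → α → ℝ} {f : ι → ℕ → α → ℝ≥0∞}
    (hf : ∀ i j, AEMeasurable (f i j) (μ i)) (hfw : ∀ i j, eLpNorm (f i j) r (μ i) ≤ w j i)
    (hF : ∀ i, ∀ᵐ x ∂(μ i), ‖F i x‖ₑ ≤ ∑' j, f i j x) :
    lNorm p (fun i => a i * eLpNorm (F i) r (μ i)) ≤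
      geoConst r ρ * (geoConst p ρ * (C * ⨆ j, ρ ^ idxDist j k * τ j)) := by
  have hw0 : ∀ j, (ρ ^ idxDist j k) ^ 2 ≠ 0 := fun j => pow_ne_zero _ (pow_ne_zero _ hρ0)
  have hwt : ∀ j, (ρ ^ idxDist j k) ^ 2 ≠ ∞ := fun j =>
    ENNReal.pow_ne_top (ENNReal.pow_ne_top (hρ.trans_le le_top).ne)
  set S : ι → ℝ≥0∞ := fun i => ∑' j, ((ρ ^ idxDist j k) ^ 2)⁻¹ * w j i with hS
  have h1 : ∀ i, eLpNorm (F i) r (μ i) ≤ geoConst r ρ * S i := by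
    intro i
    refine eLpNorm_tsum_geo_le hr hρ0 hρ k (hf i) (fun j => ?_) (hF i)
    refine (hfw i j).trans ?_
    calc w j i = (ρ ^ idxDist j k) ^ 2 * (((ρ ^ idxDist j k) ^ 2)⁻¹ * w j i) := by
          rw [← mul_assoc, ENNReal.mul_inv_cancel (hw0 j) (hwt j), one_mul]
      _ ≤ _ := mul_le_mul_right (ENNReal.le_tsum j) _
  have h2 : lNorm p (fun i => a i * S i) ≤
      geoConst p ρ * (C * ⨆ j, ρ ^ idxDist j k * τ j) := by
    refine lNorm_tsum_geo_le hp hρ0 hρ k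
      (f := fun j i => ((ρ ^ idxDist j k) ^ 2)⁻¹ * (a i * w j i)) (fun j => ?_) fun i => ?_
    · rw [lNorm_const_mul hp]
      refine (mul_le_mul_right (hw j) _).trans ?_
      have h3 : (ρ ^ 5) ^ idxDist j k = (ρ ^ idxDist j k) ^ 2 *
          ((ρ ^ idxDist j k) ^ 2 * ρ ^ idxDist j k) := by
        rw [← pow_mul, mul_comm 5, pow_mul]; ring
      calc ((ρ ^ idxDist j k) ^ 2)⁻¹ * (C * (ρ ^ 5) ^ idxDist j k * τ j)
          = (((ρ ^ idxDist j k) ^ 2)⁻¹ * (ρ ^ idxDist j k) ^ 2) *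
            ((ρ ^ idxDist j k) ^ 2 * (C * (ρ ^ idxDist j k * τ j))) := by rw [h3]; ring
        _ = (ρ ^ idxDist j k) ^ 2 * (C * (ρ ^ idxDist j k * τ j)) := by
            rw [ENNReal.inv_mul_cancel (hw0 j) (hwt j), one_mul]
        _ ≤ _ := mul_le_mul_right (mul_le_mul_right
            (le_iSup (fun j => ρ ^ idxDist j k * τ j) j) _) _
    · rw [hS, ← ENNReal.tsum_mul_left]
      exact (ENNReal.tsum_le_tsum fun j => (mul_left_comm _ _ _).le)
  calc lNorm p (fun i => a i * eLpNorm (F i) r (μ i))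
      ≤ lNorm p (fun i => geoConst r ρ * (a i * S i)) := by
        refine lNorm_mono fun i => ?_
        rw [mul_left_comm]
        exact mul_le_mul_right (h1 i) _
    _ = geoConst r ρ * lNorm p (fun i => a i * S i) := lNorm_const_mul hp _ _
    _ ≤ _ := mul_le_mul_right h2 _

theorem deltaOsc_le_sum_oscCube {l : ℕ} {r : ℝ≥0∞} (hr : r ≠ 0) {φ : (Fin n → ℝ) → ℝ}
    (hφ : Measurable φ) (k : ℕ) (x : Fin n → ℝ) :
    deltaOsc l r x (2 * (1 / 2 ^ k)) φ ≤ quasiConst r (intBox n 2).card *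
      ∑ e ∈ intBox n 2, oscCube l r φ k (floorIdx k x + e) := by
  set c : ℝ≥0∞ := (2 : ℝ≥0∞) ^ (k * n) * 2 ^ (k * n) with hc
  have hcle : ENNReal.ofReal (1 / (2 * (1 / (2 : ℝ) ^ k)) ^ (2 * n)) ≤ c := by
    rw [hc, ← ofReal_side_pow]
    exact le_mul_of_one_le_left zero_le (one_le_pow₀ (by norm_num))
  have h1 : deltaOsc l r x (2 * (1 / 2 ^ k)) φ ≤
      eLpNorm (fun z : (Fin n → ℝ) × (Fin n → ℝ) => diff l z.1 φ z.2) r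
        ((c • (volume.prod volume : Measure ((Fin n → ℝ) × (Fin n → ℝ)))).restrict
          (cube (0 : Fin n → ℝ) (2 * (2 * (1 / 2 ^ k))) ×ˢ cube x (2 * (1 / 2 ^ k)))) := by
    refine eLpNorm_mono_measure _ ?_
    rw [Measure.restrict_smul, ← Measure.prod_restrict]
    exact fun s => mul_le_mul_left hcle _
  refine h1.trans ((eLpNorm_restrict_le_sum hr (intBox n 2)
    ((isOpen_cube _ _).measurableSet.prod (isOpen_cube _ _).measurableSet)
    (T := fun e => cube (0 : Fin n → ℝ) (2 * (2 * (1 / 2 ^ k))) ×ˢ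
      dyadicHalfOpen k (floorIdx k x + e))
    (fun e _ => (isOpen_cube _ _).measurableSet.prod (measurableSet_dyadicHalfOpen _ _)) ?_
    (measurable_diff l hφ).aemeasurable).trans_eq ?_)
  · rintro ⟨h, y⟩ ⟨hh, hy⟩
    refine Set.mem_iUnion₂.2 ⟨floorIdx k y - floorIdx k x, mem_intBox.2 fun i => ?_, hh,
      mem_dyadicHalfOpen.2 (by simp)⟩
    refine abs_floorIdx_sub_le (R := 1) ?_ i
    have h2 : ‖y - x‖ ≤ 1 / 2 ^ k := by
      rw [pi_norm_le_iff_of_nonneg (by positivity)]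
      intro i
      have := (hy i).le
      rwa [mul_div_cancel_left₀ _ (two_ne_zero)] at this
    calc (2 : ℝ) ^ k * ‖y - x‖ ≤ 2 ^ k * (1 / 2 ^ k) := by gcongr
      _ = ((1 : ℕ) : ℝ) := by field_simp; simp
  · congr 1
    refine Finset.sum_congr rfl fun e _ => ?_
    rw [oscCube_eq, Measure.restrict_smul, ← Measure.prod_restrict]

theorem eLpNorm_cube_le_sum {r : ℝ≥0∞} (hr : r ≠ 0) {φ : (Fin n → ℝ) → ℝ}
    (hφ : Measurable φ) (x : Fin n → ℝ) :
    eLpNorm φ r (volume.restrict (cube x 2)) ≤ quasiConst r (intBox n 2).card *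
      ∑ e ∈ intBox n 2, eLpNorm φ r (cubeMeas 0 (floorIdx 0 x + e)) := by
  simp only [cubeMeas_zero]
  refine eLpNorm_restrict_le_sum hr (intBox n 2) (isOpen_cube _ _).measurableSet
    (fun e _ => measurableSet_dyadicHalfOpen _ _) (fun y hy => ?_) hφ.aemeasurable
  refine Set.mem_iUnion₂.2 ⟨floorIdx 0 y - floorIdx 0 x, mem_intBox.2 fun i => ?_,
    mem_dyadicHalfOpen.2 (by simp)⟩
  refine abs_floorIdx_sub_le (R := 1) ?_ i
  rw [pow_zero, one_mul, Nat.cast_one, pi_norm_le_iff_of_nonneg zero_le_one]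
  intro i
  simpa using (hy i).le

/-- The norms over dyadic cubes that control the terms of the quasi-norm. -/
def cubeTerm (l : ℕ) (r : ℝ≥0∞) (φ : (Fin n → ℝ) → ℝ) : ℕ → (Fin n → ℤ) → ℝ≥0∞
  | 0, m => eLpNorm φ r (cubeMeas 0 m)
  | k + 1, m => oscCube l r φ (k + 1) m

variable {p : ℝ≥0∞} {t : ℕ → (Fin n → ℝ) → ℝ} {α₁ α₂ α₃ : ℝ} {σ₁ σ₂ : ℝ≥0∞}

theorem WeightClass.exists_besovTerm_le (ht : WeightClass p α₁ α₂ α₃ σ₁ σ₂ t) (hp : p ≠ 0)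
    (l : ℕ) {r : ℝ≥0∞} (hr : r ≠ 0) :
    ∃ C : ℝ≥0, ∀ φ : (Fin n → ℝ) → ℝ, Measurable φ → ∀ k, besovTerm l p r t φ k ≤
      C * lNorm p (fun m => assoc p t k m * cubeTerm l r φ k m) := by
  obtain ⟨C, hC⟩ := ht.exists_lNorm_box_le hp 2
  set Q := quasiConst r (intBox n 2).card with hQ
  have hQt : Q ≠ ∞ := quasiConst_ne_top _ _
  have key : ∀ (k : ℕ) (u : (Fin n → ℝ) → ℝ≥0∞) (v : (Fin n → ℤ) → ℝ≥0∞),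
      (∀ x, u x ≤ Q * ∑ e ∈ intBox n 2, v (floorIdx k x + e)) →
      eLpNorm (fun x => ENNReal.ofReal (t k x) * u x) p volume ≤
        (Q.toNNReal * C : ℝ≥0) * lNorm p (fun m => assoc p t k m * v m) := by
    intro k u v huv
    calc eLpNorm (fun x => ENNReal.ofReal (t k x) * u x) p volume
        ≤ eLpNorm (fun x => Q * (ENNReal.ofReal (t k x) *
          ∑ e ∈ intBox n 2, v (floorIdx k x + e))) p volume := by
          refine eLpNorm_mono_ennreal fun x => ?_
          rw [enorm_eq_self, mul_left_comm]
          exact mul_le_mul_right (huv x) _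
      _ = Q * lNorm p (fun m => assoc p t k m * ∑ e ∈ intBox n 2, v (m + e)) := by
          rw [eLpNorm_const_mul_ennreal hp _ hQt, lNorm_assoc_mul hp (ht.admissible k).1.2
            (ht.assoc_ne_zero k) fun m => ∑ e ∈ intBox n 2, v (m + e)]
      _ ≤ Q * (C * lNorm p (fun m => assoc p t k m * v m)) := mul_le_mul_right (hC k v) _
      _ = _ := by rw [ENNReal.coe_mul, ENNReal.coe_toNNReal hQt, mul_assoc]
  refine ⟨Q.toNNReal * C, fun φ hφ k => ?_⟩
  cases k with
  | zero => exact key 0 _ (cubeTerm l r φ 0) fun x => eLpNorm_cube_le_sum hr hφ x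
  | succ k => exact key (k + 1) _ (cubeTerm l r φ (k + 1)) fun x =>
      deltaOsc_le_sum_oscCube hr hφ (k + 1) x

end Levels

/-! ### Differences of spline series -/

section Synthesis

variable {n : ℕ}

/-- The sum of the moduli of the terms of a difference. -/
def absDiff (l : ℕ) (h : Fin n → ℝ) (g : (Fin n → ℝ) → ℝ) (x : Fin n → ℝ) : ℝ :=
  ∑ i ∈ Finset.range (l + 1), (l.choose i : ℝ) * |g (x + (i : ℝ) • h)|

theorem absDiff_nonneg (l : ℕ) (h : Fin n → ℝ) (g : (Fin n → ℝ) → ℝ) (x : Fin n → ℝ) :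
    0 ≤ absDiff l h g x :=
  Finset.sum_nonneg fun _ _ => by positivity

theorem abs_diff_le_absDiff (l : ℕ) (h : Fin n → ℝ) (g : (Fin n → ℝ) → ℝ) (x : Fin n → ℝ) :
    |diff l h g x| ≤ absDiff l h g x := by
  refine (Finset.abs_sum_le_sum_abs _ _).trans (Finset.sum_le_sum fun i _ => ?_)
  rw [abs_mul, abs_mul, abs_pow, abs_neg, abs_one, one_pow, mul_one, Nat.abs_cast]

theorem measurable_absDiff (l : ℕ) {g : (Fin n → ℝ) → ℝ} (hg : Measurable g) :
    Measurable fun z : (Fin n → ℝ) × (Fin n → ℝ) => absDiff l z.1 g z.2 := by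
  refine Finset.measurable_fun_sum _ fun i _ => measurable_const.mul ?_
  refine measurable_abs.comp (hg.comp ?_)
  fun_prop

/-- Finitely many coarse levels do not matter; for j ≥ k every value entering the difference is
bounded by `absDiff`, because the binomial coefficients are at least 1. -/
theorem summable_of_tsum_enorm_absDiff {l k : ℕ} {h y : Fin n → ℝ} {g : ℕ → (Fin n → ℝ) → ℝ}
    (hs : ∑' j, ‖if j < k then diff l h (g j) y else absDiff l h (g j) y‖ₑ ≠ ∞) {i : ℕ}
    (hi : i ∈ Finset.range (l + 1)) : Summable fun j => g j (y + (i : ℝ) • h) := by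
  have h1 := tsum_enorm_ne_top_iff_summable_norm.1 hs
  refine h1.of_norm_bounded_eventually_nat ((eventually_ge_atTop k).mono fun j hj => ?_)
  rw [if_neg (not_lt.2 hj), Real.norm_eq_abs, Real.norm_eq_abs, abs_of_nonneg (absDiff_nonneg _ _ _ _)]
  have h2 : (l.choose i : ℝ) * |g j (y + (i : ℝ) • h)| ≤ absDiff l h (g j) y :=
    Finset.single_le_sum (f := fun i => (l.choose i : ℝ) * |g j (y + (i : ℝ) • h)|)
      (fun _ _ => by positivity) hi
  refine le_trans (le_mul_of_one_le_left (abs_nonneg _) ?_) h2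
  exact_mod_cast Nat.choose_pos (Nat.lt_succ_iff.1 (Finset.mem_range.1 hi))

/-- If the right side is finite, the series converges at all points entering the difference, which
then commutes with the sum; otherwise there is nothing to prove. Points where the pointwise series
diverges thus need no separate treatment. -/
theorem enorm_diff_tsum_le (l k : ℕ) (h y : Fin n → ℝ) (g : ℕ → (Fin n → ℝ) → ℝ) :
    ‖diff l h (fun x => ∑' j, g j x) y‖ₑ ≤
      ∑' j, ‖if j < k then diff l h (g j) y else absDiff l h (g j) y‖ₑ := by
  by_cases hs : ∑' j, ‖if j < k then diff l h (g j) y else absDiff l h (g j) y‖ₑ = ∞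
  · rw [hs]; exact le_top
  have h1 : HasSum (fun j => diff l h (g j) y) (diff l h (fun x => ∑' j, g j x) y) :=
    hasSum_sum fun i hi => (summable_of_tsum_enorm_absDiff hs hi).hasSum.mul_left _
  rw [← h1.tsum_eq]
  refine enorm_tsum_le_tsum_enorm.trans (ENNReal.tsum_le_tsum fun j => ?_)
  split_ifs
  · exact le_rfl
  · rw [Real.enorm_eq_ofReal_abs, Real.enorm_eq_ofReal (absDiff_nonneg _ _ _ _)]
    exact ENNReal.ofReal_le_ofReal (abs_diff_le_absDiff _ _ _ _)

theorem enorm_sum_range_sub_tsum_le (N : ℕ) (a : ℕ → ℝ) :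
    ‖∑ j ∈ Finset.range N, a j - ∑' j, a j‖ₑ ≤ ∑' j, if j < N then 0 else ‖a j‖ₑ := by
  by_cases hs : (∑' j, if j < N then 0 else ‖a j‖ₑ) = ∞
  · rw [hs]; exact le_top
  have h0 : ∀ j, (if j < N then 0 else ‖a j‖ₑ) = ‖if j < N then 0 else a j‖ₑ := fun j => by
    split_ifs <;> simp
  simp only [h0] at hs ⊢
  have h1 := tsum_enorm_ne_top_iff_summable_norm.1 hs
  have h2 : Summable a := h1.of_norm_bounded_eventually_nat ((eventually_ge_atTop N).mono
    fun j hj => by rw [if_neg (not_lt.2 hj)])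
  have h3 : HasSum (fun j => if j < N then 0 else a j) (∑' j, a j - ∑ j ∈ Finset.range N, a j) := by
    have h4 : HasSum (fun j => if j < N then a j else 0) (∑ j ∈ Finset.range N, a j) := by
      have h5 : HasSum (fun j => if j < N then a j else 0)
          (∑ j ∈ Finset.range N, if j < N then a j else 0) :=
        hasSum_sum_of_ne_finset_zero fun j hj => if_neg (by simpa using hj)
      rwa [Finset.sum_congr rfl fun j hj => if_pos (Finset.mem_range.1 hj)] at h5
    have h6 := h2.hasSum.sub h4
    rwa [show (fun j => a j - if j < N then a j else 0) = fun j => if j < N then 0 else a j from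
      funext fun j => by split_ifs <;> simp] at h6
  rw [enorm_sub_rev, ← h3.tsum_eq]
  exact enorm_tsum_le_tsum_enorm

/-- The bound for fine levels, without cancellation: steps of norm at most 2 move the unit cube by
at most 2l, so every translate is controlled on one box of cubes. -/
theorem exists_eLpNorm_absDiff_le (n l : ℕ) {r : ℝ≥0∞} (hr : r ≠ 0) :
    ∃ C : ℝ≥0, ∀ (g : (Fin n → ℝ) → ℝ), Measurable g → ∀ (k : ℕ) (m : Fin n → ℤ),
      eLpNorm (fun z : (Fin n → ℝ) × (Fin n → ℝ) =>
          absDiff l z.1 (fun y => g (cubeMap k m y)) z.2) r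
        ((volume.restrict (Metric.ball 0 2)).prod (cubeMeas 0 0)) ≤
        C * ∑ e ∈ intBox n (2 * l + 1 + 1), eLpNorm g r (cubeMeas k (m + e)) := by
  set V : ℝ≥0∞ := volume (Metric.ball (0 : Fin n → ℝ) 2) ^ (r.toReal⁻¹) with hV
  have hVt : V ≠ ∞ := ENNReal.rpow_ne_top_of_nonneg (by positivity) measure_ball_lt_top.ne
  set D : ℝ≥0∞ := quasiConst r (Finset.range (l + 1)).card *
    (∑ i ∈ Finset.range (l + 1), ‖(l.choose i : ℝ)‖ₑ) with hD
  have hDt : D ≠ ∞ := ENNReal.mul_ne_top (quasiConst_ne_top _ _) (sum_enorm_ne_top _ _)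
  set Q := quasiConst r (intBox n (2 * l + 1 + 1)).card with hQ
  have hCt : V * (D * Q) ≠ ∞ :=
    ENNReal.mul_ne_top hVt (ENNReal.mul_ne_top hDt (quasiConst_ne_top _ _))
  refine ⟨(V * (D * Q)).toNNReal, fun g hg k m => ?_⟩
  rw [ENNReal.coe_toNNReal hCt]
  set u : (Fin n → ℝ) → ℝ := fun y => g (cubeMap k m y) with hu
  have hum : Measurable u := hg.comp (measurableEmbedding_cubeMap k m).measurable
  have h1 : eLpNorm u r (volume.restrict (Metric.closedBall 0 ((2 * l + 1 : ℕ) : ℝ))) ≤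
      Q * ∑ e ∈ intBox n (2 * l + 1 + 1), eLpNorm g r (cubeMeas k (m + e)) := by
    simp only [eLpNorm_cubeMeas, cubeMeas_zero]
    refine eLpNorm_restrict_le_sum hr _ measurableSet_closedBall
      (fun m _ => measurableSet_dyadicHalfOpen 0 m) (fun x hx => ?_) hum.aemeasurable
    exact Set.mem_iUnion₂.2 ⟨floorIdx 0 x,
      floorIdx_zero_mem_intBox (mem_closedBall_zero_iff.1 hx), mem_dyadicHalfOpen.2 rfl⟩
  refine (eLpNorm_prod_le hr (measurable_absDiff l hum)
    (S := D * (Q * ∑ e ∈ intBox n (2 * l + 1 + 1), eLpNorm g r (cubeMeas k (m + e)))) ?_).trans_eq ?_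
  · refine (ae_restrict_mem measurableSet_ball).mono fun h hh => ?_
    refine eLpNorm_linComb_le hr (Finset.range (l + 1)) (fun i => (l.choose i : ℝ))
      (f := fun i y => |u (y + (i : ℝ) • h)|) (fun i _ => ?_) fun i hi => ?_
    · exact (measurable_abs.comp (hum.comp (by fun_prop))).aemeasurable
    · refine le_trans (le_of_eq ?_) ((eLpNorm_translate_le (r := r) u ((i : ℝ) • h)
        (S := dyadicHalfOpen 0 0) measurableSet_closedBall fun x hx => ?_).trans h1)
      · rw [cubeMeas_zero]
        exact eLpNorm_norm (fun y => u (y + (i : ℝ) • h))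
      · have h2 := dyadicHalfOpen_zero_subset (K := 0)
          (mem_intBox.2 fun i => by simp : (0 : Fin n → ℤ) ∈ intBox n 0) hx
        rw [mem_closedBall_zero_iff] at h2 ⊢
        have h3 : ‖h‖ ≤ 2 := (mem_ball_zero_iff.1 hh).le
        have h4 : (i : ℝ) ≤ l := by exact_mod_cast Nat.lt_succ_iff.1 (Finset.mem_range.1 hi)
        refine (norm_add_le _ _).trans ?_
        rw [norm_smul, Real.norm_natCast]
        have h5 : (i : ℝ) * ‖h‖ ≤ l * 2 := mul_le_mul h4 h3 (norm_nonneg _) (Nat.cast_nonneg _)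
        push_cast at h2 ⊢
        linarith
  · rw [Measure.restrict_apply_univ]
    ring

/-- The bound for coarse levels: measured in cells of level j, the steps are at most 2 · 2^{-(k-j)},
and an l-th difference of a degree-l spline is of the order of the l-th power of the step. -/
theorem exists_oscCube_splineSum_le (n : ℕ) {l : ℕ} (hl : l ≠ 0) {r : ℝ≥0∞} (hr : r ≠ 0) :
    ∃ C : ℝ≥0, ∀ (j k : ℕ), j ≤ k → ∀ (b : (Fin n → ℤ) → ℝ) (m : Fin n → ℤ),
      oscCube l r (splineSum l j b) k m ≤ C * ((2 : ℝ≥0∞) ^ (-(l : ℝ))) ^ (k - j) *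
        ∑ e ∈ intBox n (3 * l + 1), ENNReal.ofReal |b (ancestor (k - j) m + e)| := by
  obtain ⟨C, hC, h⟩ := exists_abs_diff_splineSum_le n hl
  set V : ℝ≥0∞ := volume (Metric.ball (0 : Fin n → ℝ) 2) ^ (r.toReal⁻¹) with hV
  have hVt : V ≠ ∞ := ENNReal.rpow_ne_top_of_nonneg (by positivity) measure_ball_lt_top.ne
  have hCt : V * (ENNReal.ofReal C * 2 ^ l) ≠ ∞ :=
    ENNReal.mul_ne_top hVt (ENNReal.mul_ne_top ENNReal.ofReal_ne_top (by finiteness))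
  refine ⟨(V * (ENNReal.ofReal C * 2 ^ l)).toNNReal, fun j k hjk b m => ?_⟩
  rw [ENNReal.coe_toNNReal hCt, oscCube]
  set W : ℝ≥0∞ := ∑ e ∈ intBox n (3 * l + 1), ENNReal.ofReal |b (ancestor (k - j) m + e)| with hW
  refine (eLpNorm_prod_le hr (measurable_diff l ((measurable_splineSum hl j b).comp
    (measurableEmbedding_cubeMap k m).measurable))
    (S := ENNReal.ofReal C * 2 ^ l * ((2 : ℝ≥0∞) ^ (-(l : ℝ))) ^ (k - j) * W) ?_).trans_eq ?_
  · refine (ae_restrict_mem measurableSet_ball).mono fun z hz => ?_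
    have h1 : ∀ᵐ y ∂cubeMeas (0 : ℕ) (0 : Fin n → ℤ),
        ‖diff l z (fun y => splineSum l j b (cubeMap k m y)) y‖ₑ ≤
          ENNReal.ofReal C * 2 ^ l * ((2 : ℝ≥0∞) ^ (-(l : ℝ))) ^ (k - j) * W := by
      refine (ae_mem_dyadicHalfOpen 0 0).mono fun y hy => ?_
      have hx : floorIdx j (cubeMap k m y) = ancestor (k - j) m := by
        rw [floorIdx_eq_ancestor hjk, floorIdx_cubeMap, hy, zero_add]
      have hz2 : ‖z‖ ≤ 2 := (mem_ball_zero_iff.1 hz).le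
      have hstep : (2 : ℝ) ^ j * ‖((2 : ℝ) ^ k)⁻¹ • z‖ ≤ 2 * ((2 : ℝ) ^ (k - j))⁻¹ := by
        rw [norm_smul, norm_inv, norm_pow, Real.norm_ofNat]
        obtain ⟨d, rfl⟩ := Nat.exists_eq_add_of_le hjk
        rw [Nat.add_sub_cancel_left, pow_add]
        have : (2 : ℝ) ^ j * ((2 ^ j * 2 ^ d)⁻¹ * ‖z‖) = ‖z‖ * (2 ^ d)⁻¹ := by field_simp
        rw [this]
        gcongr
      have hstep2 : (2 : ℝ) * ((2 : ℝ) ^ (k - j))⁻¹ ≤ 2 :=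
        mul_le_of_le_one_right (by norm_num) (inv_le_one_of_one_le₀ (one_le_pow₀ (by norm_num)))
      have h2 := h j b (((2 : ℝ) ^ k)⁻¹ • z) (cubeMap k m y) (hstep.trans hstep2)
      rw [diff_comp_cubeMap, Real.enorm_eq_ofReal_abs]
      refine (ENNReal.ofReal_le_ofReal h2).trans ?_
      rw [hx, ENNReal.ofReal_mul (by positivity),
        ENNReal.ofReal_sum_of_nonneg fun _ _ => abs_nonneg _]
      refine mul_le_mul_left ?_ _
      rw [ENNReal.ofReal_mul hC, mul_assoc]
      refine mul_le_mul_right ((ENNReal.ofReal_le_ofReal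
        (pow_le_pow_left₀ (by positivity) hstep l)).trans_eq ?_) _
      rw [ENNReal.ofReal_pow (by positivity), ENNReal.ofReal_mul (by norm_num),
        ENNReal.ofReal_inv_of_pos (by positivity), ENNReal.ofReal_pow (by norm_num), mul_pow,
        ENNReal.ofReal_ofNat, ENNReal.rpow_neg, ENNReal.rpow_natCast, ← ENNReal.inv_pow,
        ← ENNReal.inv_pow, ← pow_mul, ← pow_mul, mul_comm (k - j)]
    refine (eLpNorm_mono_ennreal_ae (g := fun _ => _) h1).trans ?_
    rw [eLpNorm_const _ hr (IsProbabilityMeasure.ne_zero _)]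
    simp
  · rw [Measure.restrict_apply_univ]
    ring

variable {p : ℝ≥0∞} {t : ℕ → (Fin n → ℝ) → ℝ} {α₁ α₂ α₃ : ℝ} {σ₁ : ℝ≥0∞}

/-- A spline of level j is dominated by a step function of level j, the sum of its nearby
coefficients, to which the lower transfer applies. -/
theorem WeightClass.exists_lNorm_eLpNorm_splineSum_le (ht : WeightClass p α₁ α₂ α₃ σ₁ p t)
    (hp : p ≠ 0) (hσ : σ₁ ≠ 0) {θ r : ℝ≥0∞} (hθ : θ ≠ 0) (hθr : θ ≤ r)
    (hH : θ⁻¹ = p⁻¹ + σ₁⁻¹) {l : ℕ} (hl : l ≠ 0) :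
    ∃ C : ℝ≥0, ∀ k j : ℕ, k ≤ j → ∀ b : (Fin n → ℤ) → ℝ,
      lNorm p (fun m => assoc p t k m * eLpNorm (splineSum l j b) r (cubeMeas k m)) ≤
        C * ((2 : ℝ≥0∞) ^ (-(α₁ - n * ((θ⁻¹).toReal - (r⁻¹).toReal)))) ^ (j - k) *
          lNorm p (fun m => assoc p t j m * ENNReal.ofReal |b m|) := by
  have hr : r ≠ 0 := (lt_of_lt_of_le (pos_iff_ne_zero.2 hθ) hθr).ne'
  obtain ⟨C₁, hC₁, h₁⟩ := exists_abs_splineSum_le n hl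
  obtain ⟨C₂, h₂⟩ := ht.exists_lNorm_comp_floorIdx_le hp hσ hθ hθr hH
  obtain ⟨C₃, h₃⟩ := ht.exists_lNorm_box_le hp l
  refine ⟨C₁.toNNReal * C₂ * C₃, fun k j hkj b => ?_⟩
  set R : ℝ≥0∞ := ((2 : ℝ≥0∞) ^ (-(α₁ - n * ((θ⁻¹).toReal - (r⁻¹).toReal)))) ^ (j - k) with hR
  set B : (Fin n → ℤ) → ℝ≥0∞ := fun m => ∑ e ∈ intBox n l, ENNReal.ofReal |b (m + e)| with hB
  have h4 : ∀ m, eLpNorm (splineSum l j b) r (cubeMeas k m) ≤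
      C₁.toNNReal * eLpNorm (fun x => B (floorIdx j x)) r (cubeMeas k m) := by
    intro m
    rw [← eLpNorm_const_mul_ennreal hr _ ENNReal.coe_ne_top]
    refine eLpNorm_mono_ennreal fun x => ?_
    rw [Real.enorm_eq_ofReal_abs]
    refine (ENNReal.ofReal_le_ofReal (h₁ j b x)).trans ?_
    rw [ENNReal.ofReal_mul hC₁, ENNReal.ofReal_sum_of_nonneg fun _ _ => abs_nonneg _]
    exact le_rfl
  calc lNorm p (fun m => assoc p t k m * eLpNorm (splineSum l j b) r (cubeMeas k m))
      ≤ lNorm p (fun m => C₁.toNNReal *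
        (assoc p t k m * eLpNorm (fun x => B (floorIdx j x)) r (cubeMeas k m))) := by
        refine lNorm_mono fun m => ?_
        rw [mul_left_comm]
        exact mul_le_mul_right (h4 m) _
    _ = C₁.toNNReal * lNorm p (fun m =>
        assoc p t k m * eLpNorm (fun x => B (floorIdx j x)) r (cubeMeas k m)) :=
        lNorm_const_mul hp _ _
    _ ≤ C₁.toNNReal * (C₂ * R * (C₃ * lNorm p (fun m => assoc p t j m * ENNReal.ofReal |b m|))) :=
        mul_le_mul_right ((h₂ k j hkj B).trans (mul_le_mul_right
          (h₃ j fun m => ENNReal.ofReal |b m|) _)) _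
    _ = _ := by push_cast; ring

theorem WeightClass.exists_lNorm_absDiff_splineSum_le (ht : WeightClass p α₁ α₂ α₃ σ₁ p t)
    (hp : p ≠ 0) (hσ : σ₁ ≠ 0) {θ r : ℝ≥0∞} (hθ : θ ≠ 0) (hθr : θ ≤ r)
    (hH : θ⁻¹ = p⁻¹ + σ₁⁻¹) {l : ℕ} (hl : l ≠ 0) :
    ∃ C : ℝ≥0, ∀ k j : ℕ, k ≤ j → ∀ b : (Fin n → ℤ) → ℝ,
      lNorm p (fun m => assoc p t k m * eLpNorm (fun z : (Fin n → ℝ) × (Fin n → ℝ) =>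
          absDiff l z.1 (fun y => splineSum l j b (cubeMap k m y)) z.2) r
        ((volume.restrict (Metric.ball 0 2)).prod (cubeMeas 0 0))) ≤
        C * ((2 : ℝ≥0∞) ^ (-(α₁ - n * ((θ⁻¹).toReal - (r⁻¹).toReal)))) ^ (j - k) *
          lNorm p (fun m => assoc p t j m * ENNReal.ofReal |b m|) := by
  have hr : r ≠ 0 := (lt_of_lt_of_le (pos_iff_ne_zero.2 hθ) hθr).ne'
  obtain ⟨C₁, h₁⟩ := exists_eLpNorm_absDiff_le n l hr
  obtain ⟨C₂, h₂⟩ := ht.exists_lNorm_eLpNorm_splineSum_le hp hσ hθ hθr hH hl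
  obtain ⟨C₃, h₃⟩ := ht.exists_lNorm_box_le hp (2 * l + 1 + 1)
  refine ⟨C₁ * (C₃ * C₂), fun k j hkj b => ?_⟩
  refine (lNorm_mono (b := fun m => C₁ * (assoc p t k m * ∑ e ∈ intBox n (2 * l + 1 + 1),
    eLpNorm (splineSum l j b) r (cubeMeas k (m + e)))) fun m => ?_).trans ?_
  · rw [mul_left_comm]
    exact mul_le_mul_right (h₁ _ (measurable_splineSum hl j b) k m) _
  · rw [lNorm_const_mul hp]
    refine (mul_le_mul_right ((h₃ k fun m => eLpNorm (splineSum l j b) r (cubeMeas k m)).trans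
      (mul_le_mul_right (h₂ k j hkj b) _)) _).trans_eq ?_
    push_cast
    ring

/-- Per level, smoothness gains 2^{-l} and the upper weight condition costs 2^{α₂}; the balance
decays when α₂ < l. -/
theorem WeightClass.exists_lNorm_oscCube_splineSum_le (ht : WeightClass p α₁ α₂ α₃ σ₁ p t)
    (hp : p ≠ 0) {r : ℝ≥0∞} (hr : r ≠ 0) {l : ℕ} (hl : l ≠ 0) :
    ∃ C : ℝ≥0, ∀ j k : ℕ, j ≤ k → ∀ b : (Fin n → ℤ) → ℝ,
      lNorm p (fun m => assoc p t k m * oscCube l r (splineSum l j b) k m) ≤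
        C * ((2 : ℝ≥0∞) ^ (-((l : ℝ) - α₂))) ^ (k - j) *
          lNorm p (fun m => assoc p t j m * ENNReal.ofReal |b m|) := by
  obtain ⟨C₁, h₁⟩ := exists_oscCube_splineSum_le n hl hr
  obtain ⟨C₂, h₂⟩ := ht.exists_lNorm_ancestor_le hp
  obtain ⟨C₃, h₃⟩ := ht.exists_lNorm_box_le hp (3 * l + 1)
  refine ⟨C₁ * (C₂ * C₃), fun j k hjk b => ?_⟩
  set B : (Fin n → ℤ) → ℝ≥0∞ := fun m =>
    ∑ e ∈ intBox n (3 * l + 1), ENNReal.ofReal |b (m + e)| with hB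
  set R : ℝ≥0∞ := C₁ * ((2 : ℝ≥0∞) ^ (-(l : ℝ))) ^ (k - j) with hR
  refine (lNorm_mono (b := fun m => R * (assoc p t k m * B (ancestor (k - j) m))) fun m => ?_).trans ?_
  · rw [mul_left_comm]
    exact mul_le_mul_right (h₁ j k hjk b m) _
  · rw [lNorm_const_mul hp]
    refine (mul_le_mul_right ((h₂ j k hjk B).trans (mul_le_mul_right
      (h₃ j fun m => ENNReal.ofReal |b m|) _)) _).trans_eq ?_
    rw [show -((l : ℝ) - α₂) = -(l : ℝ) + α₂ by ring, two_rpow_add, mul_pow, hR]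
    push_cast
    ring

end Synthesis

/-! ### Synthesis of functions from spline series -/

section SynthesisNorm

variable {n : ℕ}

theorem lNorm_succ_le {q : ℝ≥0∞} (a : ℕ → ℝ≥0∞) : lNorm q (fun k => a (k + 1)) ≤ lNorm q a := by
  unfold lNorm
  split_ifs
  · exact iSup_comp_le a Nat.succ
  · exact ENNReal.rpow_le_rpow (ENNReal.tsum_comp_le_tsum_of_injective (add_left_injective 1)
      fun i => a i ^ q.toReal) (by positivity)

/-- The rate is the fifth root of the slower of the two decays, as `lNorm_mul_eLpNorm_tsum_geo_le`
consumes five powers. -/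
theorem exists_common_rate {x y : ℝ} (hx : 0 < x) (hy : 0 < y) :
    ∃ ρ : ℝ≥0∞, ρ ≠ 0 ∧ ρ < 1 ∧ (2 : ℝ≥0∞) ^ (-x) ≤ ρ ^ 5 ∧ (2 : ℝ≥0∞) ^ (-y) ≤ ρ ^ 5 := by
  have h0 : 0 < min x y / 5 := by have := lt_min hx hy; positivity
  have h5 : ((2 : ℝ≥0∞) ^ (-(min x y / 5))) ^ 5 = 2 ^ (-(min x y)) := by
    rw [← ENNReal.rpow_natCast, ← ENNReal.rpow_mul]
    congr 1
    push_cast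
    ring
  refine ⟨2 ^ (-(min x y / 5)), two_rpow_ne_zero _, two_rpow_neg_lt_one h0, ?_, ?_⟩ <;> rw [h5] <;>
    refine ENNReal.rpow_le_rpow_of_exponent_le (by norm_num) (neg_le_neg ?_)
  exacts [min_le_left _ _, min_le_right _ _]

/-- The sum of a spline series. -/
def splineSeries (l : ℕ) (β : ℕ → (Fin n → ℤ) → ℝ) (x : Fin n → ℝ) : ℝ :=
  ∑' j, splineSum l j (β j) x

theorem measurable_splineSeries {l : ℕ} (hl : l ≠ 0) (β : ℕ → (Fin n → ℤ) → ℝ) :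
    Measurable (splineSeries l β) :=
  Measurable.tsum fun j => measurable_splineSum hl j (β j)

/-- The terms of the coefficient quasi-norm. -/
def coeffTerm (p : ℝ≥0∞) (t : ℕ → (Fin n → ℝ) → ℝ) (β : ℕ → (Fin n → ℤ) → ℝ) (k : ℕ) : ℝ≥0∞ :=
  lNorm p (fun m => assoc p t k m * ENNReal.ofReal |β k m|)

variable {p : ℝ≥0∞} {t : ℕ → (Fin n → ℝ) → ℝ} {α₁ α₂ α₃ : ℝ} {σ₁ : ℝ≥0∞}

/-- Only the levels j ≥ N contribute, so for large N the supremum carries ρ^N and gives convergence,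
while N = 0 bounds the series itself. -/
theorem WeightClass.exists_lNorm_tail_le (ht : WeightClass p α₁ α₂ α₃ σ₁ p t)
    (hp : p ≠ 0) (hσ : σ₁ ≠ 0) {θ r : ℝ≥0∞} (hθ : θ ≠ 0) (hθr : θ ≤ r)
    (hH : θ⁻¹ = p⁻¹ + σ₁⁻¹) {l : ℕ} (hl : l ≠ 0) {ρ : ℝ≥0∞} (hρ0 : ρ ≠ 0) (hρ : ρ < 1)
    (hρα : (2 : ℝ≥0∞) ^ (-(α₁ - n * ((θ⁻¹).toReal - (r⁻¹).toReal))) ≤ ρ ^ 5) :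
    ∃ C : ℝ≥0, ∀ (β : ℕ → (Fin n → ℤ) → ℝ) (N : ℕ),
      lNorm p (fun m => assoc p t 0 m * eLpNorm (fun x =>
        ∑ k ∈ Finset.range N, splineSum l k (β k) x - splineSeries l β x) r (cubeMeas 0 m)) ≤
        C * ⨆ j, ρ ^ idxDist j 0 * if j < N then 0 else coeffTerm p t β j := by
  have hr : r ≠ 0 := (lt_of_lt_of_le (pos_iff_ne_zero.2 hθ) hθr).ne'
  obtain ⟨C, hC⟩ := ht.exists_lNorm_eLpNorm_splineSum_le hp hσ hθ hθr hH hl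
  have hCt : geoConst r ρ * (geoConst p ρ * C) ≠ ∞ := ENNReal.mul_ne_top (geoConst_ne_top hr hρ)
    (ENNReal.mul_ne_top (geoConst_ne_top hp hρ) ENNReal.coe_ne_top)
  refine ⟨(geoConst r ρ * (geoConst p ρ * C)).toNNReal, fun β N => ?_⟩
  rw [ENNReal.coe_toNNReal hCt, mul_assoc, mul_assoc]
  refine lNorm_mul_eLpNorm_tsum_geo_le hp hr hρ0 hρ 0 (a := assoc p t 0)
    (w := fun j m => if j < N then 0 else eLpNorm (splineSum l j (β j)) r (cubeMeas 0 m))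
    (f := fun _ j x => if j < N then 0 else ‖splineSum l j (β j) x‖ₑ)
    (fun j => ?_) (fun m j => ?_) (fun m j => ?_) fun m => Eventually.of_forall fun x => ?_
  · by_cases hj : j < N
    · simp only [hj, if_true, mul_zero]
      have h0 := lNorm_const_mul hp 0 fun _ : Fin n → ℤ => (0 : ℝ≥0∞)
      simp only [zero_mul] at h0
      rw [h0]
    · simp only [hj, if_false]
      refine (hC 0 j (Nat.zero_le j) (β j)).trans (mul_le_mul_left (mul_le_mul_right ?_ _) _)
      have : idxDist j 0 = j - 0 := by simp [idxDist]
      rw [this]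
      exact pow_le_pow_left' hρα _
  · by_cases hj : j < N
    · simp only [hj, if_true]; exact aemeasurable_const
    · simp only [hj, if_false]
      exact (measurable_splineSum hl j (β j)).enorm.aemeasurable
  · by_cases hj : j < N
    · simp only [hj, if_true]; simp
    · simp only [hj, if_false]
      exact (eLpNorm_enorm _).le
  · exact enorm_sum_range_sub_tsum_le N fun j => splineSum l j (β j) x

/-- Levels below k use genuine differences and decay by l - α₂; levels from k on use sums of moduli
and decay by α₁ - n(1/θ - 1/r). Level 0 contains no difference and is the tail estimate with N = 0.
-/
theorem WeightClass.exists_lNorm_cubeTerm_splineSeries_le (ht : WeightClass p α₁ α₂ α₃ σ₁ p t)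
    (hp : p ≠ 0) (hσ : σ₁ ≠ 0) {θ r : ℝ≥0∞} (hθ : θ ≠ 0) (hθr : θ ≤ r)
    (hH : θ⁻¹ = p⁻¹ + σ₁⁻¹) {l : ℕ} (hl : l ≠ 0) {ρ : ℝ≥0∞} (hρ0 : ρ ≠ 0) (hρ : ρ < 1)
    (hρα : (2 : ℝ≥0∞) ^ (-(α₁ - n * ((θ⁻¹).toReal - (r⁻¹).toReal))) ≤ ρ ^ 5)
    (hρl : (2 : ℝ≥0∞) ^ (-((l : ℝ) - α₂)) ≤ ρ ^ 5) :
    ∃ C : ℝ≥0, ∀ (β : ℕ → (Fin n → ℤ) → ℝ) (k : ℕ),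
      lNorm p (fun m => assoc p t k m * cubeTerm l r (splineSeries l β) k m) ≤
        C * ⨆ j, ρ ^ idxDist j k * coeffTerm p t β j := by
  have hr : r ≠ 0 := (lt_of_lt_of_le (pos_iff_ne_zero.2 hθ) hθr).ne'
  obtain ⟨C₀, h₀⟩ := ht.exists_lNorm_tail_le hp hσ hθ hθr hH hl hρ0 hρ hρα
  obtain ⟨C₁, h₁⟩ := ht.exists_lNorm_absDiff_splineSum_le hp hσ hθ hθr hH hl
  obtain ⟨C₂, h₂⟩ := ht.exists_lNorm_oscCube_splineSum_le hp hr hl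
  set K : ℝ≥0∞ := geoConst r ρ * (geoConst p ρ * (C₁ + C₂)) with hK
  have hKt : K ≠ ∞ := ENNReal.mul_ne_top (geoConst_ne_top hr hρ)
    (ENNReal.mul_ne_top (geoConst_ne_top hp hρ)
      (ENNReal.add_ne_top.2 ⟨ENNReal.coe_ne_top, ENNReal.coe_ne_top⟩))
  refine ⟨C₀ + K.toNNReal, fun β k => ?_⟩
  rw [ENNReal.coe_add, ENNReal.coe_toNNReal hKt]
  cases k with
  | zero =>
    have h3 := h₀ β 0
    simp only [Finset.range_zero, Finset.sum_empty, zero_sub, Nat.not_lt_zero, if_false] at h3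
    have h4 : ∀ m, eLpNorm (fun x => -splineSeries l β x) r (cubeMeas 0 m) =
        cubeTerm l r (splineSeries l β) 0 m := fun m => eLpNorm_neg (splineSeries l β) r _
    simp only [h4] at h3
    exact h3.trans (mul_le_mul_left le_self_add _)
  | succ k =>
    refine le_trans ?_ (mul_le_mul_left le_add_self _)
    rw [hK, mul_assoc, mul_assoc]
    set s : ℕ → (Fin n → ℤ) → (Fin n → ℝ) → ℝ := fun j m y =>
      splineSum l j (β j) (cubeMap (k + 1) m y) with hs
    have hsm : ∀ j m, Measurable (s j m) := fun j m => (measurable_splineSum hl j (β j)).comp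
      (measurableEmbedding_cubeMap (k + 1) m).measurable
    refine lNorm_mul_eLpNorm_tsum_geo_le hp hr hρ0 hρ (k + 1) (a := assoc p t (k + 1))
      (w := fun j m => if j < k + 1 then oscCube l r (splineSum l j (β j)) (k + 1) m else
        eLpNorm (fun z : (Fin n → ℝ) × (Fin n → ℝ) => absDiff l z.1 (s j m) z.2) r
          ((volume.restrict (Metric.ball 0 2)).prod (cubeMeas 0 0)))
      (f := fun m j z => ‖if j < k + 1 then diff l z.1 (s j m) z.2 else
        absDiff l z.1 (s j m) z.2‖ₑ)
      (fun j => ?_) (fun m j => ?_) (fun m j => ?_) fun m => Eventually.of_forall fun z => ?_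
    · by_cases hj : j < k + 1
      · simp only [hj, if_true]
        refine (h₂ j (k + 1) hj.le (β j)).trans
          (mul_le_mul_left (mul_le_mul' le_add_self ?_) _)
        have : idxDist j (k + 1) = k + 1 - j := by simp only [idxDist]; omega
        rw [this]
        exact pow_le_pow_left' hρl _
      · simp only [hj, if_false]
        refine (h₁ (k + 1) j (not_lt.1 hj) (β j)).trans
          (mul_le_mul_left (mul_le_mul' le_self_add ?_) _)
        have : idxDist j (k + 1) = j - (k + 1) := by simp only [idxDist]; omega
        rw [this]
        exact pow_le_pow_left' hρα _
    · by_cases hj : j < k + 1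
      · simp only [hj, if_true]; exact (measurable_diff l (hsm j m)).enorm.aemeasurable
      · simp only [hj, if_false]; exact (measurable_absDiff l (hsm j m)).enorm.aemeasurable
    · by_cases hj : j < k + 1
      · simp only [hj, if_true]; exact (eLpNorm_enorm _).le
      · simp only [hj, if_false]; exact (eLpNorm_enorm _).le
    · exact enorm_diff_tsum_le l (k + 1) z.1 z.2 fun j => s j m

theorem coeffTerm_le {q : ℝ≥0∞} (hq : q ≠ 0) (p : ℝ≥0∞) (t : ℕ → (Fin n → ℝ) → ℝ)
    (β : ℕ → (Fin n → ℤ) → ℝ) (k : ℕ) : coeffTerm p t β k ≤ coeffNorm p q t β :=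
  le_lNorm hq (coeffTerm p t β) k

theorem WeightClass.exists_synthesis (ht : WeightClass p α₁ α₂ α₃ σ₁ p t)
    (hp : p ≠ 0) (hσ : σ₁ ≠ 0) {θ r : ℝ≥0∞} (hθ : θ ≠ 0) (hθr : θ ≤ r)
    (hH : θ⁻¹ = p⁻¹ + σ₁⁻¹) (hα₁ : (n : ℝ) * ((θ⁻¹).toReal - (r⁻¹).toReal) < α₁)
    {l : ℕ} (hl : l ≠ 0) (hα₂ : α₂ < l) {q : ℝ≥0∞} (hq : q ≠ 0) :
    ∃ C : ℝ≥0, ∀ β : ℕ → (Fin n → ℤ) → ℝ, coeffNorm p q t β ≠ ∞ →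
      Represents l r β (splineSeries l β) ∧ MemLpLoc r (splineSeries l β) ∧
        besovNorm l p q r t (splineSeries l β) ≤ C * coeffNorm p q t β := by
  have hr : r ≠ 0 := (lt_of_lt_of_le (pos_iff_ne_zero.2 hθ) hθr).ne'
  obtain ⟨ρ, hρ0, hρ, hρα, hρl⟩ := exists_common_rate (sub_pos.2 hα₁) (sub_pos.2 hα₂)
  obtain ⟨C₀, h₀⟩ := ht.exists_lNorm_tail_le hp hσ hθ hθr hH hl hρ0 hρ hρα
  obtain ⟨C₁, h₁⟩ := ht.exists_lNorm_cubeTerm_splineSeries_le hp hσ hθ hθr hH hl hρ0 hρ hρα hρl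
  obtain ⟨C₂, h₂⟩ := ht.exists_besovTerm_le hp l hr
  -- G is the constant of the Hardy inequality. Its finiteness follows from that of `geoConst q ρ`,
  -- of which it is a factor next to a nonzero one.
  set G : ℝ≥0∞ := (2 * (1 - ρ ^ q.toReal)⁻¹) ^ (q.toReal⁻¹) with hG
  have hGt : G ≠ ∞ := fun h => by
    have h1 := geoConst_ne_top hq hρ
    rw [geoConst, ← hG, h, ENNReal.mul_top] at h1
    · exact h1 rfl
    · exact mul_ne_zero two_ne_zero (ENNReal.inv_ne_zero.2 (ne_top_of_le_ne_top
        ENNReal.one_ne_top tsub_le_self))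
  refine ⟨2 * (C₂ * C₁ * G.toNNReal), fun β hβ => ?_⟩
  set φ := splineSeries l β with hφ
  have hφm : Measurable φ := measurable_splineSeries hl β
  have hcube : ∀ (N : ℕ) (m : Fin n → ℤ), eLpNorm (fun x =>
      ∑ k ∈ Finset.range N, splineSum l k (β k) x - φ x) r (cubeMeas 0 m) ≤
        (assoc p t 0 m)⁻¹ * (C₀ * coeffNorm p q t β) * ρ ^ N := by
    intro N m
    set X := eLpNorm (fun x =>
      ∑ k ∈ Finset.range N, splineSum l k (β k) x - φ x) r (cubeMeas 0 m) with hX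
    have h3 : assoc p t 0 m * X ≤ C₀ * (ρ ^ N * coeffNorm p q t β) := by
      refine (le_lNorm hp (fun m => assoc p t 0 m * eLpNorm (fun x =>
        ∑ k ∈ Finset.range N, splineSum l k (β k) x - φ x) r (cubeMeas 0 m)) m).trans
        ((h₀ β N).trans (mul_le_mul_right (iSup_le fun j => ?_) _))
      split_ifs with hj
      · simp
      · refine mul_le_mul' ?_ (coeffTerm_le hq p t β j)
        refine pow_le_pow_of_le_one zero_le hρ.le ?_
        simp only [idxDist]
        omega
    calc X = (assoc p t 0 m)⁻¹ * (assoc p t 0 m * X) := by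
          rw [← mul_assoc, ENNReal.inv_mul_cancel (ht.assoc_ne_zero 0 m) (ht.assoc_ne_top 0 m),
            one_mul]
      _ ≤ (assoc p t 0 m)⁻¹ * (C₀ * (ρ ^ N * coeffNorm p q t β)) := mul_le_mul_right h3 _
      _ = _ := by ring
  have hKt : ∀ m, (assoc p t 0 m)⁻¹ * (C₀ * coeffNorm p q t β) ≠ ∞ := fun m =>
    ENNReal.mul_ne_top (ENNReal.inv_ne_top.2 (ht.assoc_ne_zero 0 m))
      (ENNReal.mul_ne_top ENNReal.coe_ne_top hβ)
  refine ⟨?_, fun K hK => ?_, ?_⟩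
  · refine tendstoLpLoc_of_cubeMeas hr
      (fun N => (measurable_splineSum_partial hl β N).aemeasurable) hφm.aemeasurable fun m => ?_
    have hlim := ENNReal.Tendsto.const_mul (a := (assoc p t 0 m)⁻¹ * (C₀ * coeffNorm p q t β))
      (ENNReal.tendsto_pow_atTop_nhds_zero_of_lt_one hρ) (Or.inr (hKt m))
    rw [mul_zero] at hlim
    exact tendsto_of_tendsto_of_tendsto_of_le_of_le tendsto_const_nhds hlim (fun _ => zero_le)
      fun N => hcube N m
  · obtain ⟨s, hs⟩ := exists_eLpNorm_restrict_le_sum hr hK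
    refine ⟨hφm.aestronglyMeasurable, (hs φ hφm.aemeasurable).trans_lt ?_⟩
    refine (ENNReal.mul_ne_top (quasiConst_ne_top _ _)
      (ENNReal.sum_ne_top.2 fun m _ => ?_)).lt_top
    -- The empty partial sum turns the error bound into a bound for φ.
    have h3 := hcube 0 m
    simp only [Finset.range_zero, Finset.sum_empty, zero_sub, pow_zero, mul_one] at h3
    have h4 : eLpNorm (fun x => -φ x) r (cubeMeas 0 m) = eLpNorm φ r (cubeMeas 0 m) :=
      eLpNorm_neg φ r _
    rw [h4] at h3
    exact ne_top_of_le_ne_top (hKt m) h3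
  · have h3 : lNorm q (besovTerm l p r t φ) ≤ C₂ * C₁ * G * coeffNorm p q t β := by
      refine (lNorm_mono (b := fun k => (C₂ * C₁ : ℝ≥0∞) *
        ⨆ j, ρ ^ idxDist j k * coeffTerm p t β j) fun k => ?_).trans ?_
      · rw [mul_assoc]
        exact (h₂ φ hφm k).trans (mul_le_mul_right (h₁ β k) _)
      · rw [lNorm_const_mul hq, mul_assoc _ G]
        exact mul_le_mul_right (lNorm_iSup_geo_le hq hρ (coeffTerm p t β)) _
    rw [besovNorm_eq]
    refine (add_le_add ((lNorm_succ_le (besovTerm l p r t φ)).trans h3)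
      ((le_lNorm hq (besovTerm l p r t φ) 0).trans h3)).trans_eq ?_
    push_cast
    rw [ENNReal.coe_toNNReal hGt]
    ring

end SynthesisNorm

/-! ### Equivalence of the quasi-norms -/

section Equivalence

variable {n : ℕ} {p : ℝ≥0∞} {t : ℕ → (Fin n → ℝ) → ℝ} {α₁ α₂ α₃ : ℝ} {σ₁ : ℝ≥0∞}

theorem N₃_le {l : ℕ} {q r : ℝ≥0∞} {φ : (Fin n → ℝ) → ℝ} {β : ℕ → (Fin n → ℤ) → ℝ}
    (hβ : Represents l r β φ) : N₃ l p q r t φ ≤ coeffNorm p q t β :=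
  iInf_le (fun β : {β : ℕ → (Fin n → ℤ) → ℝ // Represents l r β φ} => coeffNorm p q t β.1) ⟨β, hβ⟩

/-- Every notion involved is unchanged on null sets, so φ may be replaced by a Borel measurable
representative. -/
theorem WeightClass.exists_decomposition (ht : WeightClass p α₁ α₂ α₃ σ₁ p t)
    (hp : p ≠ 0) (hσ : σ₁ ≠ 0) {θ r : ℝ≥0∞} (hθ : θ ≠ 0) (hθr : θ ≤ r)
    (hH : θ⁻¹ = p⁻¹ + σ₁⁻¹) (hα₁ : (n : ℝ) * ((θ⁻¹).toReal - (r⁻¹).toReal) < α₁)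
    {l : ℕ} (hl : l ≠ 0) {q : ℝ≥0∞} (hq : q ≠ 0) (A : ℝ) :
    ∃ C : ℝ≥0, ∀ φ : (Fin n → ℝ) → ℝ, MemBesov l p q r t φ →
      (∃ β, Represents l r β φ ∧ coeffNorm p q t β ≤ C * besovNorm l p q r t φ) ∧
      ∀ P : ℕ → (Fin n → ℤ) → MvPolynomial (Fin n) ℝ, IsNearBest A l r φ P →
        Represents l r (fun k m => coeffFun l k m (splineIncrement l P k)) φ ∧
        N₄ l p q t P ≤ C * besovNorm l p q r t φ := by
  obtain ⟨C, hC⟩ := ht.exists_decomposition_of_measurable hp hσ hθ hθr hH hα₁ hl hq A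
  refine ⟨C, fun φ hφ => ?_⟩
  have hm := hφ.1.aemeasurable
  have hae := hm.ae_eq_mk
  have h := hC (hm.mk φ) hm.measurable_mk
    ⟨hφ.1.congr_ae hae, besovNorm_congr_ae l p q r t hae ▸ hφ.2⟩
  simpa only [represents_congr_ae hae, isNearBest_congr_ae hae, besovNorm_congr_ae l p q r t hae]
    using h

end Equivalence

end VarBesov

end

/-! ### The atomic decomposition theorem. -/

open VarBesov in
theorem corollary4p4 (n : ℕ) (hn : 1 ≤ n) (l : ℕ) (hl : 1 ≤ l)
    (p q r θ : ℝ≥0∞) (hp : 0 < p) (hq : 0 < q) (hr : 0 < r) (hθ : 0 < θ) (hθ' : θ ≤ min r p)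
    (α₁ α₂ α₃ : ℝ) (hα₃ : 0 ≤ α₃) (σ₁ σ₂ : ℝ≥0∞)
    (hσ₁ : σ₁ = θ * ENNReal.conjExponent (pTheta p θ)) (hσ₂ : σ₂ = p)
    (hα₁ : (n : ℝ) * ((θ⁻¹).toReal - (r⁻¹).toReal) < α₁) (hα₂ : α₂ < (l : ℝ))
    (t : ℕ → (Fin n → ℝ) → ℝ) (ht : WeightClass p α₁ α₂ α₃ σ₁ σ₂ t)
    (A : ℝ) (hA : 1 ≤ A) :
    (∃ C : ℝ≥0, 0 < C ∧ ∀ φ : (Fin n → ℝ) → ℝ, MemBesov l p q r t φ →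
      (∃ β : ℕ → (Fin n → ℤ) → ℝ, Represents l r β φ) ∧
      N₃ l p q r t φ ≤ C * besovNorm l p q r t φ ∧
      ∀ P : ℕ → (Fin n → ℤ) → MvPolynomial (Fin n) ℝ, IsNearBest A l r φ P →
        N₃ l p q r t φ ≤ N₄ l p q t P ∧
        N₄ l p q t P ≤ C * besovNorm l p q r t φ) ∧
    (∃ C₁ C₂ : ℝ≥0, 0 < C₁ ∧ 0 < C₂ ∧ ∀ β : ℕ → (Fin n → ℤ) → ℝ, coeffNorm p q t β < ∞ →
      ∃ φ : (Fin n → ℝ) → ℝ, Represents l r β φ ∧ MemBesov l p q r t φ ∧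
        besovNorm l p q r t φ ≤ C₁ * N₃ l p q r t φ ∧
        ∀ P : ℕ → (Fin n → ℤ) → MvPolynomial (Fin n) ℝ, IsNearBest A l r φ P →
          C₁ * N₃ l p q r t φ ≤ C₂ * N₄ l p q t P) := by
  have hl' : l ≠ 0 := Nat.one_le_iff_ne_zero.1 hl
  have hθr : θ ≤ r := hθ'.trans (min_le_left _ _)
  have hθp : θ ≤ p := hθ'.trans (min_le_right _ _)
  have hH : θ⁻¹ = p⁻¹ + σ₁⁻¹ := hσ₁ ▸ holder_exponent hp.ne' hθ.ne' hθp
  have hσ : σ₁ ≠ 0 := by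
    rw [hσ₁]
    exact mul_ne_zero hθ.ne' (by simp [ENNReal.conjExponent])
  rw [hσ₂] at ht
  obtain ⟨C, hC⟩ := ht.exists_decomposition hp.ne' hσ hθ.ne' hθr hH hα₁ hl' hq.ne' A
  refine ⟨⟨C + 1, by positivity, fun φ hφ => ?_⟩, ?_⟩
  · obtain ⟨⟨β, hβ, hβC⟩, h2⟩ := hC φ hφ
    have hle : (C : ℝ≥0∞) * besovNorm l p q r t φ ≤ (C + 1 : ℝ≥0) * besovNorm l p q r t φ :=
      mul_le_mul_left (by push_cast; exact le_self_add) _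
    exact ⟨⟨β, hβ⟩, ((N₃_le hβ).trans hβC).trans hle, fun P hP =>
      ⟨N₃_le (h2 P hP).1, (h2 P hP).2.trans hle⟩⟩
  · obtain ⟨D, hD⟩ := ht.exists_synthesis hp.ne' hσ hθ.ne' hθr hH hα₁ hl' hα₂ hq.ne'
    -- With equal constants the last inequality is just N₃ ≤ N₄; adding 1 makes the constant
    -- nonzero, so that it can be moved into the infimum.
    refine ⟨D + 1, D + 1, by positivity, by positivity, fun β hβ => ?_⟩
    obtain ⟨h1, h2, h3⟩ := hD β hβ.ne
    have hB : MemBesov l p q r t (splineSeries l β) :=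
      ⟨h2, h3.trans_lt (ENNReal.mul_lt_top ENNReal.coe_lt_top hβ)⟩
    refine ⟨splineSeries l β, h1, hB, ?_, fun P hP => ?_⟩
    -- The array β need not be optimal for φ. Any competing γ of finite norm has a sum equal to φ
    -- almost everywhere, so the synthesis bound holds with the norm of γ; an infinite norm makes
    -- the bound trivial.
    · rw [N₃, ENNReal.mul_iInf_of_ne (by simp) ENNReal.coe_ne_top]
      refine le_iInf fun ⟨γ, hγ⟩ => ?_
      by_cases hγt : coeffNorm p q t γ = ∞
      · rw [hγt, ENNReal.mul_top (by simp)]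
        exact le_top
      · obtain ⟨h4, h5, h6⟩ := hD γ hγt
        rw [besovNorm_congr_ae l p q r t (Represents.ae_eq hl' hr.ne' h2.aemeasurable
          h5.aemeasurable hγ h4)]
        exact h6.trans (mul_le_mul_left (by push_cast; exact le_self_add) _)
    -- By the analysis part the array defining N₄ represents φ, so it competes in the infimum.
    · exact mul_le_mul_right (N₃_le ((hC _ hB).2 P hP).1) _
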